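/- Let $N\ge 2$, let $\hbar$ be a parameter with $\operatorname{Re}\hbar>0$ (e.g. $\hbar>0$), and let $k\in\mathbb C$ be an arbitrary level. **Bosons.** Let $\mathcal A_{\hbar,k}(sl_N)$ be the Heisenberg algebra generated by $\hat\lambda_\mu(t)$ $(1\le\mu\le N)$, $\hat b_{\mu\nu}(t)$, $\hat c_{\mu\nu}(t)$ $(1\le\mu<\nu\le N)$, $t\in\mathbb R\setminus\{0\}$ (with $\hat b_{\mu\nu}=\hat c_{\mu\nu}=0$ for all other index pairs), with $$[\hat\lambda_\mu(t),\hat\lambda_\mu(t')]=\frac{\sinh\frac{(k+N)\hbar t}2\,\sinh\frac{(N-1)\hbar t}2\,\sinh\frac{\hbar t}2}{\hbar^2t\,\sinh\frac{N\hbar t}2}\,\delta(t+t'),$$ $$[\hat\lambda_\mu(t),\hat\lambda_\nu(t')]=-\frac{\sinh\frac{(k+N)\hbar t}2\,\sinh^2\frac{\hbar t}2}{\hbar^2t\,\sinh\frac{N\hbar t}2}\,e^{\operatorname{sign}(\mu-\nu)N\hbar t/2}\,\delta(t+t')\quad(\mu\ne\nu),$$ $$\sum_{\mu=1}^Ne^{(1-\mu)\hbar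 t}\hat\lambda_\mu(t)=0,\qquad [\hat b_{\mu\nu}(t),\hat b_{\mu'\nu'}(t')]=-[\hat c_{\mu\nu}(t),\hat c_{\mu'\nu'}(t')]=-\frac{\sinh^2\frac{\hbar t}2}{\hbar^2t}\delta_{\mu\mu'}\delta_{\nu\nu'}\delta(t+t'),$$ all other commutators being $0$. The Fock space $\mathcal F$ is generated by the modes with $t<0$ (smeared with continuous functions compactly supported away from $t=0$) from a vacuum killed by the modes with $t>0$. For $\chi=\lambda_\mu,b_{\mu\nu},c_{\mu\nu}$ put $$\chi^+(u)=e^{2\hbar\int_0^\infty\hat\chi(t)e^{-iut}dt},\quad \chi^-(u)=e^{-2\hbar\int_{-\infty}^0\hat\chi(t)e^{-iut}dt},\quad \chi(u)=e^{-\hbar\int_{-\infty}^0\frac{\hat\chi(t)e^{-iut}}{\sinh(\hbar t/2)}dt}\,e^{-\hbar\int_0^\infty\frac{\hat\chi(t)e^{-iut}}{\sinh(\hbar t/2)}dt},$$ and $(b+c)_{\mu\nu}(u)={:}b_{\mu\nu}(u)c_{\mu\nu}(u){:}$. Write $u_r=u+r\,i\hbar$. **The assignment.** For $1\le\mu\le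 N$ and $1\le\nu\le N-1$ let $$k_\mu^+(u)\mapsto\;:\lambda_\mu^+(u_{(k-N)/4})^{-1}\prod_{\alpha=1}^{\mu-1}b^+_{\alpha\mu}(u_{(\mu-\alpha)/2})\prod_{\beta=\mu+1}^Nb^+_{\mu\beta}(u_{(\mu-\beta)/2})^{-1}:,$$ $$k_\mu^-(u)\mapsto\;:\lambda_\mu^-(u_{-(k-N)/4})^{-1}\prod_{\rho=1}^{\mu-1}\prod_{\gamma=\mu}^{N}b^-_{\rho\gamma}(u_{(\rho+\gamma)/2})\prod_{\alpha=1}^{\mu}\prod_{\beta=\mu+1}^Nb^-_{\alpha\beta}(u_{(\alpha+\beta-2)/2})^{-1}:,$$ $$X_\nu^+(u)\mapsto\sum_{m=1}^\nu:(b+c)_{m\nu}(u_{-\frac{m-\nu-1}2})\Big\{\frac{b^+_{m,\nu+1}(u_{-\frac{m-\nu-1}2})}{(b+c)_{m,\nu+1}(u_{-\frac{m-\nu}2})}-\frac{b^-_{m,\nu+1}(u_{-\frac{m-\nu-1}2})}{(b+c)_{m,\nu+1}(u_{-\frac{m-\nu-2}2})}\Big\}\prod_{n=1}^{m-1}\frac{b^+_{n,\nu+1}(u_{-\frac{n-\nu-1}2})}{b^+_{n\nu}(u_{-\frac{n-\nu}2})}:,$$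 $$\begin{aligned}X_\nu^-(u)\mapsto\;&:\sum_{m=1}^\nu(b+c)_{m,\nu+1}(u_{\frac{\nu+m}2})\,\lambda_\nu^-(u_{-\frac{k-N}4})\lambda_{\nu+1}^-(u_{-\frac{k-N}4})^{-1}\\&\times\Big[\tfrac{1+\delta_{m\nu}}{b^-_{m\nu}(u_{\frac{\nu+m}2})(b+c)_{m\nu}(u_{\frac{\nu+m-1}2})}-\tfrac1{b^+_{m\nu}(u_{\frac{\nu+m}2})(b+c)_{m\nu}(u_{\frac{\nu+m+1}2})}\Big]\prod_{n=m+1}^\nu\frac{b^-_{n,\nu+1}(u_{\frac{\nu+n-1}2})}{b^-_{n\nu}(u_{\frac{\nu+n}2})}\prod_{s=\nu+1}^N\frac{b^-_{\nu s}(u_{\frac{\nu+s}2})}{b^-_{\nu+1,s}(u_{\frac{\nu+s-1}2})}\\&-\sum_{m=\nu+1}^N(b+c)_{\nu m}(u_{-\frac{2k+m-\nu-1}2})\,\lambda_\nu^+(u_{-\frac{3k+N}4})\lambda_{\nu+1}^+(u_{-\frac{3k+N}4})^{-1}\\&\times\Big[(1+\delta_{m,\nu+1})\tfrac{b^+_{\nu+1,m}(u_{-\frac{2k+m-\nu-1}2})}{(b+c)_{\nu+1,m}(u_{-\frac{2k+m-\nu}2})}-\tfrac{b^-_{\nu+1,m}(u_{-\frac{2k+m-\nu-1}2})}{(b+c)_{\nu+1,m}(u_{-\frac{2k+m-\nu-2}2})}\Big]\prod_{n=m}^N\frac{b^+_{\nu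 n}(u_{-\frac{2k+n-\nu}2})}{b^+_{\nu+1,n}(u_{-\frac{2k+n-\nu-1}2})}:\end{aligned}$$ (fields with a vanishing boson are $1$), and let $k_\mu^\pm(u)^{-1}$ go to the inverse exponentials. **Claim.** This assignment extends to a homomorphism $\psi_{\hbar,k}$ from the free algebra on the currents $k_\mu^\pm(u)^{\pm1},X_\nu^\pm(u)$, $u\in\mathbb C$, to operators on the (completed) Fock space. The operators are well defined on $\mathcal F$: there is $R\ge0$, depending only on $N,\hbar,k$, such that the matrix coefficients between Fock vectors of a product $J_1(u_1)\cdots J_n(u_n)$ of currents converge and are holomorphic for $\operatorname{Im}(u_i-u_j)<-R$ $(i<j)$. The operators satisfy, inside such products, in the sense of analytic continuation from these domains, the level $k$ Drinfeld current relations of $DY_\hbar(gl_N)$ with $\hbar$ replaced by $-i\hbar$. Namely, with $\rho(u)=\dfrac{\Gamma(\frac{iu}{N\hbar})\Gamma(1+\frac{iu}{N\hbar})}{\Gamma(\frac1N+\frac{iu}{N\hbar})\Gamma(1-\frac1N+\frac{iu}{N\hbar})}$ and $w=u-v$: 1. $k^\pm_\mu(u)k^\pm_\nu(v)=k^\pm_\nu(v)k^\pm_\mu(u)$.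 2. $\rho(w+ik\hbar)\,f_{\mu\nu}(w+ik\hbar)\,k_\mu^+(u)k_\nu^-(v)=k_\nu^-(v)k_\mu^+(u)\,f_{\mu\nu}(w)\,\rho(w)$, where $f_{\mu\nu}(w)$ is $1$, $\frac{w}{w-i\hbar}$, $\frac{w+i\hbar}{w}$ for $\mu=\nu$, $\mu<\nu$, $\mu>\nu$ respectively. 3. $k^\pm_\mu(u)X^+_\mu(v)k^\pm_\mu(u)^{-1}=\frac{w}{w-i\hbar}X^+_\mu(v)$ and $k^\pm_{\mu+1}(u)X^+_\mu(v)k^\pm_{\mu+1}(u)^{-1}=\frac{w}{w+i\hbar}X^+_\mu(v)$. 4. $k^-_\mu(u)X^-_\mu(v)k^-_\mu(u)^{-1}=\frac{w-i\hbar}{w}X^-_\mu(v)$ and $k^-_{\mu+1}(u)X^-_\mu(v)k^-_{\mu+1}(u)^{-1}=\frac{w+i\hbar}{w}X^-_\mu(v)$; for $k^+$ the same with $w$ replaced by $w+ik\hbar$ in the fractions. 5. $k^\pm_\mu(u)X^{\epsilon}_\nu(v)k^\pm_\mu(u)^{-1}=X^{\epsilon}_\nu(v)$, $\epsilon=\pm$,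 if $\mu-\nu\ge2$ or $\mu-\nu\le-1$. 6. The two sides of each of $(w\pm i\hbar)X^\pm_\mu(u)X^\pm_\mu(v)=(w\mp i\hbar)X^\pm_\mu(v)X^\pm_\mu(u)$; $\ (w-i\hbar)X^+_\mu(u)X^+_{\mu+1}(v)=w\,X^+_{\mu+1}(v)X^+_\mu(u)$; $\ w\,X^-_\mu(u)X^-_{\mu+1}(v)=(w-i\hbar)X^-_{\mu+1}(v)X^-_\mu(u)$; $\ X^\pm_\mu(u)X^\pm_\nu(v)=X^\pm_\nu(v)X^\pm_\mu(u)$ for $|\mu-\nu|\ge2$ have the same analytic continuation, and it is regular (holomorphic for all $u,v$ between the other factors). 7. For $|\mu-\nu|=1$ the meromorphic continuation of $X^\pm_\mu(u_1)X^\pm_\mu(u_2)X^\pm_\nu(v)-2X^\pm_\mu(u_1)X^\pm_\nu(v)X^\pm_\mu(u_2)+X^\pm_\nu(v)X^\pm_\mu(u_1)X^\pm_\mu(u_2)+\{u_1\leftrightarrow u_2\}$ is $0$. 8. $[X^+_\mu(u),X^-_\nu(v)]\simeq-i\hbar\,\delta_{\mu\nu}\big(\delta(w+ik\hbar)k^+_{\mu+1}(u)k^+_\mu(u)^{-1}-\delta(w)k^-_{\mu+1}(v)k^-_\mu(v)^{-1}\big)$,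 $\delta$ being the difference of the two determinations of $1/(\cdot)$. That is: $X^+_\mu(u)X^-_\nu(v)$ and $X^-_\nu(v)X^+_\mu(u)$ have the same meromorphic continuation, and it equals $-i\hbar\,\delta_{\mu\nu}\big(\frac{1}{w+ik\hbar}k^+_{\mu+1}(u)k^+_\mu(u)^{-1}-\frac1{w}k^-_{\mu+1}(v)k^-_\mu(v)^{-1}\big)$ up to a regular term. -/

import Mathlib

open Complex Set MeasureTheory

noncomputable section

namespace YangianBoson

/-- The data on which everything depends: the rank parameter `N ≥ 2`, the deformation parameter
`ħ` with `Re ħ > 0` (in particular any real `ħ > 0`) and the level `k`, an arbitrary complex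
number (the critical level `k = -N` is included). -/
structure Params where
  N : ℕ
  hbar : ℂ
  k : ℂ
  two_le : 2 ≤ N
  hbar_pos : 0 < hbar.re

/-- The indices `1 ≤ μ ≤ N`. -/
abbrev Idx (N : ℕ) : Type := ↥(Finset.Icc 1 N)

/-- The indices `1 ≤ ν ≤ N - 1`. -/
abbrev RootIdx (N : ℕ) : Type := ↥(Finset.Ico 1 N)

/-- The index pairs `1 ≤ μ < ν ≤ N`. -/
abbrev PairIdx (N : ℕ) : Type :=
  ↥((Finset.Icc 1 N ×ˢ Finset.Icc 1 N).filter fun p : ℕ × ℕ => p.1 < p.2)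

/-- The species of bosons: `λ_μ`, then `b_{μν}`, then `c_{μν}`. -/
abbrev Boson (N : ℕ) : Type := Idx N ⊕ (PairIdx N ⊕ PairIdx N)

/-! ### The Heisenberg algebra with a continuous parameter -/

/-- The coefficient of `δ(t + t')` in the commutator `[χ̂_s(t), χ̂_{s'}(t')]`, as a function
of `t`. -/
def comm (P : Params) : Boson P.N → Boson P.N → ℝ → ℂ
  | .inl μ, .inl ν, t =>
      if μ = ν then
        sinh ((P.k + P.N) / 2 * P.hbar * t) * sinh ((P.N - 1) / 2 * P.hbar * t)
            * sinh (P.hbar * t / 2)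
          / (P.hbar ^ 2 * t * sinh (P.N / 2 * P.hbar * t))
      else
        -(sinh ((P.k + P.N) / 2 * P.hbar * t) * sinh (P.hbar * t / 2) ^ 2
            / (P.hbar ^ 2 * t * sinh (P.N / 2 * P.hbar * t)))
          * exp ((if (ν : ℕ) < (μ : ℕ) then 1 else -1) * (P.N / 2) * P.hbar * t)
  | .inr (.inl p), .inr (.inl q), t =>
      if p = q then -(sinh (P.hbar * t / 2) ^ 2 / (P.hbar ^ 2 * t)) else 0
  | .inr (.inr p), .inr (.inr q), t =>
      if p = q then sinh (P.hbar * t / 2) ^ 2 / (P.hbar ^ 2 * t) else 0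
  | _, _, _ => 0

/-- Coefficient functions of smeared modes: families of functions, indexed by the species and
continuous on the half line `t > 0` (the values at `t ≤ 0` are never used).  Such an `f` serves
either for the annihilation operator `∫_{t>0} ∑_s f_s(t) χ̂_s(t) dt` or for the creation operator
`∫_{t>0} ∑_s f_s(t) χ̂_s(-t) dt`. -/
def ModeFn (P : Params) : Submodule ℂ (Boson P.N → ℝ → ℂ) where
  carrier := {f | ∀ s, ContinuousOn (f s) (Ioi 0)}
  add_mem' := fun hf hg s => (hf s).add (hg s)
  zero_mem' := fun _ => continuousOn_const
  smul_mem' := fun c _ hf s => (hf s).const_smul c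

/-- The values `η_s(t)` of the commuting creation modes `χ̂_s(-t)`, `t > 0`: continuous families
subject to the linear relation `∑_μ e^{(1-μ)ħt'} λ̂_μ(t') = 0` at `t' = -t`. -/
def Config (P : Params) : Submodule ℂ (Boson P.N → ℝ → ℂ) where
  carrier := {η | (∀ s, ContinuousOn (η s) (Ioi 0)) ∧
    ∀ t : ℝ, 0 < t →
      ∑ μ : Idx P.N, exp ((1 - (μ : ℕ)) * P.hbar * (-t : ℝ)) * η (.inl μ) t = 0}
  add_mem' := by
    rintro f g ⟨hf, hf'⟩ ⟨hg, hg'⟩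
    refine ⟨fun s => (hf s).add (hg s), fun t ht => ?_⟩
    simp only [Pi.add_apply, mul_add, Finset.sum_add_distrib]
    rw [hf' t ht, hg' t ht, add_zero]
  zero_mem' := ⟨fun _ => continuousOn_const, fun _ _ => by simp⟩
  smul_mem' := by
    rintro c f ⟨hf, hf'⟩
    refine ⟨fun s => (hf s).const_smul c, fun t ht => ?_⟩
    have h := congrArg (fun x => c * x) (hf' t ht)
    simp only [Finset.mul_sum, mul_zero] at h
    rw [← h]
    refine Finset.sum_congr rfl fun μ _ => ?_
    simp only [Pi.smul_apply, smul_eq_mul]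
    ring

theorem sinh_ne_zero_of_re_pos {z : ℂ} (hz : 0 < z.re) : sinh z ≠ 0 := by
  intro h
  rw [Complex.sinh, div_eq_zero_iff] at h
  rcases h with h | h
  · have h1 : exp z = exp (-z) := sub_eq_zero.mp h
    have h2 := congrArg (fun w : ℂ => ‖w‖) h1
    simp only [norm_exp, neg_re, Real.exp_eq_exp] at h2
    linarith
  · norm_num at h

theorem sinh_denominator_ne_zero (P : Params) {t : ℝ} (ht : 0 < t) :
    sinh (P.N / 2 * P.hbar * t) ≠ 0 := by
  apply sinh_ne_zero_of_re_pos
  have hN : (0 : ℝ) < P.N := by exact_mod_cast lt_of_lt_of_le (by norm_num) P.two_le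
  have : (P.N / 2 * P.hbar * t : ℂ) = ((P.N / 2 * t : ℝ) : ℂ) * P.hbar := by push_cast; ring
  rw [this, re_ofReal_mul]
  have := P.hbar_pos
  positivity

theorem hbar_ne_zero (P : Params) : P.hbar ≠ 0 := by
  intro h
  have := P.hbar_pos
  simp [h] at this

theorem comm_continuousOn (P : Params) (s s' : Boson P.N) :
    ContinuousOn (comm P s s') (Ioi 0) := by
  have hh := hbar_ne_zero P
  have hden : ∀ t ∈ Ioi (0 : ℝ), P.hbar ^ 2 * (t : ℂ) * sinh (P.N / 2 * P.hbar * t) ≠ 0 :=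
    fun t ht => mul_ne_zero (mul_ne_zero (pow_ne_zero _ hh)
      (ofReal_ne_zero.mpr (ne_of_gt ht))) (sinh_denominator_ne_zero P ht)
  have hden' : ∀ t ∈ Ioi (0 : ℝ), P.hbar ^ 2 * (t : ℂ) ≠ 0 :=
    fun t ht => mul_ne_zero (pow_ne_zero _ hh) (ofReal_ne_zero.mpr (ne_of_gt ht))
  have c0 : ∀ f : ℝ → ℂ, (∀ t, f t = 0) → ContinuousOn f (Ioi 0) := fun f hf => by
    rw [show f = fun _ => 0 from funext hf]; exact continuousOn_const
  rcases s with μ | p | p <;> rcases s' with ν | q | q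
  · by_cases h : μ = ν
    · have e : comm P (.inl μ) (.inl ν) = fun t : ℝ =>
          sinh ((P.k + P.N) / 2 * P.hbar * t) * sinh ((P.N - 1) / 2 * P.hbar * t)
            * sinh (P.hbar * t / 2)
          / (P.hbar ^ 2 * t * sinh (P.N / 2 * P.hbar * t)) := by
        funext t; simp [comm, h]
      rw [e]
      exact ContinuousOn.div (by fun_prop) (by fun_prop) hden
    · have e : comm P (.inl μ) (.inl ν) = fun t : ℝ =>
          -(sinh ((P.k + P.N) / 2 * P.hbar * t) * sinh (P.hbar * t / 2) ^ 2
            / (P.hbar ^ 2 * t * sinh (P.N / 2 * P.hbar * t)))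
          * exp ((if (ν : ℕ) < (μ : ℕ) then 1 else -1) * (P.N / 2) * P.hbar * t) := by
        funext t; simp [comm, h]
      rw [e]
      exact ((ContinuousOn.div (by fun_prop) (by fun_prop) hden).neg).mul (by fun_prop)
  · exact c0 _ fun t => by simp [comm]
  · exact c0 _ fun t => by simp [comm]
  · exact c0 _ fun t => by simp [comm]
  · by_cases h : p = q
    · have e : comm P (.inr (.inl p)) (.inr (.inl q)) = fun t : ℝ =>
          -(sinh (P.hbar * t / 2) ^ 2 / (P.hbar ^ 2 * t)) := by
        funext t; simp [comm, h]
      rw [e]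
      exact (ContinuousOn.div (by fun_prop) (by fun_prop) hden').neg
    · exact c0 _ fun t => by simp [comm, h]
  · exact c0 _ fun t => by simp [comm]
  · exact c0 _ fun t => by simp [comm]
  · exact c0 _ fun t => by simp [comm]
  · by_cases h : p = q
    · have e : comm P (.inr (.inr p)) (.inr (.inr q)) = fun t : ℝ =>
          sinh (P.hbar * t / 2) ^ 2 / (P.hbar ^ 2 * t) := by
        funext t; simp [comm, h]
      rw [e]
      exact ContinuousOn.div (by fun_prop) (by fun_prop) hden'
    · exact c0 _ fun t => by simp [comm, h]

/-- The commutators respect the linear relation between the `λ̂_μ`. -/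
theorem comm_relation (P : Params) (s : Boson P.N) (t : ℝ) :
    ∑ ν : Idx P.N, exp ((1 - (ν : ℕ)) * P.hbar * (-t : ℝ)) * comm P s (.inl ν) t = 0 := by
  rcases s with μ | p | p
  · set x : ℂ := P.hbar * t / 2 with hx
    set C : ℂ := sinh ((P.k + P.N) / 2 * P.hbar * t) * sinh x
        / (P.hbar ^ 2 * t * sinh (P.N / 2 * P.hbar * t)) with hC
    let H : ℕ → ℂ := fun j =>
      if j < (μ : ℕ) then exp (P.N * x) * exp ((2 * j - 1) * x) / 2
      else exp (-(P.N * x)) * exp ((2 * j - 1) * x) / 2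
    have key : ∀ ν : Idx P.N,
        exp ((1 - (ν : ℕ)) * P.hbar * (-t : ℝ)) * comm P (.inl μ) (.inl ν) t
          = -C * (H ν - H ((ν : ℕ) - 1)) := by
      intro ν
      have hν := Finset.mem_Icc.mp ν.2
      have hμ := Finset.mem_Icc.mp μ.2
      have hcast : (((ν : ℕ) - 1 : ℕ) : ℂ) = (ν : ℕ) - 1 := by
        rw [Nat.cast_sub hν.1]; simp
      have e1 : exp ((1 - (ν : ℕ)) * P.hbar * (-t : ℝ)) = exp ((2 * (ν : ℕ) - 2) * x) := by
        rw [hx]; congr 1; push_cast; ring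
      have key2 : exp ((2 * (ν : ℕ) - 2) * x) * sinh x
          = (exp ((2 * (ν : ℕ) - 1) * x) - exp ((2 * ((ν : ℕ) - 1 : ℂ) - 1) * x)) / 2 := by
        rw [Complex.sinh, mul_div_assoc', mul_sub, ← exp_add, ← exp_add]
        congr 3 <;> ring_nf
      by_cases h : μ = ν
      · subst h
        have a1 : ¬ ((μ : ℕ) < (μ : ℕ)) := lt_irrefl _
        have a2 : (μ : ℕ) - 1 < (μ : ℕ) := by omega
        simp only [H, a1, a2, if_true, if_false, comm, hcast, e1]
        have e2 : sinh ((P.N - 1) / 2 * P.hbar * t) = (exp ((P.N - 1) * x)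
            - exp (-((P.N - 1) * x))) / 2 := by
          rw [Complex.sinh, hx]; congr 3 <;> ring
        have e3 : exp (-(P.N * x)) * exp ((2 * (μ : ℕ) - 1) * x)
            = exp ((2 * (μ : ℕ) - 2) * x) * exp (-((P.N - 1) * x)) := by
          rw [← exp_add, ← exp_add]; congr 1; ring
        have e4 : exp (P.N * x) * exp ((2 * ((μ : ℕ) - 1 : ℂ) - 1) * x)
            = exp ((2 * (μ : ℕ) - 2) * x) * exp ((P.N - 1) * x) := by
          rw [← exp_add, ← exp_add]; congr 1; ring
        rw [e2, e3, e4, hC]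
        ring
      · have hne : (μ : ℕ) ≠ (ν : ℕ) := fun h' => h (Subtype.ext h')
        by_cases hlt : (ν : ℕ) < (μ : ℕ)
        · have a2 : (ν : ℕ) - 1 < (μ : ℕ) := by omega
          simp only [H, hlt, a2, if_true, comm, h, if_false, hcast, e1]
          have e5 : exp (1 * (P.N / 2) * P.hbar * t) = exp (P.N * x) := by
            rw [hx]; congr 1; ring
          rw [e5]
          calc _ = -C * exp (P.N * x) * (exp ((2 * (ν : ℕ) - 2) * x) * sinh x) := by
                rw [hC]; ring
            _ = _ := by rw [key2]; ring
        · have a2 : ¬ ((ν : ℕ) - 1 < (μ : ℕ)) := by omega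
          simp only [H, hlt, a2, comm, h, if_false, hcast, e1]
          have e5 : exp (-1 * (P.N / 2) * P.hbar * t) = exp (-(P.N * x)) := by
            rw [hx]; congr 1; ring
          rw [e5]
          calc _ = -C * exp (-(P.N * x)) * (exp ((2 * (ν : ℕ) - 2) * x) * sinh x) := by
                rw [hC]; ring
            _ = _ := by rw [key2]; ring
    rw [Finset.sum_congr rfl fun ν _ => key ν, ← Finset.mul_sum,
      Finset.sum_coe_sort (Finset.Icc 1 P.N) (fun j : ℕ => H j - H (j - 1))]
    have tele : ∀ n : ℕ, ∑ j ∈ Finset.Icc 1 n, (H j - H (j - 1)) = H n - H 0 := by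
      intro n
      induction n with
      | zero => simp
      | succ n ih => rw [Finset.sum_Icc_succ_top (by omega), ih]; simp
    have hμ := Finset.mem_Icc.mp μ.2
    have a1 : ¬ (P.N < (μ : ℕ)) := by omega
    have a2 : 0 < (μ : ℕ) := by omega
    have e6 : exp (-(P.N * x)) * exp ((2 * P.N - 1) * x)
        = exp (P.N * x) * exp ((2 * ((0 : ℕ) : ℂ) - 1) * x) := by
      rw [← exp_add, ← exp_add]; congr 1; push_cast; ring
    rw [tele]
    simp only [H, a1, a2, if_true, if_false]
    rw [e6]
    ring
  · simp [comm]
  · simp [comm]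

/-- The direction `∑_s f_s(t) [χ̂_s(t), · ]` in which the annihilation operator
`∫_{t>0} ∑_s f_s(t) χ̂_s(t) dt` differentiates. -/
def dir (P : Params) : ModeFn P →ₗ[ℂ] Config P where
  toFun f := ⟨fun s' t => ∑ s, f.1 s t * comm P s s' t, by
    refine ⟨fun s' => continuousOn_finsetSum _ fun s _ => (f.2 s).mul (comm_continuousOn P s s'),
      fun t _ => ?_⟩
    simp only [Finset.mul_sum]
    rw [Finset.sum_comm]
    refine Finset.sum_eq_zero fun s _ => ?_
    have h := congrArg (fun z => f.1 s t * z) (comm_relation P s t)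
    simp only [Finset.mul_sum, mul_zero] at h
    rw [← h]
    exact Finset.sum_congr rfl fun ν _ => by ring⟩
  map_add' f g := by
    apply Subtype.ext
    funext s' t
    simp [add_mul, Finset.sum_add_distrib]
  map_smul' c f := by
    apply Subtype.ext
    funext s' t
    simp [Finset.mul_sum, mul_add, mul_assoc]

/-- The value at `η` of the creation operator `∫_{t>0} ∑_s f_s(t) χ̂_s(-t) dt`. -/
def pair (P : Params) (η : Config P) (f : ModeFn P) : ℂ :=
  ∫ t in Ioi (0 : ℝ), ∑ s, η.1 s t * f.1 s t

/-- Convergence of the integral that defines `pair`. -/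
def PairConverges (P : Params) (η : Config P) (f : ModeFn P) : Prop :=
  IntegrableOn (fun t : ℝ => ∑ s, η.1 s t * f.1 s t) (Ioi 0)

/-- Families of functions vanishing outside a compact subset of the half line `t > 0`. -/
def IsTest {P : Params} (f : Boson P.N → ℝ → ℂ) : Prop :=
  ∃ a b : ℝ, 0 < a ∧ ∀ s t, t ∉ Icc a b → f s t = 0

/-- The space in which the completed Fock space lives: functionals of the (commuting) creation
modes.  The value at `η` of the functional of a vector is the generating function of its matrix
coefficients against the dual Fock space. -/
abbrev Functional (P : Params) : Type := Config P → ℂ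

/-- The Fock space: it is generated from the vacuum, the constant functional `1`, by the creation
operators smeared with test functions. -/
def fock (P : Params) : Subalgebra ℂ (Functional P) :=
  Algebra.adjoin ℂ {Ψ | ∃ f : ModeFn P, IsTest f.1 ∧ Ψ = fun η => pair P η f}

/-- The creation operator `∫_{t>0} ∑_s f_s(t) χ̂_s(-t) dt`. -/
def create (P : Params) (f : ModeFn P) (Ψ : Functional P) : Functional P :=
  fun η => pair P η f * Ψ η

/-- The annihilation operator `∫_{t>0} ∑_s f_s(t) χ̂_s(t) dt`. -/
def annihilate (P : Params) (f : ModeFn P) (Ψ : Functional P) : Functional P :=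
  fun η => deriv (fun z : ℂ => Ψ (η + z • dir P f)) 0

/-- The exponents of normal ordered exponentials: `e = (f, g)` stands for
`∫_{t>0} ∑_s f_s(t) χ̂_s(t) dt + ∫_{t>0} ∑_s g_s(t) χ̂_s(-t) dt`. -/
abbrev Exponent (P : Params) : Type := ModeFn P × ModeFn P

/-- The normal ordered exponential `:exp(f, g): = exp(creation g) exp(annihilation f)`; the
exponential of a derivation is a translation. -/
def vertex (P : Params) (e : Exponent P) : Module.End ℂ (Functional P) where
  toFun Ψ := fun η => exp (pair P η e.2) * Ψ (η + dir P e.1)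
  map_add' Ψ Φ := by funext η; simp [mul_add]
  map_smul' c Ψ := by funext η; simp; ring

/-! The definitions above do represent the Heisenberg algebra and its exponentials. -/

theorem IsTest.pairConverges {P : Params} {f : ModeFn P} (hf : IsTest f.1) (η : Config P) :
    PairConverges P η f := by
  obtain ⟨a, b, ha, h⟩ := hf
  have hsub : Icc a b ⊆ Ioi 0 := fun t ht => lt_of_lt_of_le ha ht.1
  have h1 : IntegrableOn (fun t : ℝ => ∑ s, η.1 s t * f.1 s t) (Icc a b) := by
    apply ContinuousOn.integrableOn_Icc
    exact continuousOn_finsetSum _ fun s _ =>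
      ((η.2.1 s).mono hsub).mul ((f.2 s).mono hsub)
  refine (h1.integrable_of_forall_notMem_eq_zero fun t ht => ?_).integrableOn
  exact Finset.sum_eq_zero fun s _ => by rw [h s t ht, mul_zero]

theorem pair_add_smul {P : Params} {f : ModeFn P} (η ζ : Config P) (z : ℂ)
    (h1 : PairConverges P η f) (h2 : PairConverges P ζ f) :
    pair P (η + z • ζ) f = pair P η f + z * pair P ζ f := by
  unfold pair
  rw [← integral_const_mul, ← integral_add h1 (h2.const_mul z)]
  congr 1
  funext t
  simp [add_mul, Finset.sum_add_distrib, Finset.mul_sum, mul_add, mul_assoc]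

theorem fock_differentiable {P : Params} {Ψ : Functional P} (hΨ : Ψ ∈ fock P) (η ζ : Config P) :
    Differentiable ℂ fun z : ℂ => Ψ (η + z • ζ) := by
  induction hΨ using Algebra.adjoin_induction with
  | mem Ψ h =>
    obtain ⟨f, hf, rfl⟩ := h
    simp only [pair_add_smul η ζ _ (hf.pairConverges η) (hf.pairConverges ζ)]
    fun_prop
  | algebraMap r => simp [Pi.algebraMap_apply]
  | add Ψ Φ _ _ h1 h2 => exact h1.add h2
  | mul Ψ Φ _ _ h1 h2 => exact h1.mul h2

/-- The vacuum is killed by the annihilation operators. -/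
theorem annihilate_vacuum (P : Params) (f : ModeFn P) : annihilate P f 1 = 0 := by
  funext η
  simp [annihilate]

/-- The Heisenberg commutation relation on the Fock space: the commutator of
`∫ ∑_s f_s(t) χ̂_s(t) dt` and `∫ ∑_s g_s(t) χ̂_s(-t) dt` is
`∫ ∑_{s,s'} f_s(t) g_{s'}(t) comm_{ss'}(t) dt`. -/
theorem annihilate_create (P : Params) (f g : ModeFn P) (hg : IsTest g.1)
    (Ψ : Functional P) (hΨ : Ψ ∈ fock P) :
    annihilate P f (create P g Ψ) =
      create P g (annihilate P f Ψ)
        + (∫ t in Ioi (0 : ℝ), ∑ s', (∑ s, f.1 s t * comm P s s' t) * g.1 s' t) • Ψ := by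
  funext η
  have hd := (fock_differentiable hΨ η (dir P f)) 0
  have hp : HasDerivAt (fun z : ℂ => pair P (η + z • dir P f) g) (pair P (dir P f) g) 0 := by
    simp only [pair_add_smul η (dir P f) _ (hg.pairConverges _) (hg.pairConverges _)]
    simpa using ((hasDerivAt_id (0 : ℂ)).mul_const (pair P (dir P f) g)).const_add (pair P η g)
  have h := (hp.mul hd.hasDerivAt).deriv
  simp only [annihilate, create, Pi.add_apply, Pi.smul_apply, smul_eq_mul]
  refine Eq.trans h ?_
  simp only [zero_smul, add_zero]
  rw [add_comm]
  rfl

/-- `z ↦ exp(z · annihilation)` is the one parameter group generated by the annihilation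
operator. -/
theorem vertex_annihilation (P : Params) (f : ModeFn P) (Ψ : Functional P) (hΨ : Ψ ∈ fock P)
    (η : Config P) (z : ℂ) :
    HasDerivAt (fun z : ℂ => vertex P (z • f, 0) Ψ η)
      (vertex P (z • f, 0) (annihilate P f Ψ) η) z := by
  have hd := (fock_differentiable hΨ (η + z • dir P f) (dir P f)) 0
  have h1 : HasDerivAt (fun w : ℂ => Ψ (η + z • dir P f + w • dir P f))
      (annihilate P f Ψ (η + z • dir P f)) (z - z) := by
    rw [sub_self]; exact hd.hasDerivAt
  have h2 := HasDerivAt.comp (h₂ := fun w : ℂ => Ψ (η + z • dir P f + w • dir P f))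
    (h := fun x : ℂ => id x - z) z h1 ((hasDerivAt_id z).sub_const z)
  have h3 : (fun z : ℂ => vertex P (z • f, 0) Ψ η)
      = (fun w : ℂ => Ψ (η + z • dir P f + w • dir P f)) ∘ (fun x => id x - z) := by
    funext w
    simp [vertex, pair, add_assoc, ← add_smul]
  rw [h3]
  refine h2.congr_deriv ?_
  simp [vertex, pair]

/-- `z ↦ exp(z · creation)` is the one parameter group generated by the creation operator. -/
theorem vertex_creation (P : Params) (f : ModeFn P) (Ψ : Functional P) (η : Config P) (z : ℂ) :
    HasDerivAt (fun z : ℂ => vertex P (0, z • f) Ψ η) (create P f (vertex P (0, z • f) Ψ) η) z := by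
  have h0 : ∀ z : ℂ, pair P η (z • f) = z * pair P η f := fun z => by
    unfold pair
    rw [← integral_const_mul]
    congr 1
    funext t
    simp only [Finset.mul_sum, SetLike.val_smul, Pi.smul_apply, smul_eq_mul]
    exact Finset.sum_congr rfl fun s _ => by ring
  have h1 : ∀ z : ℂ, vertex P (0, z • f) Ψ η = exp (z * pair P η f) * Ψ η := fun z => by
    simp [vertex, h0]
  simp only [create, h1]
  have h2 := (((hasDerivAt_id z).mul_const (pair P η f)).cexp).mul_const (Ψ η)
  simp only [id_eq, one_mul] at h2
  refine h2.congr_deriv ?_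
  ring

/-! ### Normal ordered expressions and the elementary fields -/

/-- Finite linear combinations of normal ordered exponentials.  The multiplication of this algebra
is the normal ordered product. -/
abbrev NormalOrdered (P : Params) : Type := AddMonoidAlgebra ℂ (Exponent P)

/-- The normal ordered exponential with exponent `e`. -/
def nexp {P : Params} (e : Exponent P) : NormalOrdered P := AddMonoidAlgebra.single e 1

/-- The operator given by a normal ordered expression. -/
def op (P : Params) (x : NormalOrdered P) : Module.End ℂ (Functional P) :=
  x.coeff.sum fun e c => c • vertex P e

/-- A mode function concentrated on the species selected by the weights `w`. -/
def modeFn (P : Params) (w : Boson P.N → ℂ) (f : ℝ → ℂ) (hf : ContinuousOn f (Ioi 0)) :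
    ModeFn P :=
  ⟨fun s t => w s * f t, fun _ => continuousOn_const.mul hf⟩

theorem sinh_half_ne_zero (P : Params) {t : ℝ} (ht : 0 < t) : sinh (P.hbar * t / 2) ≠ 0 := by
  apply sinh_ne_zero_of_re_pos
  have : (P.hbar * t / 2 : ℂ) = ((t / 2 : ℝ) : ℂ) * P.hbar := by push_cast; ring
  rw [this, re_ofReal_mul]
  have := P.hbar_pos
  positivity

/-- The exponent `2ħ ∫_{t>0} χ̂(t) e^{-iut} dt` of the field `χ⁺(u)`. -/
def fieldPlus (P : Params) (w : Boson P.N → ℂ) (u : ℂ) : Exponent P :=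
  (modeFn P w (fun t => 2 * P.hbar * exp (-(I * u * t))) (by fun_prop), 0)

/-- The exponent `-2ħ ∫_{t<0} χ̂(t) e^{-iut} dt` of the field `χ⁻(u)`. -/
def fieldMinus (P : Params) (w : Boson P.N → ℂ) (u : ℂ) : Exponent P :=
  (0, modeFn P w (fun t => -(2 * P.hbar * exp (-(I * u * (-t : ℝ))))) (by fun_prop))

/-- The exponent `-ħ ∫_{t≠0} χ̂(t) e^{-iut} / sinh(ħt/2) dt` of the field `χ(u) = χ(1|u;0)`. -/
def fieldFull (P : Params) (w : Boson P.N → ℂ) (u : ℂ) : Exponent P :=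
  (modeFn P w (fun t => -(P.hbar / sinh (P.hbar * t / 2) * exp (-(I * u * t))))
      ((ContinuousOn.div (by fun_prop) (by fun_prop) fun _ ht => sinh_half_ne_zero P ht).mul
        (by fun_prop)).neg,
    modeFn P w (fun t => -(P.hbar / sinh (P.hbar * (-t : ℝ) / 2) * exp (-(I * u * (-t : ℝ)))))
      ((ContinuousOn.div (by fun_prop) (by fun_prop) fun t ht => by
          have h : (P.hbar * (-t : ℝ) / 2 : ℂ) = -(P.hbar * t / 2) := by push_cast; ring
          rw [h, sinh_neg]
          exact neg_ne_zero.mpr (sinh_half_ne_zero P ht)).mul (by fun_prop)).neg)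

/-- The species `λ_μ`. -/
def lamW (P : Params) (μ : ℕ) : Boson P.N → ℂ
  | .inl i => if (i : ℕ) = μ then 1 else 0
  | _ => 0

/-- The species `b_{μν}`; it is `0` unless `1 ≤ μ < ν ≤ N`. -/
def bW (P : Params) (μ ν : ℕ) : Boson P.N → ℂ
  | .inr (.inl p) => if p.1 = (μ, ν) then 1 else 0
  | _ => 0

/-- The species `c_{μν}`; it is `0` unless `1 ≤ μ < ν ≤ N`. -/
def cW (P : Params) (μ ν : ℕ) : Boson P.N → ℂ
  | .inr (.inr p) => if p.1 = (μ, ν) then 1 else 0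
  | _ => 0

/-- The shifted argument `u + r i ħ`. -/
def sh (P : Params) (u r : ℂ) : ℂ := u + r * (I * P.hbar)

/-- `λ_μ^+(u + r i ħ)`. -/
def lamPlus (P : Params) (μ : ℕ) (u r : ℂ) : Exponent P := fieldPlus P (lamW P μ) (sh P u r)

/-- `λ_μ^-(u + r i ħ)`. -/
def lamMinus (P : Params) (μ : ℕ) (u r : ℂ) : Exponent P := fieldMinus P (lamW P μ) (sh P u r)

/-- `b_{μν}^+(u + r i ħ)`. -/
def bPlus (P : Params) (μ ν : ℕ) (u r : ℂ) : Exponent P := fieldPlus P (bW P μ ν) (sh P u r)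

/-- `b_{μν}^-(u + r i ħ)`. -/
def bMinus (P : Params) (μ ν : ℕ) (u r : ℂ) : Exponent P := fieldMinus P (bW P μ ν) (sh P u r)

/-- `(b + c)_{μν}(u + r i ħ) = :b_{μν}(u + r i ħ) c_{μν}(u + r i ħ):`. -/
def bc (P : Params) (μ ν : ℕ) (u r : ℂ) : Exponent P :=
  fieldFull P (bW P μ ν) (sh P u r) + fieldFull P (cW P μ ν) (sh P u r)

/-! ### The images of the currents -/

/-- The exponent of the image of `k_μ^+(u)`. -/
def kPlusExp (P : Params) (μ : ℕ) (u : ℂ) : Exponent P :=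
  -lamPlus P μ u ((P.k - P.N) / 4)
    + ∑ α ∈ Finset.Ico 1 μ, bPlus P α μ u (((μ : ℂ) - α) / 2)
    - ∑ β ∈ Finset.Icc (μ + 1) P.N, bPlus P μ β u (((μ : ℂ) - β) / 2)

/-- The exponent of the image of `k_μ^-(u)`. -/
def kMinusExp (P : Params) (μ : ℕ) (u : ℂ) : Exponent P :=
  -lamMinus P μ u (-((P.k - P.N) / 4))
    + ∑ ρ ∈ Finset.Ico 1 μ, ∑ γ ∈ Finset.Icc μ P.N, bMinus P ρ γ u (((ρ : ℂ) + γ) / 2)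
    - ∑ α ∈ Finset.Icc 1 μ, ∑ β ∈ Finset.Icc (μ + 1) P.N,
        bMinus P α β u (((α : ℂ) + β - 2) / 2)

/-- The image of `X_ν^+(u)`. -/
def xPlusImage (P : Params) (ν : ℕ) (u : ℂ) : NormalOrdered P :=
  ∑ m ∈ Finset.Icc 1 ν,
    nexp (bc P m ν u (-(((m : ℂ) - ν - 1) / 2)))
    * (nexp (bPlus P m (ν + 1) u (-(((m : ℂ) - ν - 1) / 2))
          - bc P m (ν + 1) u (-(((m : ℂ) - ν) / 2)))
      - nexp (bMinus P m (ν + 1) u (-(((m : ℂ) - ν - 1) / 2))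
          - bc P m (ν + 1) u (-(((m : ℂ) - ν - 2) / 2))))
    * nexp (∑ n ∈ Finset.Ico 1 m,
        (bPlus P n (ν + 1) u (-(((n : ℂ) - ν - 1) / 2))
          - bPlus P n ν u (-(((n : ℂ) - ν) / 2))))

/-- The image of `X_ν^-(u)`. -/
def xMinusImage (P : Params) (ν : ℕ) (u : ℂ) : NormalOrdered P :=
  (∑ m ∈ Finset.Icc 1 ν,
    nexp (bc P m (ν + 1) u (((ν : ℂ) + m) / 2)
      + lamMinus P ν u (-((P.k - P.N) / 4)) - lamMinus P (ν + 1) u (-((P.k - P.N) / 4)))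
    * ((1 + if m = ν then 1 else 0 : ℂ) • nexp (-bMinus P m ν u (((ν : ℂ) + m) / 2)
          - bc P m ν u (((ν : ℂ) + m - 1) / 2))
      - nexp (-bPlus P m ν u (((ν : ℂ) + m) / 2)
          - bc P m ν u (((ν : ℂ) + m + 1) / 2)))
    * nexp (∑ n ∈ Finset.Icc (m + 1) ν,
        (bMinus P n (ν + 1) u (((ν : ℂ) + n - 1) / 2) - bMinus P n ν u (((ν : ℂ) + n) / 2)))
    * nexp (∑ s ∈ Finset.Icc (ν + 1) P.N,
        (bMinus P ν s u (((ν : ℂ) + s) / 2) - bMinus P (ν + 1) s u (((ν : ℂ) + s - 1) / 2))))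
  - ∑ m ∈ Finset.Icc (ν + 1) P.N,
    nexp (bc P ν m u (-((2 * P.k + m - ν - 1) / 2))
      + lamPlus P ν u (-((3 * P.k + P.N) / 4)) - lamPlus P (ν + 1) u (-((3 * P.k + P.N) / 4)))
    * ((1 + if m = ν + 1 then 1 else 0 : ℂ) •
          nexp (bPlus P (ν + 1) m u (-((2 * P.k + m - ν - 1) / 2))
            - bc P (ν + 1) m u (-((2 * P.k + m - ν) / 2)))
      - nexp (bMinus P (ν + 1) m u (-((2 * P.k + m - ν - 1) / 2))
          - bc P (ν + 1) m u (-((2 * P.k + m - ν - 2) / 2))))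
    * nexp (∑ n ∈ Finset.Icc m P.N,
        (bPlus P ν n u (-((2 * P.k + n - ν) / 2))
          - bPlus P (ν + 1) n u (-((2 * P.k + n - ν - 1) / 2))))

/-- The currents that generate the Yangian double of `gl_N`: `k_μ^±`, their inverses and
`X_ν^±`. -/
inductive Current (N : ℕ) : Type where
  | kPlus (μ : Idx N)
  | kPlusInv (μ : Idx N)
  | kMinus (μ : Idx N)
  | kMinusInv (μ : Idx N)
  | xPlus (ν : RootIdx N)
  | xMinus (ν : RootIdx N)

/-- The normal ordered expression assigned to a current at the point `u`. -/
def image (P : Params) : Current P.N → ℂ → NormalOrdered P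
  | .kPlus μ, u => nexp (kPlusExp P μ u)
  | .kPlusInv μ, u => nexp (-kPlusExp P μ u)
  | .kMinus μ, u => nexp (kMinusExp P μ u)
  | .kMinusInv μ, u => nexp (-kMinusExp P μ u)
  | .xPlus ν, u => xPlusImage P ν u
  | .xMinus ν, u => xMinusImage P ν u

/-! ### The relations in the sense of analytic continuation -/

/-- The free algebra on the currents at all points of the spectral plane. -/
abbrev FreeCurrents (P : Params) : Type := FreeAlgebra ℂ (Current P.N × ℂ)

/-- The generator `J(u)`. -/
def cur {P : Params} (J : Current P.N) (u : ℂ) : FreeCurrents P := FreeAlgebra.ι ℂ (J, u)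

/-- Homomorphisms from the free algebra on the currents to operators on (the completed) Fock
space. -/
abbrev Realization (P : Params) : Type := FreeCurrents P →ₐ[ℂ] Module.End ℂ (Functional P)

/-- The index `ν` as an index in `1, …, N`. -/
def low {N : ℕ} (ν : RootIdx N) : Idx N :=
  ⟨ν, Finset.mem_Icc.mpr ⟨(Finset.mem_Ico.mp ν.2).1, (Finset.mem_Ico.mp ν.2).2.le⟩⟩

/-- The index `ν + 1` as an index in `1, …, N`. -/
def high {N : ℕ} (ν : RootIdx N) : Idx N :=
  ⟨ν + 1, Finset.mem_Icc.mpr ⟨by omega, (Finset.mem_Ico.mp ν.2).2⟩⟩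

/-- A product of currents converges when the imaginary parts of the arguments increase by more
than `R` from each factor to every later one.  A probe is a choice of currents to the left and to
the right of the product under consideration, of a vector of the Fock space on which the product
acts and of a test configuration at which the result is evaluated. -/
structure Probe (P : Params) (R : ℝ) where
  left : List (Current P.N × ℂ)
  right : List (Current P.N × ℂ)
  ordered : (left ++ right).Pairwise fun x y => (x.2 - y.2).im < -R
  ket : Functional P
  ket_mem : ket ∈ fock P
  bra : Config P
  bra_test : IsTest bra.1

namespace Probe

variable {P : Params} {R : ℝ}

/-- The matrix coefficient of `left * A * right`. -/
def eval (p : Probe P R) (ψ : Realization P) (A : FreeCurrents P) : ℂ :=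
  ψ ((p.left.map (FreeAlgebra.ι ℂ)).prod * A * (p.right.map (FreeAlgebra.ι ℂ)).prod)
    p.ket p.bra

/-- The points that lie after the left and before the right insertions; this is all of `ℂ` when
there are no insertions. -/
def band (p : Probe P R) : Set ℂ :=
  {u | (∀ x ∈ p.left, (x.2 - u).im < -R) ∧ ∀ y ∈ p.right, (u - y.2).im < -R}

/-- `A(u, v)`, which converges for `Im (u - v) < -R`, and `B(u, v)`, which converges for
`Im (u - v) > R`, are the same up to analytic continuation, and their common value differs from
`C(u, v)` by a regular (everywhere holomorphic) term. -/
def EqUpToReg (p : Probe P R) (ψ : Realization P) (A B C : ℂ → ℂ → FreeCurrents P) : Prop :=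
  ∃ M : ℂ × ℂ → ℂ, DifferentiableOn ℂ M (p.band ×ˢ p.band) ∧
    ∀ u ∈ p.band, ∀ v ∈ p.band,
      ((u - v).im < -R → p.eval ψ (A u v) = M (u, v) + p.eval ψ (C u v)) ∧
      (R < (u - v).im → p.eval ψ (B u v) = M (u, v) + p.eval ψ (C u v))

end Probe

/-- The scalar factor
`ρ(u) = Γ(iu/Nħ) Γ(1 + iu/Nħ) / (Γ(1/N + iu/Nħ) Γ(1 - 1/N + iu/Nħ))`. -/
def rho (P : Params) (u : ℂ) : ℂ :=
  Gamma (I * u / (P.N * P.hbar)) * Gamma (1 + I * u / (P.N * P.hbar))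
    / (Gamma (1 / P.N + I * u / (P.N * P.hbar)) * Gamma (1 - 1 / P.N + I * u / (P.N * P.hbar)))

/-- The Serre combination: the three factors `Y_0(z_0)`, `Y_1(z_1)`, `Y_2(z_2)` are multiplied in
the order `σ`, with coefficient `-2` if `Y_2` is in the middle and `1` otherwise. -/
def serreCoeff (σ : Equiv.Perm (Fin 3)) : ℂ := if σ 1 = 2 then -2 else 1

/-- `J(z_0)`, `J(z_1)`, `J'(z_2)`, multiplied in the order `σ`. -/
def serreWord {P : Params} (J J' : Current P.N) (σ : Equiv.Perm (Fin 3)) (z : Fin 3 → ℂ) :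
    FreeCurrents P :=
  let Y : Fin 3 → FreeCurrents P := ![cur J (z 0), cur J (z 1), cur J' (z 2)]
  Y (σ 0) * Y (σ 1) * Y (σ 2)

/-- The Serre relation up to analytic continuation: the six products, each convergent in its own
domain, have meromorphic continuations `G_σ / d`, and the Serre combination of these
vanishes. -/
def SerreRelation {P : Params} (R : ℝ) (ψ : Realization P) (J J' : Current P.N) : Prop :=
  ∃ d : MvPolynomial (Fin 3) ℂ, d ≠ 0 ∧ ∀ p : Probe P R,
    ∃ G : Equiv.Perm (Fin 3) → (Fin 3 → ℂ) → ℂ,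
      (∀ σ, DifferentiableOn ℂ (G σ) {z | ∀ i, z i ∈ p.band}) ∧
      (∀ σ z, (∀ i, z i ∈ p.band) → (z (σ 0) - z (σ 1)).im < -R →
        (z (σ 1) - z (σ 2)).im < -R →
          MvPolynomial.eval z d * p.eval ψ (serreWord J J' σ z) = G σ z) ∧
      ∀ z, (∀ i, z i ∈ p.band) → ∑ σ, serreCoeff σ * G σ z = 0

/-- The Drinfeld current relations of the Yangian double of `gl_N` at level `k`, with `ħ` replaced
by `-iħ`, up to analytic continuation and inside arbitrary products of currents. -/
structure DrinfeldRelations (P : Params) (R : ℝ) (ψ : Realization P) : Prop where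
  kPlus_inv : ∀ μ u, ψ (cur (.kPlus μ) u * cur (.kPlusInv μ) u) = 1 ∧
    ψ (cur (.kPlusInv μ) u * cur (.kPlus μ) u) = 1
  kMinus_inv : ∀ μ u, ψ (cur (.kMinus μ) u * cur (.kMinusInv μ) u) = 1 ∧
    ψ (cur (.kMinusInv μ) u * cur (.kMinus μ) u) = 1
  kPlus_kPlus : ∀ μ ν u v,
    ψ (cur (.kPlus μ) u * cur (.kPlus ν) v) = ψ (cur (.kPlus ν) v * cur (.kPlus μ) u)
  kMinus_kMinus : ∀ μ ν u v,
    ψ (cur (.kMinus μ) u * cur (.kMinus ν) v) = ψ (cur (.kMinus ν) v * cur (.kMinus μ) u)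
  kPlus_kMinus_eq : ∀ μ : Idx P.N, ∀ p : Probe P R, ∀ u ∈ p.band, ∀ v ∈ p.band,
    (u - v).im < -R →
      rho P (u - v + I * P.k * P.hbar) * p.eval ψ (cur (.kPlus μ) u * cur (.kMinus μ) v)
        = p.eval ψ (cur (.kMinus μ) v * cur (.kPlus μ) u) * rho P (u - v)
  kPlus_kMinus_lt : ∀ μ ν : Idx P.N, (μ : ℕ) < ν → ∀ p : Probe P R, ∀ u ∈ p.band, ∀ v ∈ p.band,
    (u - v).im < -R →
      rho P (u - v + I * P.k * P.hbar)
          * ((u - v + I * P.k * P.hbar) / (u - v - I * P.hbar + I * P.k * P.hbar))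
          * p.eval ψ (cur (.kPlus μ) u * cur (.kMinus ν) v)
        = p.eval ψ (cur (.kMinus ν) v * cur (.kPlus μ) u)
          * ((u - v) / (u - v - I * P.hbar)) * rho P (u - v)
  kPlus_kMinus_gt : ∀ μ ν : Idx P.N, (ν : ℕ) < μ → ∀ p : Probe P R, ∀ u ∈ p.band, ∀ v ∈ p.band,
    (u - v).im < -R →
      rho P (u - v + I * P.k * P.hbar)
          * ((u - v + I * P.hbar + I * P.k * P.hbar) / (u - v + I * P.k * P.hbar))
          * p.eval ψ (cur (.kPlus μ) u * cur (.kMinus ν) v)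
        = p.eval ψ (cur (.kMinus ν) v * cur (.kPlus μ) u)
          * ((u - v + I * P.hbar) / (u - v)) * rho P (u - v)
  kPlus_xPlus_low : ∀ ν, ∀ p : Probe P R, ∀ u ∈ p.band, ∀ v ∈ p.band, (u - v).im < -R →
    p.eval ψ (cur (.kPlus (low ν)) u * cur (.xPlus ν) v * cur (.kPlusInv (low ν)) u)
      = (u - v) / (u - v - I * P.hbar) * p.eval ψ (cur (.xPlus ν) v)
  kMinus_xPlus_low : ∀ ν, ∀ p : Probe P R, ∀ u ∈ p.band, ∀ v ∈ p.band, R < (u - v).im →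
    p.eval ψ (cur (.kMinus (low ν)) u * cur (.xPlus ν) v * cur (.kMinusInv (low ν)) u)
      = (u - v) / (u - v - I * P.hbar) * p.eval ψ (cur (.xPlus ν) v)
  kPlus_xPlus_high : ∀ ν, ∀ p : Probe P R, ∀ u ∈ p.band, ∀ v ∈ p.band, (u - v).im < -R →
    p.eval ψ (cur (.kPlus (high ν)) u * cur (.xPlus ν) v * cur (.kPlusInv (high ν)) u)
      = (u - v) / (u - v + I * P.hbar) * p.eval ψ (cur (.xPlus ν) v)
  kMinus_xPlus_high : ∀ ν, ∀ p : Probe P R, ∀ u ∈ p.band, ∀ v ∈ p.band, R < (u - v).im →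
    p.eval ψ (cur (.kMinus (high ν)) u * cur (.xPlus ν) v * cur (.kMinusInv (high ν)) u)
      = (u - v) / (u - v + I * P.hbar) * p.eval ψ (cur (.xPlus ν) v)
  kMinus_xMinus_low : ∀ ν, ∀ p : Probe P R, ∀ u ∈ p.band, ∀ v ∈ p.band, R < (u - v).im →
    p.eval ψ (cur (.kMinus (low ν)) u * cur (.xMinus ν) v * cur (.kMinusInv (low ν)) u)
      = (u - v - I * P.hbar) / (u - v) * p.eval ψ (cur (.xMinus ν) v)
  kMinus_xMinus_high : ∀ ν, ∀ p : Probe P R, ∀ u ∈ p.band, ∀ v ∈ p.band, R < (u - v).im →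
    p.eval ψ (cur (.kMinus (high ν)) u * cur (.xMinus ν) v * cur (.kMinusInv (high ν)) u)
      = (u - v + I * P.hbar) / (u - v) * p.eval ψ (cur (.xMinus ν) v)
  kPlus_xMinus_low : ∀ ν, ∀ p : Probe P R, ∀ u ∈ p.band, ∀ v ∈ p.band, (u - v).im < -R →
    p.eval ψ (cur (.kPlus (low ν)) u * cur (.xMinus ν) v * cur (.kPlusInv (low ν)) u)
      = (u - v - I * P.hbar + I * P.k * P.hbar) / (u - v + I * P.k * P.hbar)
        * p.eval ψ (cur (.xMinus ν) v)
  kPlus_xMinus_high : ∀ ν, ∀ p : Probe P R, ∀ u ∈ p.band, ∀ v ∈ p.band, (u - v).im < -R →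
    p.eval ψ (cur (.kPlus (high ν)) u * cur (.xMinus ν) v * cur (.kPlusInv (high ν)) u)
      = (u - v + I * P.hbar + I * P.k * P.hbar) / (u - v + I * P.k * P.hbar)
        * p.eval ψ (cur (.xMinus ν) v)
  kPlus_x_far : ∀ (μ : Idx P.N) (ν : RootIdx P.N), (ν + 2 ≤ (μ : ℕ) ∨ (μ : ℕ) + 1 ≤ ν) →
    ∀ J ∈ ({.xPlus ν, .xMinus ν} : Set (Current P.N)),
    ∀ p : Probe P R, ∀ u ∈ p.band, ∀ v ∈ p.band, (u - v).im < -R →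
      p.eval ψ (cur (.kPlus μ) u * cur J v * cur (.kPlusInv μ) u) = p.eval ψ (cur J v)
  kMinus_x_far : ∀ (μ : Idx P.N) (ν : RootIdx P.N), (ν + 2 ≤ (μ : ℕ) ∨ (μ : ℕ) + 1 ≤ ν) →
    ∀ J ∈ ({.xPlus ν, .xMinus ν} : Set (Current P.N)),
    ∀ p : Probe P R, ∀ u ∈ p.band, ∀ v ∈ p.band, R < (u - v).im →
      p.eval ψ (cur (.kMinus μ) u * cur J v * cur (.kMinusInv μ) u) = p.eval ψ (cur J v)
  xPlus_xPlus : ∀ ν, ∀ p : Probe P R, p.EqUpToReg ψ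
    (fun u v => (u - v + I * P.hbar) • (cur (.xPlus ν) u * cur (.xPlus ν) v))
    (fun u v => (u - v - I * P.hbar) • (cur (.xPlus ν) v * cur (.xPlus ν) u)) 0
  xMinus_xMinus : ∀ ν, ∀ p : Probe P R, p.EqUpToReg ψ
    (fun u v => (u - v - I * P.hbar) • (cur (.xMinus ν) u * cur (.xMinus ν) v))
    (fun u v => (u - v + I * P.hbar) • (cur (.xMinus ν) v * cur (.xMinus ν) u)) 0
  xPlus_xPlus_succ : ∀ μ ν : RootIdx P.N, (ν : ℕ) = μ + 1 → ∀ p : Probe P R, p.EqUpToReg ψ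
    (fun u v => (u - v - I * P.hbar) • (cur (.xPlus μ) u * cur (.xPlus ν) v))
    (fun u v => (u - v) • (cur (.xPlus ν) v * cur (.xPlus μ) u)) 0
  xMinus_xMinus_succ : ∀ μ ν : RootIdx P.N, (ν : ℕ) = μ + 1 → ∀ p : Probe P R, p.EqUpToReg ψ
    (fun u v => (u - v) • (cur (.xMinus μ) u * cur (.xMinus ν) v))
    (fun u v => (u - v - I * P.hbar) • (cur (.xMinus ν) v * cur (.xMinus μ) u)) 0
  serre_xPlus : ∀ μ ν : RootIdx P.N, ((ν : ℕ) = μ + 1 ∨ (μ : ℕ) = ν + 1) →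
    SerreRelation R ψ (.xPlus μ) (.xPlus ν)
  serre_xMinus : ∀ μ ν : RootIdx P.N, ((ν : ℕ) = μ + 1 ∨ (μ : ℕ) = ν + 1) →
    SerreRelation R ψ (.xMinus μ) (.xMinus ν)
  xPlus_xPlus_far : ∀ μ ν : RootIdx P.N, ((μ : ℕ) + 2 ≤ ν ∨ (ν : ℕ) + 2 ≤ μ) →
    ∀ p : Probe P R, p.EqUpToReg ψ
      (fun u v => cur (.xPlus μ) u * cur (.xPlus ν) v)
      (fun u v => cur (.xPlus ν) v * cur (.xPlus μ) u) 0
  xMinus_xMinus_far : ∀ μ ν : RootIdx P.N, ((μ : ℕ) + 2 ≤ ν ∨ (ν : ℕ) + 2 ≤ μ) →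
    ∀ p : Probe P R, p.EqUpToReg ψ
      (fun u v => cur (.xMinus μ) u * cur (.xMinus ν) v)
      (fun u v => cur (.xMinus ν) v * cur (.xMinus μ) u) 0
  xPlus_xMinus_ne : ∀ μ ν : RootIdx P.N, μ ≠ ν → ∀ p : Probe P R, p.EqUpToReg ψ
    (fun u v => cur (.xPlus μ) u * cur (.xMinus ν) v)
    (fun u v => cur (.xMinus ν) v * cur (.xPlus μ) u) 0
  /-- `δ(u - a)` is the difference of the expansions of `1/(u - a)` for the two orderings of `u`
  and `a`; so a commutator equal to `-iħ (δ(u - v + ikħ) H⁺(u) - δ(u - v) H⁻(v))` means that the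
  two products have the common continuation below. -/
  xPlus_xMinus_eq : ∀ ν, ∀ p : Probe P R, p.EqUpToReg ψ
    (fun u v => cur (.xPlus ν) u * cur (.xMinus ν) v)
    (fun u v => cur (.xMinus ν) v * cur (.xPlus ν) u)
    (fun u v => (-(I * P.hbar)) •
      ((1 / (u - v + I * P.k * P.hbar)) • (cur (.kPlus (high ν)) u * cur (.kPlusInv (low ν)) u)
        - (1 / (u - v)) • (cur (.kMinus (high ν)) v * cur (.kMinusInv (low ν)) v)))

/-- The currents are well defined on the Fock space: on Fock vectors and test configurations all
integrals in the exponents converge absolutely; so do all the contractions in products with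
arguments ordered by their imaginary parts; and the matrix coefficients of such products are
holomorphic (those of a single current are entire). -/
structure WellDefined (P : Params) (R : ℝ) (ψ : Realization P) : Prop where
  creation : ∀ J u, ∀ e ∈ (image P J u).coeff.support, ∀ η : Config P, IsTest η.1 →
    PairConverges P η e.2
  annihilation : ∀ J u, ∀ e ∈ (image P J u).coeff.support, ∀ f : ModeFn P, IsTest f.1 →
    PairConverges P (dir P e.1) f
  contraction : ∀ J J' u v, (u - v).im < -R → ∀ e ∈ (image P J u).coeff.support,
    ∀ e' ∈ (image P J' v).coeff.support, PairConverges P (dir P e.1) e'.2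
  holomorphic : ∀ (n : ℕ) (J : Fin n → Current P.N), ∀ Ψ ∈ fock P, ∀ η : Config P, IsTest η.1 →
    DifferentiableOn ℂ
      (fun z : Fin n → ℂ => ψ ((List.ofFn fun i => cur (J i) (z i)).prod) Ψ η)
      {z | ∀ i j, i < j → (z i - z j).im < -R}

end YangianBoson

end

open Complex Set MeasureTheory

noncomputable section

namespace YangianBoson

open Filter Topology

set_option linter.unusedSimpArgs false

/-! The algebra on the currents is free, so the homomorphism exists at once; the content is the
convergence of products and the relations. Each current is a finite sum of normal ordered
exponentials (`op_image`), and inside a matrix coefficient two adjacent exponentials merge into one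
at the cost of the scalar `exp (contr P e e')` (`prod_vertex_mul_vertex`). The contraction is a
Laplace integral over t > 0 in the difference w of the two arguments. It converges for Im w <
-`radius P`, because all shifts in the currents are bounded in terms of N and k. Holomorphy of
matrix coefficients is the holomorphy of such integrals (`differentiableOn_word`).

For the bosons b and c the integrand is e^{-iwt}/t times a sum of differences of characters e^{rħt},
and a Frullani integral turns each difference into a linear fractional function of w
(`exp_laplace_frullani`). The bosons λ contribute in addition a kernel that does not depend on the
indices. It drops out of λ_ν λ_{ν+1}⁻¹, hence of every contraction with a current X, and in k⁺k⁻ it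
produces ρ(w)/ρ(w + ikħ) by Euler's limit for Γ (`exp_laplace_rhoKernel`). After telescoping along
rows and columns of bosons, the contraction of two terms, at least one of them from a current X,
consists of one or two factors (w + r iħ)/(w + s iħ). The shifts are collected in tables, which are
verified by a finite case distinction on the relative positions of the indices.

The relations then follow up to the question of poles. The contraction with k^± is the same for all
terms of an X, which gives the relations between k and X. For two currents X the contractions in the
two orders are the same rational function up to the structure factors α and β of the relation
(`Exchange`), and the merged exponential does not depend on the order; so the two products have the
same continuation. The Serre relations reduce to one polynomial identity in the α and β, since the
same product of numerators is left over in all six orders (`serreRelation_of_exchange`).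

Regularity remains. For X⁺X⁺, and for X⁻X⁻ with equal indices, the numerators are polynomial. In the
other products single terms have a simple pole. These terms come in pairs with opposite residues,
and at the pole the two exponents coincide. The difference of the two matrix coefficients then
vanishes where u - v = a, so it is divisible by u - v - a (`exists_differentiableOn_eq_mul`,
`Probe.Reg.sum_pole`). Only in X_ν⁺X_ν⁻ do two terms stay without a partner; at their poles their
exponents become those of k_{ν+1}^±(k_ν^±)⁻¹, and they account for the right hand side of the
commutator. -/

theorem norm_exp_neg_I_mul (w : ℂ) (t : ℝ) : ‖exp (-(I * w * t))‖ = Real.exp (w.im * t) := by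
  rw [norm_exp]
  congr 1
  simp

/-! ### Laplace integrals on the half line -/

theorem integrableOn_real_exp_mul {c : ℝ} (hc : c < 0) :
    IntegrableOn (fun t : ℝ => Real.exp (c * t)) (Ioi 0) := by
  simpa using _root_.integrableOn_exp_mul_Ioi hc 0

theorem laplace_integrableOn {h : ℝ → ℂ} (hc : ContinuousOn h (Ioi 0)) {C ρ : ℝ}
    (hb : ∀ t, 0 < t → ‖h t‖ ≤ C * Real.exp (ρ * t)) {w : ℂ} (hw : w.im < -ρ) :
    IntegrableOn (fun t : ℝ => exp (-(I * w * t)) * h t) (Ioi 0) := by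
  have h1 : IntegrableOn (fun t : ℝ => C * Real.exp ((w.im + ρ) * t)) (Ioi 0) :=
    (integrableOn_real_exp_mul (by linarith)).const_mul C
  refine Integrable.mono' h1 ?_ ?_
  · exact (ContinuousOn.mul (by fun_prop) hc).aestronglyMeasurable measurableSet_Ioi
  · refine (ae_restrict_iff' measurableSet_Ioi).2 (Eventually.of_forall fun t ht => ?_)
    rw [norm_mul, norm_exp_neg_I_mul, add_mul, Real.exp_add]
    nlinarith [hb t ht, Real.exp_pos (w.im * t)]

theorem laplace_hasDerivAt {h : ℝ → ℂ} (hc : ContinuousOn h (Ioi 0)) {C ρ : ℝ}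
    (hb : ∀ t, 0 < t → ‖h t‖ ≤ C * Real.exp (ρ * t)) {w : ℂ} (hw : w.im < -ρ) :
    HasDerivAt (fun w : ℂ => ∫ t in Ioi (0 : ℝ), exp (-(I * w * t)) * h t)
      (∫ t in Ioi (0 : ℝ), -(I * t) * exp (-(I * w * t)) * h t) w := by
  -- The gap to the boundary of convergence is 4δ: one δ pays for moving w inside the ball, one for
  -- the estimate t ≤ e^{δt}/δ, and e^{-2δt} is left as an integrable bound.
  set δ : ℝ := (-ρ - w.im) / 4 with hδ
  have hδ0 : 0 < δ := by rw [hδ]; linarith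
  have hC : 0 ≤ C := by
    have := (norm_nonneg _).trans (hb 1 one_pos)
    exact nonneg_of_mul_nonneg_left this (Real.exp_pos _)
  refine (hasDerivAt_integral_of_dominated_loc_of_deriv_le
    (F := fun (w : ℂ) (t : ℝ) => exp (-(I * w * t)) * h t)
    (F' := fun (w : ℂ) (t : ℝ) => -(I * t) * exp (-(I * w * t)) * h t)
    (bound := fun t : ℝ => C / δ * Real.exp (-(2 * δ) * t)) (Metric.ball_mem_nhds w hδ0)
    ?_ ?_ ?_ ?_ ?_ ?_).2
  · refine Eventually.of_forall fun x => ?_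
    exact (ContinuousOn.mul (by fun_prop) hc).aestronglyMeasurable measurableSet_Ioi
  · exact laplace_integrableOn hc hb hw
  · exact (ContinuousOn.mul (by fun_prop) hc).aestronglyMeasurable measurableSet_Ioi
  · refine (ae_restrict_iff' measurableSet_Ioi).2 (Eventually.of_forall fun t ht x hx => ?_)
    have ht0 : (0 : ℝ) < t := ht
    have hx' : x.im - w.im < δ := by
      have h1 : ‖x - w‖ < δ := by simpa [dist_eq_norm] using hx
      have h2 := (abs_lt.1 ((abs_im_le_norm (x - w)).trans_lt h1)).2
      simpa using h2
    rw [norm_mul, norm_mul, norm_exp_neg_I_mul, norm_neg, norm_mul, norm_I, one_mul, norm_real,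
      Real.norm_of_nonneg ht0.le]
    have h3 : t ≤ Real.exp (δ * t) / δ := by
      rw [le_div_iff₀ hδ0]
      have := Real.add_one_le_exp (δ * t)
      nlinarith
    have h4 : x.im * t ≤ (w.im + δ) * t := by nlinarith
    calc t * Real.exp (x.im * t) * ‖h t‖
        ≤ Real.exp (δ * t) / δ * Real.exp ((w.im + δ) * t) * (C * Real.exp (ρ * t)) := by
          gcongr
          exact hb t ht0
      _ = C / δ * (Real.exp (δ * t) * Real.exp ((w.im + δ) * t) * Real.exp (ρ * t)) := by
          field_simp
      _ = C / δ * Real.exp (-(2 * δ) * t) := by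
          rw [← Real.exp_add, ← Real.exp_add]
          congr 2
          rw [hδ]; ring
  · exact (integrableOn_real_exp_mul (by linarith)).const_mul _
  · refine Eventually.of_forall fun t x _ => ?_
    have h1 : HasDerivAt (fun x : ℂ => -(I * x * t)) (-(I * t)) x := by
      have h := (hasDerivAt_id x).const_mul (-(I * t))
      rw [mul_one] at h
      refine h.congr_of_eventuallyEq (Eventually.of_forall fun y => ?_)
      simp only [id]
      ring
    refine (h1.cexp.mul_const (h t)).congr_deriv ?_
    ring

/-- Decay as Im w → -∞. This fixes the constant of integration in the Frullani formula and makes the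
remainder in the product formula for ρ tend to 1. -/
theorem norm_laplace_le {h : ℝ → ℂ} {C ρ : ℝ}
    (hb : ∀ t, 0 < t → ‖h t‖ ≤ C * Real.exp (ρ * t)) {w : ℂ} (hw : w.im < -ρ) :
    ‖∫ t in Ioi (0 : ℝ), exp (-(I * w * t)) * h t‖ ≤ C / (-ρ - w.im) := by
  have h1 : IntegrableOn (fun t : ℝ => C * Real.exp ((w.im + ρ) * t)) (Ioi 0) :=
    (integrableOn_real_exp_mul (by linarith)).const_mul C
  refine (norm_integral_le_of_norm_le h1 ?_).trans_eq ?_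
  · refine (ae_restrict_iff' measurableSet_Ioi).2 (Eventually.of_forall fun t ht => ?_)
    rw [norm_mul, norm_exp_neg_I_mul, add_mul, Real.exp_add]
    nlinarith [hb t ht, Real.exp_pos (w.im * t)]
  · rw [integral_const_mul, integral_exp_mul_Ioi (by linarith)]
    have : w.im + ρ ≠ 0 := by linarith
    have h2 : -ρ - w.im ≠ 0 := by linarith
    simp only [mul_zero, Real.exp_zero]
    field_simp
    ring

/-! ### Frullani integrals -/

theorem norm_exp_sub_one_le' (z : ℂ) : ‖exp z - 1‖ ≤ ‖z‖ * Real.exp ‖z‖ := by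
  have h := Complex.norm_exp_sub_sum_le_exp_norm_sub_sum z 1
  simp at h
  have h2 : Real.exp ‖z‖ - 1 ≤ ‖z‖ * Real.exp ‖z‖ := by
    have h3 := Real.add_one_le_exp (-‖z‖)
    have h4 : Real.exp (-‖z‖) * Real.exp ‖z‖ = 1 := by rw [← Real.exp_add]; simp
    nlinarith [Real.exp_pos ‖z‖]
  exact h.trans h2

/-- The kernel whose Laplace transform is the logarithm of a linear fractional function. -/
def frullaniKernel (a b : ℂ) (t : ℝ) : ℂ := (exp (a * t) - exp (b * t)) / t

theorem frullaniKernel_continuousOn (a b : ℂ) : ContinuousOn (frullaniKernel a b) (Ioi 0) :=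
  ContinuousOn.div (by fun_prop) (by fun_prop) fun _ ht => ofReal_ne_zero.mpr (ne_of_gt ht)

/-- Taking out e^{bt} leaves (e^{(a-b)t} - 1)/t, which grows at most at the rate ‖a‖ + ‖b‖; together
with e^{bt} this is 2‖b‖ + ‖a‖. The rate is crude, and it is the origin of the factor 3 in `radius`.
-/
theorem norm_frullaniKernel_le (a b : ℂ) {ρ : ℝ} (hρ : 2 * ‖b‖ + ‖a‖ ≤ ρ) {t : ℝ} (ht : 0 < t) :
    ‖frullaniKernel a b t‖ ≤ ‖a - b‖ * Real.exp (ρ * t) := by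
  have h1 : exp (a * t) - exp (b * t) = exp (b * t) * (exp ((a - b) * t) - 1) := by
    rw [mul_sub, ← exp_add, mul_one]; congr 2; ring
  rw [frullaniKernel, norm_div, h1, norm_mul, norm_real, Real.norm_of_nonneg ht.le,
    div_le_iff₀ ht]
  have h2 : ‖exp (b * t)‖ ≤ Real.exp (‖b‖ * t) := by
    refine (norm_exp_le_exp_norm _).trans_eq ?_
    rw [norm_mul, norm_real, Real.norm_of_nonneg ht.le]
  have h3 := norm_exp_sub_one_le' ((a - b) * t)
  rw [norm_mul, norm_real, Real.norm_of_nonneg ht.le] at h3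
  have h4 : ‖a - b‖ * t ≤ (‖a‖ + ‖b‖) * t := by gcongr; exact norm_sub_le a b
  calc _ ≤ Real.exp (‖b‖ * t) * (‖a - b‖ * t * Real.exp ((‖a‖ + ‖b‖) * t)) := by
        gcongr
        exact h3.trans (by gcongr)
    _ = ‖a - b‖ * (Real.exp (‖b‖ * t) * Real.exp ((‖a‖ + ‖b‖) * t)) * t := by ring
    _ ≤ _ := by
        rw [← Real.exp_add]
        gcongr
        nlinarith

theorem integral_exp_neg_I_mul {w a : ℂ} (h : w.im < -‖a‖) :
    IntegrableOn (fun t : ℝ => exp (-(I * w * t)) * exp (a * t)) (Ioi 0) ∧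
    ∫ t in Ioi (0 : ℝ), exp (-(I * w * t)) * exp (a * t) = 1 / (I * w - a) := by
  have e : ∀ t : ℝ, exp (-(I * w * t)) * exp (a * t) = exp ((a - I * w) * t) := fun t => by
    rw [← exp_add]; congr 1; ring
  have hre : (a - I * w).re < 0 := by
    have := (abs_le.1 (abs_re_le_norm a)).2
    simp
    linarith
  simp only [e]
  refine ⟨integrableOn_exp_mul_complex_Ioi hre 0, ?_⟩
  rw [integral_exp_mul_complex_Ioi hre 0]
  have h0 : a - I * w ≠ 0 := fun h' => by rw [h'] at hre; simp at hre
  have h1 : I * w - a ≠ 0 := fun h' => h0 (by rw [← neg_sub, h', neg_zero])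
  field_simp
  simp

theorem I_mul_sub_ne_zero {w a : ℂ} (h : w.im < -‖a‖) : I * w - a ≠ 0 := fun h' => by
  have := (abs_le.1 (abs_re_le_norm a)).2
  have h2 := congrArg re h'
  simp at h2
  linarith

/-- Differentiation under the integral removes the denominator t, and the derivative in w is the
logarithmic derivative of (iw - b)/(iw - a). So the quotient G of the two sides is constant on a
half plane, and letting w → -i∞ shows that the constant is 1. -/
theorem exp_laplace_frullani {a b : ℂ} {w : ℂ} (hw : w.im < -(2 * ‖b‖ + ‖a‖)) :
    exp (∫ t in Ioi (0 : ℝ), exp (-(I * w * t)) * frullaniKernel a b t)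
      = (I * w - b) / (I * w - a) := by
  set ρ := 2 * ‖b‖ + ‖a‖ with hρ
  have hna := norm_nonneg a
  have hnb := norm_nonneg b
  set F : ℂ → ℂ := fun w => ∫ t in Ioi (0 : ℝ), exp (-(I * w * t)) * frullaniKernel a b t with hF
  set U : Set ℂ := {w | w.im < -ρ} with hU
  have hUo : IsOpen U := isOpen_lt continuous_im continuous_const
  have hUc : Convex ℝ U := convex_halfSpace_im_lt _
  have hb' : ∀ t : ℝ, 0 < t → ‖frullaniKernel a b t‖ ≤ ‖a - b‖ * Real.exp (ρ * t) :=
    fun t ht => norm_frullaniKernel_le a b le_rfl ht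
  have hFd : ∀ x ∈ U, HasDerivAt F (-I * (1 / (I * x - a) - 1 / (I * x - b))) x := by
    intro x hx
    have hx' : x.im < -ρ := hx
    refine (laplace_hasDerivAt (frullaniKernel_continuousOn a b) hb' hx).congr_deriv ?_
    obtain ⟨ia, ea⟩ := integral_exp_neg_I_mul (w := x) (a := a) (by linarith)
    obtain ⟨ib, eb⟩ := integral_exp_neg_I_mul (w := x) (a := b) (by linarith)
    rw [← ea, ← eb, ← integral_sub ia ib, ← integral_const_mul]
    refine setIntegral_congr_fun measurableSet_Ioi fun t ht => ?_
    have ht0 : (t : ℂ) ≠ 0 := ofReal_ne_zero.mpr (ne_of_gt ht)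
    simp only [frullaniKernel]
    field_simp
  have hnea : ∀ x ∈ U, I * x - a ≠ 0 := fun x hx =>
    I_mul_sub_ne_zero (by have : x.im < -ρ := hx; linarith)
  have hneb : ∀ x ∈ U, I * x - b ≠ 0 := fun x hx =>
    I_mul_sub_ne_zero (by have : x.im < -ρ := hx; linarith)
  set G : ℂ → ℂ := fun x => exp (F x) * ((I * x - a) / (I * x - b)) with hG
  have hGd : ∀ x ∈ U, HasDerivAt G 0 x := by
    intro x hx
    have h1 : HasDerivAt (fun x : ℂ => I * x - a) I x := by
      simpa using ((hasDerivAt_id x).const_mul I).sub_const a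
    have h2 : HasDerivAt (fun x : ℂ => I * x - b) I x := by
      simpa using ((hasDerivAt_id x).const_mul I).sub_const b
    refine ((hFd x hx).cexp.mul (h1.div h2 (hneb x hx))).congr_deriv ?_
    have := hnea x hx
    have := hneb x hx
    simp only [Pi.div_apply]
    field_simp
    ring
  have hconst : ∀ x ∈ U, ∀ y ∈ U, G x = G y := by
    intro x hx y hy
    refine (hUo.is_const_of_deriv_eq_zero (hUc.isPreconnected)
      (fun z hz => (hGd z hz).differentiableAt.differentiableWithinAt)
      (fun z hz => (hGd z hz).deriv) hx hy)
  have hlim : Tendsto (fun y : ℝ => G (-(I * y))) atTop (𝓝 1) := by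
    have hF0 : Tendsto (fun y : ℝ => F (-(I * y))) atTop (𝓝 0) := by
      have hev : ∀ᶠ y : ℝ in atTop, ‖F (-(I * y))‖ ≤ ‖a - b‖ / (-ρ + y) := by
        filter_upwards [eventually_gt_atTop ρ] with y hy
        refine (norm_laplace_le hb' (w := -(I * y)) (by simp; linarith)).trans_eq ?_
        congr 1
        simp
      refine squeeze_zero_norm' hev ?_
      exact Tendsto.const_div_atTop (tendsto_atTop_add_const_left _ _ tendsto_id) _
    have hR : Tendsto (fun y : ℝ => (I * (-(I * y)) - a) / (I * (-(I * y)) - b)) atTop (𝓝 1) := by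
      have e : ∀ᶠ y : ℝ in atTop, 1 + (b - a) / ((y : ℂ) - b)
          = (I * (-(I * y)) - a) / (I * (-(I * y)) - b) := by
        filter_upwards [eventually_gt_atTop ‖b‖] with y hy
        have h0 : (y : ℂ) - b ≠ 0 := fun h' => by
          have h5 : (y : ℂ) = b := sub_eq_zero.1 h'
          rw [← h5, norm_real] at hy
          exact absurd hy (not_lt.2 (le_abs_self y))
        have e1 : I * (-(I * y)) = (y : ℂ) := by
          linear_combination (-(y : ℂ)) * I_mul_I
        rw [e1]
        field_simp
        ring
      refine Tendsto.congr' e ?_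
      have h7 : Tendsto (fun y : ℝ => ((y : ℂ) - b)) atTop (Bornology.cobounded ℂ) := by
        have : Tendsto (fun y : ℝ => (y : ℂ)) atTop (Bornology.cobounded ℂ) := by
          rw [← tendsto_norm_atTop_iff_cobounded]
          simpa using tendsto_abs_atTop_atTop
        exact (tendsto_sub_const_cobounded b).comp this
      have := ((tendsto_inv₀_cobounded (α := ℂ)).comp h7).const_mul (b - a)
      simpa [div_eq_mul_inv] using this.const_add 1
    simpa [hG] using ((continuous_exp.tendsto 0).comp hF0).mul hR
  have hGw : G w = 1 := by
    refine tendsto_nhds_unique (Tendsto.congr' ?_ tendsto_const_nhds) hlim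
    filter_upwards [eventually_gt_atTop ρ] with y hy
    exact hconst w hw _ (show (-(I * (y : ℂ))).im < -ρ by simp; linarith)
  have h1 := hnea w hw
  have h2 := hneb w hw
  rw [eq_div_iff h1]
  have h3 : exp (F w) * ((I * w - a) / (I * w - b)) = 1 := hGw
  field_simp at h3
  exact h3

/-! ### Holomorphic functions of several variables -/

/-- Interval integrals of families of holomorphic functions are holomorphic. -/
theorem differentiableOn_intervalIntegral {E : Type*} [NormedAddCommGroup E] [NormedSpace ℂ E]
    [FiniteDimensional ℂ E] {U : Set E} (hU : IsOpen U) {F : E → ℝ → ℂ} {a b : ℝ}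
    (hc : ContinuousOn (fun p : E × ℝ => F p.1 p.2) (U ×ˢ univ))
    (hd : ∀ θ, DifferentiableOn ℂ (fun x => F x θ) U) :
    DifferentiableOn ℂ (fun x => ∫ θ in a..b, F x θ) U := by
  have : FiniteDimensional ℝ E := FiniteDimensional.complexToReal E
  have : ProperSpace E := FiniteDimensional.proper ℂ E
  borelize E
  intro x₀ hx₀
  obtain ⟨r, hr, hrU⟩ := Metric.isOpen_iff.1 hU x₀ hx₀
  set s : ℝ := r / 4 with hs
  have hs0 : 0 < s := by positivity
  have hsub : Metric.closedBall x₀ (2 * s) ⊆ U :=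
    (Metric.closedBall_subset_ball (by linarith)).trans hrU
  obtain ⟨C, hC⟩ : ∃ C, ∀ p ∈ Metric.closedBall x₀ (2 * s) ×ˢ uIcc a b, ‖F p.1 p.2‖ ≤ C :=
    ((isCompact_closedBall x₀ (2 * s)).prod isCompact_uIcc).exists_bound_of_continuousOn
      (hc.mono (prod_mono hsub (subset_univ _)))
  have hcont : ∀ x ∈ U, Continuous (F x) := fun x hx => by
    rw [← continuousOn_univ]
    exact hc.comp (f := fun θ : ℝ => (x, θ)) (by fun_prop) fun θ _ => ⟨hx, mem_univ _⟩
  have hmeas : AEStronglyMeasurable (fun θ => fderiv ℂ (fun x => F x θ) x₀)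
      (volume.restrict (uIoc a b)) := by
    -- The measurability of derivatives with a parameter needs a function that is continuous on the
    -- whole space. The map φ sends everything into a ball inside U and is the identity near x₀, so
    -- composing with it does not change the derivative at x₀.
    let β : ContDiffBump x₀ := ⟨s, 2 * s, hs0, by linarith⟩
    set φ : E → E := fun x => x₀ + (β x : ℝ) • (x - x₀) with hφ
    have hφU : ∀ x, φ x ∈ U := by
      intro x
      apply hsub
      rw [Metric.mem_closedBall, dist_eq_norm, hφ, add_sub_cancel_left, norm_smul,
        Real.norm_of_nonneg β.nonneg]
      by_cases hx : x ∈ Metric.ball x₀ (2 * s)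
      · rw [Metric.mem_ball, dist_eq_norm] at hx
        have := β.le_one (x := x)
        nlinarith [norm_nonneg (x - x₀), β.nonneg (x := x)]
      · have h0 : β x = 0 := β.zero_of_le_dist (by simpa using hx)
        rw [h0, zero_mul]
        positivity
    have hφc : Continuous φ := by
      have := β.continuous
      fun_prop
    have hG : Continuous (Function.uncurry fun (θ : ℝ) (x : E) => F (φ x) θ) := by
      rw [← continuousOn_univ]
      exact hc.comp (f := fun p : ℝ × E => (φ p.2, p.1)) (by fun_prop)
        fun p _ => ⟨hφU _, mem_univ _⟩
    have h1 : Measurable fun θ : ℝ => fderiv ℂ (fun x => F (φ x) θ) x₀ :=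
      (measurable_fderiv_with_param ℂ hG).comp (f := fun θ : ℝ => (θ, x₀))
        (measurable_id.prodMk measurable_const)
    have h2 : (fun θ => fderiv ℂ (fun x => F x θ) x₀) = fun θ => fderiv ℂ (fun x => F (φ x) θ) x₀ := by
      funext θ
      refine Filter.EventuallyEq.fderiv_eq ?_
      filter_upwards [β.eventuallyEq_one] with x hx
      have hx1 : β x = 1 := hx
      simp [hφ, hx1]
    rw [h2]
    exact h1.stronglyMeasurable.aestronglyMeasurable
  have hball : ∀ x ∈ Metric.ball x₀ s, Metric.ball x s ⊆ Metric.closedBall x₀ (2 * s) := by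
    intro x hx y hy
    rw [Metric.mem_ball] at hx hy
    rw [Metric.mem_closedBall]
    linarith [dist_triangle y x x₀]
  refine (intervalIntegral.hasFDerivAt_integral_of_dominated_of_fderiv_le
    (F' := fun x θ => fderiv ℂ (fun x => F x θ) x) (bound := fun _ => (C + C) / s)
    (Metric.ball_mem_nhds x₀ hs0) ?_ ?_ hmeas ?_ ?_ ?_).differentiableAt.differentiableWithinAt
  · filter_upwards [hU.mem_nhds hx₀] with x hx
    exact (hcont x hx).aestronglyMeasurable
  · exact (hcont x₀ hx₀).intervalIntegrable _ _
  · refine Eventually.of_forall fun θ hθ x hx => ?_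
    have hθ' : θ ∈ uIcc a b := uIoc_subset_uIcc hθ
    have hd' : DifferentiableOn ℂ (fun x => F x θ) (Metric.ball x s) :=
      (hd θ).mono ((hball x hx).trans hsub)
    have hxm : x ∈ Metric.closedBall x₀ (2 * s) := hball x hx (Metric.mem_ball_self hs0)
    -- Cauchy estimate: on the ball of radius s around x the function stays within 2C of its value
    -- at x.
    refine norm_fderiv_le_div_of_mapsTo_ball hd' (fun y hy => ?_) hs0
    rw [Metric.mem_closedBall, dist_eq_norm]
    exact (norm_sub_le _ _).trans
      (add_le_add (hC (y, θ) ⟨hball x hx hy, hθ'⟩) (hC (x, θ) ⟨hxm, hθ'⟩))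
  · exact intervalIntegrable_const
  · refine Eventually.of_forall fun θ _ x hx => ?_
    have hxU : x ∈ U := hsub (hball x hx (Metric.mem_ball_self hs0))
    exact ((hd θ).differentiableAt (hU.mem_nhds hxU)).hasFDerivAt

/-- A holomorphic function of two variables that vanishes where `u - v = a` is divisible by
`u - v - a`. -/
theorem exists_differentiableOn_eq_mul {B : Set ℂ} (hB : IsOpen B) (a : ℂ) {G : ℂ × ℂ → ℂ}
    (hG : DifferentiableOn ℂ G (B ×ˢ B))
    (h0 : ∀ u ∈ B, ∀ v ∈ B, u - v = a → G (u, v) = 0) :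
    ∃ M : ℂ × ℂ → ℂ, DifferentiableOn ℂ M (B ×ˢ B) ∧
      ∀ u ∈ B, ∀ v ∈ B, G (u, v) = (u - v - a) * M (u, v) := by
  classical
  have hBB : IsOpen (B ×ˢ B) := hB.prod hB
  have hfst : ∀ v ∈ B, DifferentiableOn ℂ (fun ζ => G (ζ, v)) B := fun v hv =>
    hG.comp (f := fun ζ : ℂ => (ζ, v)) (by fun_prop) fun ζ hζ => ⟨hζ, hv⟩
  -- The quotient, with the singularity removed by the partial derivative in the first variable.
  -- Away from the line it is a quotient of holomorphic functions; the points on the line need joint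
  -- holomorphy in both variables.
  refine ⟨fun p => if p.1 - p.2 = a then deriv (fun ζ => G (ζ, p.2)) p.1
    else G p / (p.1 - p.2 - a), ?_, ?_⟩
  swap
  · intro u hu v hv
    by_cases h : u - v = a
    · rw [h0 u hu v hv h, h, sub_self, zero_mul]
    · have : u - v - a ≠ 0 := sub_ne_zero.2 h
      simp only [if_neg h]
      field_simp
  rintro ⟨u₀, v₀⟩ hp₀
  have hu₀ : u₀ ∈ B := hp₀.1
  have hv₀ : v₀ ∈ B := hp₀.2
  by_cases h : u₀ - v₀ = a
  swap
  · have hne : ∀ᶠ p : ℂ × ℂ in 𝓝 (u₀, v₀), p.1 - p.2 ≠ a :=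
      ContinuousAt.eventually_ne (by fun_prop) h
    have hd : DifferentiableAt ℂ (fun p : ℂ × ℂ => G p / (p.1 - p.2 - a)) (u₀, v₀) := by
      simp only [div_eq_mul_inv]
      exact (hG.differentiableAt (hBB.mem_nhds hp₀)).fun_mul
        (DifferentiableAt.fun_inv (by fun_prop) (sub_ne_zero.2 h))
    refine (hd.congr_of_eventuallyEq ?_).differentiableWithinAt
    filter_upwards [hne] with p hp
    rw [if_neg hp]
  obtain ⟨ε, hε, hεB⟩ := Metric.isOpen_iff.1 hB u₀ hu₀
  obtain ⟨ε', hε', hεB'⟩ := Metric.isOpen_iff.1 hB v₀ hv₀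
  set r : ℝ := min ε ε' / 4 with hr
  have hr0 : 0 < r := by positivity
  have hcl : Metric.closedBall u₀ (2 * r) ⊆ B := by
    refine (Metric.closedBall_subset_ball ?_).trans hεB
    have := min_le_left ε ε'
    linarith
  have hvB : Metric.ball v₀ r ⊆ B := by
    refine (Metric.ball_subset_ball ?_).trans hεB'
    have := min_le_right ε ε'
    linarith
  set U : Set (ℂ × ℂ) := Metric.ball u₀ r ×ˢ Metric.ball v₀ r with hU
  have hUo : IsOpen U := Metric.isOpen_ball.prod Metric.isOpen_ball
  have hva : ∀ v ∈ Metric.ball v₀ r, v + a ∈ Metric.ball u₀ r := by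
    intro v hv
    rw [Metric.mem_ball, dist_eq_norm] at hv ⊢
    rwa [show v + a - u₀ = v - v₀ by rw [← h]; ring]
  have hcirc : ∀ θ, circleMap u₀ (2 * r) θ ∈ Metric.sphere u₀ (2 * r) := fun θ =>
    circleMap_mem_sphere _ (by positivity) _
  have hsph : ∀ ζ ∈ Metric.sphere u₀ (2 * r), ∀ x ∈ Metric.ball u₀ r, ζ - x ≠ 0 := by
    intro ζ hζ x hx h'
    rw [sub_eq_zero] at h'
    rw [← h', Metric.mem_ball] at hx
    rw [Metric.mem_sphere] at hζ
    linarith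
  -- Near a point of the line the quotient is a Cauchy integral over a fixed circle in the first
  -- variable. The circle has radius 2r while u and v + a stay within r of its centre, so no
  -- denominator vanishes and the integrand is jointly holomorphic in (u, v). Cauchy's formula for
  -- `dslope` identifies the integral with the quotient, on the line too.
  set N : ℂ × ℂ → ℂ := fun p => (2 * Real.pi * I)⁻¹ * ∮ ζ in C(u₀, 2 * r),
    (ζ - p.1)⁻¹ * (G (ζ, p.2) / (ζ - (p.2 + a))) with hN
  have hNd : DifferentiableOn ℂ N U := by
    refine DifferentiableOn.const_mul ?_ _
    simp only [circleIntegral]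
    refine differentiableOn_intervalIntegral hUo ?_ ?_
    · simp only [deriv_circleMap, smul_eq_mul]
      refine ContinuousOn.mul (by fun_prop) (ContinuousOn.mul ?_ (ContinuousOn.div ?_ ?_ ?_))
      · refine ContinuousOn.inv₀ (by fun_prop) fun p hp => ?_
        exact hsph _ (hcirc _) _ hp.1.1
      · exact hG.continuousOn.comp (f := fun p : (ℂ × ℂ) × ℝ => (circleMap u₀ (2 * r) p.2, p.1.2))
          (by fun_prop) fun p hp => ⟨hcl (Metric.sphere_subset_closedBall (hcirc _)), hvB hp.1.2⟩
      · fun_prop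
      · intro p hp
        exact hsph _ (hcirc _) _ (hva _ hp.1.2)
    · intro θ
      simp only [smul_eq_mul, div_eq_mul_inv]
      refine DifferentiableOn.const_mul (DifferentiableOn.fun_mul ?_ (DifferentiableOn.fun_mul ?_
        (DifferentiableOn.fun_inv (by fun_prop) fun p hp => ?_))) _
      · refine DifferentiableOn.fun_inv (by fun_prop) fun p hp => ?_
        exact hsph _ (hcirc _) _ hp.1
      · exact hG.comp (f := fun p : ℂ × ℂ => (circleMap u₀ (2 * r) θ, p.2))
          (by fun_prop) fun p hp => ⟨hcl (Metric.sphere_subset_closedBall (hcirc _)), hvB hp.2⟩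
      · exact hsph _ (hcirc _) _ (hva _ hp.2)
  have hp₀U : (u₀, v₀) ∈ U := ⟨Metric.mem_ball_self hr0, Metric.mem_ball_self hr0⟩
  refine ((hNd.differentiableAt (hUo.mem_nhds hp₀U)).congr_of_eventuallyEq
    ?_).differentiableWithinAt
  filter_upwards [hUo.mem_nhds hp₀U] with p hp
  have hv : p.2 ∈ B := hvB hp.2
  have hvaB : p.2 + a ∈ Metric.ball u₀ (2 * r) :=
    Metric.ball_subset_ball (by linarith) (hva _ hp.2)
  have hG0 : G (p.2 + a, p.2) = 0 :=
    h0 _ (hcl (Metric.ball_subset_closedBall hvaB)) _ hv (by ring)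
  have hds : DifferentiableOn ℂ (dslope (fun ζ => G (ζ, p.2)) (p.2 + a)) B :=
    (differentiableOn_dslope (hB.mem_nhds (hcl (Metric.ball_subset_closedBall hvaB)))).2
      (hfst _ hv)
  have hdc : DiffContOnCl ℂ (dslope (fun ζ => G (ζ, p.2)) (p.2 + a)) (Metric.ball u₀ (2 * r)) := by
    apply DifferentiableOn.diffContOnCl
    rw [closure_ball _ (by positivity)]
    exact hds.mono hcl
  have hp1 : p.1 ∈ Metric.ball u₀ (2 * r) := Metric.ball_subset_ball (by linarith) hp.1
  have hcauchy := hdc.two_pi_i_inv_smul_circleIntegral_sub_inv_smul hp1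
  have hval : ∀ x, x ≠ p.2 + a →
      dslope (fun ζ => G (ζ, p.2)) (p.2 + a) x = G (x, p.2) / (x - (p.2 + a)) := by
    intro x hx
    rw [dslope_of_ne _ hx, slope_def_field, hG0, sub_zero]
  have hNp : N p = dslope (fun ζ => G (ζ, p.2)) (p.2 + a) p.1 := by
    rw [← hcauchy, hN]
    simp only [smul_eq_mul]
    congr 1
    refine circleIntegral.integral_congr (by positivity) fun ζ hζ => ?_
    rw [hval ζ fun h' => hsph ζ hζ _ (hva _ hp.2) (by rw [h', sub_self])]
  rw [hNp]
  by_cases h' : p.1 - p.2 = a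
  · rw [if_pos h', show p.2 + a = p.1 by rw [← h']; ring, dslope_same]
  · rw [if_neg h', hval _ fun h2 => h' (by rw [h2]; ring), sub_sub]

/-! ### The Laplace transform behind the scalar factor ρ -/

/-- The kernel whose Laplace transform is the logarithm of `ρ`. -/
def rhoKernel (P : Params) (t : ℝ) : ℂ :=
  (1 - exp (-P.hbar * t)) * (1 - exp (-((P.N - 1) * P.hbar) * t))
    / (t * (1 - exp (-(P.N * P.hbar) * t)))

theorem re_mul_hbar_pos (P : Params) : 0 < (P.N * P.hbar : ℂ).re := by
  have hN : (0 : ℝ) < P.N := by exact_mod_cast lt_of_lt_of_le (by norm_num) P.two_le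
  have := P.hbar_pos
  simp
  positivity

theorem norm_exp_neg_mul_hbar_lt (P : Params) {t : ℝ} (ht : 0 < t) :
    ‖exp (-(P.N * P.hbar) * t)‖ < 1 := by
  have h0 := re_mul_hbar_pos P
  rw [norm_exp, Real.exp_lt_one_iff, re_mul_ofReal, neg_re]
  nlinarith

theorem one_sub_exp_ne_zero (P : Params) {t : ℝ} (ht : 0 < t) :
    1 - exp (-(P.N * P.hbar) * t) ≠ 0 := fun h => by
  have := norm_exp_neg_mul_hbar_lt P ht
  rw [← sub_eq_zero.1 h] at this
  simp at this

theorem rhoKernel_continuousOn (P : Params) : ContinuousOn (rhoKernel P) (Ioi 0) :=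
  ContinuousOn.div (by fun_prop) (by fun_prop) fun _ ht =>
    mul_ne_zero (ofReal_ne_zero.mpr (ne_of_gt ht)) (one_sub_exp_ne_zero P ht)

theorem norm_one_sub_exp_le {z : ℂ} (hz : 0 ≤ z.re) {t : ℝ} (ht : 0 < t) :
    ‖1 - exp (-z * t)‖ ≤ 2 * ‖z‖ * t := by
  have h1 : ‖exp (-z * t)‖ ≤ 1 := by
    rw [norm_exp, Real.exp_le_one_iff, re_mul_ofReal, neg_re]
    nlinarith
  by_cases h : ‖-z * t‖ ≤ 1
  · rw [norm_sub_rev]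
    refine (Complex.norm_exp_sub_one_le h).trans_eq ?_
    rw [norm_mul, norm_neg, norm_real, Real.norm_of_nonneg ht.le]
    ring
  · rw [norm_mul, norm_neg, norm_real, Real.norm_of_nonneg ht.le] at h
    have h2 := norm_sub_le (1 : ℂ) (exp (-z * t))
    rw [norm_one] at h2
    linarith

/-- Each factor of the numerator is O(t), and with x = Re(Nħ) the denominator satisfies |1 -
e^{-Nħt}| ≥ 1 - e^{-xt} ≥ x t e^{-xt}. -/
theorem exists_norm_rhoKernel_le (P : Params) :
    ∃ C, ∀ t : ℝ, 0 < t → ‖rhoKernel P t‖ ≤ C * Real.exp ((P.N * P.hbar : ℂ).re * t) := by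
  set x := (P.N * P.hbar : ℂ).re with hx
  have hx0 : 0 < x := re_mul_hbar_pos P
  have hN : (2 : ℝ) ≤ P.N := by exact_mod_cast P.two_le
  refine ⟨2 * ‖P.hbar‖ * (2 * ‖(P.N - 1) * P.hbar‖) / x, fun t ht => ?_⟩
  have hh : 0 ≤ P.hbar.re := P.hbar_pos.le
  have h1 := norm_one_sub_exp_le hh ht
  have h2 : ‖1 - exp (-((P.N - 1) * P.hbar) * t)‖ ≤ 2 * ‖(P.N - 1) * P.hbar‖ * t := by
    refine norm_one_sub_exp_le ?_ ht
    have : ((P.N - 1) * P.hbar : ℂ).re = (P.N - 1) * P.hbar.re := by simp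
    rw [this]
    nlinarith
  have h3 : x * t ≤ Real.exp (x * t) * ‖1 - exp (-(P.N * P.hbar) * t)‖ := by
    have e1 : ‖exp (-(P.N * P.hbar) * t)‖ = Real.exp (-(x * t)) := by
      rw [norm_exp, re_mul_ofReal, neg_re, neg_mul]
    have e2 : 1 - Real.exp (-(x * t)) ≤ ‖1 - exp (-(P.N * P.hbar) * t)‖ := by
      rw [← e1]
      have := norm_sub_norm_le (1 : ℂ) (exp (-(P.N * P.hbar) * t))
      rwa [norm_one] at this
    have e3 : Real.exp (x * t) * Real.exp (-(x * t)) = 1 := by rw [← Real.exp_add]; simp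
    have e4 := Real.add_one_le_exp (x * t)
    nlinarith [Real.exp_pos (x * t)]
  have h4 : 0 < ‖1 - exp (-(P.N * P.hbar) * t)‖ := norm_pos_iff.2 (one_sub_exp_ne_zero P ht)
  rw [rhoKernel, norm_div, norm_mul, norm_mul, norm_real, Real.norm_of_nonneg ht.le,
    div_le_iff₀ (by positivity)]
  calc _ ≤ 2 * ‖P.hbar‖ * t * (2 * ‖(P.N - 1) * P.hbar‖ * t) := by gcongr
    _ = 2 * ‖P.hbar‖ * (2 * ‖(P.N - 1) * P.hbar‖) / x * t * (x * t) := by field_simp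
    _ ≤ 2 * ‖P.hbar‖ * (2 * ‖(P.N - 1) * P.hbar‖) / x * t *
        (Real.exp (x * t) * ‖1 - exp (-(P.N * P.hbar) * t)‖) := by gcongr
    _ = _ := by ring

/-- With q = e^{-Nħt}, the identity 1/(1 - q) = 1 + q/(1 - q) splits the kernel into a part without
this denominator and q times the kernel itself. Multiplication by q shifts w to w - iNħ under the
Laplace transform. Iteration yields the partial products of the Gamma quotient and a remainder. -/
theorem exp_laplace_rhoKernel_partial (P : Params) {w : ℂ} (hw : w.im < -(3 * P.N * ‖P.hbar‖))
    (M : ℕ) :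
    exp (∫ t in Ioi (0 : ℝ), exp (-(I * w * t)) * rhoKernel P t)
      = (∏ j ∈ Finset.range M, ((I * w + j * (P.N * P.hbar) + P.hbar)
            * (I * w + j * (P.N * P.hbar) + (P.N - 1) * P.hbar))
          / ((I * w + j * (P.N * P.hbar)) * (I * w + j * (P.N * P.hbar) + P.N * P.hbar)))
        * exp (∫ t in Ioi (0 : ℝ), exp (-(I * (w - I * (M * (P.N * P.hbar))) * t))
            * rhoKernel P t) := by
  have hN : (2 : ℝ) ≤ P.N := by exact_mod_cast P.two_le
  have hre := re_mul_hbar_pos P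
  have hre' : (P.N * P.hbar : ℂ).re ≤ P.N * ‖P.hbar‖ := by
    have := re_le_norm (P.N * P.hbar : ℂ)
    simpa using this
  have hn0 := norm_nonneg P.hbar
  obtain ⟨C, hC⟩ := exists_norm_rhoKernel_le P
  induction M with
  | zero => simp
  | succ M ih =>
    rw [ih, Finset.prod_range_succ, mul_assoc]
    congr 1
    set w' := w - I * (M * (P.N * P.hbar)) with hw'
    have him : w'.im < -(3 * P.N * ‖P.hbar‖) := by
      have : w'.im = w.im - M * (P.N * P.hbar : ℂ).re := by
        rw [hw']; simp
      rw [this]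
      have : (0 : ℝ) ≤ M * (P.N * P.hbar : ℂ).re := by positivity
      linarith
    have e0 : I * w' = I * w + M * (P.N * P.hbar) := by
      rw [hw']; linear_combination (-(M * (P.N * P.hbar)) : ℂ) * I_mul_I
    have e1 : w - I * ((M + 1 : ℕ) * (P.N * P.hbar)) = w' - I * (P.N * P.hbar) := by
      rw [hw']; push_cast; ring
    have him' : (w' - I * (P.N * P.hbar)).im < -(3 * P.N * ‖P.hbar‖) := by
      have : (w' - I * (P.N * P.hbar)).im = w'.im - (P.N * P.hbar : ℂ).re := by simp
      linarith
    have hbF1 : w'.im < -(2 * ‖-P.hbar‖ + ‖(0 : ℂ)‖) := by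
      rw [norm_neg, norm_zero]; nlinarith
    have hbF2 : w'.im < -(2 * ‖(-(P.N * P.hbar) : ℂ)‖ + ‖(-((P.N - 1) * P.hbar) : ℂ)‖) := by
      have : ‖((P.N : ℂ) - 1)‖ ≤ P.N := by
        have : ((P.N : ℂ) - 1) = ((P.N - 1 : ℝ) : ℂ) := by push_cast; ring
        rw [this, norm_real, Real.norm_of_nonneg (by linarith)]
        linarith
      rw [norm_neg, norm_neg, norm_mul, norm_mul, Complex.norm_natCast]
      nlinarith
    have i1 := laplace_integrableOn (frullaniKernel_continuousOn 0 (-P.hbar))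
      (fun t ht => norm_frullaniKernel_le 0 (-P.hbar) le_rfl ht) hbF1
    have i2 := laplace_integrableOn
      (frullaniKernel_continuousOn (-((P.N - 1) * P.hbar)) (-(P.N * P.hbar)))
      (fun t ht => norm_frullaniKernel_le (-((P.N - 1) * P.hbar)) (-(P.N * P.hbar)) le_rfl ht) hbF2
    have i3 := laplace_integrableOn (rhoKernel_continuousOn P) hC
      (w := w' - I * (P.N * P.hbar)) (by nlinarith)
    -- The numerator (1 - p)(1 - p') with p = e^{-ħt} and pp' = q equals (1 - p) - (p' - q), so the
    -- part without the denominator is a difference of two Frullani kernels.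
    have hsplit : ∫ t in Ioi (0 : ℝ), exp (-(I * w' * t)) * rhoKernel P t
        = (∫ t in Ioi (0 : ℝ), exp (-(I * w' * t)) * frullaniKernel 0 (-P.hbar) t)
          - (∫ t in Ioi (0 : ℝ), exp (-(I * w' * t))
              * frullaniKernel (-((P.N - 1) * P.hbar)) (-(P.N * P.hbar)) t)
          + ∫ t in Ioi (0 : ℝ), exp (-(I * (w' - I * (P.N * P.hbar)) * t)) * rhoKernel P t := by
      rw [← integral_sub i1 i2]
      refine Eq.trans ?_ (integral_add (i1.sub i2) i3)
      refine setIntegral_congr_fun measurableSet_Ioi fun t ht => ?_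
      have ht0 : (t : ℂ) ≠ 0 := ofReal_ne_zero.mpr (ne_of_gt ht)
      have hd := one_sub_exp_ne_zero P ht
      have s1 : exp (-(I * (w' - I * (P.N * P.hbar)) * t))
          = exp (-(I * w' * t)) * exp (-(P.N * P.hbar) * t) := by
        rw [← exp_add]; congr 1
        linear_combination (P.N * P.hbar * t : ℂ) * I_mul_I
      have s2 : exp (-P.hbar * t) * exp (-((P.N - 1) * P.hbar) * t)
          = exp (-(P.N * P.hbar) * t) := by
        rw [← exp_add]; congr 1; ring
      simp only [rhoKernel, frullaniKernel, s1, zero_mul, exp_zero]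
      generalize exp (-(P.N * P.hbar) * t) = r at *
      generalize exp (-((P.N - 1) * P.hbar) * t) = q at *
      generalize exp (-P.hbar * t) = p at *
      field_simp
      linear_combination (1 - r) * s2
    rw [hsplit, exp_add, exp_sub, exp_laplace_frullani hbF1, exp_laplace_frullani hbF2, e1, e0]
    congr 1
    have n1 := I_mul_sub_ne_zero (w := w') (a := -(P.N * P.hbar)) (by
      have := norm_nonneg (-((P.N - 1) * P.hbar) : ℂ)
      have := norm_nonneg (-((P.N) * P.hbar) : ℂ)
      linarith)
    have n2 := I_mul_sub_ne_zero (w := w') (a := 0) (by rw [norm_zero]; nlinarith)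
    rw [e0] at n1 n2
    simp only [sub_neg_eq_add, sub_zero] at n1 n2 ⊢
    field_simp

/-- The remainder in the partial product formula tends to 1 as its argument moves to -i∞, and the
partial products are quotients of the sequences in Euler's limit for Γ. -/
theorem exp_laplace_rhoKernel (P : Params) {w : ℂ} (hw : w.im < -(3 * P.N * ‖P.hbar‖)) :
    exp (∫ t in Ioi (0 : ℝ), exp (-(I * w * t)) * rhoKernel P t) = rho P w := by
  have hN : (2 : ℝ) ≤ P.N := by exact_mod_cast P.two_le
  have hN0 : (P.N : ℂ) ≠ 0 := by
    have := P.two_le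
    exact Nat.cast_ne_zero.2 (by omega)
  have hh := hbar_ne_zero P
  have hre := re_mul_hbar_pos P
  have hn0 := norm_nonneg P.hbar
  obtain ⟨C, hC⟩ := exists_norm_rhoKernel_le P
  have hre' : (P.N * P.hbar : ℂ).re ≤ P.N * ‖P.hbar‖ := by
    have := re_le_norm (P.N * P.hbar : ℂ)
    simpa using this
  have hrem : Tendsto (fun M : ℕ => exp (∫ t in Ioi (0 : ℝ),
      exp (-(I * (w - I * ((M + 1 : ℕ) * (P.N * P.hbar))) * t)) * rhoKernel P t)) atTop (𝓝 1) := by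
    rw [← exp_zero]
    refine (continuous_exp.tendsto 0).comp ?_
    have him : ∀ M : ℕ, (w - I * ((M + 1 : ℕ) * (P.N * P.hbar))).im
        = w.im - (M + 1 : ℕ) * (P.N * P.hbar : ℂ).re := fun M => by simp
    have hle : ∀ M : ℕ, ‖∫ t in Ioi (0 : ℝ),
        exp (-(I * (w - I * ((M + 1 : ℕ) * (P.N * P.hbar))) * t)) * rhoKernel P t‖
        ≤ C / ((M : ℝ) * (P.N * P.hbar : ℂ).re + -w.im) := by
      intro M
      have h1 : (w - I * ((M + 1 : ℕ) * (P.N * P.hbar))).im < -(P.N * P.hbar : ℂ).re := by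
        rw [him]
        have : (0 : ℝ) ≤ (M + 1 : ℕ) * (P.N * P.hbar : ℂ).re := by positivity
        nlinarith
      refine (norm_laplace_le hC h1).trans_eq ?_
      rw [him]; push_cast; ring
    refine squeeze_zero_norm hle ?_
    refine Tendsto.const_div_atTop (tendsto_atTop_add_const_right _ _ ?_) _
    exact Tendsto.atTop_mul_const hre tendsto_natCast_atTop_atTop
  have hprod : ∀ M : ℕ, (∏ j ∈ Finset.range (M + 1), ((I * w + j * (P.N * P.hbar) + P.hbar)
            * (I * w + j * (P.N * P.hbar) + (P.N - 1) * P.hbar))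
          / ((I * w + j * (P.N * P.hbar)) * (I * w + j * (P.N * P.hbar) + P.N * P.hbar)))
        = exp (∫ t in Ioi (0 : ℝ), exp (-(I * w * t)) * rhoKernel P t)
          / exp (∫ t in Ioi (0 : ℝ), exp (-(I * (w - I * ((M + 1 : ℕ) * (P.N * P.hbar))) * t))
            * rhoKernel P t) := fun M => by
    rw [exp_laplace_rhoKernel_partial P hw (M + 1), mul_div_assoc, div_self (exp_ne_zero _),
      mul_one]
  have hlim1 := (tendsto_const_nhds (x := exp (∫ t in Ioi (0 : ℝ),
    exp (-(I * w * t)) * rhoKernel P t))).div hrem one_ne_zero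
  simp only [Pi.div_def, ← hprod, div_one] at hlim1
  refine tendsto_nhds_unique hlim1 ?_
  set z : ℂ := I * w / (P.N * P.hbar) with hz
  have hc : (P.N * P.hbar : ℂ) ≠ 0 := mul_ne_zero hN0 hh
  have hIw : I * w = z * (P.N * P.hbar) := by rw [hz]; field_simp
  -- A pole of Γ would force Re(iw) ≤ 0, whereas Re(iw) = -Im w > 0.
  have hne : ∀ r : ℝ, 0 ≤ r → ∀ m : ℕ, r + z ≠ -m := by
    intro r hr m h
    have h1 : I * w = -((r + m : ℝ) : ℂ) * (P.N * P.hbar) := by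
      rw [hIw]; push_cast; linear_combination (P.N * P.hbar) * h
    have h2 := congrArg re h1
    rw [← ofReal_neg, re_ofReal_mul] at h2
    have h3 : (I * w).re = -w.im := by simp
    rw [h3] at h2
    have : (0 : ℝ) ≤ (r + m) * (P.N * P.hbar : ℂ).re := by positivity
    nlinarith
  have hN1 : (1 : ℝ) / P.N ≤ 1 := by rw [div_le_one (by linarith)]; linarith
  have g1 : Gamma (1 / P.N + z) ≠ 0 := Gamma_ne_zero fun m => by
    have := hne (1 / P.N) (by positivity) m
    push_cast at this; exact this
  have g2 : Gamma (1 - 1 / P.N + z) ≠ 0 := Gamma_ne_zero fun m => by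
    have := hne (1 - 1 / P.N) (by linarith) m
    push_cast at this; exact this
  have hlim2 := ((GammaSeq_tendsto_Gamma z).mul (GammaSeq_tendsto_Gamma (1 + z))).div
    ((GammaSeq_tendsto_Gamma (1 / P.N + z)).mul (GammaSeq_tendsto_Gamma (1 - 1 / P.N + z)))
    (mul_ne_zero g1 g2)
  refine Tendsto.congr' ?_ hlim2
  filter_upwards [eventually_gt_atTop 0] with M hM
  have hM0 : (M : ℂ) ≠ 0 := Nat.cast_ne_zero.2 hM.ne'
  have hf : (M.factorial : ℂ) ≠ 0 := Nat.cast_ne_zero.2 (Nat.factorial_ne_zero _)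
  have hp : ∀ s : ℂ, (M : ℂ) ^ s ≠ 0 := fun s => by simp [cpow_eq_zero_iff, hM0]
  simp only [GammaSeq, Pi.div_apply]
  -- The powers of M in Euler's limit cancel because z + (1 + z) = (1/N + z) + (1 - 1/N + z).
  have hpow : (M : ℂ) ^ z * (M : ℂ) ^ (1 + z)
      = (M : ℂ) ^ (1 / P.N + z) * (M : ℂ) ^ (1 - 1 / P.N + z) := by
    rw [← cpow_add _ _ hM0, ← cpow_add _ _ hM0]; congr 1; ring
  have hj : ∀ r : ℝ, 0 ≤ r → ∀ j : ℕ, (r + z) + j ≠ 0 := fun r hr j h =>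
    hne r hr j (eq_neg_of_add_eq_zero_left h)
  have hP : ∀ r : ℝ, 0 ≤ r → ∏ j ∈ Finset.range (M + 1), ((r + z) + j) ≠ 0 := fun r hr =>
    Finset.prod_ne_zero_iff.2 fun j _ => hj r hr j
  have q0 := hP 0 le_rfl
  have q1 := hP 1 zero_le_one
  have q2 := hP (1 / P.N) (by positivity)
  have q3 := hP (1 - 1 / P.N) (by linarith)
  push_cast at q0 q1 q2 q3
  rw [zero_add] at q0
  have e : ∀ j ∈ Finset.range (M + 1), ((I * w + j * (P.N * P.hbar) + P.hbar)
            * (I * w + j * (P.N * P.hbar) + (P.N - 1) * P.hbar))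
          / ((I * w + j * (P.N * P.hbar)) * (I * w + j * (P.N * P.hbar) + P.N * P.hbar))
      = ((1 / P.N + z + j) * (1 - 1 / P.N + z + j)) / ((z + j) * (1 + z + j)) := by
    intro j _
    have h1 := hj 0 le_rfl j
    have h2 := hj 1 zero_le_one j
    push_cast at h1 h2
    rw [zero_add] at h1
    have h3 : z * (P.N * P.hbar) + j * (P.N * P.hbar) = (z + j) * (P.N * P.hbar) := by ring
    have h4 : (z + j) * (P.N * P.hbar) + P.N * P.hbar = (1 + z + j) * (P.N * P.hbar) := by ring
    rw [hIw, h3, h4]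
    field_simp
    ring
  rw [Finset.prod_congr rfl e, Finset.prod_div_distrib, Finset.prod_mul_distrib,
    Finset.prod_mul_distrib]
  have := hp z
  have := hp (1 + z)
  have := hp (1 / P.N + z)
  have := hp (1 - 1 / P.N + z)
  rw [div_mul_div_comm, div_mul_div_comm, div_div_div_eq,
    div_eq_div_iff (by positivity) (by positivity)]
  linear_combination (M.factorial : ℂ) ^ 2 * (∏ j ∈ Finset.range (M + 1), (1 / P.N + z + j))
    * (∏ j ∈ Finset.range (M + 1), (1 - 1 / P.N + z + j))
    * (∏ j ∈ Finset.range (M + 1), (z + j)) * (∏ j ∈ Finset.range (M + 1), (1 + z + j)) * hpow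

/-! ### Contractions of the elementary fields -/

/-- The integrand of the contraction of two exponents. -/
def kernel (P : Params) (t : ℝ) : Exponent P →ₗ[ℂ] Exponent P →ₗ[ℂ] ℂ :=
  LinearMap.mk₂ ℂ (fun e e' => ∑ s', (dir P e.1).1 s' t * e'.2.1 s' t)
    (fun e₁ e₂ e' => by simp [add_mul, Finset.sum_add_distrib])
    (fun c e e' => by
      simp only [Prod.smul_fst, map_smul, SetLike.val_smul, Pi.smul_apply, smul_eq_mul,
        Finset.mul_sum, mul_assoc])
    (fun e e₁ e₂ => by simp [mul_add, Finset.sum_add_distrib])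
    (fun c e e' => by
      simp only [Prod.smul_snd, SetLike.val_smul, Pi.smul_apply, smul_eq_mul, Finset.mul_sum]
      exact Finset.sum_congr rfl fun _ _ => by ring)

theorem kernel_apply (P : Params) (t : ℝ) (e e' : Exponent P) :
    kernel P t e e' = ∑ s', (dir P e.1).1 s' t * e'.2.1 s' t := rfl

/-- The contraction of two exponents. -/
def contr (P : Params) (e e' : Exponent P) : ℂ := pair P (dir P e.1) e'.2

theorem contr_eq (P : Params) (e e' : Exponent P) :
    contr P e e' = ∫ t in Ioi (0 : ℝ), kernel P t e e' := rfl

/-- The pairing of the weights of two species. -/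
def weightPair (P : Params) (w w' : Boson P.N → ℂ) (t : ℝ) : ℂ :=
  ∑ s', (∑ s, w s * comm P s s' t) * w' s'

theorem kernel_modeFn (P : Params) (t : ℝ) (w w' : Boson P.N → ℂ) {f g : ℝ → ℂ} (hf hg)
    (x x' : ModeFn P) :
    kernel P t (modeFn P w f hf, x) (x', modeFn P w' g hg) = weightPair P w w' t * (f t * g t) := by
  rw [kernel_apply, weightPair, Finset.sum_mul]
  refine Finset.sum_congr rfl fun s' _ => ?_
  simp only [dir, modeFn, LinearMap.coe_mk, AddHom.coe_mk, Finset.sum_mul]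
  exact Finset.sum_congr rfl fun s _ => by ring

theorem kernel_fieldPlus_fieldMinus (P : Params) (t : ℝ) (w w' : Boson P.N → ℂ) (u v : ℂ) :
    kernel P t (fieldPlus P w u) (fieldMinus P w' v) = weightPair P w w' t *
      (2 * P.hbar * exp (-(I * u * t)) * -(2 * P.hbar * exp (-(I * v * (-t : ℝ))))) :=
  kernel_modeFn P t w w' _ _ _ _

theorem kernel_fieldPlus_fieldFull (P : Params) (t : ℝ) (w w' : Boson P.N → ℂ) (u v : ℂ) :
    kernel P t (fieldPlus P w u) (fieldFull P w' v) = weightPair P w w' t *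
      (2 * P.hbar * exp (-(I * u * t))
        * -(P.hbar / sinh (P.hbar * (-t : ℝ) / 2) * exp (-(I * v * (-t : ℝ))))) :=
  kernel_modeFn P t w w' _ _ _ _

theorem kernel_fieldFull_fieldMinus (P : Params) (t : ℝ) (w w' : Boson P.N → ℂ) (u v : ℂ) :
    kernel P t (fieldFull P w u) (fieldMinus P w' v) = weightPair P w w' t *
      (-(P.hbar / sinh (P.hbar * t / 2) * exp (-(I * u * t)))
        * -(2 * P.hbar * exp (-(I * v * (-t : ℝ))))) :=
  kernel_modeFn P t w w' _ _ _ _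

theorem kernel_fieldFull_fieldFull (P : Params) (t : ℝ) (w w' : Boson P.N → ℂ) (u v : ℂ) :
    kernel P t (fieldFull P w u) (fieldFull P w' v) = weightPair P w w' t *
      (-(P.hbar / sinh (P.hbar * t / 2) * exp (-(I * u * t)))
        * -(P.hbar / sinh (P.hbar * (-t : ℝ) / 2) * exp (-(I * v * (-t : ℝ))))) :=
  kernel_modeFn P t w w' _ _ _ _

theorem kernel_zero_fst (P : Params) (t : ℝ) (x : ModeFn P) (e : Exponent P) :
    kernel P t (0, x) e = 0 := by
  simp [kernel_apply]

theorem kernel_zero_snd (P : Params) (t : ℝ) (x : ModeFn P) (e : Exponent P) :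
    kernel P t e (x, 0) = 0 := by
  simp [kernel_apply]

/-- Existence of the bosons `b_{ab}`, `c_{ab}`. -/
abbrev IsPair (P : Params) (a b : ℕ) : Prop := 1 ≤ a ∧ a < b ∧ b ≤ P.N

theorem sum_pairIdx (P : Params) (a b : ℕ) (f : PairIdx P.N → ℂ) (c : ℂ)
    (hf : ∀ p : PairIdx P.N, p.1 = (a, b) → f p = c) :
    ∑ p : PairIdx P.N, (if p.1 = (a, b) then f p else 0) = if IsPair P a b then c else 0 := by
  by_cases h : IsPair P a b
  · rw [if_pos h]
    have hm : (a, b) ∈ (Finset.Icc 1 P.N ×ˢ Finset.Icc 1 P.N).filter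
        fun p : ℕ × ℕ => p.1 < p.2 := by
      obtain ⟨h1, h2, h3⟩ := h
      simp only [Finset.mem_filter, Finset.mem_product, Finset.mem_Icc]
      omega
    rw [Finset.sum_eq_single (⟨(a, b), hm⟩ : PairIdx P.N)]
    · rw [if_pos rfl, hf _ rfl]
    · intro p _ hp
      rw [if_neg fun h' => hp (Subtype.ext h')]
    · intro h'
      exact absurd (Finset.mem_univ _) h'
  · rw [if_neg h]
    refine Finset.sum_eq_zero fun p _ => if_neg fun h' => h ?_
    have := p.2
    simp only [Finset.mem_filter, Finset.mem_product, Finset.mem_Icc, h'] at this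
    exact ⟨this.1.1.1, this.2, this.1.2.2⟩

theorem sum_pairIdx_ite (P : Params) (q : PairIdx P.N) (a b : ℕ) (c : ℂ) :
    (∑ p : PairIdx P.N, (if p.1 = (a, b) then (1 : ℂ) else 0) * (if p = q then c else 0))
      = if q.1 = (a, b) then c else 0 := by
  rw [Finset.sum_eq_single q]
  · simp
  · intro p _ hp
    simp [hp]
  · simp

theorem weightPair_b_b (P : Params) (a b a' b' : ℕ) (t : ℝ) :
    weightPair P (bW P a b) (bW P a' b') t
      = if a = a' ∧ b = b' ∧ IsPair P a b then -(sinh (P.hbar * t / 2) ^ 2 / (P.hbar ^ 2 * t))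
        else 0 := by
  simp only [weightPair, Fintype.sum_sum_type, bW, comm, zero_mul, mul_zero, Finset.sum_const_zero,
    zero_add, add_zero, sum_pairIdx_ite]
  by_cases h : a = a' ∧ b = b'
  · obtain ⟨rfl, rfl⟩ := h
    simp only [true_and]
    rw [← sum_pairIdx P a b (fun _ => -(sinh (P.hbar * t / 2) ^ 2 / (P.hbar ^ 2 * t))) _
      fun _ _ => rfl]
    refine Finset.sum_congr rfl fun p _ => ?_
    split_ifs <;> simp
  · rw [if_neg fun h' => h ⟨h'.1, h'.2.1⟩]
    refine Finset.sum_eq_zero fun p _ => ?_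
    by_cases h1 : p.1 = (a, b)
    · have h2 : p.1 ≠ (a', b') := fun h2 => h (by rw [h1] at h2; simpa using h2)
      rw [if_neg h2, mul_zero]
    · rw [if_neg h1, zero_mul]

theorem weightPair_c_c (P : Params) (a b a' b' : ℕ) (t : ℝ) :
    weightPair P (cW P a b) (cW P a' b') t = -weightPair P (bW P a b) (bW P a' b') t := by
  simp only [weightPair, Fintype.sum_sum_type, bW, cW, comm, zero_mul, mul_zero,
    Finset.sum_const_zero, zero_add, add_zero, sum_pairIdx_ite]
  rw [← Finset.sum_neg_distrib]
  refine Finset.sum_congr rfl fun p _ => ?_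
  split_ifs <;> simp

theorem weightPair_b_c (P : Params) (a b a' b' : ℕ) (t : ℝ) :
    weightPair P (bW P a b) (cW P a' b') t = 0 := by
  simp only [weightPair, Fintype.sum_sum_type, bW, cW, comm, zero_mul, mul_zero,
    Finset.sum_const_zero, add_zero]

theorem weightPair_c_b (P : Params) (a b a' b' : ℕ) (t : ℝ) :
    weightPair P (cW P a b) (bW P a' b') t = 0 := by
  simp only [weightPair, Fintype.sum_sum_type, bW, cW, comm, zero_mul, mul_zero,
    Finset.sum_const_zero, add_zero]

theorem weightPair_lam_b (P : Params) (μ a' b' : ℕ) (t : ℝ) :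
    weightPair P (lamW P μ) (bW P a' b') t = 0 := by
  simp only [weightPair, Fintype.sum_sum_type, bW, lamW, comm, zero_mul, mul_zero,
    Finset.sum_const_zero, add_zero]

theorem weightPair_lam_c (P : Params) (μ a' b' : ℕ) (t : ℝ) :
    weightPair P (lamW P μ) (cW P a' b') t = 0 := by
  simp only [weightPair, Fintype.sum_sum_type, cW, lamW, comm, zero_mul, mul_zero,
    Finset.sum_const_zero, add_zero]

theorem weightPair_b_lam (P : Params) (μ a' b' : ℕ) (t : ℝ) :
    weightPair P (bW P a' b') (lamW P μ) t = 0 := by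
  simp only [weightPair, Fintype.sum_sum_type, bW, lamW, comm, zero_mul, mul_zero,
    Finset.sum_const_zero, add_zero]

theorem weightPair_c_lam (P : Params) (μ a' b' : ℕ) (t : ℝ) :
    weightPair P (cW P a' b') (lamW P μ) t = 0 := by
  simp only [weightPair, Fintype.sum_sum_type, cW, lamW, comm, zero_mul, mul_zero,
    Finset.sum_const_zero, add_zero]

theorem weightPair_lam_lam (P : Params) (μ ν : Idx P.N) (t : ℝ) :
    weightPair P (lamW P μ) (lamW P ν) t = comm P (.inl μ) (.inl ν) t := by
  simp only [weightPair, Fintype.sum_sum_type, lamW, zero_mul, mul_zero,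
    Finset.sum_const_zero, add_zero]
  rw [Finset.sum_eq_single ν, if_pos rfl, mul_one, Finset.sum_eq_single μ, if_pos rfl, one_mul]
  · intro i _ hi
    rw [if_neg fun h => hi (Subtype.ext h), zero_mul]
  · simp
  · intro i _ hi
    rw [if_neg fun h => hi (Subtype.ext h), mul_zero]
  · simp

/-- The character `r ↦ e^{rħt}`. -/
def chi (P : Params) (t : ℝ) (r : ℂ) : ℂ := exp (r * P.hbar * t)

theorem chi_add (P : Params) (t : ℝ) (r s : ℂ) : chi P t (r + s) = chi P t r * chi P t s := by
  rw [chi, chi, chi, ← exp_add]; congr 1; ring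

theorem chi_zero (P : Params) (t : ℝ) : chi P t 0 = 1 := by simp [chi]

theorem chi_neg (P : Params) (t : ℝ) (r : ℂ) : chi P t (-r) = (chi P t r)⁻¹ := by
  rw [chi, chi, ← exp_neg]; congr 1; ring

theorem chi_ne_zero (P : Params) (t : ℝ) (r : ℂ) : chi P t r ≠ 0 := exp_ne_zero _

theorem sinh_eq_chi (P : Params) (t : ℝ) (r : ℂ) :
    sinh (r * P.hbar * t) = (chi P t r - chi P t (-r)) / 2 := by
  rw [Complex.sinh, chi, chi]; congr 3; ring

theorem sinh_half_eq_chi (P : Params) (t : ℝ) :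
    sinh (P.hbar * t / 2) = (chi P t (1 / 2) - chi P t (-(1 / 2))) / 2 := by
  rw [← sinh_eq_chi]; congr 1; ring

theorem exp_sh (P : Params) (u r : ℂ) (t : ℝ) :
    exp (-(I * sh P u r * t)) = exp (-(I * u * t)) * chi P t r := by
  rw [chi, ← exp_add, sh]; congr 1
  linear_combination (-(r * P.hbar * t)) * I_mul_I

theorem exp_sh_neg (P : Params) (u r : ℂ) (t : ℝ) :
    exp (-(I * sh P u r * (-t : ℝ))) = exp (I * u * t) * chi P t (-r) := by
  rw [chi, ← exp_add, sh]; congr 1; push_cast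
  linear_combination (r * P.hbar * t) * I_mul_I

/-- The factor `e^{-iwt}/t` common to all contractions. -/
def expo (w : ℂ) (t : ℝ) : ℂ := exp (-(I * w * t)) / t

theorem exp_mul_exp_eq (u v : ℂ) (t : ℝ) :
    exp (-(I * u * t)) * exp (I * v * t) = exp (-(I * (u - v) * t)) := by
  rw [← exp_add]; congr 1; ring

section
variable (P : Params) {t : ℝ} (ht : 0 < t) (u v r r' : ℂ) (a b a' b' μ ν : ℕ)
include ht

/-- Since 4 sinh²(ħt/2) = χ(1) - 2 + χ(-1), the contraction is a second difference of the character
at the difference of the shifts. -/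
theorem kernel_bPlus_bMinus : kernel P t (bPlus P a b u r) (bMinus P a' b' v r') =
    if a = a' ∧ b = b' ∧ IsPair P a b then
      expo (u - v) t * (chi P t (r - r' + 1) - 2 * chi P t (r - r') + chi P t (r - r' - 1))
    else 0 := by
  rw [bPlus, bMinus, kernel_fieldPlus_fieldMinus, weightPair_b_b]
  split_ifs
  · rw [exp_sh, exp_sh_neg, sinh_half_eq_chi, expo, ← exp_mul_exp_eq]
    have h0 : (t : ℂ) ≠ 0 := ofReal_ne_zero.mpr ht.ne'
    have hh := hbar_ne_zero P
    have e1 : chi P t (1 / 2) * chi P t (1 / 2) = chi P t 1 := by rw [← chi_add]; norm_num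
    have e2 : chi P t (-(1 / 2)) * chi P t (-(1 / 2)) = chi P t (-1) := by
      rw [← chi_add]; norm_num
    have e3 : chi P t (1 / 2) * chi P t (-(1 / 2)) = 1 := by
      rw [← chi_add, ← chi_zero P t]; norm_num
    rw [show r - r' + 1 = r + -r' + 1 by ring, show r - r' - 1 = r + -r' + -1 by ring,
      show r - r' = r + -r' by ring, chi_add P t (r + -r') 1, chi_add P t (r + -r') (-1),
      chi_add P t r, ← e1, ← e2]
    field_simp
    linear_combination (-2 * chi P t r * chi P t (-r')) * e3
  · rw [zero_mul]

/-- The denominator sinh(ħt/2) in the field (b+c) cancels one of the two factors sinh of the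
commutator, so that a first difference remains. The boson c does not see b⁺. -/
theorem kernel_bPlus_bc : kernel P t (bPlus P a b u r) (bc P a' b' v r') =
    if a = a' ∧ b = b' ∧ IsPair P a b then
      expo (u - v) t * (chi P t (r - r' - 1 / 2) - chi P t (r - r' + 1 / 2)) else 0 := by
  rw [bPlus, bc, map_add, kernel_fieldPlus_fieldFull, kernel_fieldPlus_fieldFull,
    weightPair_b_b, weightPair_b_c, zero_mul, add_zero]
  split_ifs
  · have h0 : (t : ℂ) ≠ 0 := ofReal_ne_zero.mpr ht.ne'
    have hh := hbar_ne_zero P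
    have hs := sinh_half_ne_zero P ht
    have hs' : sinh (P.hbar * (-t : ℝ) / 2) = -sinh (P.hbar * t / 2) := by
      rw [← sinh_neg]; congr 1; push_cast; ring
    rw [exp_sh, exp_sh_neg, expo, ← exp_mul_exp_eq, hs']
    have e1 : chi P t (r - r' - 1 / 2) - chi P t (r - r' + 1 / 2)
        = -(2 * sinh (P.hbar * t / 2) * (chi P t r * chi P t (-r'))) := by
      rw [sinh_half_eq_chi, ← chi_add, mul_div_cancel₀ _ two_ne_zero, sub_mul, ← chi_add,
        ← chi_add, neg_sub]
      congr 2 <;> ring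
    rw [e1]
    field_simp
  · rw [zero_mul]

theorem kernel_bc_bMinus : kernel P t (bc P a b u r) (bMinus P a' b' v r') =
    if a = a' ∧ b = b' ∧ IsPair P a b then
      expo (u - v) t * (chi P t (r - r' - 1 / 2) - chi P t (r - r' + 1 / 2)) else 0 := by
  rw [bMinus, bc, map_add, LinearMap.add_apply, kernel_fieldFull_fieldMinus,
    kernel_fieldFull_fieldMinus, weightPair_b_b, weightPair_c_b, zero_mul, add_zero]
  split_ifs
  · have h0 : (t : ℂ) ≠ 0 := ofReal_ne_zero.mpr ht.ne'
    have hh := hbar_ne_zero P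
    have hs := sinh_half_ne_zero P ht
    rw [exp_sh, exp_sh_neg, expo, ← exp_mul_exp_eq]
    have e1 : chi P t (r - r' - 1 / 2) - chi P t (r - r' + 1 / 2)
        = -(2 * sinh (P.hbar * t / 2) * (chi P t r * chi P t (-r'))) := by
      rw [sinh_half_eq_chi, ← chi_add, mul_div_cancel₀ _ two_ne_zero, sub_mul, ← chi_add,
        ← chi_add, neg_sub]
      congr 2 <;> ring
    rw [e1]
    field_simp
  · rw [zero_mul]

/-- The difference of the contractions of `λ_μ⁺` with `λ_ν⁻` and with `λ_μ⁻`. -/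
def lamDiff (P : Params) (t : ℝ) (μ ν : ℕ) : ℂ :=
  if μ < ν then (chi P t ((P.k + P.N) / 2) - chi P t (-((P.k + P.N) / 2))) * (1 - chi P t (-1))
  else if ν < μ then
    (chi P t ((P.k + P.N) / 2) - chi P t (-((P.k + P.N) / 2))) * (chi P t 1 - 1)
  else 0

/-- On the diagonal, sinh((N-1)ħt/2) sinh(ħt/2)/sinh(Nħt/2) is half of t · `rhoKernel`. In the
difference between an off-diagonal commutator and the diagonal one the denominator sinh(Nħt/2)
cancels, which leaves the combination of characters `lamDiff`. The transcendental part is thus the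
same for all μ and ν. -/
theorem kernel_lamPlus_lamMinus (hμ : μ ∈ Finset.Icc 1 P.N) (hν : ν ∈ Finset.Icc 1 P.N) :
    kernel P t (lamPlus P μ u r) (lamMinus P ν v r') =
      expo (u - v) t * (chi P t (r - r')
        * (lamDiff P t μ ν - (chi P t ((P.k + P.N) / 2) - chi P t (-((P.k + P.N) / 2)))
          * (t * rhoKernel P t))) := by
  have h0 : (t : ℂ) ≠ 0 := ofReal_ne_zero.mpr ht.ne'
  have hh := hbar_ne_zero P
  have hd := one_sub_exp_ne_zero P ht
  have hd' := sinh_denominator_ne_zero P ht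
  have e := weightPair_lam_lam P ⟨μ, hμ⟩ ⟨ν, hν⟩ t
  simp only at e
  rw [lamPlus, lamMinus, kernel_fieldPlus_fieldMinus, e, exp_sh, exp_sh_neg, expo,
    ← exp_mul_exp_eq, sub_eq_add_neg r r', chi_add P t r]
  set A := chi P t ((P.k + P.N) / 2) - chi P t (-((P.k + P.N) / 2)) with hA
  set x := chi P t (1 / 2) with hx
  set y := chi P t (P.N / 2) with hy
  have hx0 : x ≠ 0 := chi_ne_zero _ _ _
  have hy0 : y ≠ 0 := chi_ne_zero _ _ _
  have q1 : chi P t 1 = x ^ 2 := by rw [hx, pow_two, ← chi_add]; norm_num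
  have q2 : chi P t P.N = y ^ 2 := by rw [hy, pow_two, ← chi_add]; congr 1; ring
  have q3 : chi P t ((P.N - 1) / 2) = y / x := by
    rw [hx, hy, eq_div_iff (chi_ne_zero _ _ _), ← chi_add]; congr 1; ring
  have q4 : exp (-P.hbar * t) = (x ^ 2)⁻¹ := by
    rw [← q1, ← chi_neg, chi]; congr 1; ring
  have q5 : exp (-(P.N * P.hbar) * t) = (y ^ 2)⁻¹ := by
    rw [← q2, ← chi_neg, chi]; congr 1; ring
  have q6 : exp (-((P.N - 1) * P.hbar) * t) = x ^ 2 / y ^ 2 := by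
    rw [← q1, ← q2, div_eq_mul_inv, ← chi_neg, ← chi_add, chi]; congr 1; ring
  rw [q5] at hd
  have s1 : sinh (P.hbar * t / 2) = (x - x⁻¹) / 2 := by rw [sinh_half_eq_chi, chi_neg]
  have s2 : sinh ((P.k + P.N) / 2 * P.hbar * t) = A / 2 := sinh_eq_chi P t _
  have s3 : sinh ((P.N - 1) / 2 * P.hbar * t) = (y / x - x / y) / 2 := by
    rw [sinh_eq_chi, chi_neg, q3, inv_div]
  have s4 : sinh (P.N / 2 * P.hbar * t) = (y - y⁻¹) / 2 := by rw [sinh_eq_chi, chi_neg]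
  rw [s4] at hd'
  have hy1 : y ^ 2 - 1 ≠ 0 := by
    intro h
    apply hd
    rw [sub_eq_zero.1 h]; norm_num
  have hy2 : y - y⁻¹ ≠ 0 := fun h => hd' (by rw [h, zero_div])
  have d1 : (y - y⁻¹) = (y ^ 2 - 1) / y := by field_simp
  have d2 : 1 - (y ^ 2)⁻¹ = (y ^ 2 - 1) / y ^ 2 := by field_simp
  have hr : (t : ℂ) * rhoKernel P t
      = (x ^ 2 - 1) * (y ^ 2 - x ^ 2) / (x ^ 2 * (y ^ 2 - 1)) := by
    rw [rhoKernel, q4, q5, q6, d2]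
    field_simp
  rw [hr]
  simp only [comm, lamDiff, Subtype.mk.injEq, ← hA, chi_neg P t 1, q1]
  rw [s1, s2, s3, s4, d1]
  rcases lt_trichotomy μ ν with h | h | h
  · have e5 : exp (-1 * (P.N / 2) * P.hbar * t) = y⁻¹ := by
      rw [hy, ← chi_neg, chi]; congr 1; ring
    rw [if_neg h.ne, if_neg (by omega : ¬ν < μ), if_pos h, e5]
    field_simp
    ring
  · rw [if_pos h, if_neg (by omega : ¬μ < ν), if_neg (by omega : ¬ν < μ)]
    field_simp
    ring
  · have e5 : exp (1 * (P.N / 2) * P.hbar * t) = y := by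
      rw [hy, chi]; congr 1; ring
    rw [if_neg h.ne', if_pos h, if_neg (by omega : ¬μ < ν), if_pos h, e5]
    field_simp
    ring

end

section
variable (P : Params) (t : ℝ) (u v r r' : ℂ) (a b a' b' μ ν : ℕ) (e : Exponent P)

-- The bosons b and c have opposite commutators and enter with the same weight. Hence (b+c) fields
-- are invisible to each other, and among the fields without λ only those involving some b^±
-- contract.
@[simp] theorem kernel_bc_bc : kernel P t (bc P a b u r) (bc P a' b' v r') = 0 := by
  simp only [bc, map_add, LinearMap.add_apply, kernel_fieldFull_fieldFull, weightPair_c_c,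
    weightPair_b_c, weightPair_c_b]
  ring

@[simp] theorem kernel_lamMinus_left : kernel P t (lamMinus P μ u r) e = 0 := kernel_zero_fst _ _ _ _
@[simp] theorem kernel_bMinus_left : kernel P t (bMinus P a b u r) e = 0 := kernel_zero_fst _ _ _ _
@[simp] theorem kernel_lamPlus_right : kernel P t e (lamPlus P μ u r) = 0 := kernel_zero_snd _ _ _ _
@[simp] theorem kernel_bPlus_right : kernel P t e (bPlus P a b u r) = 0 := kernel_zero_snd _ _ _ _

@[simp] theorem kernel_lamPlus_bMinus : kernel P t (lamPlus P μ u r) (bMinus P a b v r') = 0 := by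
  rw [lamPlus, bMinus, kernel_fieldPlus_fieldMinus, weightPair_lam_b, zero_mul]

@[simp] theorem kernel_lamPlus_bc : kernel P t (lamPlus P μ u r) (bc P a b v r') = 0 := by
  rw [lamPlus, bc, map_add, kernel_fieldPlus_fieldFull, kernel_fieldPlus_fieldFull,
    weightPair_lam_b, weightPair_lam_c, zero_mul, add_zero]

@[simp] theorem kernel_bPlus_lamMinus : kernel P t (bPlus P a b u r) (lamMinus P μ v r') = 0 := by
  rw [bPlus, lamMinus, kernel_fieldPlus_fieldMinus, weightPair_b_lam, zero_mul]

@[simp] theorem kernel_bc_lamMinus : kernel P t (bc P a b u r) (lamMinus P μ v r') = 0 := by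
  rw [bc, lamMinus, map_add, LinearMap.add_apply, kernel_fieldFull_fieldMinus,
    kernel_fieldFull_fieldMinus, weightPair_b_lam, weightPair_c_lam, zero_mul, add_zero]

end

/-! ### Holomorphic families of pairings -/

section
variable {P : Params} {D : Type*} [NormedAddCommGroup D] [NormedSpace ℂ D] {U : Set D}

/-- The pairing converges and depends holomorphically on the parameter. -/
def HolPair (U : Set D) (η : D → Config P) (f : D → ModeFn P) : Prop :=
  (∀ z ∈ U, PairConverges P (η z) (f z)) ∧ DifferentiableOn ℂ (fun z => pair P (η z) (f z)) U

theorem PairConverges.add_left {η ζ : Config P} {f : ModeFn P} (h : PairConverges P η f)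
    (h' : PairConverges P ζ f) : PairConverges P (η + ζ) f := by
  refine (h.add h').congr (Eventually.of_forall fun t => ?_)
  simp only [Submodule.coe_add, Pi.add_apply, add_mul, Finset.sum_add_distrib]

theorem PairConverges.neg_left {η : Config P} {f : ModeFn P} (h : PairConverges P η f) :
    PairConverges P (-η) f := by
  refine h.neg.congr (Eventually.of_forall fun t => ?_)
  simp only [Submodule.coe_neg, Pi.neg_apply, neg_mul, Finset.sum_neg_distrib]

theorem PairConverges.add_right {η : Config P} {f g : ModeFn P} (h : PairConverges P η f)
    (h' : PairConverges P η g) : PairConverges P η (f + g) := by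
  refine (h.add h').congr (Eventually.of_forall fun t => ?_)
  simp only [Submodule.coe_add, Pi.add_apply, mul_add, Finset.sum_add_distrib]

theorem PairConverges.neg_right {η : Config P} {f : ModeFn P} (h : PairConverges P η f) :
    PairConverges P η (-f) := by
  refine h.neg.congr (Eventually.of_forall fun t => ?_)
  simp only [Submodule.coe_neg, Pi.neg_apply, mul_neg, Finset.sum_neg_distrib]

theorem pair_add_left {η ζ : Config P} {f : ModeFn P} (h : PairConverges P η f)
    (h' : PairConverges P ζ f) : pair P (η + ζ) f = pair P η f + pair P ζ f := by
  simpa using pair_add_smul η ζ 1 h h'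

theorem pair_add_right {η : Config P} {f g : ModeFn P} (h : PairConverges P η f)
    (h' : PairConverges P η g) : pair P η (f + g) = pair P η f + pair P η g := by
  unfold pair
  rw [← integral_add h h']
  congr 1
  funext t
  simp only [Submodule.coe_add, Pi.add_apply, mul_add, Finset.sum_add_distrib]

theorem pair_neg_left (η : Config P) (f : ModeFn P) : pair P (-η) f = -pair P η f := by
  unfold pair
  rw [← integral_neg]
  congr 1
  funext t
  simp only [Submodule.coe_neg, Pi.neg_apply, neg_mul, Finset.sum_neg_distrib]

theorem pair_neg_right (η : Config P) (f : ModeFn P) : pair P η (-f) = -pair P η f := by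
  unfold pair
  rw [← integral_neg]
  congr 1
  funext t
  simp only [Submodule.coe_neg, Pi.neg_apply, mul_neg, Finset.sum_neg_distrib]

theorem pair_zero_left (f : ModeFn P) : pair P 0 f = 0 := by simp [pair]

theorem pair_zero_right (η : Config P) : pair P η 0 = 0 := by simp [pair]

theorem HolPair.zero_left (f : D → ModeFn P) : HolPair U (fun _ => 0) f :=
  ⟨fun z _ => by simp [PairConverges], by simp [pair_zero_left]⟩

theorem HolPair.zero_right (η : D → Config P) : HolPair U η fun _ => 0 :=
  ⟨fun z _ => by simp [PairConverges], by simp [pair_zero_right]⟩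

theorem HolPair.add_left {η ζ : D → Config P} {f : D → ModeFn P} (h : HolPair U η f)
    (h' : HolPair U ζ f) : HolPair U (fun z => η z + ζ z) f :=
  ⟨fun z hz => (h.1 z hz).add_left (h'.1 z hz),
    (h.2.add h'.2).congr fun z hz => pair_add_left (h.1 z hz) (h'.1 z hz)⟩

theorem HolPair.add_right {η : D → Config P} {f g : D → ModeFn P} (h : HolPair U η f)
    (h' : HolPair U η g) : HolPair U η fun z => f z + g z :=
  ⟨fun z hz => (h.1 z hz).add_right (h'.1 z hz),
    (h.2.add h'.2).congr fun z hz => pair_add_right (h.1 z hz) (h'.1 z hz)⟩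

theorem HolPair.neg_left {η : D → Config P} {f : D → ModeFn P} (h : HolPair U η f) :
    HolPair U (fun z => -η z) f :=
  ⟨fun z hz => (h.1 z hz).neg_left, h.2.neg.congr fun _ _ => pair_neg_left _ _⟩

theorem HolPair.neg_right {η : D → Config P} {f : D → ModeFn P} (h : HolPair U η f) :
    HolPair U η fun z => -f z :=
  ⟨fun z hz => (h.1 z hz).neg_right, h.2.neg.congr fun _ _ => pair_neg_right _ _⟩

/-- Continuous functions on the half line of exponential growth. -/
def IsMild (ρ : ℝ) (h : ℝ → ℂ) : Prop :=
  ContinuousOn h (Ioi 0) ∧ ∃ C, ∀ t, 0 < t → ‖h t‖ ≤ C * Real.exp (ρ * t)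

theorem IsMild.add {ρ : ℝ} {g h : ℝ → ℂ} (hg : IsMild ρ g) (hh : IsMild ρ h) :
    IsMild ρ fun t => g t + h t := by
  obtain ⟨hg, C, hC⟩ := hg
  obtain ⟨hh, C', hC'⟩ := hh
  refine ⟨hg.add hh, C + C', fun t ht => (norm_add_le _ _).trans ?_⟩
  rw [add_mul]
  exact add_le_add (hC t ht) (hC' t ht)

theorem IsMild.const_mul {ρ : ℝ} {h : ℝ → ℂ} (hh : IsMild ρ h) (c : ℂ) :
    IsMild ρ fun t => c * h t := by
  obtain ⟨hh, C, hC⟩ := hh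
  refine ⟨continuousOn_const.mul hh, ‖c‖ * C, fun t ht => ?_⟩
  rw [norm_mul, mul_assoc]
  gcongr
  exact hC t ht

theorem IsMild.sub {ρ : ℝ} {g h : ℝ → ℂ} (hg : IsMild ρ g) (hh : IsMild ρ h) :
    IsMild ρ fun t => g t - h t := by
  simpa [sub_eq_add_neg] using hg.add (hh.const_mul (-1))

theorem IsMild.congr {ρ : ℝ} {g h : ℝ → ℂ} (hg : IsMild ρ g) (e : ∀ t, 0 < t → h t = g t) :
    IsMild ρ h := by
  obtain ⟨hg, C, hC⟩ := hg
  exact ⟨hg.congr fun t ht => e t ht, C, fun t ht => (e t ht) ▸ hC t ht⟩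

theorem holPair_of_isMild {η : D → Config P} {f : D → ModeFn P} {ρ : ℝ} {h : ℝ → ℂ}
    (hh : IsMild ρ h) {w : D → ℂ} (hw : DifferentiableOn ℂ w U) (him : ∀ z ∈ U, (w z).im < -ρ)
    (e : ∀ z ∈ U, ∀ t : ℝ, 0 < t →
      ∑ s, (η z).1 s t * (f z).1 s t = exp (-(I * w z * t)) * h t) :
    HolPair U η f := by
  obtain ⟨hc, C, hC⟩ := hh
  refine ⟨fun z hz => ?_, ?_⟩
  · exact (integrableOn_congr_fun (fun t ht => e z hz t ht) measurableSet_Ioi).2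
      (laplace_integrableOn hc hC (him z hz))
  · have h1 : DifferentiableOn ℂ (fun w : ℂ => ∫ t in Ioi (0 : ℝ), exp (-(I * w * t)) * h t)
        {w | w.im < -ρ} := fun w hw =>
      (laplace_hasDerivAt hc hC hw).differentiableAt.differentiableWithinAt
    refine (h1.comp hw him).congr fun z hz => ?_
    exact setIntegral_congr_fun measurableSet_Ioi fun t ht => e z hz t ht

theorem isMild_of_compact {h : ℝ → ℂ} (hc : ContinuousOn h (Ioi 0)) {a b : ℝ} (ha : 0 < a)
    (h0 : ∀ t, t ∉ Icc a b → h t = 0) (ρ : ℝ) : IsMild ρ h := by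
  have hsub : Icc a b ⊆ Ioi 0 := fun t ht => lt_of_lt_of_le ha ht.1
  obtain ⟨C, hC⟩ := isCompact_Icc.exists_bound_of_continuousOn
    ((hc.mono hsub).div (g := fun t : ℝ => (Real.exp (ρ * t) : ℂ)) (by fun_prop)
      fun t _ => ofReal_ne_zero.2 (Real.exp_pos _).ne')
  refine ⟨hc, max C 0, fun t ht => ?_⟩
  by_cases h : t ∈ Icc a b
  · have h1 := hC t h
    simp only [Pi.div_apply] at h1
    rw [norm_div, norm_real, Real.norm_of_nonneg (Real.exp_pos _).le,
      div_le_iff₀ (Real.exp_pos _)] at h1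
    exact h1.trans (by gcongr; exact le_max_left _ _)
  · rw [h0 t h, norm_zero]
    positivity

theorem holPair_of_compact {η : D → Config P} {f : D → ModeFn P} {h : ℝ → ℂ}
    (hc : ContinuousOn h (Ioi 0)) {a b : ℝ} (ha : 0 < a) (h0 : ∀ t, t ∉ Icc a b → h t = 0)
    {w : D → ℂ} (hw : DifferentiableOn ℂ w U)
    (e : ∀ z ∈ U, ∀ t : ℝ, 0 < t →
      ∑ s, (η z).1 s t * (f z).1 s t = exp (-(I * w z * t)) * h t) :
    HolPair U η f := by
  -- A function with compact support in t > 0 obeys an exponential bound of every rate, so near each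
  -- z₀ the rate is chosen such that the half plane of convergence contains w z₀.
  have key : ∀ z₀ ∈ U, HolPair (U ∩ w ⁻¹' {x | x.im < (w z₀).im + 1}) η f := fun z₀ _ =>
    holPair_of_isMild (isMild_of_compact hc ha h0 (-((w z₀).im + 1)))
      (hw.mono inter_subset_left) (fun z hz => by simpa using hz.2) fun z hz => e z hz.1
  refine ⟨fun z hz => (key z hz).1 z ⟨hz, by simp⟩, fun z hz => ?_⟩
  have h1 := (key z hz).2 z ⟨hz, by simp⟩
  refine h1.mono_of_mem_nhdsWithin ?_
  refine inter_mem self_mem_nhdsWithin ?_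
  exact (hw z hz).continuousWithinAt.preimage_mem_nhdsWithin
    ((isOpen_lt continuous_im continuous_const).mem_nhds (by simp))

/-! ### Exponents composed of elementary fields -/

/-- A bound for the shifts that occur in the currents. -/
def shiftBound (P : Params) : ℝ := P.N + ‖P.k‖ + 1

/-- A bound for the shifts that occur in the contractions. -/
def poleBound (P : Params) : ℝ := 4 * (P.N + ‖P.k‖ + 2)

/-- The distance of the arguments that makes all contractions converge. -/
def radius (P : Params) : ℝ := 3 * poleBound P * ‖P.hbar‖

theorem radius_nonneg (P : Params) : 0 ≤ radius P := by
  unfold radius poleBound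
  positivity

/-- The elementary fields, as functions of their argument. -/
def fieldSet (P : Params) : Set (ℂ → Exponent P) :=
  {f | ∃ r : ℂ, ‖r‖ ≤ shiftBound P ∧
    ((∃ μ ∈ Finset.Icc 1 P.N, f = fun u => lamPlus P μ u r) ∨
    (∃ μ ∈ Finset.Icc 1 P.N, f = fun u => lamMinus P μ u r) ∨
    (∃ a b, f = fun u => bPlus P a b u r) ∨ (∃ a b, f = fun u => bMinus P a b u r) ∨
    (∃ a b, f = fun u => bc P a b u r))}

/-- The exponents composed of elementary fields at the positions in `Z`. -/
def fieldsAt (P : Params) (Z : Set (D → ℂ)) : AddSubgroup (D → Exponent P) :=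
  AddSubgroup.closure {e | ∃ f ∈ fieldSet P, ∃ ζ ∈ Z, e = fun z => f (ζ z)}

theorem frullaniKernel_eq_chi (P : Params) (a b : ℂ) (t : ℝ) :
    frullaniKernel (a * P.hbar) (b * P.hbar) t = (chi P t a - chi P t b) / t := rfl

theorem isMild_frullani {a b : ℂ} (ha : ‖a‖ ≤ poleBound P) (hb : ‖b‖ ≤ poleBound P) :
    IsMild (radius P) fun t => (chi P t a - chi P t b) / t := by
  refine ⟨frullaniKernel_continuousOn (a * P.hbar) (b * P.hbar), _, fun t ht =>
    norm_frullaniKernel_le (a * P.hbar) (b * P.hbar) ?_ ht⟩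
  rw [norm_mul, norm_mul, radius]
  have := mul_le_mul_of_nonneg_right ha (norm_nonneg P.hbar)
  have := mul_le_mul_of_nonneg_right hb (norm_nonneg P.hbar)
  linarith

theorem isMild_chi_mul_rhoKernel {a : ℂ} (ha : ‖a‖ + P.N ≤ 3 * poleBound P) :
    IsMild (radius P) fun t => chi P t a * rhoKernel P t := by
  obtain ⟨C, hC⟩ := exists_norm_rhoKernel_le P
  have hC0 : 0 ≤ C :=
    nonneg_of_mul_nonneg_left ((norm_nonneg _).trans (hC 1 one_pos)) (Real.exp_pos _)
  refine ⟨ContinuousOn.mul (by unfold chi; fun_prop) (rhoKernel_continuousOn P), C,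
    fun t ht => ?_⟩
  have h1 : ‖chi P t a‖ ≤ Real.exp (‖a‖ * ‖P.hbar‖ * t) := by
    refine (norm_exp_le_exp_norm _).trans_eq ?_
    rw [norm_mul, norm_mul, norm_real, Real.norm_of_nonneg ht.le]
  have h2 : (P.N * P.hbar : ℂ).re ≤ P.N * ‖P.hbar‖ := by
    have := re_le_norm (P.N * P.hbar : ℂ)
    simpa using this
  rw [norm_mul]
  calc ‖chi P t a‖ * ‖rhoKernel P t‖
      ≤ Real.exp (‖a‖ * ‖P.hbar‖ * t) * (C * Real.exp ((P.N * ‖P.hbar‖) * t)) := by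
        gcongr
        exact (hC t ht).trans (by gcongr)
    _ = C * Real.exp ((‖a‖ + P.N) * ‖P.hbar‖ * t) := by
        rw [mul_left_comm, ← Real.exp_add]; congr 2; ring
    _ ≤ _ := by
        rw [radius]
        gcongr

theorem exists_isMild_kernel {f g : ℂ → Exponent P} (hf : f ∈ fieldSet P) (hg : g ∈ fieldSet P) :
    ∃ h, IsMild (radius P) h ∧ ∀ u v : ℂ, ∀ t : ℝ, 0 < t →
      kernel P t (f u) (g v) = exp (-(I * (u - v) * t)) * h t := by
  have hzero : (∀ u v : ℂ, ∀ t : ℝ, 0 < t → kernel P t (f u) (g v) = 0) →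
      ∃ h, IsMild (radius P) h ∧ ∀ u v : ℂ, ∀ t : ℝ, 0 < t →
        kernel P t (f u) (g v) = exp (-(I * (u - v) * t)) * h t := fun H =>
    ⟨fun _ => 0, ⟨continuousOn_const, 0, by simp⟩, fun u v t ht => by rw [H u v t ht, mul_zero]⟩
  have hN : (2 : ℝ) ≤ P.N := by exact_mod_cast P.two_le
  obtain ⟨r, hr, hf⟩ := hf
  obtain ⟨r', hr', hg⟩ := hg
  have hk := norm_nonneg P.k
  have hrr : ‖r - r'‖ ≤ 2 * shiftBound P := (norm_sub_le _ _).trans (by linarith)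
  have hshift : ∀ c : ℂ, ‖c‖ ≤ (P.N + ‖P.k‖) / 2 + 2 → ‖r - r' + c‖ ≤ poleBound P := fun c hc => by
    refine (norm_add_le _ _).trans ?_
    unfold poleBound
    unfold shiftBound at hrr
    linarith
  have hshift' : ∀ c : ℂ, ‖c‖ ≤ (P.N + ‖P.k‖) / 2 →
      ‖r - r' + c‖ + P.N ≤ 3 * poleBound P := fun c hc => by
    have := norm_add_le (r - r') c
    unfold poleBound
    unfold shiftBound at hrr
    linarith
  have h0 : ‖r - r'‖ ≤ poleBound P := by simpa using hshift 0 (by rw [norm_zero]; linarith)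
  have h1 : ‖r - r' + 1‖ ≤ poleBound P := hshift 1 (by rw [norm_one]; linarith)
  have h2 : ‖r - r' - 1‖ ≤ poleBound P := by
    rw [sub_eq_add_neg _ (1 : ℂ)]; exact hshift (-1) (by rw [norm_neg, norm_one]; linarith)
  have h3 : ‖r - r' + 1 / 2‖ ≤ poleBound P := hshift (1 / 2) (by norm_num; linarith)
  have h4 : ‖r - r' - 1 / 2‖ ≤ poleBound P := by
    rw [sub_eq_add_neg _ (1 / 2 : ℂ)]; exact hshift (-(1 / 2)) (by norm_num; linarith)
  -- Of the 25 pairs of fields only four contract: λ⁺ with λ⁻, b⁺ with b⁻, b⁺ with (b+c), and (b+c)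
  -- with b⁻.
  rcases hf with ⟨μ, hμ, rfl⟩ | ⟨μ, hμ, rfl⟩ | ⟨a, b, rfl⟩ | ⟨a, b, rfl⟩ | ⟨a, b, rfl⟩ <;>
  rcases hg with ⟨ν, hν, rfl⟩ | ⟨ν, hν, rfl⟩ | ⟨a', b', rfl⟩ | ⟨a', b', rfl⟩ | ⟨a', b', rfl⟩ <;>
  first
    | (refine hzero fun u v t _ => ?_
       simp only [kernel_bc_bc, kernel_lamMinus_left, kernel_bMinus_left, kernel_lamPlus_right,
         kernel_bPlus_right, kernel_lamPlus_bMinus, kernel_lamPlus_bc, kernel_bPlus_lamMinus,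
         kernel_bc_lamMinus]
       done)
    | skip
  -- The case of λ⁺ and λ⁻. The factor χ(κ) - χ(-κ) is distributed, so that the rational part
  -- consists of Frullani kernels at shifts ±κ + σ with |σ| ≤ 1 and the rest of two shifted copies
  -- of the kernel of ρ.
  · set κ : ℂ := (P.k + P.N) / 2 with hκ
    have hκn : ‖κ‖ ≤ (P.N + ‖P.k‖) / 2 := by
      have := norm_add_le P.k (P.N : ℂ)
      rw [Complex.norm_natCast] at this
      rw [hκ, norm_div]
      norm_num
      linarith
    have hc1 : ∀ σ : ℂ, ‖σ‖ ≤ 1 → ‖r - r' + (κ + σ)‖ ≤ poleBound P := fun σ hσ =>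
      hshift _ ((norm_add_le _ _).trans (by linarith))
    have hc2 : ∀ σ : ℂ, ‖σ‖ ≤ 1 → ‖r - r' + (-κ + σ)‖ ≤ poleBound P := fun σ hσ =>
      hshift _ ((norm_add_le _ _).trans (by rw [norm_neg]; linarith))
    have hrho : IsMild (radius P) fun t => chi P t (r - r' + κ) * rhoKernel P t
        - chi P t (r - r' + -κ) * rhoKernel P t :=
      (isMild_chi_mul_rhoKernel (hshift' _ hκn)).sub
        (isMild_chi_mul_rhoKernel (hshift' _ (by rwa [norm_neg])))
    have hd : ∀ σ τ : ℂ, ‖σ‖ ≤ 1 → ‖τ‖ ≤ 1 → IsMild (radius P) fun t =>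
        (chi P t (r - r' + (κ + σ)) - chi P t (r - r' + (κ + τ))) / t
        - (chi P t (r - r' + (-κ + σ)) - chi P t (r - r' + (-κ + τ))) / t := fun σ τ hσ hτ =>
      (isMild_frullani (hc1 σ hσ) (hc1 τ hτ)).sub (isMild_frullani (hc2 σ hσ) (hc2 τ hτ))
    refine ⟨fun t => chi P t (r - r') * (lamDiff P t μ ν / t
      - (chi P t κ - chi P t (-κ)) * rhoKernel P t), ?_, fun u v t ht => ?_⟩
    · rcases lt_trichotomy μ ν with h | h | h
      · refine ((hd 0 (-1) (by simp) (by simp)).sub hrho).congr fun t ht => ?_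
        simp only [lamDiff, if_pos h, chi_add, chi_zero, ← hκ]
        ring
      · refine (hrho.const_mul (-1)).congr fun t ht => ?_
        simp only [lamDiff, h, lt_irrefl, if_false, chi_add]
        ring
      · refine ((hd 1 0 (by simp) (by simp)).sub hrho).congr fun t ht => ?_
        simp only [lamDiff, if_pos h, if_neg h.not_gt, chi_add, chi_zero, ← hκ]
        ring
    · have ht0 : (t : ℂ) ≠ 0 := ofReal_ne_zero.mpr ht.ne'
      rw [kernel_lamPlus_lamMinus P ht _ _ _ _ _ _ hμ hν, expo, ← hκ]
      field_simp
  · by_cases h : a = a' ∧ b = b' ∧ IsPair P a b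
    · refine ⟨_, (isMild_frullani h1 h0).sub (isMild_frullani h0 h2), fun u v t ht => ?_⟩
      rw [kernel_bPlus_bMinus P ht, if_pos h, expo]
      ring
    · exact hzero fun u v t ht => by rw [kernel_bPlus_bMinus P ht, if_neg h]
  · by_cases h : a = a' ∧ b = b' ∧ IsPair P a b
    · refine ⟨_, isMild_frullani h4 h3, fun u v t ht => ?_⟩
      rw [kernel_bPlus_bc P ht, if_pos h, expo]
      ring
    · exact hzero fun u v t ht => by rw [kernel_bPlus_bc P ht, if_neg h]
  · by_cases h : a = a' ∧ b = b' ∧ IsPair P a b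
    · refine ⟨_, isMild_frullani h4 h3, fun u v t ht => ?_⟩
      rw [kernel_bc_bMinus P ht, if_pos h, expo]
      ring
    · exact hzero fun u v t ht => by rw [kernel_bc_bMinus P ht, if_neg h]

/-- For two single fields the contraction is a Laplace transform evaluated at the difference of the
positions; sums and inverses follow since the contraction is additive in both arguments. -/
theorem holPair_contr {Z Z' : Set (D → ℂ)} (hZ : ∀ ζ ∈ Z, DifferentiableOn ℂ ζ U)
    (hZ' : ∀ ζ ∈ Z', DifferentiableOn ℂ ζ U)
    (him : ∀ ζ ∈ Z, ∀ ζ' ∈ Z', ∀ z ∈ U, (ζ z - ζ' z).im < -radius P)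
    {e e' : D → Exponent P} (he : e ∈ fieldsAt P Z) (he' : e' ∈ fieldsAt P Z') :
    HolPair U (fun z => dir P (e z).1) fun z => (e' z).2 := by
  induction he using AddSubgroup.closure_induction with
  | mem e h =>
    obtain ⟨f, hf, ζ, hζ, rfl⟩ := h
    induction he' using AddSubgroup.closure_induction with
    | mem e' h' =>
      obtain ⟨g, hg, ζ', hζ', rfl⟩ := h'
      obtain ⟨h, hh, hk⟩ := exists_isMild_kernel hf hg
      exact holPair_of_isMild hh ((hZ ζ hζ).sub (hZ' ζ' hζ')) (him ζ hζ ζ' hζ')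
        fun z _ t ht => hk (ζ z) (ζ' z) t ht
    | zero => exact HolPair.zero_right _
    | add x y _ _ hx hy => exact hx.add_right hy
    | neg x _ hx => exact hx.neg_right
  | zero =>
    have e : (fun z => dir P ((0 : D → Exponent P) z).1) = fun _ => 0 := funext fun z => by
      rw [Pi.zero_apply, Prod.fst_zero, map_zero]
    exact e ▸ HolPair.zero_left _
  | add x y _ _ hx hy =>
    have e : (fun z => dir P ((x + y) z).1) = fun z => dir P (x z).1 + dir P (y z).1 :=
      funext fun z => by rw [Pi.add_apply, Prod.fst_add, map_add]
    exact e ▸ hx.add_left hy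
  | neg x _ hx =>
    have e : (fun z => dir P ((-x) z).1) = fun z => -dir P (x z).1 :=
      funext fun z => by rw [Pi.neg_apply, Prod.fst_neg, map_neg]
    exact e ▸ hx.neg_left

/-- The test configuration has compact support in t > 0, so the pairing converges wherever the
fields sit and no separation of positions is needed. -/
theorem holPair_bra {Z : Set (D → ℂ)} (hZ : ∀ ζ ∈ Z, DifferentiableOn ℂ ζ U) {η : Config P}
    (hη : IsTest η.1) {e : D → Exponent P} (he : e ∈ fieldsAt P Z) :
    HolPair U (fun _ => η) fun z => (e z).2 := by
  obtain ⟨a, b, ha, h0⟩ := hη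
  have key : ∀ (ζ : D → ℂ), DifferentiableOn ℂ ζ U → ∀ (r : ℂ) (w : Boson P.N → ℂ) (γ : ℝ → ℂ),
      ContinuousOn γ (Ioi 0) → ∀ f : D → ModeFn P,
      (∀ z s, ∀ t : ℝ, (f z).1 s t = w s * (γ t * exp (-(I * sh P (ζ z) r * (-t : ℝ))))) →
      HolPair U (fun _ => η) f := by
    intro ζ hζ r w γ hγ f hf
    refine holPair_of_compact (h := fun t => ∑ s, η.1 s t * w s * γ t)
      (w := fun z => -sh P (ζ z) r)
      (continuousOn_finsetSum _ fun s _ => ((η.2.1 s).mul continuousOn_const).mul hγ) ha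
      (fun t ht => Finset.sum_eq_zero fun s _ => by rw [h0 s t ht, zero_mul, zero_mul])
      (by unfold sh; fun_prop) fun z _ t _ => ?_
    rw [Finset.mul_sum]
    refine Finset.sum_congr rfl fun s _ => ?_
    have : exp (-(I * sh P (ζ z) r * (-t : ℝ))) = exp (-(I * -sh P (ζ z) r * t)) := by
      congr 1; push_cast; ring
    rw [hf, this]
    ring
  induction he using AddSubgroup.closure_induction with
  | mem e h =>
    obtain ⟨f, ⟨r, -, hf⟩, ζ, hζ, rfl⟩ := h
    have hfull : ContinuousOn (fun t : ℝ => -(P.hbar / sinh (P.hbar * (-t : ℝ) / 2))) (Ioi 0) := by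
      refine (ContinuousOn.div (by fun_prop) (by fun_prop) fun t ht => ?_).neg
      have h : (P.hbar * (-t : ℝ) / 2 : ℂ) = -(P.hbar * t / 2) := by push_cast; ring
      rw [h, sinh_neg]
      exact neg_ne_zero.mpr (sinh_half_ne_zero P ht)
    rcases hf with ⟨μ, hμ, rfl⟩ | ⟨μ, hμ, rfl⟩ | ⟨a, b, rfl⟩ | ⟨a, b, rfl⟩ | ⟨a, b, rfl⟩
    · exact HolPair.zero_right _
    · exact key ζ (hZ ζ hζ) r (lamW P μ) (fun _ => -(2 * P.hbar)) continuousOn_const _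
        fun z s t => by simp only [lamMinus, fieldMinus, modeFn]; ring
    · exact HolPair.zero_right _
    · exact key ζ (hZ ζ hζ) r (bW P a b) (fun _ => -(2 * P.hbar)) continuousOn_const _
        fun z s t => by simp only [bMinus, fieldMinus, modeFn]; ring
    · exact (key ζ (hZ ζ hζ) r (bW P a b) _ hfull (fun z => (fieldFull P (bW P a b) (sh P (ζ z) r)).2)
        fun z s t => by simp only [fieldFull, modeFn]; ring).add_right
        (key ζ (hZ ζ hζ) r (cW P a b) _ hfull (fun z => (fieldFull P (cW P a b) (sh P (ζ z) r)).2)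
        fun z s t => by simp only [fieldFull, modeFn]; ring)
  | zero => exact HolPair.zero_right _
  | add x y _ _ hx hy => exact hx.add_right hy
  | neg x _ hx => exact hx.neg_right

/-- The counterpart for the vector: the test function of a creation operator has compact support, so
the translation by the annihilation part of any field pairs with it at every position. -/
theorem holPair_ket {Z : Set (D → ℂ)} (hZ : ∀ ζ ∈ Z, DifferentiableOn ℂ ζ U) {f : ModeFn P}
    (hf : IsTest f.1) {e : D → Exponent P} (he : e ∈ fieldsAt P Z) :
    HolPair U (fun z => dir P (e z).1) fun _ => f := by
  obtain ⟨a, b, ha, h0⟩ := hf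
  have key : ∀ (ζ : D → ℂ), DifferentiableOn ℂ ζ U → ∀ (r : ℂ) (w : Boson P.N → ℂ) (γ : ℝ → ℂ),
      ContinuousOn γ (Ioi 0) → ∀ g : D → ModeFn P,
      (∀ z s, ∀ t : ℝ, (g z).1 s t = w s * (γ t * exp (-(I * sh P (ζ z) r * t)))) →
      HolPair U (fun z => dir P (g z)) fun _ => f := by
    intro ζ hζ r w γ hγ g hg
    refine holPair_of_compact
      (h := fun t => ∑ s', (∑ s, w s * γ t * comm P s s' t) * f.1 s' t)
      (w := fun z => sh P (ζ z) r)
      (continuousOn_finsetSum _ fun s' _ => (continuousOn_finsetSum _ fun s _ =>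
        (continuousOn_const.mul hγ).mul (comm_continuousOn P s s')).mul (f.2 s')) ha
      (fun t ht => Finset.sum_eq_zero fun s _ => by rw [h0 s t ht, mul_zero])
      (by unfold sh; fun_prop) fun z _ t _ => ?_
    rw [Finset.mul_sum]
    refine Finset.sum_congr rfl fun s' _ => ?_
    rw [← mul_assoc, Finset.mul_sum]
    congr 1
    refine Finset.sum_congr rfl fun s _ => ?_
    rw [hg]
    ring
  induction he using AddSubgroup.closure_induction with
  | mem e h =>
    obtain ⟨φ, ⟨r, -, hφ⟩, ζ, hζ, rfl⟩ := h
    have hfull : ContinuousOn (fun t : ℝ => -(P.hbar / sinh (P.hbar * t / 2))) (Ioi 0) :=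
      (ContinuousOn.div (by fun_prop) (by fun_prop) fun t ht => sinh_half_ne_zero P ht).neg
    have hz : HolPair U (fun _ : D => dir P (0 : ModeFn P)) fun _ => f := by
      rw [map_zero]; exact HolPair.zero_left _
    rcases hφ with ⟨μ, hμ, rfl⟩ | ⟨μ, hμ, rfl⟩ | ⟨a, b, rfl⟩ | ⟨a, b, rfl⟩ | ⟨a, b, rfl⟩
    · exact key ζ (hZ ζ hζ) r (lamW P μ) (fun _ => 2 * P.hbar) continuousOn_const _
        fun z s t => by simp only [lamPlus, fieldPlus, modeFn]
    · exact hz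
    · exact key ζ (hZ ζ hζ) r (bW P a b) (fun _ => 2 * P.hbar) continuousOn_const _
        fun z s t => by simp only [bPlus, fieldPlus, modeFn]
    · exact hz
    · have h1 := (key ζ (hZ ζ hζ) r (bW P a b) _ hfull
        (fun z => (fieldFull P (bW P a b) (sh P (ζ z) r)).1)
        fun z s t => by simp only [fieldFull, modeFn]; ring).add_left
        (key ζ (hZ ζ hζ) r (cW P a b) _ hfull (fun z => (fieldFull P (cW P a b) (sh P (ζ z) r)).1)
        fun z s t => by simp only [fieldFull, modeFn]; ring)
      have e : (fun z => dir P (bc P a b (ζ z) r).1) = fun z =>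
          dir P (fieldFull P (bW P a b) (sh P (ζ z) r)).1
            + dir P (fieldFull P (cW P a b) (sh P (ζ z) r)).1 := funext fun z => by
        rw [bc, Prod.fst_add, map_add]
      exact e ▸ h1
  | zero =>
    have e : (fun z => dir P ((0 : D → Exponent P) z).1) = fun _ => 0 := funext fun z => by
      rw [Pi.zero_apply, Prod.fst_zero, map_zero]
    exact e ▸ HolPair.zero_left _
  | add x y _ _ hx hy =>
    have e : (fun z => dir P ((x + y) z).1) = fun z => dir P (x z).1 + dir P (y z).1 :=
      funext fun z => by rw [Pi.add_apply, Prod.fst_add, map_add]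
    exact e ▸ hx.add_left hy
  | neg x _ hx =>
    have e : (fun z => dir P ((-x) z).1) = fun z => -dir P (x z).1 :=
      funext fun z => by rw [Pi.neg_apply, Prod.fst_neg, map_neg]
    exact e ▸ hx.neg_left

end

/-! ### Expansion of the currents in normal ordered exponentials -/

section
variable (P : Params)

/-- The terms of `X_ν⁺(u)`; the flag selects the summand in the bracket. -/
def xPlusExp (ν m : ℕ) : Bool → ℂ → Exponent P
  | true, u => bc P m ν u (-(((m : ℂ) - ν - 1) / 2))
      + (bPlus P m (ν + 1) u (-(((m : ℂ) - ν - 1) / 2))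
          - bc P m (ν + 1) u (-(((m : ℂ) - ν) / 2)))
      + ∑ n ∈ Finset.Ico 1 m, (bPlus P n (ν + 1) u (-(((n : ℂ) - ν - 1) / 2))
          - bPlus P n ν u (-(((n : ℂ) - ν) / 2)))
  | false, u => bc P m ν u (-(((m : ℂ) - ν - 1) / 2))
      + (bMinus P m (ν + 1) u (-(((m : ℂ) - ν - 1) / 2))
          - bc P m (ν + 1) u (-(((m : ℂ) - ν - 2) / 2)))
      + ∑ n ∈ Finset.Ico 1 m, (bPlus P n (ν + 1) u (-(((n : ℂ) - ν - 1) / 2))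
          - bPlus P n ν u (-(((n : ℂ) - ν) / 2)))

/-- The terms of the first sum in `X_ν⁻(u)`. -/
def xMinusExp₁ (ν m : ℕ) (a : Bool) (u : ℂ) : Exponent P :=
  bc P m (ν + 1) u (((ν : ℂ) + m) / 2)
      + lamMinus P ν u (-((P.k - P.N) / 4)) - lamMinus P (ν + 1) u (-((P.k - P.N) / 4))
    + (match a with
      | true => -bMinus P m ν u (((ν : ℂ) + m) / 2) - bc P m ν u (((ν : ℂ) + m - 1) / 2)
      | false => -bPlus P m ν u (((ν : ℂ) + m) / 2) - bc P m ν u (((ν : ℂ) + m + 1) / 2))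
    + ∑ n ∈ Finset.Icc (m + 1) ν,
        (bMinus P n (ν + 1) u (((ν : ℂ) + n - 1) / 2) - bMinus P n ν u (((ν : ℂ) + n) / 2))
    + ∑ s ∈ Finset.Icc (ν + 1) P.N,
        (bMinus P ν s u (((ν : ℂ) + s) / 2) - bMinus P (ν + 1) s u (((ν : ℂ) + s - 1) / 2))

/-- The terms of the second sum in `X_ν⁻(u)`. -/
def xMinusExp₂ (ν m : ℕ) (a : Bool) (u : ℂ) : Exponent P :=
  bc P ν m u (-((2 * P.k + m - ν - 1) / 2))
      + lamPlus P ν u (-((3 * P.k + P.N) / 4)) - lamPlus P (ν + 1) u (-((3 * P.k + P.N) / 4))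
    + (match a with
      | true => bPlus P (ν + 1) m u (-((2 * P.k + m - ν - 1) / 2))
          - bc P (ν + 1) m u (-((2 * P.k + m - ν) / 2))
      | false => bMinus P (ν + 1) m u (-((2 * P.k + m - ν - 1) / 2))
          - bc P (ν + 1) m u (-((2 * P.k + m - ν - 2) / 2)))
    + ∑ n ∈ Finset.Icc m P.N,
        (bPlus P ν n u (-((2 * P.k + n - ν) / 2))
          - bPlus P (ν + 1) n u (-((2 * P.k + n - ν - 1) / 2)))

/-- The labels of the terms of the currents: the sum, the summation index and the summand in the
bracket. -/
abbrev Label : Type := Bool × ℕ × Bool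

/-- The labels that occur in a current. -/
def labels : Current P.N → Finset Label
  | .kPlus _ | .kPlusInv _ | .kMinus _ | .kMinusInv _ => {(true, 0, true)}
  | .xPlus ν => {true} ×ˢ Finset.Icc 1 (ν : ℕ) ×ˢ Finset.univ
  | .xMinus ν => (Finset.univ ×ˢ Finset.Icc 1 P.N ×ˢ Finset.univ).filter fun i : Label =>
      if i.1 then i.2.1 ≤ ν ∧ (i.2.2 = true ∨ i.2.1 < ν)
      else ν + 1 ≤ i.2.1 ∧ (i.2.2 = true ∨ ν + 1 < i.2.1)

/-- The coefficient of a term. -/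
def coef : Label → ℂ
  | (true, _, true) => 1
  | (true, _, false) => -1
  | (false, _, true) => -1
  | (false, _, false) => 1

/-- The exponent of a term. -/
def texp : Current P.N → Label → ℂ → Exponent P
  | .kPlus μ, _ => kPlusExp P μ
  | .kPlusInv μ, _ => fun u => -kPlusExp P μ u
  | .kMinus μ, _ => kMinusExp P μ
  | .kMinusInv μ, _ => fun u => -kMinusExp P μ u
  | .xPlus ν, (_, m, a) => xPlusExp P ν m a
  | .xMinus ν, (true, m, a) => xMinusExp₁ P ν m a
  | .xMinus ν, (false, m, a) => xMinusExp₂ P ν m a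

end

theorem nexp_mul {P : Params} (e e' : Exponent P) : nexp e * nexp e' = nexp (e + e') := by
  rw [nexp, nexp, AddMonoidAlgebra.single_mul_single, mul_one, nexp]

theorem bW_self (P : Params) (a : ℕ) : bW P a a = 0 := by
  funext s
  rcases s with μ | p | p
  · rfl
  · have := p.2
    simp only [Finset.mem_filter] at this
    simp only [bW, Pi.zero_apply, ite_eq_right_iff, one_ne_zero, imp_false]
    rintro h
    rw [h] at this
    exact lt_irrefl _ this.2
  · rfl

theorem cW_self (P : Params) (a : ℕ) : cW P a a = 0 := by
  funext s
  rcases s with μ | p | p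
  · rfl
  · rfl
  · have := p.2
    simp only [Finset.mem_filter] at this
    simp only [cW, Pi.zero_apply, ite_eq_right_iff, one_ne_zero, imp_false]
    rintro h
    rw [h] at this
    exact lt_irrefl _ this.2

theorem modeFn_zero (P : Params) (f : ℝ → ℂ) (hf) : modeFn P 0 f hf = 0 := by
  apply Subtype.ext
  funext s t
  simp [modeFn]

theorem bPlus_self (P : Params) (a : ℕ) (u r : ℂ) : bPlus P a a u r = 0 := by
  rw [bPlus, fieldPlus, bW_self, modeFn_zero]; rfl

theorem bMinus_self (P : Params) (a : ℕ) (u r : ℂ) : bMinus P a a u r = 0 := by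
  rw [bMinus, fieldMinus, bW_self, modeFn_zero]; rfl

theorem bc_self (P : Params) (a : ℕ) (u r : ℂ) : bc P a a u r = 0 := by
  refine Prod.ext (Subtype.ext ?_) (Subtype.ext ?_) <;> funext s t <;>
    simp [bc, fieldFull, modeFn, bW_self, cW_self]

/-- At m = n the two exponents in the bracket agree, because they differ only in bosons with equal
indices, which vanish. The coefficient becomes 2 - 1 = 1 and only the first summand is kept. This is
the effect of the Kronecker deltas in X⁻ and the reason why `labels` omits one flag at the end of
each sum. -/
theorem sum_bool_filter {M : Type*} [AddCommGroup M] [Module ℂ M] (s : Finset ℕ) (n : ℕ)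
    (p : ℕ → Prop) [DecidablePred p] (hp : ∀ m ∈ s, m ≠ n → p m) (hn : ¬p n) (x y : ℕ → M)
    (hxy : x n = y n) :
    ∑ m ∈ s, ((1 + if m = n then 1 else 0 : ℂ) • x m - y m)
      = ∑ m ∈ s, (x m + if p m then -y m else 0) := by
  refine Finset.sum_congr rfl fun m hm => ?_
  by_cases h : m = n
  · subst h
    rw [if_pos rfl, if_neg hn, hxy, add_zero, add_smul, one_smul, add_sub_cancel_right]
  · rw [if_neg h, if_pos (hp m hm h), add_zero, one_smul, sub_eq_add_neg]

theorem sum_labels_xMinus {M : Type*} [AddCommMonoid M] (P : Params) (ν : RootIdx P.N)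
    (F : Label → M) :
    ∑ i ∈ labels P (.xMinus ν), F i
      = ∑ m ∈ Finset.Icc 1 (ν : ℕ), (F (true, m, true) + if m < ν then F (true, m, false) else 0)
        + ∑ m ∈ Finset.Icc ((ν : ℕ) + 1) P.N,
          (F (false, m, true) + if ν + 1 < m then F (false, m, false) else 0) := by
  have hν := Finset.mem_Ico.mp ν.2
  rw [labels, Finset.sum_filter, Finset.sum_product, Fintype.sum_bool, Finset.sum_product,
    Finset.sum_product]
  simp only [Fintype.sum_bool]
  congr 1
  · rw [← Finset.sum_subset (Finset.Icc_subset_Icc_right hν.2.le :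
      Finset.Icc 1 (ν : ℕ) ⊆ Finset.Icc 1 P.N)]
    · refine Finset.sum_congr rfl fun m hm => ?_
      have := (Finset.mem_Icc.mp hm).2
      simp [this]
    · intro m _ hm
      have h : ¬m ≤ ν := by simp only [Finset.mem_Icc] at *; omega
      simp [h]
  · rw [← Finset.sum_subset (Finset.Icc_subset_Icc_left (by omega) :
      Finset.Icc ((ν : ℕ) + 1) P.N ⊆ Finset.Icc 1 P.N)]
    · refine Finset.sum_congr rfl fun m hm => ?_
      have := (Finset.mem_Icc.mp hm).1
      simp [this]
    · intro m _ hm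
      have h : ¬ν + 1 ≤ m := by simp only [Finset.mem_Icc] at *; omega
      simp [h]

theorem image_eq_sum (P : Params) (J : Current P.N) (u : ℂ) :
    image P J u = ∑ i ∈ labels P J, coef i • nexp (texp P J i u) := by
  rcases J with μ | μ | μ | μ | ν | ν
  · simp [image, labels, coef, texp]
  · simp [image, labels, coef, texp]
  · simp [image, labels, coef, texp]
  · simp [image, labels, coef, texp]
  · rw [labels, Finset.sum_product, Finset.sum_singleton, Finset.sum_product, image, xPlusImage]
    refine Finset.sum_congr rfl fun m _ => ?_
    rw [Fintype.sum_bool]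
    simp only [texp, coef, one_smul, neg_smul, xPlusExp, mul_sub, sub_mul, nexp_mul]
    rw [sub_eq_add_neg]
  · rw [sum_labels_xMinus, image, xMinusImage, sub_eq_add_neg, ← Finset.sum_neg_distrib]
    congr 1
    · simp only [texp, coef, one_smul, neg_smul]
      rw [← sum_bool_filter _ ν (fun m => m < ν) (fun m hm h => by
        have := Finset.mem_Icc.mp hm; omega) (lt_irrefl _)]
      · refine Finset.sum_congr rfl fun m _ => ?_
        simp only [xMinusExp₁, mul_sub, sub_mul, nexp_mul, mul_smul_comm, smul_mul_assoc]
      · simp only [xMinusExp₁, bMinus_self, bPlus_self, bc_self]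
    · simp only [texp, coef, one_smul, neg_smul]
      have e := sum_bool_filter (Finset.Icc ((ν : ℕ) + 1) P.N) (ν + 1) (fun m => ν + 1 < m)
        (fun m hm h => by have := Finset.mem_Icc.mp hm; omega) (lt_irrefl _)
        (fun m => nexp (xMinusExp₂ P ν m true u)) (fun m => nexp (xMinusExp₂ P ν m false u))
        (by simp only [xMinusExp₂, bMinus_self, bPlus_self, bc_self])
      have e2 := congrArg Neg.neg e
      rw [← Finset.sum_neg_distrib, ← Finset.sum_neg_distrib] at e2
      refine Eq.trans ?_ (e2.trans ?_)
      · refine Finset.sum_congr rfl fun m _ => ?_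
        simp only [xMinusExp₂, mul_sub, sub_mul, nexp_mul, mul_smul_comm, smul_mul_assoc]
      · refine Finset.sum_congr rfl fun m _ => ?_
        split_ifs <;> simp [add_comm]

/-- `op` as a linear map. -/
def opLinear (P : Params) : NormalOrdered P →ₗ[ℂ] Module.End ℂ (Functional P) where
  toFun := op P
  map_add' _ _ := Finsupp.sum_add_index' (h := fun e c => c • vertex P e)
    (fun _ => zero_smul _ _) fun _ _ _ => add_smul _ _ _
  map_smul' c x := by
    refine (Finsupp.sum_smul_index' (h := fun e c => c • vertex P e) fun _ => zero_smul _ _).trans ?_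
    simp only [op, Finsupp.smul_sum, smul_assoc, RingHom.id_apply]
    rfl

theorem op_nexp (P : Params) (e : Exponent P) : op P (nexp e) = vertex P e :=
  (Finsupp.sum_single_index (h := fun e c => c • vertex P e) (zero_smul _ _)).trans (one_smul _ _)

theorem op_sum {ι : Type*} (P : Params) (s : Finset ι) (c : ι → ℂ) (e : ι → Exponent P) :
    op P (∑ i ∈ s, c i • nexp (e i)) = ∑ i ∈ s, c i • vertex P (e i) := by
  change opLinear P _ = _
  rw [map_sum]
  refine Finset.sum_congr rfl fun i _ => ?_
  rw [map_smul]
  exact congrArg _ (op_nexp P _)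

theorem op_image (P : Params) (J : Current P.N) (u : ℂ) :
    op P (image P J u) = ∑ i ∈ labels P J, coef i • vertex P (texp P J i u) := by
  rw [image_eq_sum, op_sum]

/-- Terms with equal exponents may merge or cancel, so the support can be smaller than the set of
labels; this inclusion is all that the convergence statements need. -/
theorem mem_support_image (P : Params) (J : Current P.N) (u : ℂ) {e : Exponent P}
    (he : e ∈ (image P J u).coeff.support) : ∃ i ∈ labels P J, e = texp P J i u := by
  by_contra! h
  rw [Finsupp.mem_support_iff] at he
  apply he
  have key : ∀ s : Finset Label, (∀ i ∈ s, e ≠ texp P J i u) →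
      (∑ i ∈ s, coef i • nexp (texp P J i u)).coeff e = 0 := by
    intro s
    induction s using Finset.induction_on with
    | empty => intro _; simp
    | insert i s hi ih =>
      intro hs
      rw [Finset.sum_insert hi, AddMonoidAlgebra.coeff_add, Finsupp.add_apply,
        ih fun j hj => hs j (Finset.mem_insert_of_mem hj), add_zero, AddMonoidAlgebra.coeff_smul,
        Finsupp.smul_apply, nexp, AddMonoidAlgebra.coeff_single, 
        Finsupp.single_eq_of_ne (hs i (Finset.mem_insert_self _ _)), smul_zero]
  rw [image_eq_sum]
  exact key _ h

/-! ### The exponents are composed of elementary fields -/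

section
variable {P : Params}

theorem comp_mem_fieldsAt {D : Type*} {Z : Set (D → ℂ)} {ζ : D → ℂ} (hζ : ζ ∈ Z)
    {f : ℂ → Exponent P} (hf : f ∈ AddSubgroup.closure (fieldSet P)) :
    (fun z => f (ζ z)) ∈ fieldsAt P Z := by
  induction hf using AddSubgroup.closure_induction with
  | mem f h => exact AddSubgroup.subset_closure ⟨f, h, ζ, hζ, rfl⟩
  | zero => exact zero_mem _
  | add x y _ _ hx hy => exact add_mem hx hy
  | neg x _ hx => exact neg_mem hx

theorem lamPlus_mem {μ : ℕ} (hμ : μ ∈ Finset.Icc 1 P.N) {r : ℂ} (hr : ‖r‖ ≤ shiftBound P) :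
    (fun u => lamPlus P μ u r) ∈ AddSubgroup.closure (fieldSet P) :=
  AddSubgroup.subset_closure ⟨r, hr, .inl ⟨μ, hμ, rfl⟩⟩

theorem lamMinus_mem {μ : ℕ} (hμ : μ ∈ Finset.Icc 1 P.N) {r : ℂ} (hr : ‖r‖ ≤ shiftBound P) :
    (fun u => lamMinus P μ u r) ∈ AddSubgroup.closure (fieldSet P) :=
  AddSubgroup.subset_closure ⟨r, hr, .inr (.inl ⟨μ, hμ, rfl⟩)⟩

theorem bPlus_mem (a b : ℕ) {r : ℂ} (hr : ‖r‖ ≤ shiftBound P) :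
    (fun u => bPlus P a b u r) ∈ AddSubgroup.closure (fieldSet P) :=
  AddSubgroup.subset_closure ⟨r, hr, .inr (.inr (.inl ⟨a, b, rfl⟩))⟩

theorem bMinus_mem (a b : ℕ) {r : ℂ} (hr : ‖r‖ ≤ shiftBound P) :
    (fun u => bMinus P a b u r) ∈ AddSubgroup.closure (fieldSet P) :=
  AddSubgroup.subset_closure ⟨r, hr, .inr (.inr (.inr (.inl ⟨a, b, rfl⟩)))⟩

theorem bc_mem (a b : ℕ) {r : ℂ} (hr : ‖r‖ ≤ shiftBound P) :
    (fun u => bc P a b u r) ∈ AddSubgroup.closure (fieldSet P) :=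
  AddSubgroup.subset_closure ⟨r, hr, .inr (.inr (.inr (.inr ⟨a, b, rfl⟩)))⟩

theorem sum_mem_closure {ι : Type*} (s : Finset ι) {f : ι → ℂ → Exponent P}
    (hf : ∀ i ∈ s, f i ∈ AddSubgroup.closure (fieldSet P)) :
    (fun u => ∑ i ∈ s, f i u) ∈ AddSubgroup.closure (fieldSet P) := by
  have e : (fun u => ∑ i ∈ s, f i u) = ∑ i ∈ s, f i := by
    funext u
    rw [Finset.sum_apply]
  rw [e]
  exact sum_mem hf

/-- A combination `x + c k` with real `x` is a shift within the bound. -/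
theorem norm_shift_le {r : ℂ} (x c : ℝ) (e : r = x + c * P.k) (hx : -(P.N + 1) ≤ x ∧ x ≤ P.N + 1)
    (hc : |c| ≤ 1) : ‖r‖ ≤ shiftBound P := by
  rw [e]
  refine (norm_add_le _ _).trans ?_
  have hx' := abs_le.mpr hx
  rw [norm_mul, norm_real, norm_real, Real.norm_eq_abs, Real.norm_eq_abs, shiftBound]
  have := mul_le_mul_of_nonneg_right hc (norm_nonneg P.k)
  linarith

theorem kPlusExp_mem {μ : ℕ} (hμ : μ ∈ Finset.Icc 1 P.N) :
    kPlusExp P μ ∈ AddSubgroup.closure (fieldSet P) := by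
  have h := Finset.mem_Icc.mp hμ
  have h1 : (1 : ℝ) ≤ μ := by exact_mod_cast h.1
  have h2 : (μ : ℝ) ≤ P.N := by exact_mod_cast h.2
  refine sub_mem (add_mem (neg_mem (lamPlus_mem hμ ?_)) (sum_mem_closure _ fun α hα => bPlus_mem _ _ ?_))
    (sum_mem_closure _ fun β hβ => bPlus_mem _ _ ?_)
  · exact norm_shift_le (-P.N / 4) (1 / 4) (by push_cast; ring) ⟨by linarith, by linarith⟩
      (by norm_num [abs_le])
  · have h3 : (α : ℝ) ≤ μ := by exact_mod_cast (Finset.mem_Ico.mp hα).2.le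
    have h4 : (0 : ℝ) ≤ α := Nat.cast_nonneg _
    exact norm_shift_le ((μ - α) / 2) 0 (by push_cast; ring) ⟨by linarith, by linarith⟩ (by norm_num)
  · have h3 : (β : ℝ) ≤ P.N := by exact_mod_cast (Finset.mem_Icc.mp hβ).2
    have h4 : (0 : ℝ) ≤ β := Nat.cast_nonneg _
    exact norm_shift_le ((μ - β) / 2) 0 (by push_cast; ring) ⟨by linarith, by linarith⟩ (by norm_num)

theorem kMinusExp_mem {μ : ℕ} (hμ : μ ∈ Finset.Icc 1 P.N) :
    kMinusExp P μ ∈ AddSubgroup.closure (fieldSet P) := by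
  have h := Finset.mem_Icc.mp hμ
  have h1 : (1 : ℝ) ≤ μ := by exact_mod_cast h.1
  have h2 : (μ : ℝ) ≤ P.N := by exact_mod_cast h.2
  refine sub_mem (add_mem (neg_mem (lamMinus_mem hμ ?_)) (sum_mem_closure _ fun α hα =>
    sum_mem_closure _ fun β hβ => bMinus_mem _ _ ?_)) (sum_mem_closure _ fun α hα =>
    sum_mem_closure _ fun β hβ => bMinus_mem _ _ ?_)
  · exact norm_shift_le (P.N / 4) (-1 / 4) (by push_cast; ring) ⟨by linarith, by linarith⟩
      (by norm_num [abs_le])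
  · have h3 : (α : ℝ) ≤ μ := by exact_mod_cast (Finset.mem_Ico.mp hα).2.le
    have h4 : (0 : ℝ) ≤ α := Nat.cast_nonneg _
    have h5 : (β : ℝ) ≤ P.N := by exact_mod_cast (Finset.mem_Icc.mp hβ).2
    have h6 : (0 : ℝ) ≤ β := Nat.cast_nonneg _
    exact norm_shift_le ((α + β) / 2) 0 (by push_cast; ring) ⟨by linarith, by linarith⟩ (by norm_num)
  · have h3 : (α : ℝ) ≤ μ := by exact_mod_cast (Finset.mem_Icc.mp hα).2
    have h4 : (0 : ℝ) ≤ α := Nat.cast_nonneg _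
    have h5 : (β : ℝ) ≤ P.N := by exact_mod_cast (Finset.mem_Icc.mp hβ).2
    have h6 : (0 : ℝ) ≤ β := Nat.cast_nonneg _
    exact norm_shift_le ((α + β - 2) / 2) 0 (by push_cast; ring) ⟨by linarith, by linarith⟩
      (by norm_num)

theorem xPlusExp_mem {ν m : ℕ} (hν : ν ∈ Finset.Ico 1 P.N) (hm : m ∈ Finset.Icc 1 ν) (a : Bool) :
    xPlusExp P ν m a ∈ AddSubgroup.closure (fieldSet P) := by
  have h1 : (ν : ℝ) ≤ P.N := by exact_mod_cast (Finset.mem_Ico.mp hν).2.le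
  have h2 : (m : ℝ) ≤ ν := by exact_mod_cast (Finset.mem_Icc.mp hm).2
  have h3 : (1 : ℝ) ≤ m := by exact_mod_cast (Finset.mem_Icc.mp hm).1
  have s1 : ‖(-(((m : ℂ) - ν - 1) / 2))‖ ≤ shiftBound P :=
    norm_shift_le (-((m - ν - 1) / 2)) 0 (by push_cast; ring) ⟨by linarith, by linarith⟩ (by norm_num)
  have s2 : ‖(-(((m : ℂ) - ν) / 2))‖ ≤ shiftBound P :=
    norm_shift_le (-((m - ν) / 2)) 0 (by push_cast; ring) ⟨by linarith, by linarith⟩ (by norm_num)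
  have s3 : ‖(-(((m : ℂ) - ν - 2) / 2))‖ ≤ shiftBound P :=
    norm_shift_le (-((m - ν - 2) / 2)) 0 (by push_cast; ring) ⟨by linarith, by linarith⟩ (by norm_num)
  have s4 : (fun u => ∑ n ∈ Finset.Ico 1 m, (bPlus P n (ν + 1) u (-(((n : ℂ) - ν - 1) / 2))
      - bPlus P n ν u (-(((n : ℂ) - ν) / 2)))) ∈ AddSubgroup.closure (fieldSet P) := by
    refine sum_mem_closure _ fun n hn => ?_
    have h4 : (n : ℝ) ≤ m := by exact_mod_cast (Finset.mem_Ico.mp hn).2.le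
    have h5 : (0 : ℝ) ≤ n := Nat.cast_nonneg _
    refine sub_mem (bPlus_mem _ _ ?_) (bPlus_mem _ _ ?_)
    · exact norm_shift_le (-((n - ν - 1) / 2)) 0 (by push_cast; ring) ⟨by linarith, by linarith⟩
        (by norm_num)
    · exact norm_shift_le (-((n - ν) / 2)) 0 (by push_cast; ring) ⟨by linarith, by linarith⟩
        (by norm_num)
  cases a
  · exact add_mem (add_mem (bc_mem _ _ s1) (sub_mem (bMinus_mem _ _ s1) (bc_mem _ _ s3))) s4
  · exact add_mem (add_mem (bc_mem _ _ s1) (sub_mem (bPlus_mem _ _ s1) (bc_mem _ _ s2))) s4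

theorem xMinusExp₁_mem {ν m : ℕ} (hν : ν ∈ Finset.Ico 1 P.N) (hm : m ∈ Finset.Icc 1 ν) (a : Bool) :
    xMinusExp₁ P ν m a ∈ AddSubgroup.closure (fieldSet P) := by
  have hν' := Finset.mem_Ico.mp hν
  have h1 : (ν : ℝ) + 1 ≤ P.N := by exact_mod_cast hν'.2
  have h2 : (m : ℝ) ≤ ν := by exact_mod_cast (Finset.mem_Icc.mp hm).2
  have h3 : (1 : ℝ) ≤ m := by exact_mod_cast (Finset.mem_Icc.mp hm).1
  have s0 : ‖(-((P.k - P.N) / 4))‖ ≤ shiftBound P :=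
    norm_shift_le (P.N / 4) (-1 / 4) (by push_cast; ring) ⟨by linarith, by linarith⟩
      (by norm_num [abs_le])
  have s1 : ‖(((ν : ℂ) + m) / 2)‖ ≤ shiftBound P :=
    norm_shift_le ((ν + m) / 2) 0 (by push_cast; ring) ⟨by linarith, by linarith⟩ (by norm_num)
  have s2 : ‖(((ν : ℂ) + m - 1) / 2)‖ ≤ shiftBound P :=
    norm_shift_le ((ν + m - 1) / 2) 0 (by push_cast; ring) ⟨by linarith, by linarith⟩ (by norm_num)
  have s3 : ‖(((ν : ℂ) + m + 1) / 2)‖ ≤ shiftBound P :=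
    norm_shift_le ((ν + m + 1) / 2) 0 (by push_cast; ring) ⟨by linarith, by linarith⟩ (by norm_num)
  have hs : ∀ n : ℕ, n ≤ P.N → ‖(((ν : ℂ) + n) / 2)‖ ≤ shiftBound P
      ∧ ‖(((ν : ℂ) + n - 1) / 2)‖ ≤ shiftBound P := fun n hn => by
    have h4 : (n : ℝ) ≤ P.N := by exact_mod_cast hn
    have h5 : (0 : ℝ) ≤ n := Nat.cast_nonneg _
    exact ⟨norm_shift_le ((ν + n) / 2) 0 (by push_cast; ring) ⟨by linarith, by linarith⟩
      (by norm_num), norm_shift_le ((ν + n - 1) / 2) 0 (by push_cast; ring)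
      ⟨by linarith, by linarith⟩ (by norm_num)⟩
  have l1 := lamMinus_mem (P := P) (μ := ν) (Finset.mem_Icc.mpr ⟨hν'.1, hν'.2.le⟩) s0
  have l2 := lamMinus_mem (P := P) (μ := ν + 1) (Finset.mem_Icc.mpr ⟨by omega, hν'.2⟩) s0
  refine add_mem (add_mem (add_mem (sub_mem (add_mem (bc_mem _ _ s1) l1) l2) ?_)
    (sum_mem_closure _ fun n hn => ?_)) (sum_mem_closure _ fun n hn => ?_)
  · cases a
    · exact sub_mem (neg_mem (bPlus_mem _ _ s1)) (bc_mem _ _ s3)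
    · exact sub_mem (neg_mem (bMinus_mem _ _ s1)) (bc_mem _ _ s2)
  · have := hs n ((Finset.mem_Icc.mp hn).2.trans hν'.2.le)
    exact sub_mem (bMinus_mem _ _ this.2) (bMinus_mem _ _ this.1)
  · have := hs n (Finset.mem_Icc.mp hn).2
    exact sub_mem (bMinus_mem _ _ this.1) (bMinus_mem _ _ this.2)

theorem xMinusExp₂_mem {ν m : ℕ} (hν : ν ∈ Finset.Ico 1 P.N) (hm : m ∈ Finset.Icc (ν + 1) P.N)
    (a : Bool) : xMinusExp₂ P ν m a ∈ AddSubgroup.closure (fieldSet P) := by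
  have hν' := Finset.mem_Ico.mp hν
  have hm' := Finset.mem_Icc.mp hm
  have h1 : (ν : ℝ) + 1 ≤ P.N := by exact_mod_cast hν'.2
  have h3 : (1 : ℝ) ≤ ν := by exact_mod_cast hν'.1
  have s0 : ‖(-((3 * P.k + P.N) / 4))‖ ≤ shiftBound P :=
    norm_shift_le (-P.N / 4) (-3 / 4) (by push_cast; ring) ⟨by linarith, by linarith⟩
      (by norm_num [abs_le])
  have hs : ∀ n : ℕ, ν + 1 ≤ n → n ≤ P.N → ‖(-((2 * P.k + n - ν) / 2))‖ ≤ shiftBound P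
      ∧ ‖(-((2 * P.k + n - ν - 1) / 2))‖ ≤ shiftBound P
      ∧ ‖(-((2 * P.k + n - ν - 2) / 2))‖ ≤ shiftBound P := fun n hn' hn => by
    have h4 : (n : ℝ) ≤ P.N := by exact_mod_cast hn
    have h5 : (ν : ℝ) + 1 ≤ n := by exact_mod_cast hn'
    refine ⟨?_, ?_, ?_⟩
    · exact norm_shift_le (-((n - ν) / 2)) (-1) (by push_cast; ring) ⟨by linarith, by linarith⟩
        (by norm_num)
    · exact norm_shift_le (-((n - ν - 1) / 2)) (-1) (by push_cast; ring) ⟨by linarith, by linarith⟩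
        (by norm_num)
    · exact norm_shift_le (-((n - ν - 2) / 2)) (-1) (by push_cast; ring) ⟨by linarith, by linarith⟩
        (by norm_num)
  obtain ⟨s1, s2, s3⟩ := hs m hm'.1 hm'.2
  have l1 := lamPlus_mem (P := P) (μ := ν) (Finset.mem_Icc.mpr ⟨hν'.1, hν'.2.le⟩) s0
  have l2 := lamPlus_mem (P := P) (μ := ν + 1) (Finset.mem_Icc.mpr ⟨by omega, hν'.2⟩) s0
  refine add_mem (add_mem (sub_mem (add_mem (bc_mem _ _ s2) l1) l2) ?_)
    (sum_mem_closure _ fun n hn => ?_)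
  · cases a
    · exact sub_mem (bMinus_mem _ _ s2) (bc_mem _ _ s3)
    · exact sub_mem (bPlus_mem _ _ s2) (bc_mem _ _ s1)
  · have hn' := Finset.mem_Icc.mp hn
    have := hs n (by omega) hn'.2
    exact sub_mem (bPlus_mem _ _ this.1) (bPlus_mem _ _ this.2.1)

theorem mem_labels_xPlus {ν : RootIdx P.N} {i : Label} : i ∈ labels P (.xPlus ν) ↔
    i.1 = true ∧ i.2.1 ∈ Finset.Icc 1 (ν : ℕ) := by
  simp only [labels, Finset.mem_product, Finset.mem_singleton, Finset.mem_univ, and_true]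

theorem mem_labels_xMinus {ν : RootIdx P.N} {i : Label} : i ∈ labels P (.xMinus ν) ↔
    if i.1 then i.2.1 ∈ Finset.Icc 1 (ν : ℕ) ∧ (i.2.2 = true ∨ i.2.1 < ν)
    else i.2.1 ∈ Finset.Icc ((ν : ℕ) + 1) P.N ∧ (i.2.2 = true ∨ ν + 1 < i.2.1) := by
  have := (Finset.mem_Ico.mp ν.2).2
  rcases i with ⟨s, m, a⟩
  cases s <;> simp only [labels, Finset.mem_filter, Finset.mem_product, Finset.mem_univ,
    Finset.mem_Icc, true_and, and_true, if_true, Bool.false_eq_true, if_false]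
  · constructor
    · rintro ⟨h1, h2, h3⟩; exact ⟨⟨h2, h1.2⟩, h3⟩
    · rintro ⟨h1, h2⟩; exact ⟨⟨by omega, h1.2⟩, h1.1, h2⟩
  · constructor
    · rintro ⟨h1, h2, h3⟩; exact ⟨⟨h1.1, h2⟩, h3⟩
    · rintro ⟨h1, h2⟩; exact ⟨⟨h1.1, by omega⟩, h1.2, h2⟩

theorem texp_mem {J : Current P.N} {i : Label} (hi : i ∈ labels P J) :
    texp P J i ∈ AddSubgroup.closure (fieldSet P) := by
  rcases J with μ | μ | μ | μ | ν | ν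
  · exact kPlusExp_mem μ.2
  · exact neg_mem (kPlusExp_mem μ.2)
  · exact kMinusExp_mem μ.2
  · exact neg_mem (kMinusExp_mem μ.2)
  · exact xPlusExp_mem ν.2 (mem_labels_xPlus.mp hi).2 _
  · rcases i with ⟨s, m, a⟩
    have h := mem_labels_xMinus.mp hi
    cases s
    · exact xMinusExp₂_mem ν.2 h.1 a
    · exact xMinusExp₁_mem ν.2 h.1 a

theorem texp_comp_mem {D : Type*} {Z : Set (D → ℂ)} {ζ : D → ℂ} (hζ : ζ ∈ Z) {J : Current P.N}
    {i : Label} (hi : i ∈ labels P J) : (fun z => texp P J i (ζ z)) ∈ fieldsAt P Z :=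
  comp_mem_fieldsAt hζ (texp_mem hi)

end

/-! ### Products of normal ordered exponentials -/

section
variable {P : Params} {D : Type*}

/-- A family of operators is a combination of normal ordered exponentials of fields at the
positions in `Z`. -/
def IsVertexSum (Z : Set (D → ℂ)) (A : D → Module.End ℂ (Functional P)) : Prop :=
  ∃ (s : Finset Label) (c : Label → ℂ) (e : Label → D → Exponent P),
    (∀ i ∈ s, e i ∈ fieldsAt P Z) ∧ ∀ z, A z = ∑ i ∈ s, c i • vertex P (e i z)

theorem isVertexSum_current (J : Current P.N) {Z : Set (D → ℂ)} {ζ : D → ℂ} (hζ : ζ ∈ Z) :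
    IsVertexSum Z fun z => op P (image P J (ζ z)) :=
  ⟨labels P J, coef, fun i z => texp P J i (ζ z), fun _ hi => texp_comp_mem hζ hi,
    fun z => op_image P J (ζ z)⟩

theorem isVertexSum_vertex {Z : Set (D → ℂ)} {e : D → Exponent P} (he : e ∈ fieldsAt P Z) :
    IsVertexSum Z fun z => vertex P (e z) :=
  ⟨{(true, 0, true)}, fun _ => 1, fun _ => e, fun _ _ => he, fun z => by simp⟩

theorem vertex_apply (e : Exponent P) (Ψ : Functional P) (η : Config P) :
    vertex P e Ψ η = exp (pair P η e.2) * Ψ (η + dir P e.1) := rfl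

theorem sum_vertex_apply (s : Finset Label) (c : Label → ℂ) (e : Label → Exponent P)
    (Ψ : Functional P) (η : Config P) :
    (∑ i ∈ s, c i • vertex P (e i)) Ψ η
      = ∑ i ∈ s, c i * (exp (pair P η (e i).2) * Ψ (η + dir P (e i).1)) := by
  rw [LinearMap.sum_apply, Finset.sum_apply]
  rfl

/-- Two adjacent normal ordered exponentials merge at the cost of their contraction. -/
theorem prod_vertex_mul_vertex {e₁ e₂ : Exponent P} (h : PairConverges P (dir P e₁.1) e₂.2)
    (T : Module.End ℂ (Functional P)) (Ψ : Functional P) (l : List (Module.End ℂ (Functional P))) :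
    ∀ η : Config P, PairConverges P η e₁.2 → PairConverges P η e₂.2 →
    (∀ A ∈ l, ∃ (s : Finset Label) (c : Label → ℂ) (e : Label → Exponent P),
      A = ∑ i ∈ s, c i • vertex P (e i) ∧ ∀ i ∈ s, PairConverges P (dir P (e i).1) e₁.2 ∧
        PairConverges P (dir P (e i).1) e₂.2) →
    (l.prod * (vertex P e₁ * vertex P e₂) * T) Ψ η
      = exp (contr P e₁ e₂) * (l.prod * vertex P (e₁ + e₂) * T) Ψ η := by
  induction l with
  | nil =>
    intro η h1 h2 _
    simp only [List.prod_nil, one_mul, Module.End.mul_apply, vertex_apply, contr, Prod.fst_add,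
      Prod.snd_add, map_add, pair_add_left h2 h, pair_add_right h1 h2, exp_add, add_assoc]
    ring
  | cons A l ih =>
    intro η h1 h2 hl
    obtain ⟨s, c, e, rfl, he⟩ := hl A List.mem_cons_self
    simp only [List.prod_cons, mul_assoc, Module.End.mul_apply] at ih ⊢
    -- Each exponential of the factor on the left translates the configuration η by the direction of
    -- its annihilation part. The convergence hypotheses on that factor keep the pairings with the
    -- two merging exponentials convergent.
    rw [sum_vertex_apply, sum_vertex_apply, Finset.mul_sum]
    refine Finset.sum_congr rfl fun i hi => ?_
    rw [ih _ (h1.add_left (he i hi).1) (h2.add_left (he i hi).2)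
      fun B hB => hl B (List.mem_cons_of_mem _ hB)]
    ring

end

section
variable {P : Params} {D : Type*} [NormedAddCommGroup D] [NormedSpace ℂ D] {U : Set D}

/-- Matrix coefficients of ordered products are holomorphic. -/
theorem differentiableOn_word {Ψ : Functional P} (hΨ : Ψ ∈ fock P)
    (l : List (Set (D → ℂ) × (D → Module.End ℂ (Functional P)))) :
    (∀ x ∈ l, (∀ ζ ∈ x.1, DifferentiableOn ℂ ζ U) ∧ IsVertexSum x.1 x.2) →
    (l.Pairwise fun x y => ∀ ζ ∈ x.1, ∀ ζ' ∈ y.1, ∀ z ∈ U, (ζ z - ζ' z).im < -radius P) →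
    ∀ η : D → Config P, (∀ x ∈ l, ∀ e ∈ fieldsAt P x.1, HolPair U η fun z => (e z).2) →
    (∀ f : ModeFn P, IsTest f.1 → HolPair U η fun _ => f) →
    DifferentiableOn ℂ (fun z => (l.map fun x => x.2 z).prod Ψ (η z)) U := by
  induction l with
  | nil =>
    intro _ _ η _ hη
    simp only [List.map_nil, List.prod_nil, Module.End.one_apply]
    induction hΨ using Algebra.adjoin_induction with
    | mem Ψ h =>
      obtain ⟨f, hf, rfl⟩ := h
      exact (hη f hf).2
    | algebraMap r => exact differentiableOn_const _
    | add Ψ Φ _ _ h1 h2 => exact h1.add h2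
    | mul Ψ Φ _ _ h1 h2 => exact h1.mul h2
  | cons x l ih =>
    intro hl hp η hη hη'
    obtain ⟨hx, s, c, e, he, hA⟩ := hl x List.mem_cons_self
    rw [List.pairwise_cons] at hp
    -- Removing the first factor multiplies by the exponential of a pairing and translates the
    -- configuration by an amount that depends on z. The induction therefore runs over
    -- configurations that vary with z, of which only holomorphy of pairings is recorded.
    have key : ∀ i ∈ s, DifferentiableOn ℂ (fun z => exp (pair P (η z) (e i z).2)
        * (l.map fun x => x.2 z).prod Ψ (η z + dir P (e i z).1)) U := fun i hi => by
      refine (hη x List.mem_cons_self _ (he i hi)).2.cexp.mul ?_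
      refine ih (fun y hy => hl y (List.mem_cons_of_mem _ hy)) hp.2
        (fun z => η z + dir P (e i z).1) (fun y hy e' he' => ?_) fun f hf => ?_
      · exact (hη y (List.mem_cons_of_mem _ hy) e' he').add_left
          (holPair_contr hx (hl y (List.mem_cons_of_mem _ hy)).1 (hp.1 y hy) (he i hi) he')
      · exact (hη' f hf).add_left (holPair_ket hx hf (he i hi))
    have := DifferentiableOn.fun_sum fun i hi => (key i hi).const_mul (c i)
    refine this.congr fun z _ => ?_
    rw [List.map_cons, List.prod_cons, Module.End.mul_apply, hA, sum_vertex_apply]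

end

/-! ### Matrix coefficients -/

/-- The homomorphism given by the assignment. -/
def psi (P : Params) : Realization P := FreeAlgebra.lift ℂ fun x => op P (image P x.1 x.2)

theorem psi_cur (P : Params) (J : Current P.N) (u : ℂ) :
    psi P (cur J u) = op P (image P J u) := FreeAlgebra.lift_ι_apply _ _

section
variable {P : Params}

theorem psi_prod (l : List (Current P.N × ℂ)) :
    psi P (l.map (FreeAlgebra.ι ℂ)).prod = (l.map fun x => op P (image P x.1 x.2)).prod := by
  rw [map_list_prod, List.map_map]
  congr 2
  funext x
  exact psi_cur P x.1 x.2

/-- Convergence at one point is extracted from the holomorphic statement by taking constant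
positions. -/
theorem pairConverges_bra {η : Config P} (hη : IsTest η.1) {J : Current P.N} {i : Label}
    (hi : i ∈ labels P J) (u : ℂ) : PairConverges P η (texp P J i u).2 :=
  (holPair_bra (D := ℂ) (U := univ) (Z := {fun _ => u})
    (fun ζ hζ => by rw [mem_singleton_iff.mp hζ]; exact differentiableOn_const _) hη
    (texp_comp_mem (mem_singleton _) hi)).1 0 trivial

theorem pairConverges_ket {f : ModeFn P} (hf : IsTest f.1) {J : Current P.N} {i : Label}
    (hi : i ∈ labels P J) (u : ℂ) : PairConverges P (dir P (texp P J i u).1) f :=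
  (holPair_ket (D := ℂ) (U := univ) (Z := {fun _ => u})
    (fun ζ hζ => by rw [mem_singleton_iff.mp hζ]; exact differentiableOn_const _) hf
    (texp_comp_mem (mem_singleton _) hi)).1 0 trivial

theorem pairConverges_contr {J J' : Current P.N} {i j : Label} (hi : i ∈ labels P J)
    (hj : j ∈ labels P J') {u v : ℂ} (h : (u - v).im < -radius P) :
    PairConverges P (dir P (texp P J i u).1) (texp P J' j v).2 :=
  (holPair_contr (D := ℂ) (U := univ) (Z := {fun _ => u}) (Z' := {fun _ => v})
    (fun ζ hζ => by rw [mem_singleton_iff.mp hζ]; exact differentiableOn_const _)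
    (fun ζ hζ => by rw [mem_singleton_iff.mp hζ]; exact differentiableOn_const _)
    (fun ζ hζ ζ' hζ' _ _ => by rw [mem_singleton_iff.mp hζ, mem_singleton_iff.mp hζ']; exact h)
    (texp_comp_mem (mem_singleton _) hi) (texp_comp_mem (mem_singleton _) hj)).1 0 trivial

theorem holPair_const {D : Type*} [NormedAddCommGroup D] [NormedSpace ℂ D] {U : Set D}
    (η : Config P) {f : ModeFn P} (hf : IsTest f.1) : HolPair U (fun _ => η) fun _ => f :=
  ⟨fun _ _ => hf.pairConverges η, differentiableOn_const _⟩

theorem wellDefined_psi : WellDefined P (radius P) (psi P) where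
  creation J u e he η hη := by
    obtain ⟨i, hi, rfl⟩ := mem_support_image P J u he
    exact pairConverges_bra hη hi u
  annihilation J u e he f hf := by
    obtain ⟨i, hi, rfl⟩ := mem_support_image P J u he
    exact pairConverges_ket hf hi u
  contraction J J' u v h e he e' he' := by
    obtain ⟨i, hi, rfl⟩ := mem_support_image P J u he
    obtain ⟨j, hj, rfl⟩ := mem_support_image P J' v he'
    exact pairConverges_contr hi hj h
  holomorphic n J Ψ hΨ η hη := by
    have hd : ∀ i : Fin n, Differentiable ℂ fun z : Fin n → ℂ => z i := fun i => by fun_prop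
    have h := differentiableOn_word (U := {z : Fin n → ℂ | ∀ i j, i < j →
        (z i - z j).im < -radius P}) hΨ
      (List.ofFn fun i => (({fun z : Fin n → ℂ => z i} : Set ((Fin n → ℂ) → ℂ)),
        fun z : Fin n → ℂ => op P (image P (J i) (z i)))) ?_ ?_ (fun _ => η) ?_ ?_
    · refine h.congr fun z _ => ?_
      rw [map_list_prod, List.map_ofFn, List.map_ofFn]
      simp only [Function.comp_def, psi_cur]
    · intro x hx
      obtain ⟨i, rfl⟩ := (List.mem_ofFn' _ _).mp hx
      refine ⟨fun ζ hζ => ?_, isVertexSum_current (J i) (mem_singleton _)⟩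
      rw [mem_singleton_iff.mp hζ]
      exact (hd i).differentiableOn
    · rw [List.pairwise_ofFn]
      intro i j hij ζ hζ ζ' hζ' z hz
      rw [mem_singleton_iff.mp hζ, mem_singleton_iff.mp hζ']
      exact hz i j hij
    · intro x hx e he
      obtain ⟨i, rfl⟩ := (List.mem_ofFn' _ _).mp hx
      refine holPair_bra (fun ζ hζ => ?_) hη he
      rw [mem_singleton_iff.mp hζ]
      exact (hd i).differentiableOn
    · exact fun f hf => holPair_const η hf

namespace Probe

variable (p : Probe P (radius P))

/-- The matrix coefficient of `left * A * right` for an operator `A`. -/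
def coeffOf (A : Module.End ℂ (Functional P)) : ℂ :=
  ((p.left.map fun x => op P (image P x.1 x.2)).prod * A
    * (p.right.map fun x => op P (image P x.1 x.2)).prod) p.ket p.bra

theorem eval_psi (A : FreeCurrents P) : p.eval (psi P) A = p.coeffOf (psi P A) := by
  rw [eval, map_mul, map_mul, psi_prod, psi_prod, coeffOf]

theorem eval_sub (ψ : Realization P) (A B : FreeCurrents P) :
    p.eval ψ (A - B) = p.eval ψ A - p.eval ψ B := by
  simp only [eval, mul_sub, sub_mul, map_sub]; rfl

theorem eval_smul (ψ : Realization P) (c : ℂ) (A : FreeCurrents P) :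
    p.eval ψ (c • A) = c * p.eval ψ A := by
  simp only [eval, mul_smul_comm, smul_mul_assoc, map_smul]; rfl

theorem eval_zero (ψ : Realization P) : p.eval ψ 0 = 0 := by
  simp only [eval, mul_zero, zero_mul, map_zero]; rfl

theorem coeffOf_sum {ι : Type*} (s : Finset ι) (c : ι → ℂ)
    (A : ι → Module.End ℂ (Functional P)) :
    p.coeffOf (∑ i ∈ s, c i • A i) = ∑ i ∈ s, c i * p.coeffOf (A i) := by
  simp only [coeffOf, Finset.mul_sum, Finset.sum_mul, mul_smul_comm, smul_mul_assoc,
    LinearMap.sum_apply, LinearMap.smul_apply, Finset.sum_apply, Pi.smul_apply, smul_eq_mul]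

theorem isOpen_band : IsOpen p.band := by
  have e : p.band = (⋂ x ∈ {x | x ∈ p.left}, {u | (x.2 - u).im < -radius P})
      ∩ ⋂ y ∈ {y | y ∈ p.right}, {u | (u - y.2).im < -radius P} := by
    ext u; simp [band]
  rw [e]
  refine (Set.Finite.isOpen_biInter (List.finite_toSet _) fun x _ => ?_).inter
    (Set.Finite.isOpen_biInter (List.finite_toSet _) fun x _ => ?_)
  · exact isOpen_lt (by fun_prop) continuous_const
  · exact isOpen_lt (by fun_prop) continuous_const

/-- The matrix coefficient of a normal ordered exponential is holomorphic while its positions stay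
in the band. -/
theorem coeffOf_vertex_differentiableOn {D : Type*} [NormedAddCommGroup D] [NormedSpace ℂ D]
    {U : Set D} {Z : Set (D → ℂ)} (hZ : ∀ ζ ∈ Z, DifferentiableOn ℂ ζ U ∧ ∀ z ∈ U, ζ z ∈ p.band)
    {e : D → Exponent P} (he : e ∈ fieldsAt P Z) :
    DifferentiableOn ℂ (fun z => p.coeffOf (vertex P (e z))) U := by
  let g : Current P.N × ℂ → Set (D → ℂ) × (D → Module.End ℂ (Functional P)) := fun x =>
    ({fun _ => x.2}, fun _ => op P (image P x.1 x.2))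
  have hg : ∀ x, (∀ ζ ∈ (g x).1, DifferentiableOn ℂ ζ U) ∧ IsVertexSum (g x).1 (g x).2 :=
    fun x => ⟨fun ζ hζ => by rw [mem_singleton_iff.mp hζ]; exact differentiableOn_const _,
      isVertexSum_current x.1 (mem_singleton _)⟩
  have hl : ∀ y ∈ p.left.map g ++ (Z, fun z => vertex P (e z)) :: p.right.map g,
      (∀ ζ ∈ y.1, DifferentiableOn ℂ ζ U) ∧ IsVertexSum y.1 y.2 := by
    intro y hy
    rcases List.mem_append.mp hy with h | h
    · obtain ⟨x, -, rfl⟩ := List.mem_map.mp h; exact hg x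
    · rcases List.mem_cons.mp h with rfl | h
      · exact ⟨fun ζ hζ => (hZ ζ hζ).1, isVertexSum_vertex he⟩
      · obtain ⟨x, -, rfl⟩ := List.mem_map.mp h; exact hg x
  have hord := List.pairwise_append.mp p.ordered
  have h := differentiableOn_word (U := U) p.ket_mem _ hl ?_ (fun _ => p.bra)
    (fun y hy e he => holPair_bra (hl y hy).1 p.bra_test he) fun f hf => holPair_const _ hf
  · refine h.congr fun z _ => ?_
    simp only [coeffOf, List.map_append, List.map_map, List.map_cons, List.prod_append,
      List.prod_cons, mul_assoc, Function.comp_def, g]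
  · have hgg : ∀ x y : Current P.N × ℂ, (x.2 - y.2).im < -radius P →
        ∀ ζ ∈ (g x).1, ∀ ζ' ∈ (g y).1, ∀ z ∈ U, (ζ z - ζ' z).im < -radius P :=
      fun x y hxy ζ hζ ζ' hζ' z _ => by
        rw [mem_singleton_iff.mp hζ, mem_singleton_iff.mp hζ']; exact hxy
    rw [List.pairwise_append, List.pairwise_cons, List.pairwise_map, List.pairwise_map]
    refine ⟨hord.1.imp (hgg _ _), ⟨fun y hy => ?_, hord.2.1.imp (hgg _ _)⟩, fun x hx y hy => ?_⟩
    · obtain ⟨y, hy', rfl⟩ := List.mem_map.mp hy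
      intro ζ hζ ζ' hζ' z hz
      rw [mem_singleton_iff.mp hζ']
      exact ((hZ ζ hζ).2 z hz).2 y hy'
    · obtain ⟨x, hx', rfl⟩ := List.mem_map.mp hx
      rcases List.mem_cons.mp hy with rfl | hy
      · intro ζ hζ ζ' hζ' z hz
        rw [mem_singleton_iff.mp hζ]
        exact ((hZ ζ' hζ').2 z hz).1 x hx'
      · obtain ⟨y, hy', rfl⟩ := List.mem_map.mp hy
        exact hgg _ _ (hord.2.2 x hx' y hy')

/-- Two adjacent exponentials in a matrix coefficient merge. -/
theorem coeffOf_vertex_mul {e₁ e₂ : Exponent P} (T : Module.End ℂ (Functional P))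
    (h : PairConverges P (dir P e₁.1) e₂.2)
    (h₁ : PairConverges P p.bra e₁.2) (h₂ : PairConverges P p.bra e₂.2)
    (hl : ∀ x ∈ p.left, ∀ i ∈ labels P x.1, PairConverges P (dir P (texp P x.1 i x.2).1) e₁.2 ∧
      PairConverges P (dir P (texp P x.1 i x.2).1) e₂.2) :
    p.coeffOf (vertex P e₁ * vertex P e₂ * T)
      = exp (contr P e₁ e₂) * p.coeffOf (vertex P (e₁ + e₂) * T) := by
  have := prod_vertex_mul_vertex h (T * (p.right.map fun x => op P (image P x.1 x.2)).prod) p.ket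
    (p.left.map fun x => op P (image P x.1 x.2)) p.bra h₁ h₂ fun A hA => by
      obtain ⟨x, hx, rfl⟩ := List.mem_map.mp hA
      exact ⟨labels P x.1, coef, fun i => texp P x.1 i x.2, op_image P _ _, hl x hx⟩
  simpa only [coeffOf, mul_assoc] using this

theorem pairConverges_bra {J : Current P.N} {i : Label} (hi : i ∈ labels P J) (u : ℂ) :
    PairConverges P p.bra (texp P J i u).2 :=
  YangianBoson.pairConverges_bra p.bra_test hi u

theorem pairConverges_left {J : Current P.N} {i : Label} (hi : i ∈ labels P J) {u : ℂ}
    (hu : u ∈ p.band) : ∀ x ∈ p.left, ∀ j ∈ labels P x.1,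
      PairConverges P (dir P (texp P x.1 j x.2).1) (texp P J i u).2 := fun x hx _ hj =>
  pairConverges_contr hj hi (hu.1 x hx)

/-- Only the contraction depends on the order of the factors; the merged exponential is symmetric in
them. This is the source of all exchange relations between the currents X. -/
theorem eval_cur_mul_cur (J J' : Current P.N) {u v : ℂ} (hu : u ∈ p.band) (hv : v ∈ p.band)
    (h : (u - v).im < -radius P) :
    p.eval (psi P) (cur J u * cur J' v) = ∑ x ∈ labels P J ×ˢ labels P J',
      coef x.1 * coef x.2 * exp (contr P (texp P J x.1 u) (texp P J' x.2 v))
        * p.coeffOf (vertex P (texp P J x.1 u + texp P J' x.2 v)) := by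
  rw [eval_psi, map_mul, psi_cur, psi_cur, op_image, op_image, Finset.sum_mul_sum,
    ← Finset.sum_product']
  simp only [smul_mul_smul_comm]
  rw [coeffOf_sum]
  refine Finset.sum_congr rfl fun x hx => ?_
  obtain ⟨hi, hj⟩ := Finset.mem_product.mp hx
  have := p.coeffOf_vertex_mul (e₁ := texp P J x.1 u) (e₂ := texp P J' x.2 v) 1
    (pairConverges_contr hi hj h) (p.pairConverges_bra hi u) (p.pairConverges_bra hj v)
    fun y hy i' hi' => ⟨p.pairConverges_left hi hu y hy i' hi',
      p.pairConverges_left hj hv y hy i' hi'⟩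
  rw [mul_one, mul_one] at this
  rw [this]
  ring

theorem eval_cur (J : Current P.N) (u : ℂ) :
    p.eval (psi P) (cur J u) = ∑ i ∈ labels P J, coef i * p.coeffOf (vertex P (texp P J i u)) := by
  rw [eval_psi, psi_cur, op_image, coeffOf_sum]

theorem eval_cur_mul_cur_mul_cur (J : Fin 3 → Current P.N) {z : Fin 3 → ℂ}
    (hz : ∀ a, z a ∈ p.band) (a b c : Fin 3) (hab : (z a - z b).im < -radius P)
    (hbc : (z b - z c).im < -radius P) :
    p.eval (psi P) (cur (J a) (z a) * cur (J b) (z b) * cur (J c) (z c))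
      = ∑ i ∈ labels P (J a), ∑ j ∈ labels P (J b), ∑ k ∈ labels P (J c),
        coef i * coef j * coef k * (exp (contr P (texp P (J a) i (z a)) (texp P (J b) j (z b)))
          * exp (contr P (texp P (J a) i (z a)) (texp P (J c) k (z c)))
          * exp (contr P (texp P (J b) j (z b)) (texp P (J c) k (z c))))
        * p.coeffOf (vertex P (texp P (J a) i (z a) + texp P (J b) j (z b)
          + texp P (J c) k (z c))) := by
  -- Separation is transitive because the radius is nonnegative; the outer two factors contract as
  -- well.
  have hac : (z a - z c).im < -radius P := by
    have h0 := radius_nonneg P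
    rw [sub_im] at *
    linarith
  rw [eval_psi, map_mul, map_mul, psi_cur, psi_cur, psi_cur, op_image, op_image, op_image]
  have distrib : ∀ (s t r : Finset Label) (A B C : Label → Module.End ℂ (Functional P)),
      (∑ i ∈ s, A i) * (∑ j ∈ t, B j) * (∑ k ∈ r, C k)
        = ∑ i ∈ s, ∑ j ∈ t, ∑ k ∈ r, A i * B j * C k := by
    intro s t r A B C
    rw [Finset.sum_mul_sum, Finset.sum_mul]
    refine Finset.sum_congr rfl fun i _ => ?_
    rw [Finset.sum_mul]
    exact Finset.sum_congr rfl fun j _ => Finset.mul_sum _ _ _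
  rw [distrib]
  simp only [smul_mul_smul_comm]
  have expand : ∀ (s t r : Finset Label) (c : Label → Label → Label → ℂ)
      (A : Label → Label → Label → Module.End ℂ (Functional P)),
      p.coeffOf (∑ i ∈ s, ∑ j ∈ t, ∑ k ∈ r, c i j k • A i j k)
        = ∑ i ∈ s, ∑ j ∈ t, ∑ k ∈ r, c i j k * p.coeffOf (A i j k) := by
    intro s t r c A
    simp only [coeffOf, Finset.mul_sum, Finset.sum_mul, mul_smul_comm, smul_mul_assoc,
      LinearMap.sum_apply, LinearMap.smul_apply, Finset.sum_apply, Pi.smul_apply, smul_eq_mul]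
  rw [expand]
  refine Finset.sum_congr rfl fun i hi => Finset.sum_congr rfl fun j hj =>
    Finset.sum_congr rfl fun k hk => ?_
  have c1 := pairConverges_contr hi hj hab
  have c2 := pairConverges_contr hi hk hac
  have c3 := pairConverges_contr hj hk hbc
  have l1 := p.pairConverges_left hi (hz a)
  have l2 := p.pairConverges_left hj (hz b)
  have l3 := p.pairConverges_left hk (hz c)
  have b1 := p.pairConverges_bra hi (z a)
  have b2 := p.pairConverges_bra hj (z b)
  have b3 := p.pairConverges_bra hk (z c)
  have c23 : PairConverges P (dir P (texp P (J a) i (z a) + texp P (J b) j (z b)).1)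
      (texp P (J c) k (z c)).2 := by
    rw [Prod.fst_add, map_add]; exact c2.add_left c3
  rw [p.coeffOf_vertex_mul _ c1 b1 b2 fun x hx i' hi' => ⟨l1 x hx i' hi', l2 x hx i' hi'⟩]
  have := p.coeffOf_vertex_mul 1 c23 (by rw [Prod.snd_add]; exact b1.add_right b2) b3
    fun x hx i' hi' => ⟨by
      rw [Prod.snd_add]; exact (l1 x hx i' hi').add_right (l2 x hx i' hi'), l3 x hx i' hi'⟩
  rw [mul_one, mul_one] at this
  have e : contr P (texp P (J a) i (z a) + texp P (J b) j (z b)) (texp P (J c) k (z c))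
      = contr P (texp P (J a) i (z a)) (texp P (J c) k (z c))
        + contr P (texp P (J b) j (z b)) (texp P (J c) k (z c)) := by
    rw [contr, Prod.fst_add, map_add, pair_add_left c2 c3]; rfl
  rw [this, e, exp_add]
  ring

end Probe

end

/-! ### Rational contractions -/

section
variable {P : Params}

/-- The product of the factors `(w + b iħ) / (w + a iħ)` over the pairs `(a, b)` in a list. -/
def ratio (P : Params) (L : List (ℂ × ℂ)) (w : ℂ) : ℂ :=
  (L.map fun x => (w + x.2 * (I * P.hbar)) / (w + x.1 * (I * P.hbar))).prod

/-- All zeros and poles of contractions lie within `poleBound P` · ‖ħ‖ of the origin, well inside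
the strip |Im w| ≤ `radius P`. -/
theorem shift_ne_zero {a w : ℂ} (ha : ‖a‖ ≤ poleBound P) (hw : radius P < |w.im|) :
    w + a * (I * P.hbar) ≠ 0 := by
  intro h
  have h1 : w = -(a * (I * P.hbar)) := eq_neg_of_add_eq_zero_left h
  have h2 : ‖w‖ ≤ poleBound P * ‖P.hbar‖ := by
    rw [h1, norm_neg, norm_mul, norm_mul, norm_I, one_mul]
    gcongr
  have h3 := abs_im_le_norm w
  have h4 : 0 ≤ poleBound P * ‖P.hbar‖ := (norm_nonneg w).trans h2
  rw [radius] at hw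
  linarith

theorem exp_laplace_list (L : List (ℂ × ℂ)) {w : ℂ} (hw : w.im < -radius P)
    (hL : ∀ x ∈ L, ‖x.1‖ ≤ poleBound P ∧ ‖x.2‖ ≤ poleBound P) :
    IntegrableOn (fun t : ℝ => expo w t * (L.map fun x => chi P t x.1 - chi P t x.2).sum) (Ioi 0) ∧
    exp (∫ t in Ioi (0 : ℝ), expo w t * (L.map fun x => chi P t x.1 - chi P t x.2).sum)
      = ratio P L w := by
  induction L with
  | nil => simp [ratio]
  | cons x L ih =>
    obtain ⟨hx1, hx2⟩ := hL x List.mem_cons_self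
    obtain ⟨h1, h2⟩ := ih fun y hy => hL y (List.mem_cons_of_mem _ hy)
    have e : ∀ t : ℝ, expo w t * (chi P t x.1 - chi P t x.2)
        = exp (-(I * w * t)) * frullaniKernel (x.1 * P.hbar) (x.2 * P.hbar) t := fun t => by
      rw [frullaniKernel_eq_chi, expo]; ring
    obtain ⟨hc, C, hC⟩ := isMild_frullani (P := P) hx1 hx2
    have h3 : IntegrableOn (fun t : ℝ => expo w t * (chi P t x.1 - chi P t x.2)) (Ioi 0) := by
      simp only [e]
      exact laplace_integrableOn hc hC hw
    have hb : 2 * ‖x.2 * P.hbar‖ + ‖x.1 * P.hbar‖ ≤ radius P := by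
      rw [norm_mul, norm_mul, radius]
      have := mul_le_mul_of_nonneg_right hx1 (norm_nonneg P.hbar)
      have := mul_le_mul_of_nonneg_right hx2 (norm_nonneg P.hbar)
      linarith
    have h4 : exp (∫ t in Ioi (0 : ℝ), expo w t * (chi P t x.1 - chi P t x.2))
        = (w + x.2 * (I * P.hbar)) / (w + x.1 * (I * P.hbar)) := by
      simp only [e]
      rw [exp_laplace_frullani (by linarith)]
      have hh : ∀ a : ℂ, I * w - a * P.hbar = I * (w + a * (I * P.hbar)) := fun a => by
        linear_combination (-(a * P.hbar)) * I_mul_I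
      rw [hh, hh, mul_div_mul_left _ _ I_ne_zero]
    simp only [List.map_cons, List.sum_cons, mul_add]
    refine ⟨h3.add h1, ?_⟩
    rw [integral_add h3 h1, exp_add, h2, h4, ratio, ratio, List.map_cons, List.prod_cons]

/-- The bridge from integrands to rational functions: once the kernel is a sum of differences of
characters, the exponentiated contraction can be read off from the shifts, and no further integral
has to be evaluated. -/
theorem exp_contr_eq_ratio {e e' : Exponent P} (L : List (ℂ × ℂ)) {w : ℂ} (hw : w.im < -radius P)
    (hL : ∀ x ∈ L, ‖x.1‖ ≤ poleBound P ∧ ‖x.2‖ ≤ poleBound P)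
    (h : ∀ t : ℝ, 0 < t →
      kernel P t e e' = expo w t * (L.map fun x => chi P t x.1 - chi P t x.2).sum) :
    exp (contr P e e') = ratio P L w := by
  rw [← (exp_laplace_list L hw hL).2, contr_eq]
  congr 1
  exact setIntegral_congr_fun measurableSet_Ioi fun t ht => h t ht

/-! ### Products of exponentials without contraction -/

/-- A right factor without creation part has nothing to contract with. As k⁺ has no creation part
and k⁻ no annihilation part, the inverses and the commutativity within each family hold as
identities of operators, not only of matrix coefficients. -/
theorem vertex_mul_of_snd {e e' : Exponent P} (h : e'.2 = 0) :
    vertex P e * vertex P e' = vertex P (e + e') := by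
  ext Ψ η
  simp only [Module.End.mul_apply, vertex_apply, Prod.fst_add, Prod.snd_add, h, pair_zero_right,
    exp_zero, one_mul, add_zero, map_add, add_assoc]

theorem vertex_zero : vertex P 0 = 1 := by
  ext Ψ η
  simp [vertex_apply, pair_zero_right]

theorem vertex_mul_neg_of_fst {e : Exponent P} (h : e.1 = 0) :
    vertex P e * vertex P (-e) = 1 := by
  ext Ψ η
  simp only [Module.End.mul_apply, vertex_apply, Prod.fst_neg, Prod.snd_neg, h, neg_zero, map_zero,
    add_zero, pair_neg_right, Module.End.one_apply]
  rw [← mul_assoc, ← exp_add, add_neg_cancel, exp_zero, one_mul]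

theorem vertex_comm_of_fst {e e' : Exponent P} (h : e.1 = 0) (h' : e'.1 = 0) :
    vertex P e * vertex P e' = vertex P e' * vertex P e := by
  ext Ψ η
  simp only [Module.End.mul_apply, vertex_apply, h, h', map_zero, add_zero]
  ring

theorem kPlusExp_snd (P : Params) (μ : ℕ) (u : ℂ) : (kPlusExp P μ u).2 = 0 := by
  simp [kPlusExp, lamPlus, bPlus, fieldPlus, Prod.snd_sum]

theorem kMinusExp_fst (P : Params) (μ : ℕ) (u : ℂ) : (kMinusExp P μ u).1 = 0 := by
  simp [kMinusExp, lamMinus, bMinus, fieldMinus, Prod.fst_sum]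

theorem psi_kPlus (μ : Idx P.N) (u : ℂ) : psi P (cur (.kPlus μ) u) = vertex P (kPlusExp P μ u) := by
  rw [psi_cur, image, op_nexp]

theorem psi_kPlusInv (μ : Idx P.N) (u : ℂ) :
    psi P (cur (.kPlusInv μ) u) = vertex P (-kPlusExp P μ u) := by
  rw [psi_cur, image, op_nexp]

theorem psi_kMinus (μ : Idx P.N) (u : ℂ) :
    psi P (cur (.kMinus μ) u) = vertex P (kMinusExp P μ u) := by
  rw [psi_cur, image, op_nexp]

theorem psi_kMinusInv (μ : Idx P.N) (u : ℂ) :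
    psi P (cur (.kMinusInv μ) u) = vertex P (-kMinusExp P μ u) := by
  rw [psi_cur, image, op_nexp]

theorem mem_labels_kPlus (μ : Idx P.N) : (true, 0, true) ∈ labels P (.kPlus μ) :=
  Finset.mem_singleton_self _

theorem mem_labels_kMinus (μ : Idx P.N) : (true, 0, true) ∈ labels P (.kMinus μ) :=
  Finset.mem_singleton_self _

end

/-! ### Regular terms -/

namespace Probe

section
variable {P : Params} (p : Probe P (radius P))

/-- In the order k⁻k⁺ nothing contracts, so the exchange costs exactly the contraction of k⁺ with
k⁻. -/
theorem eval_kPlus_mul_kMinus (μ ν : Idx P.N) {u v : ℂ} (hu : u ∈ p.band) (hv : v ∈ p.band)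
    (h : (u - v).im < -radius P) :
    p.eval (psi P) (cur (.kPlus μ) u * cur (.kMinus ν) v)
      = exp (contr P (kPlusExp P μ u) (kMinusExp P ν v))
        * p.eval (psi P) (cur (.kMinus ν) v * cur (.kPlus μ) u) := by
  rw [eval_cur_mul_cur p _ _ hu hv h, eval_psi, map_mul, psi_kPlus, psi_kMinus,
    vertex_mul_of_snd (kPlusExp_snd P μ u), add_comm (kMinusExp P ν v)]
  simp [labels, coef, texp]

/-- Only the left factor k⁺ contracts with the current; the inverse on the right has no creation
part. The conjugation is therefore a scalar as soon as all terms of the current have the same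
contraction. -/
theorem eval_kPlus_conj (μ : Idx P.N) (J : Current P.N) {u v q : ℂ} (hu : u ∈ p.band)
    (hv : v ∈ p.band) (h : (u - v).im < -radius P)
    (hq : ∀ i ∈ labels P J, exp (contr P (kPlusExp P μ u) (texp P J i v)) = q) :
    p.eval (psi P) (cur (.kPlus μ) u * cur J v * cur (.kPlusInv μ) u)
      = q * p.eval (psi P) (cur J v) := by
  rw [eval_cur, eval_psi, map_mul, map_mul, psi_kPlus, psi_kPlusInv, psi_cur, op_image,
    Finset.mul_sum, Finset.sum_mul, Finset.mul_sum]
  simp only [mul_smul_comm, smul_mul_assoc]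
  rw [coeffOf_sum]
  refine Finset.sum_congr rfl fun i hi => ?_
  rw [p.coeffOf_vertex_mul (e₁ := kPlusExp P μ u) _
    (pairConverges_contr (mem_labels_kPlus μ) hi h) (p.pairConverges_bra (mem_labels_kPlus μ) u)
    (p.pairConverges_bra hi v) fun x hx j hj =>
      ⟨p.pairConverges_left (mem_labels_kPlus μ) hu x hx j hj,
        p.pairConverges_left hi hv x hx j hj⟩, hq i hi, vertex_mul_of_snd
    (by rw [Prod.snd_neg, kPlusExp_snd, neg_zero]), add_neg_cancel_comm]
  ring

/-- Mirror image of the conjugation by k⁺: the left factor k⁻ has no annihilation part, and the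
current contracts with the inverse on its right. This accounts for the sign in the exponent and for
the opposite half plane. -/
theorem eval_kMinus_conj (μ : Idx P.N) (J : Current P.N) {u v q : ℂ} (hu : u ∈ p.band)
    (hv : v ∈ p.band) (h : radius P < (u - v).im)
    (hq : ∀ i ∈ labels P J, exp (-contr P (texp P J i v) (kMinusExp P μ u)) = q) :
    p.eval (psi P) (cur (.kMinus μ) u * cur J v * cur (.kMinusInv μ) u)
      = q * p.eval (psi P) (cur J v) := by
  have h' : (v - u).im < -radius P := by rw [← neg_sub, neg_im]; linarith
  rw [eval_cur, eval_psi, map_mul, map_mul, psi_kMinus, psi_kMinusInv, psi_cur, op_image,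
    Finset.mul_sum, Finset.sum_mul, Finset.mul_sum]
  simp only [mul_smul_comm, smul_mul_assoc]
  rw [coeffOf_sum]
  refine Finset.sum_congr rfl fun i hi => ?_
  have b1 := p.pairConverges_bra (mem_labels_kMinus μ) u
  have b2 := p.pairConverges_bra hi v
  have l1 := p.pairConverges_left (mem_labels_kMinus μ) hu
  have l2 := p.pairConverges_left hi hv
  have c := pairConverges_contr hi (mem_labels_kMinus μ) h'
  have e0 : dir P (kMinusExp P μ u).1 = 0 := by rw [kMinusExp_fst, map_zero]
  have c0 : ∀ f, PairConverges P (dir P (kMinusExp P μ u).1) f := fun f => by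
    rw [e0]; simp [PairConverges]
  have e1 : dir P (kMinusExp P μ u + texp P J i v).1 = dir P (texp P J i v).1 := by
    rw [Prod.fst_add, map_add, e0, zero_add]
  rw [p.coeffOf_vertex_mul (e₁ := kMinusExp P μ u) _ (c0 _) b1 b2
    fun x hx j hj => ⟨l1 x hx j hj, l2 x hx j hj⟩]
  have := p.coeffOf_vertex_mul (e₁ := kMinusExp P μ u + texp P J i v) (e₂ := -kMinusExp P μ u) 1
    (by rw [e1]; exact c.neg_right) (b1.add_right b2) b1.neg_right
    fun x hx j hj => ⟨(l1 x hx j hj).add_right (l2 x hx j hj), (l1 x hx j hj).neg_right⟩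
  rw [mul_one, mul_one, add_neg_cancel_comm] at this
  rw [this, contr, contr, e0, e1, pair_zero_left, exp_zero, Prod.snd_neg, pair_neg_right, ← hq i hi]
  simp only [contr]
  ring

theorem eval_kPlus_mul_kPlusInv (μ ν : Idx P.N) (u : ℂ) :
    p.eval (psi P) (cur (.kPlus μ) u * cur (.kPlusInv ν) u)
      = p.coeffOf (vertex P (kPlusExp P μ u - kPlusExp P ν u)) := by
  rw [eval_psi, map_mul, psi_kPlus, psi_kPlusInv, vertex_mul_of_snd
    (by rw [Prod.snd_neg, kPlusExp_snd, neg_zero]), sub_eq_add_neg]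

/-- The contraction vanishes, but merging the creation parts still requires that both pair
convergently with the insertions on the left; hence v has to lie in the band, which the analogue for
k⁺ does not need. -/
theorem eval_kMinus_mul_kMinusInv (μ ν : Idx P.N) {v : ℂ} (hv : v ∈ p.band) :
    p.eval (psi P) (cur (.kMinus μ) v * cur (.kMinusInv ν) v)
      = p.coeffOf (vertex P (kMinusExp P μ v - kMinusExp P ν v)) := by
  have b1 := p.pairConverges_bra (mem_labels_kMinus μ) v
  have b2 := p.pairConverges_bra (mem_labels_kMinus ν) v
  have l1 := p.pairConverges_left (mem_labels_kMinus μ) hv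
  have l2 := p.pairConverges_left (mem_labels_kMinus ν) hv
  have e0 : dir P (kMinusExp P μ v).1 = 0 := by rw [kMinusExp_fst, map_zero]
  rw [eval_psi, map_mul, psi_kMinus, psi_kMinusInv]
  have := p.coeffOf_vertex_mul (e₁ := kMinusExp P μ v) (e₂ := -kMinusExp P ν v) 1
    (by rw [e0]; simp [PairConverges]) b1 b2.neg_right
    fun x hx j hj => ⟨l1 x hx j hj, (l2 x hx j hj).neg_right⟩
  rw [mul_one, mul_one] at this
  rw [this, contr, e0, pair_zero_left, exp_zero, one_mul, sub_eq_add_neg]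

/-- Functions of two arguments that are, for well separated arguments, the restriction of a
holomorphic function. -/
def Reg (F : ℂ × ℂ → ℂ) : Prop :=
  ∃ M : ℂ × ℂ → ℂ, DifferentiableOn ℂ M (p.band ×ˢ p.band) ∧
    ∀ x ∈ p.band ×ˢ p.band, radius P < |(x.1 - x.2).im| → F x = M x

variable {p}

theorem Reg.of_differentiableOn {F : ℂ × ℂ → ℂ} (h : DifferentiableOn ℂ F (p.band ×ˢ p.band)) :
    p.Reg F := ⟨F, h, fun _ _ _ => rfl⟩

theorem Reg.congr {F G : ℂ × ℂ → ℂ} (hF : p.Reg F)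
    (h : ∀ x ∈ p.band ×ˢ p.band, radius P < |(x.1 - x.2).im| → G x = F x) : p.Reg G := by
  obtain ⟨M, hM, e⟩ := hF
  exact ⟨M, hM, fun x hx hR => (h x hx hR).trans (e x hx hR)⟩

theorem Reg.add {F G : ℂ × ℂ → ℂ} (hF : p.Reg F) (hG : p.Reg G) : p.Reg fun x => F x + G x := by
  obtain ⟨M, hM, e⟩ := hF
  obtain ⟨M', hM', e'⟩ := hG
  exact ⟨fun x => M x + M' x, hM.add hM', fun x hx hR => by
    beta_reduce; rw [e x hx hR, e' x hx hR]⟩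

theorem Reg.mul {F G : ℂ × ℂ → ℂ} (hF : p.Reg F) (hG : p.Reg G) : p.Reg fun x => F x * G x := by
  obtain ⟨M, hM, e⟩ := hF
  obtain ⟨M', hM', e'⟩ := hG
  exact ⟨fun x => M x * M' x, hM.mul hM', fun x hx hR => by
    beta_reduce; rw [e x hx hR, e' x hx hR]⟩

theorem Reg.sum {ι : Type*} (s : Finset ι) {F : ι → ℂ × ℂ → ℂ} (h : ∀ i ∈ s, p.Reg (F i)) :
    p.Reg fun x => ∑ i ∈ s, F i x := by
  classical
  induction s using Finset.induction_on with
  | empty => simpa using Reg.of_differentiableOn (p := p) (differentiableOn_const (0 : ℂ))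
  | insert i s hi ih =>
    simp only [Finset.sum_insert hi]
    exact (h i (Finset.mem_insert_self _ _)).add
      (ih fun j hj => h j (Finset.mem_insert_of_mem hj))

/-- A sum is regular if its terms can be matched so that the sums of matching terms are
regular. -/
theorem Reg.sum_of_involution {ι : Type*} (s : Finset ι) {F : ι → ℂ × ℂ → ℂ} (g : ι → ι)
    (hg : ∀ i ∈ s, g i ∈ s) (hgg : ∀ i ∈ s, g (g i) = i)
    (h : ∀ i ∈ s, p.Reg fun x => F i x + F (g i) x) : p.Reg fun x => ∑ i ∈ s, F i x := by
  -- Summing F i + F (g i) over all i counts every term twice, hence the factor 1/2; fixed points of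
  -- g do no harm.
  refine ((Reg.of_differentiableOn (differentiableOn_const (1 / 2 : ℂ))).mul
    (Reg.sum s h)).congr fun x _ _ => ?_
  rw [Finset.sum_add_distrib]
  have : ∑ i ∈ s, F (g i) x = ∑ i ∈ s, F i x :=
    Finset.sum_bij (fun i _ => g i) (fun i hi => hg i hi)
      (fun i hi j hj e => by rw [← hgg i hi, ← hgg j hj, e])
      (fun i hi => ⟨g i, hg i hi, hgg i hi⟩) fun _ _ => rfl
  rw [this]
  ring

/-- A pole is cancelled by the coincidence of the exponents at the pole. -/
theorem Reg.pole {e e' : ℂ × ℂ → Exponent P}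
    (he : e ∈ fieldsAt P {Prod.fst, Prod.snd}) (he' : e' ∈ fieldsAt P {Prod.fst, Prod.snd}) {a : ℂ}
    (ha : ‖a‖ ≤ poleBound P)
    (h : ∀ u v : ℂ, u - v + a * (I * P.hbar) = 0 → e (u, v) = e' (u, v)) :
    p.Reg fun x => 1 / (x.1 - x.2 + a * (I * P.hbar))
      * (p.coeffOf (vertex P (e x)) - p.coeffOf (vertex P (e' x))) := by
  have hZ : ∀ ζ ∈ ({Prod.fst, Prod.snd} : Set (ℂ × ℂ → ℂ)),
      DifferentiableOn ℂ ζ (p.band ×ˢ p.band) ∧ ∀ z ∈ p.band ×ˢ p.band, ζ z ∈ p.band := by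
    rintro ζ (rfl | rfl)
    · exact ⟨differentiableOn_fst, fun z hz => hz.1⟩
    · exact ⟨differentiableOn_snd, fun z hz => hz.2⟩
  obtain ⟨M, hM, hG⟩ := exists_differentiableOn_eq_mul p.isOpen_band (-(a * (I * P.hbar)))
    (G := fun x => p.coeffOf (vertex P (e x)) - p.coeffOf (vertex P (e' x)))
    ((p.coeffOf_vertex_differentiableOn hZ he).sub (p.coeffOf_vertex_differentiableOn hZ he'))
    fun u hu v hv huv => by
      rw [h u v (by rw [huv]; ring), sub_self]
  refine ⟨M, hM, fun x hx hR => ?_⟩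
  have h0 := shift_ne_zero ha hR
  have := hG x.1 hx.1 x.2 hx.2
  rw [show (x.1, x.2) = x from rfl] at this
  beta_reduce
  rw [this, sub_neg_eq_add, one_div, inv_mul_cancel_left₀ h0]

theorem coeffOf_add_reg {e : ℂ × ℂ → Exponent P} (he : e ∈ fieldsAt P {Prod.fst, Prod.snd}) :
    p.Reg fun x => p.coeffOf (vertex P (e x)) := by
  refine Reg.of_differentiableOn (p.coeffOf_vertex_differentiableOn (Z := {Prod.fst, Prod.snd})
    ?_ he)
  rintro ζ (rfl | rfl)
  · exact ⟨differentiableOn_fst, fun z hz => hz.1⟩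
  · exact ⟨differentiableOn_snd, fun z hz => hz.2⟩

theorem Reg.of_differentiable {f : ℂ → ℂ} (hf : Differentiable ℂ f) :
    p.Reg fun x => f (x.1 - x.2) :=
  Reg.of_differentiableOn (hf.comp (differentiable_fst.sub differentiable_snd)).differentiableOn

end

end Probe

/-! ### Exchange relations -/

section
variable {P : Params}

theorem texp_add_mem {J J' : Current P.N} {i j : Label} (hi : i ∈ labels P J)
    (hj : j ∈ labels P J') :
    (fun x : ℂ × ℂ => texp P J i x.1 + texp P J' j x.2) ∈ fieldsAt P {Prod.fst, Prod.snd} :=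
  add_mem (texp_comp_mem (mem_insert _ _) hi)
    (texp_comp_mem (mem_insert_of_mem _ (mem_singleton _)) hj)

/-- The contractions of the terms of two currents in the two orders agree up to the factors `α` and
`β` and analytic continuation. -/
structure Exchange (P : Params) (J J' : Current P.N) (α β : ℂ → ℂ) (H : Label → Label → ℂ → ℂ) :
    Prop where
  lower : ∀ i ∈ labels P J, ∀ j ∈ labels P J', ∀ u v : ℂ, (u - v).im < -radius P →
    α (u - v) * exp (contr P (texp P J i u) (texp P J' j v)) = H i j (u - v)
  upper : ∀ i ∈ labels P J, ∀ j ∈ labels P J', ∀ u v : ℂ, radius P < (u - v).im →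
    β (u - v) * exp (contr P (texp P J' j v) (texp P J i u)) = H i j (u - v)

/-- After expansion into terms, both products have the same coefficient H in front of the same
merged exponentials. One regular function, obtained from the sum with the coefficients H, therefore
serves both domains of convergence. -/
theorem Exchange.eqUpToReg {J J' : Current P.N} {α β : ℂ → ℂ} {H : Label → Label → ℂ → ℂ}
    (h : Exchange P J J' α β H) {p : Probe P (radius P)} {A B C : ℂ → ℂ → FreeCurrents P}
    (hA : ∀ u v, A u v = α (u - v) • (cur J u * cur J' v))
    (hB : ∀ u v, B u v = β (u - v) • (cur J' v * cur J u))
    (hr : p.Reg fun x => (∑ y ∈ labels P J ×ˢ labels P J', coef y.1 * coef y.2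
      * H y.1 y.2 (x.1 - x.2) * p.coeffOf (vertex P (texp P J y.1 x.1 + texp P J' y.2 x.2)))
      - p.eval (psi P) (C x.1 x.2)) :
    p.EqUpToReg (psi P) A B C := by
  obtain ⟨M, hM, e⟩ := hr
  refine ⟨M, hM, fun u hu v hv => ⟨fun huv => ?_, fun huv => ?_⟩⟩
  · rw [← e (u, v) ⟨hu, hv⟩ (lt_abs.mpr (.inr (by linarith))), sub_add_cancel, hA, p.eval_smul,
      p.eval_cur_mul_cur _ _ hu hv huv, Finset.mul_sum]
    refine Finset.sum_congr rfl fun y hy => ?_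
    obtain ⟨hi, hj⟩ := Finset.mem_product.mp hy
    rw [← h.lower _ hi _ hj u v huv]
    ring
  · have huv' : (v - u).im < -radius P := by rw [← neg_sub, neg_im]; linarith
    rw [← e (u, v) ⟨hu, hv⟩ (lt_abs.mpr (.inl huv)), sub_add_cancel, hB, p.eval_smul,
      p.eval_cur_mul_cur _ _ hv hu huv', Finset.mul_sum, Finset.sum_product, Finset.sum_product_right]
    refine Finset.sum_congr rfl fun j hj => Finset.sum_congr rfl fun i hi => ?_
    rw [← h.upper i hi j hj u v huv, add_comm (texp P J' j v)]
    ring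

theorem Exchange.eqUpToReg_zero {J J' : Current P.N} {α β : ℂ → ℂ} {H : Label → Label → ℂ → ℂ}
    (h : Exchange P J J' α β H) {p : Probe P (radius P)} {A B : ℂ → ℂ → FreeCurrents P}
    (hA : ∀ u v, A u v = α (u - v) • (cur J u * cur J' v))
    (hB : ∀ u v, B u v = β (u - v) • (cur J' v * cur J u))
    (hr : p.Reg fun x => ∑ y ∈ labels P J ×ˢ labels P J', coef y.1 * coef y.2
      * H y.1 y.2 (x.1 - x.2) * p.coeffOf (vertex P (texp P J y.1 x.1 + texp P J' y.2 x.2))) :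
    p.EqUpToReg (psi P) A B 0 :=
  h.eqUpToReg hA hB (hr.congr fun x _ _ => by
    rw [Pi.zero_apply, Pi.zero_apply, p.eval_zero, sub_zero])

theorem Probe.Reg.exchange_term {p : Probe P (radius P)} {J J' : Current P.N}
    {H : Label → Label → ℂ → ℂ} {y : Label × Label} (hy : y ∈ labels P J ×ˢ labels P J')
    (hH : Differentiable ℂ (H y.1 y.2)) :
    p.Reg fun x => coef y.1 * coef y.2 * H y.1 y.2 (x.1 - x.2)
      * p.coeffOf (vertex P (texp P J y.1 x.1 + texp P J' y.2 x.2)) := by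
  obtain ⟨hi, hj⟩ := Finset.mem_product.mp hy
  exact (((Reg.of_differentiableOn (differentiableOn_const _)).mul (Reg.of_differentiable hH))).mul
    (Probe.coeffOf_add_reg (texp_add_mem hi hj))

end

/-! ### The Serre relations follow from the exchange relations -/

theorem mvPolynomial_sub_ne_zero {p : Polynomial ℂ} (hp : p ≠ 0) {i j : Fin 3} (hij : i ≠ j) :
    Polynomial.aeval (MvPolynomial.X i - MvPolynomial.X j : MvPolynomial (Fin 3) ℂ) p ≠ 0 := by
  intro h
  -- Setting X_i to the variable X and the other variables to 0 recovers p.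
  have h1 := congrArg (MvPolynomial.aeval fun k : Fin 3 =>
    if k = i then (Polynomial.X : Polynomial ℂ) else 0) h
  rw [← Polynomial.aeval_algHom_apply, map_sub, MvPolynomial.aeval_X, MvPolynomial.aeval_X,
    if_pos rfl, if_neg hij.symm, sub_zero, Polynomial.aeval_X_left_apply, map_zero] at h1
  exact hp h1

theorem mvPolynomial_eval_sub (p : Polynomial ℂ) (i j : Fin 3) (z : Fin 3 → ℂ) :
    MvPolynomial.eval z
        (Polynomial.aeval (MvPolynomial.X i - MvPolynomial.X j : MvPolynomial (Fin 3) ℂ) p)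
      = p.eval (z i - z j) := by
  have := Polynomial.aeval_algHom_apply (MvPolynomial.aeval z : MvPolynomial (Fin 3) ℂ →ₐ[ℂ] ℂ)
    (MvPolynomial.X i - MvPolynomial.X j) p
  rw [map_sub, MvPolynomial.aeval_X, MvPolynomial.aeval_X] at this
  rw [← MvPolynomial.coe_aeval_eq_eval, RingHom.coe_coe, ← this, Polynomial.coe_aeval_eq_eval]

theorem perm_fin_three_cases (σ : Equiv.Perm (Fin 3)) :
    (σ 0 = 0 ∧ σ 1 = 1 ∧ σ 2 = 2) ∨ (σ 0 = 1 ∧ σ 1 = 0 ∧ σ 2 = 2) ∨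
    (σ 0 = 0 ∧ σ 1 = 2 ∧ σ 2 = 1) ∨ (σ 0 = 1 ∧ σ 1 = 2 ∧ σ 2 = 0) ∨
    (σ 0 = 2 ∧ σ 1 = 0 ∧ σ 2 = 1) ∨ (σ 0 = 2 ∧ σ 1 = 1 ∧ σ 2 = 0) := by
  revert σ
  decide

/-- The factor by which the product in the order `σ` has to be multiplied in order to complete the
common denominator. -/
def serreFactor (α₀ β₀ α β : Polynomial ℂ) (σ : Equiv.Perm (Fin 3)) (z : Fin 3 → ℂ) : ℂ :=
  (if σ.symm 0 < σ.symm 1 then β₀ else α₀).eval (z 0 - z 1)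
    * (if σ.symm 0 < σ.symm 2 then β else α).eval (z 0 - z 2)
    * (if σ.symm 1 < σ.symm 2 then β else α).eval (z 1 - z 2)

theorem sum_perm_fin_three (f : Equiv.Perm (Fin 3) → ℂ) (F : Fin 3 → Fin 3 → Fin 3 → ℂ)
    (h : ∀ σ : Equiv.Perm (Fin 3), f σ = F (σ.symm 0) (σ.symm 1) (σ.symm 2)) :
    ∑ σ, f σ = F 0 1 2 + F 1 0 2 + F 0 2 1 + F 1 2 0 + F 2 0 1 + F 2 1 0 := by
  have e : ∑ σ, f σ = ∑ σ : Equiv.Perm (Fin 3), F (σ 0) (σ 1) (σ 2) := by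
    rw [← Equiv.sum_comp (Equiv.inv (Equiv.Perm (Fin 3)))]
    exact Finset.sum_congr rfl fun σ _ => h _
  have u : (Finset.univ : Finset (Equiv.Perm (Fin 3))) = {1, Equiv.swap 0 1, Equiv.swap 1 2,
      finRotate 3, (finRotate 3).symm, Equiv.swap 0 2} := by decide
  rw [e, u]
  repeat rw [Finset.sum_insert (by decide)]
  rw [Finset.sum_singleton]
  have v : ∀ (σ : Equiv.Perm (Fin 3)) (a b c : Fin 3), σ 0 = a → σ 1 = b → σ 2 = c →
      F (σ 0) (σ 1) (σ 2) = F a b c := by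
    rintro σ a b c rfl rfl rfl; rfl
  rw [v 1 0 1 2 (by decide) (by decide) (by decide),
    v (Equiv.swap 0 1) 1 0 2 (by decide) (by decide) (by decide),
    v (Equiv.swap 1 2) 0 2 1 (by decide) (by decide) (by decide),
    v (finRotate 3) 1 2 0 (by decide) (by decide) (by decide),
    v (finRotate 3).symm 2 0 1 (by decide) (by decide) (by decide),
    v (Equiv.swap 0 2) 2 1 0 (by decide) (by decide) (by decide)]
  ring

theorem serreCoeff_eq (σ : Equiv.Perm (Fin 3)) : serreCoeff σ = if σ.symm 2 = 1 then -2 else 1 := by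
  rw [serreCoeff]
  congr 1
  rw [eq_iff_iff]
  exact ⟨fun h => by rw [← h, Equiv.symm_apply_apply], fun h => by rw [← h, Equiv.apply_symm_apply]⟩

section
variable {P : Params}

/-- In every order a pair of factors contributes H/α or H/β, according to which of the two comes
first. Multiplied by the product of all α and β, the six words become `serreFactor` times one common
sum S. The Serre combination is thus S times a polynomial in the differences of the arguments, and
`hid` says that this polynomial is zero. -/
theorem serreRelation_of_exchange {J J' : Current P.N} {α₀ β₀ α β : Polynomial ℂ}
    {H₀ H : Label → Label → ℂ → ℂ} (h₀ : Exchange P J J α₀.eval β₀.eval H₀)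
    (h : Exchange P J J' α.eval β.eval H)
    (hH₀ : ∀ i ∈ labels P J, ∀ j ∈ labels P J, Differentiable ℂ (H₀ i j))
    (hH : ∀ i ∈ labels P J, ∀ j ∈ labels P J', Differentiable ℂ (H i j))
    (n1 : α₀ ≠ 0) (n2 : β₀ ≠ 0) (n3 : α ≠ 0) (n4 : β ≠ 0)
    (hid : ∀ x y : ℂ,
      β₀.eval (x - y) * (β.eval x * β.eval y - 2 * (β.eval x * α.eval y) + α.eval x * α.eval y)
      + α₀.eval (x - y) * (β.eval x * β.eval y - 2 * (α.eval x * β.eval y) + α.eval x * α.eval y)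
        = 0) :
    SerreRelation (radius P) (psi P) J J' := by
  let π : Polynomial ℂ → Fin 3 → Fin 3 → MvPolynomial (Fin 3) ℂ := fun p i j =>
    Polynomial.aeval (MvPolynomial.X i - MvPolynomial.X j : MvPolynomial (Fin 3) ℂ) p
  refine ⟨π α₀ 0 1 * π β₀ 0 1 * (π α 0 2 * π β 0 2) * (π α 1 2 * π β 1 2), ?_, fun p => ?_⟩
  · have ne : ∀ q : Polynomial ℂ, q ≠ 0 → ∀ i j, i ≠ j → π q i j ≠ 0 := fun q hq i j hij =>
      mvPolynomial_sub_ne_zero hq hij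
    exact mul_ne_zero (mul_ne_zero (mul_ne_zero (ne _ n1 _ _ (by decide)) (ne _ n2 _ _ (by decide)))
      (mul_ne_zero (ne _ n3 _ _ (by decide)) (ne _ n4 _ _ (by decide))))
      (mul_ne_zero (ne _ n3 _ _ (by decide)) (ne _ n4 _ _ (by decide)))
  set K : Fin 3 → Current P.N := ![J, J, J'] with hK
  let Φ : Label → Label → Label → (Fin 3 → ℂ) → ℂ := fun i j k z =>
    p.coeffOf (vertex P (texp P J i (z 0) + texp P J j (z 1) + texp P J' k (z 2)))
  -- The sum common to all six orders: the product of the numerators H of the three pairs times the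
  -- coefficient of the fully merged exponential.
  let S : (Fin 3 → ℂ) → ℂ := fun z => ∑ i ∈ labels P J, ∑ j ∈ labels P J, ∑ k ∈ labels P J',
    coef i * coef j * coef k * (H₀ i j (z 0 - z 1) * H i k (z 0 - z 2) * H j k (z 1 - z 2))
      * Φ i j k z
  have hSd : DifferentiableOn ℂ S {z | ∀ i, z i ∈ p.band} := by
    refine DifferentiableOn.fun_sum fun i hi => DifferentiableOn.fun_sum fun j hj =>
      DifferentiableOn.fun_sum fun k hk => ?_
    have d : ∀ (f : ℂ → ℂ) (a b : Fin 3), Differentiable ℂ f →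
        Differentiable ℂ fun z : Fin 3 → ℂ => f (z a - z b) := fun f a b hf =>
      hf.comp (by fun_prop)
    refine DifferentiableOn.mul (Differentiable.differentiableOn ?_) ?_
    · exact (((d _ 0 1 (hH₀ i hi j hj)).mul (d _ 0 2 (hH i hi k hk))).mul
        (d _ 1 2 (hH j hj k hk))).const_mul _
    · have hm : ∀ a : Fin 3, (fun z : Fin 3 → ℂ => z a) ∈ range fun (a : Fin 3) (z : Fin 3 → ℂ) =>
          z a := fun a => mem_range_self a
      refine p.coeffOf_vertex_differentiableOn ?_
        (add_mem (add_mem (texp_comp_mem (hm 0) hi) (texp_comp_mem (hm 1) hj))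
          (texp_comp_mem (hm 2) hk))
      rintro ζ ⟨a, rfl⟩
      exact ⟨by fun_prop, fun z hz => hz a⟩
  refine ⟨fun σ z => serreFactor α₀ β₀ α β σ z * S z, fun σ => ?_, fun σ z hz h1 h2 => ?_,
    fun z hz => ?_⟩
  · refine DifferentiableOn.mul (Differentiable.differentiableOn ?_) hSd
    have d : ∀ (f : Polynomial ℂ) (a b : Fin 3),
        Differentiable ℂ fun z : Fin 3 → ℂ => f.eval (z a - z b) := fun f a b =>
      f.differentiable.comp (by fun_prop)
    exact ((d _ 0 1).mul (d _ 0 2)).mul (d _ 1 2)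
  · have hY : serreWord J J' σ z = cur (K (σ 0)) (z (σ 0)) * cur (K (σ 1)) (z (σ 1))
        * cur (K (σ 2)) (z (σ 2)) := by
      have : ∀ a : Fin 3, (![cur J (z 0), cur J (z 1), cur J' (z 2)] : Fin 3 → FreeCurrents P) a
          = cur (K a) (z a) := by
        intro a; fin_cases a <;> rfl
      simp only [serreWord, this]
    rw [hY, p.eval_cur_mul_cur_mul_cur K hz _ _ _ h1 h2]
    have hd : MvPolynomial.eval z (π α₀ 0 1 * π β₀ 0 1 * (π α 0 2 * π β 0 2)
          * (π α 1 2 * π β 1 2)) = α₀.eval (z 0 - z 1) * β₀.eval (z 0 - z 1)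
          * (α.eval (z 0 - z 2) * β.eval (z 0 - z 2))
          * (α.eval (z 1 - z 2) * β.eval (z 1 - z 2)) := by
      simp only [map_mul, π, mvPolynomial_eval_sub]
    rw [hd]
    have k0 : K 0 = J := rfl
    have k1 : K 1 = J := rfl
    have k2 : K 2 = J' := rfl
    have hR := radius_nonneg P
    simp only [sub_im] at h1 h2
    have symm : ∀ a b : Fin 3, σ a = b → σ.symm b = a := fun a b hab => by
      rw [← hab, Equiv.symm_apply_apply]
    beta_reduce
    -- For each order, `lower` applies to the pairs in increasing order of the indices and `upper`
    -- to the inverted pairs; the exponents of the merged terms agree because addition is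
    -- commutative.
    rcases perm_fin_three_cases σ with ⟨e0, e1, e2⟩ | ⟨e0, e1, e2⟩ | ⟨e0, e1, e2⟩ | ⟨e0, e1, e2⟩ |
      ⟨e0, e1, e2⟩ | ⟨e0, e1, e2⟩ <;>
    rw [serreFactor, symm _ _ e0, symm _ _ e1, symm _ _ e2] <;>
    simp only [e0, e1, e2, k0, k1, k2, S] at h1 h2 ⊢
    · rw [if_pos (by decide), if_pos (by decide), if_pos (by decide)]
      simp only [Finset.mul_sum]
      refine Finset.sum_congr rfl fun i hi => Finset.sum_congr rfl fun j hj =>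
        Finset.sum_congr rfl fun k hk => ?_
      rw [← h₀.lower i hi j hj _ _ (by rw [sub_im]; linarith),
        ← h.lower i hi k hk _ _ (by rw [sub_im]; linarith),
        ← h.lower j hj k hk _ _ (by rw [sub_im]; linarith)]
      ring
    · rw [if_neg (by decide), if_pos (by decide), if_pos (by decide), Finset.sum_comm]
      simp only [Finset.mul_sum]
      refine Finset.sum_congr rfl fun i hi => Finset.sum_congr rfl fun j hj =>
        Finset.sum_congr rfl fun k hk => ?_
      rw [← h₀.upper i hi j hj _ _ (by rw [sub_im]; linarith),
        ← h.lower i hi k hk _ _ (by rw [sub_im]; linarith),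
        ← h.lower j hj k hk _ _ (by rw [sub_im]; linarith),
        show texp P J j (z 1) + texp P J i (z 0) + texp P J' k (z 2)
          = texp P J i (z 0) + texp P J j (z 1) + texp P J' k (z 2) by abel]
      ring
    · rw [if_pos (by decide), if_pos (by decide), if_neg (by decide)]
      simp only [Finset.mul_sum]
      refine Finset.sum_congr rfl fun i hi => ?_
      rw [Finset.sum_comm]
      refine Finset.sum_congr rfl fun j hj => Finset.sum_congr rfl fun k hk => ?_
      rw [← h₀.lower i hi j hj _ _ (by rw [sub_im]; linarith),
        ← h.lower i hi k hk _ _ (by rw [sub_im]; linarith),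
        ← h.upper j hj k hk _ _ (by rw [sub_im]; linarith),
        show texp P J i (z 0) + texp P J' k (z 2) + texp P J j (z 1)
          = texp P J i (z 0) + texp P J j (z 1) + texp P J' k (z 2) by abel]
      ring
    · rw [if_neg (by decide), if_neg (by decide), if_pos (by decide),
        Finset.sum_congr rfl fun i hi => Finset.sum_comm, Finset.sum_comm]
      simp only [Finset.mul_sum]
      refine Finset.sum_congr rfl fun i hi => Finset.sum_congr rfl fun j hj =>
        Finset.sum_congr rfl fun k hk => ?_
      rw [← h₀.upper i hi j hj _ _ (by rw [sub_im]; linarith),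
        ← h.upper i hi k hk _ _ (by rw [sub_im]; linarith),
        ← h.lower j hj k hk _ _ (by rw [sub_im]; linarith),
        show texp P J j (z 1) + texp P J' k (z 2) + texp P J i (z 0)
          = texp P J i (z 0) + texp P J j (z 1) + texp P J' k (z 2) by abel]
      ring
    · rw [if_pos (by decide), if_neg (by decide), if_neg (by decide), Finset.sum_comm,
        Finset.sum_congr rfl fun i hi => Finset.sum_comm]
      simp only [Finset.mul_sum]
      refine Finset.sum_congr rfl fun i hi => Finset.sum_congr rfl fun j hj =>
        Finset.sum_congr rfl fun k hk => ?_
      rw [← h₀.lower i hi j hj _ _ (by rw [sub_im]; linarith),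
        ← h.upper i hi k hk _ _ (by rw [sub_im]; linarith),
        ← h.upper j hj k hk _ _ (by rw [sub_im]; linarith),
        show texp P J' k (z 2) + texp P J i (z 0) + texp P J j (z 1)
          = texp P J i (z 0) + texp P J j (z 1) + texp P J' k (z 2) by abel]
      ring
    · rw [if_neg (by decide), if_neg (by decide), if_neg (by decide), Finset.sum_comm,
        Finset.sum_congr rfl fun i hi => Finset.sum_comm, Finset.sum_comm]
      simp only [Finset.mul_sum]
      refine Finset.sum_congr rfl fun i hi => Finset.sum_congr rfl fun j hj =>
        Finset.sum_congr rfl fun k hk => ?_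
      rw [← h₀.upper i hi j hj _ _ (by rw [sub_im]; linarith),
        ← h.upper i hi k hk _ _ (by rw [sub_im]; linarith),
        ← h.upper j hj k hk _ _ (by rw [sub_im]; linarith),
        show texp P J' k (z 2) + texp P J j (z 1) + texp P J i (z 0)
          = texp P J i (z 0) + texp P J j (z 1) + texp P J' k (z 2) by abel]
      ring
  · simp only [← mul_assoc]
    rw [← Finset.sum_mul]
    refine mul_eq_zero_of_left ?_ _
    rw [sum_perm_fin_three _ (fun a b c => (if c = 1 then -2 else 1) *
      ((if a < b then β₀ else α₀).eval (z 0 - z 1) * (if a < c then β else α).eval (z 0 - z 2)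
        * (if b < c then β else α).eval (z 1 - z 2))) fun σ => by rw [serreCoeff_eq, serreFactor]]
    -- The argument of α₀ and β₀ is the difference of the two others: (z 0 - z 2) - (z 1 - z 2) = z
    -- 0 - z 1.
    have := hid (z 0 - z 2) (z 1 - z 2)
    rw [sub_sub_sub_cancel_right] at this
    simp
    linear_combination this

end

/-! ### Rows and columns of bosons -/

theorem sum_ite_and_eq (s : Finset ℕ) (c : ℕ) (R : Prop) [Decidable R] (Q : ℕ → Prop)
    [DecidablePred Q] (f : ℕ → ℂ) :
    ∑ n ∈ s, (if R ∧ n = c ∧ Q n then f n else 0) = if R ∧ c ∈ s ∧ Q c then f c else 0 := by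
  by_cases h : R ∧ c ∈ s
  · rw [Finset.sum_eq_single c]
    · simp [h]
    · intro b _ hb; simp [hb]
    · intro h'; exact absurd h.2 h'
  · rw [if_neg fun h' => h ⟨h'.1, h'.2.1⟩]
    refine Finset.sum_eq_zero fun n hn => if_neg ?_
    rintro ⟨hR, rfl, -⟩
    exact h ⟨hR, hn⟩

theorem sum_ite_and_eq' (s : Finset ℕ) (c : ℕ) (R : Prop) [Decidable R] (Q : ℕ → Prop)
    [DecidablePred Q] (f : ℕ → ℂ) :
    ∑ n ∈ s, (if R ∧ c = n ∧ Q n then f n else 0) = if R ∧ c ∈ s ∧ Q c then f c else 0 := by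
  rw [← sum_ite_and_eq]
  simp only [eq_comm]

theorem sum_Ico_ite {a b a' b' : ℕ} (h : a ≤ a') (h' : b' ≤ b) (f : ℕ → ℂ) (Q : ℕ → Prop)
    [DecidablePred Q] (hQ : ∀ n, a ≤ n → n < b → (Q n ↔ a' ≤ n ∧ n < b')) :
    ∑ n ∈ Finset.Ico a b, (if Q n then f n else 0) = ∑ n ∈ Finset.Ico a' b', f n := by
  rw [← Finset.sum_filter]
  congr 1
  ext n
  simp only [Finset.mem_filter, Finset.mem_Ico]
  constructor
  · rintro ⟨h1, h2⟩; exact (hQ n h1.1 h1.2).mp h2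
  · rintro h1
    have h2 : a ≤ n ∧ n < b := by omega
    exact ⟨h2, (hQ n h2.1 h2.2).mpr h1⟩

/-- `∏_{a ≤ n < b} b_{ny}⁺(u + (c - n/2) iħ)`. -/
def colPlus (P : Params) (y a b : ℕ) (u c : ℂ) : Exponent P :=
  ∑ n ∈ Finset.Ico a b, bPlus P n y u (c - n / 2)

/-- `∏_{a ≤ n < b} b_{xn}⁺(u + (c - n/2) iħ)`. -/
def rowPlus (P : Params) (x a b : ℕ) (u c : ℂ) : Exponent P :=
  ∑ n ∈ Finset.Ico a b, bPlus P x n u (c - n / 2)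

/-- `∏_{a ≤ n < b} b_{ny}⁻(u + (c + n/2) iħ)`. -/
def colMinus (P : Params) (y a b : ℕ) (u c : ℂ) : Exponent P :=
  ∑ n ∈ Finset.Ico a b, bMinus P n y u (c + n / 2)

/-- `∏_{a ≤ n < b} b_{xn}⁻(u + (c + n/2) iħ)`. -/
def rowMinus (P : Params) (x a b : ℕ) (u c : ℂ) : Exponent P :=
  ∑ n ∈ Finset.Ico a b, bMinus P x n u (c + n / 2)

section
variable (P : Params) (t : ℝ) (u v r r' : ℂ) (a b a' b' x y x' y' μ ν : ℕ) (e : Exponent P)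

theorem kernel_colMinus_left (c : ℂ) : kernel P t (colMinus P y a b u c) e = 0 := by
  simp [colMinus, LinearMap.sum_apply]

theorem kernel_rowMinus_left (c : ℂ) : kernel P t (rowMinus P x a b u c) e = 0 := by
  simp [rowMinus, LinearMap.sum_apply]

theorem kernel_colPlus_right (c : ℂ) : kernel P t e (colPlus P y a b u c) = 0 := by
  simp [colPlus]

theorem kernel_rowPlus_right (c : ℂ) : kernel P t e (rowPlus P x a b u c) = 0 := by
  simp [rowPlus]

theorem kernel_lamPlus_colMinus (c : ℂ) :
    kernel P t (lamPlus P μ u r) (colMinus P y a b v c) = 0 := by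
  simp [colMinus]

theorem kernel_lamPlus_rowMinus (c : ℂ) :
    kernel P t (lamPlus P μ u r) (rowMinus P x a b v c) = 0 := by
  simp [rowMinus]

theorem kernel_colPlus_lamMinus (c : ℂ) :
    kernel P t (colPlus P y a b u c) (lamMinus P μ v r) = 0 := by
  simp [colPlus, LinearMap.sum_apply]

theorem kernel_rowPlus_lamMinus (c : ℂ) :
    kernel P t (rowPlus P x a b u c) (lamMinus P μ v r) = 0 := by
  simp [rowPlus, LinearMap.sum_apply]

end

/-- The second difference of `chi`. -/
def chiDiff (P : Params) (t : ℝ) (r : ℂ) : ℂ :=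
  chi P t (r + 1) - 2 * chi P t r + chi P t (r - 1)

/-- Along a row or column the shifts of b⁺ fall by 1/2 and those of b⁻ rise by 1/2 per index.
Contracted pairs therefore sit at shifts in unit steps, the second differences telescope, and only
the two ends of the range survive. -/
theorem sum_chiDiff (P : Params) (t : ℝ) (c : ℂ) {a b : ℕ} (h : a ≤ b) :
    ∑ n ∈ Finset.Ico a b, chiDiff P t (c - n)
      = chi P t (c - a + 1) - chi P t (c - a) - (chi P t (c - b + 1) - chi P t (c - b)) := by
  induction b, h using Nat.le_induction with
  | base => simp
  | succ b h ih =>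
    rw [Finset.sum_Ico_succ_top h, ih, chiDiff]
    push_cast
    ring_nf

section
variable (P : Params) {t : ℝ} (ht : 0 < t) (u v c c' r r' : ℂ) (a b a' b' x y x' y' : ℕ)
include ht

theorem kernel_bPlus_bMinus_chiDiff : kernel P t (bPlus P a b u r) (bMinus P a' b' v r') =
    if a = a' ∧ b = b' ∧ IsPair P a b then expo (u - v) t * chiDiff P t (r - r') else 0 :=
  kernel_bPlus_bMinus P ht u v r r' a b a' b'

theorem kernel_colPlus_bMinus : kernel P t (colPlus P y a b u c) (bMinus P x' y' v r') =
    if (y = y' ∧ a ≤ x' ∧ x' < b) ∧ IsPair P x' y then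
      expo (u - v) t * chiDiff P t (c - x' / 2 - r') else 0 := by
  simp only [colPlus, map_sum, LinearMap.sum_apply, kernel_bPlus_bMinus_chiDiff P ht]
  have := sum_ite_and_eq (Finset.Ico a b) x' (y = y') (fun n => IsPair P n y)
    fun n => expo (u - v) t * chiDiff P t (c - n / 2 - r')
  simp only [Finset.mem_Ico] at this
  exact (Finset.sum_congr rfl fun n _ => if_congr (by tauto) rfl rfl).trans
    (this.trans (if_congr (by tauto) rfl rfl))

theorem kernel_rowPlus_bMinus : kernel P t (rowPlus P x a b u c) (bMinus P x' y' v r') =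
    if (x = x' ∧ a ≤ y' ∧ y' < b) ∧ IsPair P x y' then
      expo (u - v) t * chiDiff P t (c - y' / 2 - r') else 0 := by
  simp only [rowPlus, map_sum, LinearMap.sum_apply, kernel_bPlus_bMinus_chiDiff P ht]
  have := sum_ite_and_eq (Finset.Ico a b) y' (x = x') (fun n => IsPair P x n)
    fun n => expo (u - v) t * chiDiff P t (c - n / 2 - r')
  simp only [Finset.mem_Ico] at this
  exact (Finset.sum_congr rfl fun n _ => if_congr (by tauto) rfl rfl).trans
    (this.trans (if_congr (by tauto) rfl rfl))

theorem kernel_colPlus_bc : kernel P t (colPlus P y a b u c) (bc P x' y' v r') =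
    if (y = y' ∧ a ≤ x' ∧ x' < b) ∧ IsPair P x' y then
      expo (u - v) t * (chi P t (c - x' / 2 - r' - 1 / 2) - chi P t (c - x' / 2 - r' + 1 / 2))
    else 0 := by
  simp only [colPlus, map_sum, LinearMap.sum_apply, kernel_bPlus_bc P ht]
  have := sum_ite_and_eq (Finset.Ico a b) x' (y = y') (fun n => IsPair P n y)
    fun n => expo (u - v) t * (chi P t (c - n / 2 - r' - 1 / 2) - chi P t (c - n / 2 - r' + 1 / 2))
  simp only [Finset.mem_Ico] at this
  exact (Finset.sum_congr rfl fun n _ => if_congr (by tauto) rfl rfl).trans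
    (this.trans (if_congr (by tauto) rfl rfl))

theorem kernel_rowPlus_bc : kernel P t (rowPlus P x a b u c) (bc P x' y' v r') =
    if (x = x' ∧ a ≤ y' ∧ y' < b) ∧ IsPair P x y' then
      expo (u - v) t * (chi P t (c - y' / 2 - r' - 1 / 2) - chi P t (c - y' / 2 - r' + 1 / 2))
    else 0 := by
  simp only [rowPlus, map_sum, LinearMap.sum_apply, kernel_bPlus_bc P ht]
  have := sum_ite_and_eq (Finset.Ico a b) y' (x = x') (fun n => IsPair P x n)
    fun n => expo (u - v) t * (chi P t (c - n / 2 - r' - 1 / 2) - chi P t (c - n / 2 - r' + 1 / 2))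
  simp only [Finset.mem_Ico] at this
  exact (Finset.sum_congr rfl fun n _ => if_congr (by tauto) rfl rfl).trans
    (this.trans (if_congr (by tauto) rfl rfl))

theorem kernel_bPlus_colMinus : kernel P t (bPlus P x y u r) (colMinus P y' a b v c) =
    if (y = y' ∧ a ≤ x ∧ x < b) ∧ IsPair P x y then
      expo (u - v) t * chiDiff P t (r - (c + x / 2)) else 0 := by
  simp only [colMinus, map_sum, kernel_bPlus_bMinus_chiDiff P ht]
  have := sum_ite_and_eq' (Finset.Ico a b) x (y = y') (fun _ => IsPair P x y)
    fun n => expo (u - v) t * chiDiff P t (r - (c + n / 2))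
  simp only [Finset.mem_Ico] at this
  exact (Finset.sum_congr rfl fun n _ => if_congr (by tauto) rfl rfl).trans
    (this.trans (if_congr (by tauto) rfl rfl))

theorem kernel_bPlus_rowMinus : kernel P t (bPlus P x y u r) (rowMinus P x' a b v c) =
    if (x = x' ∧ a ≤ y ∧ y < b) ∧ IsPair P x y then
      expo (u - v) t * chiDiff P t (r - (c + y / 2)) else 0 := by
  simp only [rowMinus, map_sum, kernel_bPlus_bMinus_chiDiff P ht]
  have := sum_ite_and_eq' (Finset.Ico a b) y (x = x') (fun _ => IsPair P x y)
    fun n => expo (u - v) t * chiDiff P t (r - (c + n / 2))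
  simp only [Finset.mem_Ico] at this
  exact (Finset.sum_congr rfl fun n _ => if_congr (by tauto) rfl rfl).trans
    (this.trans (if_congr (by tauto) rfl rfl))

theorem kernel_bc_colMinus : kernel P t (bc P x y u r) (colMinus P y' a b v c) =
    if (y = y' ∧ a ≤ x ∧ x < b) ∧ IsPair P x y then
      expo (u - v) t * (chi P t (r - (c + x / 2) - 1 / 2) - chi P t (r - (c + x / 2) + 1 / 2))
    else 0 := by
  simp only [colMinus, map_sum, kernel_bc_bMinus P ht]
  have := sum_ite_and_eq' (Finset.Ico a b) x (y = y') (fun _ => IsPair P x y)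
    fun n => expo (u - v) t * (chi P t (r - (c + n / 2) - 1 / 2) - chi P t (r - (c + n / 2) + 1 / 2))
  simp only [Finset.mem_Ico] at this
  exact (Finset.sum_congr rfl fun n _ => if_congr (by tauto) rfl rfl).trans
    (this.trans (if_congr (by tauto) rfl rfl))

theorem kernel_bc_rowMinus : kernel P t (bc P x y u r) (rowMinus P x' a b v c) =
    if (x = x' ∧ a ≤ y ∧ y < b) ∧ IsPair P x y then
      expo (u - v) t * (chi P t (r - (c + y / 2) - 1 / 2) - chi P t (r - (c + y / 2) + 1 / 2))
    else 0 := by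
  simp only [rowMinus, map_sum, kernel_bc_bMinus P ht]
  have := sum_ite_and_eq' (Finset.Ico a b) y (x = x') (fun _ => IsPair P x y)
    fun n => expo (u - v) t * (chi P t (r - (c + n / 2) - 1 / 2) - chi P t (r - (c + n / 2) + 1 / 2))
  simp only [Finset.mem_Ico] at this
  exact (Finset.sum_congr rfl fun n _ => if_congr (by tauto) rfl rfl).trans
    (this.trans (if_congr (by tauto) rfl rfl))

theorem kernel_colPlus_rowMinus : kernel P t (colPlus P y a b u c) (rowMinus P x a' b' v c') =
    if ((a ≤ x ∧ x < b) ∧ a' ≤ y ∧ y < b') ∧ IsPair P x y then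
      expo (u - v) t * chiDiff P t (c - x / 2 - (c' + y / 2)) else 0 := by
  simp only [colPlus, map_sum, LinearMap.sum_apply, kernel_bPlus_rowMinus P ht]
  have := sum_ite_and_eq (Finset.Ico a b) x (a' ≤ y ∧ y < b') (fun n => IsPair P n y)
    fun n => expo (u - v) t * chiDiff P t (c - n / 2 - (c' + y / 2))
  simp only [Finset.mem_Ico] at this
  exact (Finset.sum_congr rfl fun n _ => if_congr (by tauto) rfl rfl).trans
    (this.trans (if_congr (by tauto) rfl rfl))

theorem kernel_rowPlus_colMinus : kernel P t (rowPlus P x a b u c) (colMinus P y a' b' v c') =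
    if ((a ≤ y ∧ y < b) ∧ a' ≤ x ∧ x < b') ∧ IsPair P x y then
      expo (u - v) t * chiDiff P t (c - y / 2 - (c' + x / 2)) else 0 := by
  simp only [rowPlus, map_sum, LinearMap.sum_apply, kernel_bPlus_colMinus P ht]
  have := sum_ite_and_eq (Finset.Ico a b) y (a' ≤ x ∧ x < b') (fun n => IsPair P x n)
    fun n => expo (u - v) t * chiDiff P t (c - n / 2 - (c' + x / 2))
  simp only [Finset.mem_Ico] at this
  exact (Finset.sum_congr rfl fun n _ => if_congr (by tauto) rfl rfl).trans
    (this.trans (if_congr (by tauto) rfl rfl))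

/-- Only the overlap of the two ranges contracts. The hypotheses on the ends make every boson in the
overlap exist. In the borderline case max = min the bracket vanishes, so the weak inequality in the
condition is harmless. -/
theorem kernel_colPlus_colMinus (h1 : 1 ≤ a ∨ 1 ≤ a') (h2 : b ≤ y ∨ b' ≤ y) (h3 : y ≤ P.N) :
    kernel P t (colPlus P y a b u c) (colMinus P y' a' b' v c') =
      if y = y' ∧ max a a' ≤ min b b' then expo (u - v) t *
        (chi P t (c - c' - (max a a' : ℕ) + 1) - chi P t (c - c' - (max a a' : ℕ))
          - (chi P t (c - c' - (min b b' : ℕ) + 1) - chi P t (c - c' - (min b b' : ℕ))))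
      else 0 := by
  simp only [colPlus, map_sum, LinearMap.sum_apply, kernel_bPlus_colMinus P ht]
  split_ifs with h
  · rw [← sum_chiDiff P t _ h.2, Finset.mul_sum, ← Finset.Ico_inter_Ico, ← Finset.sum_ite_mem]
    refine Finset.sum_congr rfl fun n hn => ?_
    rw [Finset.mem_Ico] at hn
    by_cases hn' : a' ≤ n ∧ n < b'
    · rw [if_pos ⟨⟨h.1, hn'⟩, by omega⟩, if_pos (Finset.mem_Ico.mpr hn')]
      congr 2; ring
    · rw [if_neg fun h' => hn' h'.1.2, if_neg fun h' => hn' (Finset.mem_Ico.mp h')]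
  · refine Finset.sum_eq_zero fun n hn => if_neg fun h' => h ⟨h'.1.1, ?_⟩
    rw [Finset.mem_Ico] at hn
    omega

/-- As for columns, except that the bosons b_{xn} exist only for n > x, so that x + 1 enters as a
further lower bound of the overlap. -/
theorem kernel_rowPlus_rowMinus (h1 : 1 ≤ x)
    (h3 : b ≤ P.N + 1 ∨ b' ≤ P.N + 1) :
    kernel P t (rowPlus P x a b u c) (rowMinus P x' a' b' v c') =
      if x = x' ∧ max (max a a') (x + 1) ≤ min b b' then expo (u - v) t *
        (chi P t (c - c' - (max (max a a') (x + 1) : ℕ) + 1) - chi P t (c - c' - (max (max a a') (x + 1) : ℕ))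
          - (chi P t (c - c' - (min b b' : ℕ) + 1) - chi P t (c - c' - (min b b' : ℕ))))
      else 0 := by
  simp only [rowPlus, map_sum, LinearMap.sum_apply, kernel_bPlus_rowMinus P ht]
  split_ifs with h
  · rw [← sum_chiDiff P t _ h.2, Finset.mul_sum]
    refine (sum_Ico_ite ((le_max_left _ _).trans (le_max_left _ _)) (min_le_left _ _) _ _
      fun n h4 h5 => ?_).trans (Finset.sum_congr rfl fun n _ => ?_)
    · rw [IsPair]; omega
    · congr 2; ring
  · refine Finset.sum_eq_zero fun n hn => if_neg fun h' => h ⟨h'.1.1, ?_⟩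
    rw [Finset.mem_Ico] at hn
    omega

end

/-! The exponents of the currents in terms of rows and columns. -/

/-- The indicator of the first summand in a bracket. -/
def ind : Bool → ℂ
  | true => 1
  | false => 0

section
variable (P : Params) (u : ℂ) (ν m : ℕ)

theorem xPlusExp_true : xPlusExp P ν m true u =
    bc P m ν u ((ν + 1 - m) / 2) + bPlus P m (ν + 1) u ((ν + 1 - m) / 2)
      - bc P m (ν + 1) u ((ν - m) / 2)
      + colPlus P (ν + 1) 1 m u ((ν + 1) / 2) - colPlus P ν 1 m u (ν / 2) := by
  rw [xPlusExp, Finset.sum_sub_distrib, colPlus, colPlus]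
  simp only [show ∀ n : ℂ, -((n - ν - 1) / 2) = ((ν : ℂ) + 1) / 2 - n / 2 from fun n => by ring,
    show ∀ n : ℂ, -((n - ν) / 2) = (ν : ℂ) / 2 - n / 2 from fun n => by ring,
    show ((ν : ℂ) + 1 - m) / 2 = (ν + 1) / 2 - m / 2 by ring,
    show ((ν : ℂ) + 2 - m) / 2 = (ν + 2) / 2 - m / 2 by ring,
    show ((ν : ℂ) - m) / 2 = ν / 2 - m / 2 by ring]
  abel

theorem xPlusExp_false : xPlusExp P ν m false u =
    bc P m ν u ((ν + 1 - m) / 2) + bMinus P m (ν + 1) u ((ν + 1 - m) / 2)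
      - bc P m (ν + 1) u ((ν + 2 - m) / 2)
      + colPlus P (ν + 1) 1 m u ((ν + 1) / 2) - colPlus P ν 1 m u (ν / 2) := by
  rw [xPlusExp, Finset.sum_sub_distrib, colPlus, colPlus]
  simp only [show ∀ n : ℂ, -((n - ν - 1) / 2) = ((ν : ℂ) + 1) / 2 - n / 2 from fun n => by ring,
    show ∀ n : ℂ, -((n - ν - 2) / 2) = ((ν : ℂ) + 2) / 2 - n / 2 from fun n => by ring,
    show ∀ n : ℂ, -((n - ν) / 2) = (ν : ℂ) / 2 - n / 2 from fun n => by ring,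
    show ((ν : ℂ) + 1 - m) / 2 = (ν + 1) / 2 - m / 2 by ring,
    show ((ν : ℂ) + 2 - m) / 2 = (ν + 2) / 2 - m / 2 by ring,
    show ((ν : ℂ) - m) / 2 = ν / 2 - m / 2 by ring]
  abel

theorem xMinusExp₁_true : xMinusExp₁ P ν m true u =
    bc P m (ν + 1) u ((ν + m) / 2)
      + lamMinus P ν u (-((P.k - P.N) / 4)) - lamMinus P (ν + 1) u (-((P.k - P.N) / 4))
      - bMinus P m ν u ((ν + m) / 2) - bc P m ν u ((ν + m - 1) / 2)
      + colMinus P (ν + 1) (m + 1) (ν + 1) u ((ν - 1) / 2)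
      - colMinus P ν (m + 1) (ν + 1) u (ν / 2)
      + rowMinus P ν (ν + 1) (P.N + 1) u (ν / 2)
      - rowMinus P (ν + 1) (ν + 1) (P.N + 1) u ((ν - 1) / 2) := by
  simp only [xMinusExp₁, Finset.sum_sub_distrib, colMinus, rowMinus,
    Finset.Ico_add_one_right_eq_Icc,
    show ∀ n : ℂ, (ν + n - 1) / 2 = ((ν : ℂ) - 1) / 2 + n / 2 from fun n => by ring,
    show ∀ n : ℂ, (ν + n) / 2 = (ν : ℂ) / 2 + n / 2 from fun n => by ring]
  abel

theorem xMinusExp₁_false : xMinusExp₁ P ν m false u =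
    bc P m (ν + 1) u ((ν + m) / 2)
      + lamMinus P ν u (-((P.k - P.N) / 4)) - lamMinus P (ν + 1) u (-((P.k - P.N) / 4))
      - bPlus P m ν u ((ν + m) / 2) - bc P m ν u ((ν + m + 1) / 2)
      + colMinus P (ν + 1) (m + 1) (ν + 1) u ((ν - 1) / 2)
      - colMinus P ν (m + 1) (ν + 1) u (ν / 2)
      + rowMinus P ν (ν + 1) (P.N + 1) u (ν / 2)
      - rowMinus P (ν + 1) (ν + 1) (P.N + 1) u ((ν - 1) / 2) := by
  simp only [xMinusExp₁, Finset.sum_sub_distrib, colMinus, rowMinus,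
    Finset.Ico_add_one_right_eq_Icc,
    show ∀ n : ℂ, (ν + n - 1) / 2 = ((ν : ℂ) - 1) / 2 + n / 2 from fun n => by ring,
    show ∀ n : ℂ, (ν + n + 1) / 2 = ((ν : ℂ) + 1) / 2 + n / 2 from fun n => by ring,
    show ∀ n : ℂ, (ν + n) / 2 = (ν : ℂ) / 2 + n / 2 from fun n => by ring]
  abel

theorem xMinusExp₂_true : xMinusExp₂ P ν m true u =
    bc P ν m u ((ν + 1 - m) / 2 - P.k)
      + lamPlus P ν u (-((3 * P.k + P.N) / 4)) - lamPlus P (ν + 1) u (-((3 * P.k + P.N) / 4))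
      + bPlus P (ν + 1) m u ((ν + 1 - m) / 2 - P.k) - bc P (ν + 1) m u ((ν - m) / 2 - P.k)
      + rowPlus P ν m (P.N + 1) u (ν / 2 - P.k)
      - rowPlus P (ν + 1) m (P.N + 1) u ((ν + 1) / 2 - P.k) := by
  simp only [xMinusExp₂, Finset.sum_sub_distrib, rowPlus, Finset.Ico_add_one_right_eq_Icc,
    show ∀ n : ℂ, -((2 * P.k + n - ν - 1) / 2) = ((ν : ℂ) + 1) / 2 - P.k - n / 2 from
      fun n => by ring,
    show ∀ n : ℂ, ((ν + 1 - n) / 2 - P.k) = ((ν : ℂ) + 1) / 2 - P.k - n / 2 from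
      fun n => by ring,
    show ∀ n : ℂ, ((ν - n) / 2 - P.k) = (ν : ℂ) / 2 - P.k - n / 2 from fun n => by ring,
    show ∀ n : ℂ, -((2 * P.k + n - ν) / 2) = (ν : ℂ) / 2 - P.k - n / 2 from fun n => by ring]
  abel

theorem xMinusExp₂_false : xMinusExp₂ P ν m false u =
    bc P ν m u ((ν + 1 - m) / 2 - P.k)
      + lamPlus P ν u (-((3 * P.k + P.N) / 4)) - lamPlus P (ν + 1) u (-((3 * P.k + P.N) / 4))
      + bMinus P (ν + 1) m u ((ν + 1 - m) / 2 - P.k) - bc P (ν + 1) m u ((ν + 2 - m) / 2 - P.k)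
      + rowPlus P ν m (P.N + 1) u (ν / 2 - P.k)
      - rowPlus P (ν + 1) m (P.N + 1) u ((ν + 1) / 2 - P.k) := by
  simp only [xMinusExp₂, Finset.sum_sub_distrib, rowPlus, Finset.Ico_add_one_right_eq_Icc,
    show ∀ n : ℂ, -((2 * P.k + n - ν - 1) / 2) = ((ν : ℂ) + 1) / 2 - P.k - n / 2 from
      fun n => by ring,
    show ∀ n : ℂ, -((2 * P.k + n - ν - 2) / 2) = ((ν : ℂ) + 2) / 2 - P.k - n / 2 from
      fun n => by ring,
    show ∀ n : ℂ, ((ν + 1 - n) / 2 - P.k) = ((ν : ℂ) + 1) / 2 - P.k - n / 2 from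
      fun n => by ring,
    show ∀ n : ℂ, ((ν + 2 - n) / 2 - P.k) = ((ν : ℂ) + 2) / 2 - P.k - n / 2 from
      fun n => by ring,
    show ∀ n : ℂ, -((2 * P.k + n - ν) / 2) = (ν : ℂ) / 2 - P.k - n / 2 from fun n => by ring]
  abel

/-- The flag is turned into the number `ind a`, so that the kernels of both summands in the bracket
can be expanded at once by linearity; the cases of the flag are separated only after the positions
of the indices. -/
theorem xPlusExp_eq (a : Bool) : xPlusExp P ν m a u =
    bc P m ν u ((ν + 1 - m) / 2) + ind a • bPlus P m (ν + 1) u ((ν + 1 - m) / 2)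
      + (1 - ind a) • bMinus P m (ν + 1) u ((ν + 1 - m) / 2)
      - bc P m (ν + 1) u ((ν + 2 - m) / 2 - ind a)
      + colPlus P (ν + 1) 1 m u ((ν + 1) / 2) - colPlus P ν 1 m u (ν / 2) := by
  cases a
  · rw [xPlusExp_false]
    simp only [ind, sub_zero, zero_smul, one_smul, add_zero]
  · rw [xPlusExp_true, show ((ν : ℂ) + 2 - m) / 2 - ind true = (ν - m) / 2 by simp only [ind]; ring]
    simp only [ind, sub_self, zero_smul, one_smul, add_zero]

theorem xMinusExp₁_eq (a : Bool) : xMinusExp₁ P ν m a u =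
    bc P m (ν + 1) u ((ν + m) / 2)
      + lamMinus P ν u (-((P.k - P.N) / 4)) - lamMinus P (ν + 1) u (-((P.k - P.N) / 4))
      - ind a • bMinus P m ν u ((ν + m) / 2) - (1 - ind a) • bPlus P m ν u ((ν + m) / 2)
      - bc P m ν u ((ν + m + 1) / 2 - ind a)
      + colMinus P (ν + 1) (m + 1) (ν + 1) u ((ν - 1) / 2)
      - colMinus P ν (m + 1) (ν + 1) u (ν / 2)
      + rowMinus P ν (ν + 1) (P.N + 1) u (ν / 2)
      - rowMinus P (ν + 1) (ν + 1) (P.N + 1) u ((ν - 1) / 2) := by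
  cases a
  · rw [xMinusExp₁_false]
    simp only [ind, sub_zero, zero_smul, one_smul]
  · rw [xMinusExp₁_true,
      show ((ν : ℂ) + m + 1) / 2 - ind true = (ν + m - 1) / 2 by simp only [ind]; ring]
    simp only [ind, sub_self, zero_smul, one_smul, sub_zero]

theorem xMinusExp₂_eq (a : Bool) : xMinusExp₂ P ν m a u =
    bc P ν m u ((ν + 1 - m) / 2 - P.k)
      + lamPlus P ν u (-((3 * P.k + P.N) / 4)) - lamPlus P (ν + 1) u (-((3 * P.k + P.N) / 4))
      + ind a • bPlus P (ν + 1) m u ((ν + 1 - m) / 2 - P.k)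
      + (1 - ind a) • bMinus P (ν + 1) m u ((ν + 1 - m) / 2 - P.k)
      - bc P (ν + 1) m u ((ν + 2 - m) / 2 - P.k - ind a)
      + rowPlus P ν m (P.N + 1) u (ν / 2 - P.k)
      - rowPlus P (ν + 1) m (P.N + 1) u ((ν + 1) / 2 - P.k) := by
  cases a
  · rw [xMinusExp₂_false]
    simp only [ind, sub_zero, zero_smul, one_smul, add_zero]
  · rw [xMinusExp₂_true,
      show ((ν : ℂ) + 2 - m) / 2 - P.k - ind true = (ν - m) / 2 - P.k by simp only [ind]; ring]
    simp only [ind, sub_self, zero_smul, one_smul, add_zero]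

theorem kPlusExp_eq : kPlusExp P ν u =
    -lamPlus P ν u ((P.k - P.N) / 4) + colPlus P ν 1 ν u (ν / 2)
      - rowPlus P ν (ν + 1) (P.N + 1) u (ν / 2) := by
  simp only [kPlusExp, colPlus, rowPlus, Finset.Ico_add_one_right_eq_Icc, sub_div]

end

/-! ### Contractions of the terms of the currents

The contraction of two terms is a product of factors `(w + r iħ) / (w + s iħ)`; the tables below
list the shifts. -/

/-- The shift in the denominator of the contraction of terms of `X_ν⁺` and `X_ν'⁺`. -/
def denPlus (ν ν' : ℕ) : ℂ := if ν' = ν then 1 else if ν' = ν + 1 then -1 else 0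

/-- The shift in the numerator of the contraction of terms of `X_ν⁺` and `X_ν'⁺`. -/
def numPlus (ν ν' m : ℕ) (a : Bool) (m' : ℕ) (a' : Bool) : ℂ :=
  if ν' = ν then
    if m' < m then -1 else if m < m' then 1 else ind a' - ind a
  else if ν' = ν + 1 then
    if m' < m then 0 else if m < m' then -1 else ind a - 1
  else if ν = ν' + 1 then
    if m' < m then 1 else if m < m' then 0 else 1 - ind a'
  else 0

/-- The shift in the denominator of the contraction of terms of `X_ν⁻` and `X_ν'⁻`. -/
def denMinus (ν ν' : ℕ) : ℂ :=
  if ν' = ν then -1 else if ν' = ν + 1 then 0 else if ν = ν' + 1 then 1 else 0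

/-- The shift in the numerator of the contraction of terms of the first sums in `X_ν⁻` and
`X_ν'⁻`. -/
def numMinus₁ (ν ν' m : ℕ) (a : Bool) (m' : ℕ) (a' : Bool) : ℂ :=
  if ν' = ν then
    if m' < m then 1 else if m < m' then -1 else ind a' - ind a
  else if ν' = ν + 1 then
    if m' < m then -1 else if m < m' then 0 else -ind a'
  else if ν = ν' + 1 then
    if m' < m then 0 else if m < m' then 1 else ind a
  else 0

/-- The shift in the numerator of the contraction of terms of the second sums in `X_ν⁻` and
`X_ν'⁻`. -/
def numMinus₂ (ν ν' m : ℕ) (a : Bool) (m' : ℕ) (a' : Bool) : ℂ :=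
  if ν' = ν then
    if m < m' then 1 else if m' < m then -1 else ind a' - ind a
  else if ν' = ν + 1 then
    if m < m' then -1 else if m' < m then 0 else ind a - 1
  else if ν = ν' + 1 then
    if m < m' then 0 else if m' < m then 1 else 1 - ind a'
  else 0

/-- The shift between numerator and denominator in the contraction of terms of the first sum in
`X_ν⁻` and of the second sum in `X_ν'⁻`. -/
def epsMinus (ν ν' m : ℕ) (a : Bool) (m' : ℕ) (a' : Bool) : ℂ :=
  if ν' < ν then
    if m = ν' ∧ m' = ν then ind a - 1
    else if m = ν' + 1 ∧ m' = ν then ind a' - ind a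
    else if m = ν' + 1 ∧ m' = ν + 1 then 1 - ind a'
    else 0
  else 0

/-- The shift in the numerator of the contraction of terms of the second sum in `X_ν⁻` and of the
first sum in `X_ν'⁻`, up to the factor with `epsMinus`. -/
def numMinus (ν ν' : ℕ) : ℂ :=
  if ν' = ν then 1 else if ν' = ν + 1 then -1 else 0

/-- The shift in the denominator of the contraction of terms of `X_ν⁺` and of the first sum in
`X_ν'⁻`. -/
def denCross (ν ν' m : ℕ) (a : Bool) : ℂ :=
  if ν' = ν then 1 - m - ind a
  else -m

/-- The shift between numerator and denominator in the contraction of terms of `X_ν⁺` and of the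
first sum in `X_ν'⁻`. -/
def epsCross₁ (ν ν' m : ℕ) (a : Bool) (m' : ℕ) (a' : Bool) : ℂ :=
  if m' = m ∧ ν' = ν then ind a - ind a'
  else if m' = m ∧ ν' = ν + 1 then ind a' - ind a
  else 0

/-- The shift between numerator and denominator in the contraction of terms of `X_ν⁺` and of the
second sum in `X_ν'⁻`. -/
def epsCross₂ (ν ν' m : ℕ) (a : Bool) (m' : ℕ) (a' : Bool) : ℂ :=
  if ν' = ν then
    if m = ν ∧ m' = ν + 1 then ind a * ind a'
    else 0
  else if ν' < ν then
    if m = ν' ∧ m' = ν + 1 then ind a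
    else if m = ν' + 1 ∧ m' = ν then -ind a'
    else if m = ν' + 1 ∧ m' = ν + 1 then ind a' - ind a
    else 0
  else 0

section
variable {P : Params}

-- After bilinear expansion the kernel depends only on the relative order of m and m' and on the
-- relative position of ν and ν'. In each case the conditions are decided by arithmetic, and what
-- remains is a linear identity between characters. Everything cancels but one character in the
-- denominator and one in the numerator. The other tables are verified in the same way.
set_option maxHeartbeats 1000000 in
theorem kernel_xPlus_xPlus {t : ℝ} (ht : 0 < t) (u v : ℂ) {ν m : ℕ} (a : Bool) {ν' m' : ℕ} (a' : Bool)
    (hν : ν < P.N) (hm : 1 ≤ m) (hmν : m ≤ ν)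
    (hν' : ν' < P.N) (hm' : 1 ≤ m') (hmν' : m' ≤ ν') :
    kernel P t (xPlusExp P ν m a u) (xPlusExp P ν' m' a' v)
      = expo (u - v) t * (chi P t (denPlus ν ν') - chi P t (numPlus ν ν' m a m' a')) := by
  simp (disch := omega) only [xPlusExp_eq,
      map_add, map_sub, map_neg, map_smul, LinearMap.smul_apply, smul_eq_mul, mul_zero, LinearMap.add_apply, LinearMap.sub_apply,
      LinearMap.neg_apply, kernel_bPlus_bMinus_chiDiff P ht, kernel_bPlus_bc P ht,
      kernel_bc_bMinus P ht, kernel_bc_bc, kernel_bMinus_left, kernel_bPlus_right,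
      kernel_lamMinus_left, kernel_lamPlus_right, kernel_lamPlus_bMinus, kernel_lamPlus_bc,
      kernel_bPlus_lamMinus, kernel_bc_lamMinus, kernel_colPlus_right, kernel_rowPlus_right, kernel_colPlus_lamMinus, kernel_colPlus_bMinus P ht, kernel_colPlus_bc P ht,
      add_zero, zero_add, sub_zero, zero_sub, neg_zero]
  have s0 : m' < m ∨ m' = m ∨ m < m' := by omega
  have s1 : ν' = ν ∨ ν' = ν + 1 ∨ ν = ν' + 1 ∨ ν' + 2 ≤ ν ∨ ν + 2 ≤ ν' := by omega
  rcases s0 with h1 | rfl | h1 <;> rcases s1 with rfl | rfl | rfl | h2 | h2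
  all_goals first
    | (exfalso; omega)
    | (simp (disch := omega) only [denPlus, numPlus, IsPair, true_and, and_true, if_neg, add_zero,
         zero_add, sub_zero]
       try simp (disch := omega) only [if_pos, max_eq_left, max_eq_right,
         min_eq_left, min_eq_right]
       try simp only [chiDiff]
       push_cast
       ring_nf
       all_goals cases a <;> cases a'
       all_goals
         simp only [ind]; ring_nf)

set_option maxHeartbeats 1000000 in
theorem kernel_xMinus₁_xMinus₁ {t : ℝ} (ht : 0 < t) (u v : ℂ) {ν m : ℕ} (a : Bool) {ν' m' : ℕ} (a' : Bool)
    (hν : ν < P.N) (hm : 1 ≤ m) (hmν : m ≤ ν)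
    (ha : a = true ∨ m < ν)
    (hν' : ν' < P.N) (hm' : 1 ≤ m') (hmν' : m' ≤ ν')
    (ha' : a' = true ∨ m' < ν') :
    kernel P t (xMinusExp₁ P ν m a u) (xMinusExp₁ P ν' m' a' v)
      = expo (u - v) t * (chi P t (denMinus ν ν') - chi P t (numMinus₁ ν ν' m a m' a')) := by
  simp (disch := omega) only [xMinusExp₁_eq,
      map_add, map_sub, map_neg, map_smul, LinearMap.smul_apply, smul_eq_mul, mul_zero, LinearMap.add_apply, LinearMap.sub_apply,
      LinearMap.neg_apply, kernel_bPlus_bMinus_chiDiff P ht, kernel_bPlus_bc P ht,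
      kernel_bc_bMinus P ht, kernel_bc_bc, kernel_bMinus_left, kernel_bPlus_right,
      kernel_lamMinus_left, kernel_lamPlus_right, kernel_lamPlus_bMinus, kernel_lamPlus_bc,
      kernel_bPlus_lamMinus, kernel_bc_lamMinus, kernel_colMinus_left, kernel_rowMinus_left, kernel_bPlus_colMinus P ht, kernel_bc_colMinus P ht,
      kernel_bPlus_rowMinus P ht, kernel_bc_rowMinus P ht,
      add_zero, zero_add, sub_zero, zero_sub, neg_zero]
  have s0 : m' < m ∨ m' = m ∨ m < m' := by omega
  have s1 : ν' = ν ∨ ν' = ν + 1 ∨ ν = ν' + 1 ∨ ν' + 2 ≤ ν ∨ ν + 2 ≤ ν' := by omega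
  have s2 : m < ν' ∨ m = ν' ∨ m = ν' + 1 ∨ ν' + 1 < m := by omega
  rcases s0 with h1 | rfl | h1 <;> rcases s1 with rfl | rfl | rfl | h2 | h2 <;> rcases s2 with h3 | rfl | rfl | h3
  all_goals first
    | (exfalso; omega)
    | (simp (disch := omega) only [denMinus, numMinus₁, IsPair, true_and, and_true, if_neg, add_zero,
         zero_add, sub_zero]
       try simp (disch := omega) only [if_pos, max_eq_left, max_eq_right,
         min_eq_left, min_eq_right]
       try simp only [chiDiff]
       push_cast
       ring_nf
       all_goals cases a <;> cases a'
       all_goals try simp only [reduceCtorEq, false_or, true_or] at ha ha'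
       all_goals first
         | (exfalso; omega)
         | (simp only [ind]; ring_nf))

set_option maxHeartbeats 1000000 in
theorem kernel_xMinus₂_xMinus₂ {t : ℝ} (ht : 0 < t) (u v : ℂ) {ν m : ℕ} (a : Bool) {ν' m' : ℕ} (a' : Bool)
    (hν : ν < P.N) (hν0 : 1 ≤ ν) (hm : ν + 1 ≤ m) (hmN : m ≤ P.N)
    (ha : a = true ∨ ν + 1 < m)
    (hν' : ν' < P.N) (hν0' : 1 ≤ ν') (hm' : ν' + 1 ≤ m') (hmN' : m' ≤ P.N)
    (ha' : a' = true ∨ ν' + 1 < m') :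
    kernel P t (xMinusExp₂ P ν m a u) (xMinusExp₂ P ν' m' a' v)
      = expo (u - v) t * (chi P t (denMinus ν ν') - chi P t (numMinus₂ ν ν' m a m' a')) := by
  simp (disch := omega) only [xMinusExp₂_eq,
      map_add, map_sub, map_neg, map_smul, LinearMap.smul_apply, smul_eq_mul, mul_zero, LinearMap.add_apply, LinearMap.sub_apply,
      LinearMap.neg_apply, kernel_bPlus_bMinus_chiDiff P ht, kernel_bPlus_bc P ht,
      kernel_bc_bMinus P ht, kernel_bc_bc, kernel_bMinus_left, kernel_bPlus_right,
      kernel_lamMinus_left, kernel_lamPlus_right, kernel_lamPlus_bMinus, kernel_lamPlus_bc,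
      kernel_bPlus_lamMinus, kernel_bc_lamMinus, kernel_rowPlus_right, kernel_rowPlus_lamMinus, kernel_rowPlus_bMinus P ht, kernel_rowPlus_bc P ht,
      add_zero, zero_add, sub_zero, zero_sub, neg_zero]
  have s0 : m' < m ∨ m' = m ∨ m < m' := by omega
  have s1 : ν' = ν ∨ ν' = ν + 1 ∨ ν = ν' + 1 ∨ ν' + 2 ≤ ν ∨ ν + 2 ≤ ν' := by omega
  have s2 : m = ν + 1 ∨ ν + 1 < m := by omega
  rcases s0 with h1 | rfl | h1 <;> rcases s1 with rfl | rfl | rfl | h2 | h2 <;> rcases s2 with rfl | h5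
  all_goals first
    | (exfalso; omega)
    | (simp (disch := omega) only [denMinus, numMinus₂, IsPair, true_and, and_true, if_neg, add_zero,
         zero_add, sub_zero]
       try simp (disch := omega) only [if_pos, max_eq_left, max_eq_right,
         min_eq_left, min_eq_right]
       try simp only [chiDiff]
       push_cast
       ring_nf
       all_goals cases a <;> cases a'
       all_goals try simp only [reduceCtorEq, false_or, true_or] at ha ha'
       all_goals first
         | (exfalso; omega)
         | (simp only [ind]; ring_nf))

-- The first sum carries (b+c) fields in the columns ν and ν + 1, the second sum in the rows ν' and
-- ν' + 1. A common boson needs m ∈ {ν', ν' + 1} and m' ∈ {ν, ν + 1}. In this order λ⁻ is on the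
-- left and λ⁺ on the right, so the λ do not contract.
set_option maxHeartbeats 1000000 in
theorem kernel_xMinus₁_xMinus₂ {t : ℝ} (ht : 0 < t) (u v : ℂ) {ν m : ℕ} (a : Bool) {ν' m' : ℕ} (a' : Bool)
    (hν : ν < P.N) (hm : 1 ≤ m) (hmν : m ≤ ν)
    (ha : a = true ∨ m < ν)
    (hν' : ν' < P.N) (hν0' : 1 ≤ ν') (hm' : ν' + 1 ≤ m') (hmN' : m' ≤ P.N)
    (ha' : a' = true ∨ ν' + 1 < m') :
    kernel P t (xMinusExp₁ P ν m a u) (xMinusExp₂ P ν' m' a' v)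
      = expo (u - v) t * (chi P t (ν + P.k) - chi P t (ν + P.k + epsMinus ν ν' m a m' a')) := by
  simp (disch := omega) only [xMinusExp₁_eq, xMinusExp₂_eq,
      map_add, map_sub, map_neg, map_smul, LinearMap.smul_apply, smul_eq_mul, mul_zero, LinearMap.add_apply, LinearMap.sub_apply,
      LinearMap.neg_apply, kernel_bPlus_bMinus_chiDiff P ht, kernel_bPlus_bc P ht,
      kernel_bc_bMinus P ht, kernel_bc_bc, kernel_bMinus_left, kernel_bPlus_right,
      kernel_lamMinus_left, kernel_lamPlus_right, kernel_lamPlus_bMinus, kernel_lamPlus_bc,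
      kernel_bPlus_lamMinus, kernel_bc_lamMinus, kernel_colMinus_left, kernel_rowMinus_left, kernel_rowPlus_right, add_zero, zero_add, sub_zero, zero_sub, neg_zero]
  have s0 : ν' = ν ∨ ν' < ν ∨ ν < ν' := by omega
  have s1 : m < ν' ∨ m = ν' ∨ m = ν' + 1 ∨ ν' + 1 < m := by omega
  have s2 : m' < ν ∨ m' = ν ∨ m' = ν + 1 ∨ ν + 1 < m' := by omega
  have s3 : m' = ν' + 1 ∨ ν' + 1 < m' := by omega
  rcases s0 with rfl | h2 | h2 <;> rcases s1 with h3 | rfl | rfl | h3 <;> rcases s2 with h4 | rfl | rfl | h4 <;> rcases s3 with h6 | h6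
  all_goals first
    | (exfalso; omega)
    | (simp (disch := omega) only [epsMinus, IsPair, true_and, and_true, if_neg, add_zero,
         zero_add, sub_zero]
       try simp (disch := omega) only [if_pos, max_eq_left, max_eq_right,
         min_eq_left, min_eq_right]
       try simp only [chiDiff]
       push_cast
       ring_nf
       all_goals cases a <;> cases a'
       all_goals try simp only [reduceCtorEq, false_or, true_or] at ha ha'
       all_goals first
         | (exfalso; omega)
         | (simp only [ind]; ring_nf))

end

section
variable {P : Params}

-- Column meets column: the telescoped ends cancel except for m = m' with ν' = ν or ν' = ν + 1.
-- Where `epsCross₁` vanishes both characters coincide and the entry `denCross` has no significance.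
set_option maxHeartbeats 1000000 in
theorem kernel_xPlus_xMinus₁ {t : ℝ} (ht : 0 < t) (u v : ℂ) {ν m : ℕ} (a : Bool) {ν' m' : ℕ} (a' : Bool)
    (hν : ν < P.N) (hm : 1 ≤ m) (hmν : m ≤ ν)
    (hν' : ν' < P.N) (hm' : 1 ≤ m') (hmν' : m' ≤ ν')
    (ha' : a' = true ∨ m' < ν') :
    kernel P t (xPlusExp P ν m a u) (xMinusExp₁ P ν' m' a' v)
      = expo (u - v) t * (chi P t (denCross ν ν' m a)
        - chi P t (denCross ν ν' m a + epsCross₁ ν ν' m a m' a')) := by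
  simp (disch := omega) only [xPlusExp_eq, xMinusExp₁_eq,
      map_add, map_sub, map_neg, map_smul, LinearMap.smul_apply, smul_eq_mul, mul_zero, LinearMap.add_apply, LinearMap.sub_apply,
      LinearMap.neg_apply, kernel_bPlus_bMinus_chiDiff P ht, kernel_bPlus_bc P ht,
      kernel_bc_bMinus P ht, kernel_bc_bc, kernel_bMinus_left, kernel_bPlus_right,
      kernel_lamMinus_left, kernel_lamPlus_right, kernel_lamPlus_bMinus, kernel_lamPlus_bc,
      kernel_bPlus_lamMinus, kernel_bc_lamMinus, kernel_colPlus_right, kernel_rowPlus_right, kernel_colPlus_lamMinus, kernel_rowPlus_lamMinus, kernel_colPlus_bMinus P ht, kernel_colPlus_bc P ht,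
      kernel_bPlus_colMinus P ht, kernel_bc_colMinus P ht,
      kernel_bPlus_rowMinus P ht, kernel_bc_rowMinus P ht,
      kernel_colPlus_colMinus P ht, kernel_colPlus_rowMinus P ht, add_zero, zero_add, sub_zero, zero_sub, neg_zero]
  have s0 : m' < m ∨ m' = m ∨ m < m' := by omega
  have s1 : ν' = ν ∨ ν' = ν + 1 ∨ ν = ν' + 1 ∨ ν' + 2 ≤ ν ∨ ν + 2 ≤ ν' := by omega
  have s2 : m < ν' ∨ m = ν' ∨ m = ν' + 1 ∨ ν' + 1 < m := by omega
  rcases s0 with h1 | rfl | h1 <;> rcases s1 with rfl | rfl | rfl | h2 | h2 <;> rcases s2 with h3 | rfl | rfl | h3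
  all_goals first
    | (exfalso; omega)
    | (simp (disch := omega) only [denCross, epsCross₁, IsPair, true_and, and_true, if_neg, add_zero,
         zero_add, sub_zero]
       try simp (disch := omega) only [if_pos, max_eq_left, max_eq_right,
         min_eq_left, min_eq_right]
       try simp only [chiDiff]
       push_cast
       ring_nf
       all_goals cases a <;> cases a'
       all_goals try simp only [reduceCtorEq, false_or, true_or] at ha'
       all_goals first
         | (exfalso; omega)
         | (simp only [ind]; ring_nf))

-- All shifts are the negatives of those in the opposite order, so the factor is the same rational
-- function of the difference; the products X⁺X⁻ and X⁻X⁺ continue into each other term by term.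
set_option maxHeartbeats 1000000 in
theorem kernel_xMinus₁_xPlus {t : ℝ} (ht : 0 < t) (u v : ℂ) {ν m : ℕ} (a : Bool) {ν' m' : ℕ} (a' : Bool)
    (hν : ν < P.N) (hm : 1 ≤ m) (hmν : m ≤ ν)
    (ha : a = true ∨ m < ν)
    (hν' : ν' < P.N) (hm' : 1 ≤ m') (hmν' : m' ≤ ν') :
    kernel P t (xMinusExp₁ P ν m a u) (xPlusExp P ν' m' a' v)
      = expo (u - v) t * (chi P t (-denCross ν' ν m' a')
        - chi P t (-(denCross ν' ν m' a' + epsCross₁ ν' ν m' a' m a))) := by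
  simp (disch := omega) only [xMinusExp₁_eq, xPlusExp_eq,
      map_add, map_sub, map_neg, map_smul, LinearMap.smul_apply, smul_eq_mul, mul_zero, LinearMap.add_apply, LinearMap.sub_apply,
      LinearMap.neg_apply, kernel_bPlus_bMinus_chiDiff P ht, kernel_bPlus_bc P ht,
      kernel_bc_bMinus P ht, kernel_bc_bc, kernel_bMinus_left, kernel_bPlus_right,
      kernel_lamMinus_left, kernel_lamPlus_right, kernel_lamPlus_bMinus, kernel_lamPlus_bc,
      kernel_bPlus_lamMinus, kernel_bc_lamMinus, kernel_colMinus_left, kernel_rowMinus_left, kernel_colPlus_right, add_zero, zero_add, sub_zero, zero_sub, neg_zero]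
  have s0 : m' < m ∨ m' = m ∨ m < m' := by omega
  have s1 : ν' = ν ∨ ν' = ν + 1 ∨ ν = ν' + 1 ∨ ν' + 2 ≤ ν ∨ ν + 2 ≤ ν' := by omega
  have s2 : m = ν ∨ m < ν := by omega
  rcases s0 with h1 | rfl | h1 <;> rcases s1 with rfl | rfl | rfl | h2 | h2 <;> rcases s2 with h6 | h6
  all_goals first
    | (exfalso; omega)
    | (simp (disch := omega) only [denCross, epsCross₁, IsPair, true_and, and_true, if_neg, add_zero,
         zero_add, sub_zero]
       try simp (disch := omega) only [if_pos, max_eq_left, max_eq_right,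
         min_eq_left, min_eq_right]
       try simp only [chiDiff]
       push_cast
       ring_nf
       all_goals cases a <;> cases a'
       all_goals try simp only [reduceCtorEq, false_or, true_or] at ha
       all_goals first
         | (exfalso; omega)
         | (simp only [ind]; ring_nf))

-- Column meets row: a contribution survives only at corners m ∈ {ν', ν' + 1}, m' ∈ {ν, ν + 1}. For
-- ν = ν' the single surviving corner m = ν, m' = ν + 1 with both flags set will carry the pole that
-- belongs to k⁺.
set_option maxHeartbeats 1000000 in
theorem kernel_xPlus_xMinus₂ {t : ℝ} (ht : 0 < t) (u v : ℂ) {ν m : ℕ} (a : Bool) {ν' m' : ℕ} (a' : Bool)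
    (hν : ν < P.N) (hm : 1 ≤ m) (hmν : m ≤ ν)
    (hν' : ν' < P.N) (hν0' : 1 ≤ ν') (hm' : ν' + 1 ≤ m') (hmN' : m' ≤ P.N)
    (ha' : a' = true ∨ ν' + 1 < m') :
    kernel P t (xPlusExp P ν m a u) (xMinusExp₂ P ν' m' a' v)
      = expo (u - v) t * (chi P t (ν - ν' + P.k)
        - chi P t (ν - ν' + P.k + epsCross₂ ν ν' m a m' a')) := by
  simp (disch := omega) only [xPlusExp_eq, xMinusExp₂_eq,
      map_add, map_sub, map_neg, map_smul, LinearMap.smul_apply, smul_eq_mul, mul_zero, LinearMap.add_apply, LinearMap.sub_apply,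
      LinearMap.neg_apply, kernel_bPlus_bMinus_chiDiff P ht, kernel_bPlus_bc P ht,
      kernel_bc_bMinus P ht, kernel_bc_bc, kernel_bMinus_left, kernel_bPlus_right,
      kernel_lamMinus_left, kernel_lamPlus_right, kernel_lamPlus_bMinus, kernel_lamPlus_bc,
      kernel_bPlus_lamMinus, kernel_bc_lamMinus, kernel_colPlus_right, kernel_rowPlus_right, kernel_colPlus_lamMinus, kernel_rowPlus_lamMinus, kernel_colPlus_bMinus P ht, kernel_colPlus_bc P ht,
      add_zero, zero_add, sub_zero, zero_sub, neg_zero]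
  have s0 : ν' = ν ∨ ν' < ν ∨ ν < ν' := by omega
  have s1 : m < ν' ∨ m = ν' ∨ m = ν' + 1 ∨ ν' + 1 < m := by omega
  have s2 : m' < ν ∨ m' = ν ∨ m' = ν + 1 ∨ ν + 1 < m' := by omega
  have s3 : m' = ν' + 1 ∨ ν' + 1 < m' := by omega
  rcases s0 with rfl | h2 | h2 <;> rcases s1 with h3 | rfl | rfl | h3 <;> rcases s2 with h4 | rfl | rfl | h4 <;> rcases s3 with h6 | h6
  all_goals first
    | (exfalso; omega)
    | (simp (disch := omega) only [epsCross₂, IsPair, true_and, and_true, if_neg, add_zero,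
         zero_add, sub_zero]
       try simp (disch := omega) only [if_pos, max_eq_left, max_eq_right,
         min_eq_left, min_eq_right]
       try simp only [chiDiff]
       push_cast
       ring_nf
       all_goals cases a <;> cases a'
       all_goals try simp only [reduceCtorEq, false_or, true_or] at ha'
       all_goals first
         | (exfalso; omega)
         | (simp only [ind]; ring_nf))

set_option maxHeartbeats 1000000 in
theorem kernel_xMinus₂_xPlus {t : ℝ} (ht : 0 < t) (u v : ℂ) {ν m : ℕ} (a : Bool) {ν' m' : ℕ} (a' : Bool)
    (hν : ν < P.N) (hν0 : 1 ≤ ν) (hm : ν + 1 ≤ m) (hmN : m ≤ P.N)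
    (ha : a = true ∨ ν + 1 < m)
    (hν' : ν' < P.N) (hm' : 1 ≤ m') (hmν' : m' ≤ ν') :
    kernel P t (xMinusExp₂ P ν m a u) (xPlusExp P ν' m' a' v)
      = expo (u - v) t * (chi P t (-(ν' - ν + P.k))
        - chi P t (-(ν' - ν + P.k + epsCross₂ ν' ν m' a' m a))) := by
  simp (disch := omega) only [xMinusExp₂_eq, xPlusExp_eq,
      map_add, map_sub, map_neg, map_smul, LinearMap.smul_apply, smul_eq_mul, mul_zero, LinearMap.add_apply, LinearMap.sub_apply,
      LinearMap.neg_apply, kernel_bPlus_bMinus_chiDiff P ht, kernel_bPlus_bc P ht,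
      kernel_bc_bMinus P ht, kernel_bc_bc, kernel_bMinus_left, kernel_bPlus_right,
      kernel_lamMinus_left, kernel_lamPlus_right, kernel_lamPlus_bMinus, kernel_lamPlus_bc,
      kernel_bPlus_lamMinus, kernel_bc_lamMinus, kernel_colPlus_right, kernel_rowPlus_lamMinus, kernel_rowPlus_bMinus P ht, kernel_rowPlus_bc P ht,
      add_zero, zero_add, sub_zero, zero_sub, neg_zero]
  have s0 : ν' = ν ∨ ν' < ν ∨ ν < ν' := by omega
  have s1 : m' < ν ∨ m' = ν ∨ m' = ν + 1 ∨ ν + 1 < m' := by omega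
  have s2 : m < ν' ∨ m = ν' ∨ m = ν' + 1 ∨ ν' + 1 < m := by omega
  have s3 : m = ν + 1 ∨ ν + 1 < m := by omega
  rcases s0 with rfl | h2 | h2 <;> rcases s1 with h4 | rfl | rfl | h4 <;> rcases s2 with h3 | rfl | rfl | h3 <;> rcases s3 with h6 | h6
  all_goals first
    | (exfalso; omega)
    | (simp (disch := omega) only [epsCross₂, IsPair, true_and, and_true, if_neg, add_zero,
         zero_add, sub_zero]
       try simp (disch := omega) only [if_pos, max_eq_left, max_eq_right,
         min_eq_left, min_eq_right]
       try simp only [chiDiff]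
       push_cast
       ring_nf
       all_goals cases a <;> cases a'
       all_goals try simp only [reduceCtorEq, false_or, true_or] at ha
       all_goals first
         | (exfalso; omega)
         | (simp only [ind]; ring_nf))

end

/-! ### Contractions that involve λ or the currents k -/

section
variable (P : Params)

/-- The rational part of the contraction of `λ_μ⁺` with `λ_ν⁻`. -/
def lamShift (t : ℝ) (μ ν : ℕ) (x : ℂ) : ℂ :=
  if μ < ν then
    chi P t (x + (P.k + P.N) / 2) - chi P t (x - (P.k + P.N) / 2)
      - chi P t (x + (P.k + P.N) / 2 - 1) + chi P t (x - (P.k + P.N) / 2 - 1)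
  else if ν < μ then
    chi P t (x + (P.k + P.N) / 2 + 1) - chi P t (x - (P.k + P.N) / 2 + 1)
      - chi P t (x + (P.k + P.N) / 2) + chi P t (x - (P.k + P.N) / 2)
  else 0

/-- The part of the contraction of `λ_μ⁺` with `λ_ν⁻` that does not depend on `μ` and `ν`. -/
def rhoShift (t : ℝ) (x : ℂ) : ℂ :=
  (chi P t (x + (P.k + P.N) / 2) - chi P t (x - (P.k + P.N) / 2)) * (t * rhoKernel P t)

variable {t : ℝ} (ht : 0 < t) (u v c r r' : ℂ) (a b x y μ ν : ℕ)
include ht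

/-- Products of characters are merged into single shifted ones, so that the later identities become
linear in the characters. In λ_ν λ_{ν+1}⁻¹ the terms `rhoShift` cancel, as they do not depend on the
indices. -/
theorem kernel_lamPlus_lamMinus_eq (hμ : 1 ≤ μ) (hμ' : μ ≤ P.N) (hν : 1 ≤ ν) (hν' : ν ≤ P.N) :
    kernel P t (lamPlus P μ u r) (lamMinus P ν v r') =
      expo (u - v) t * (lamShift P t μ ν (r - r') - rhoShift P t (r - r')) := by
  rw [kernel_lamPlus_lamMinus P ht u v r r' μ ν (Finset.mem_Icc.mpr ⟨hμ, hμ'⟩)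
    (Finset.mem_Icc.mpr ⟨hν, hν'⟩), lamShift, rhoShift, lamDiff]
  generalize hx : r - r' = x
  have e : ∀ y : ℂ, chi P t (x + y) = chi P t x * chi P t y := chi_add P t x
  have e1 : ∀ y : ℂ, chi P t (x - y) = chi P t x * chi P t (-y) := fun y => by
    rw [sub_eq_add_neg, e]
  have e2 : ∀ z y : ℂ, chi P t (z - y) = chi P t z * chi P t (-y) := fun z y => by
    rw [sub_eq_add_neg, chi_add]
  split_ifs
  · rw [e2 _ 1, e2 _ 1, e, e1]; ring
  · rw [chi_add P t _ 1, chi_add P t _ 1, e, e1]; ring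
  · rw [e, e1]; ring

omit ht in
theorem kMinusExp_eq : kMinusExp P μ u =
    -lamMinus P μ u (-((P.k - P.N) / 4))
      + ∑ ρ ∈ Finset.Ico 1 μ, rowMinus P ρ μ (P.N + 1) u (ρ / 2)
      - ∑ α ∈ Finset.Ico 1 (μ + 1), rowMinus P α (μ + 1) (P.N + 1) u (α / 2 - 1) := by
  simp only [kMinusExp, rowMinus, Finset.Ico_add_one_right_eq_Icc, add_div, sub_div,
    add_sub_right_comm]
  norm_num

/-- A given boson b_{ab} occurs at most once in each of the two double products of k_μ⁻, so each
product contributes at most one second difference. -/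
theorem kernel_bPlus_kMinus : kernel P t (bPlus P a b u r) (kMinusExp P μ v) =
    (if (a < μ ∧ μ ≤ b) ∧ IsPair P a b then
      expo (u - v) t * chiDiff P t (r - (a / 2 + b / 2)) else 0)
    - if (a ≤ μ ∧ μ < b) ∧ IsPair P a b then
      expo (u - v) t * chiDiff P t (r - (a / 2 - 1 + b / 2)) else 0 := by
  simp only [kMinusExp_eq, map_sub, map_add, map_neg, map_sum, kernel_bPlus_lamMinus,
    kernel_bPlus_rowMinus P ht, neg_zero, zero_add]
  have h1 := sum_ite_and_eq' (Finset.Ico 1 μ) a (μ ≤ b ∧ b < P.N + 1) (fun _ => IsPair P a b)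
    fun n => expo (u - v) t * chiDiff P t (r - (n / 2 + b / 2))
  have h2 := sum_ite_and_eq' (Finset.Ico 1 (μ + 1)) a (μ + 1 ≤ b ∧ b < P.N + 1)
    (fun _ => IsPair P a b) fun n => expo (u - v) t * chiDiff P t (r - (n / 2 - 1 + b / 2))
  simp only [Finset.mem_Ico] at h1 h2
  congr 1
  · exact (Finset.sum_congr rfl fun n _ => if_congr (by tauto) rfl rfl).trans
      (h1.trans (if_congr (by rw [IsPair]; omega) rfl rfl))
  · exact (Finset.sum_congr rfl fun n _ => if_congr (by tauto) rfl rfl).trans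
      (h2.trans (if_congr (by rw [IsPair]; omega) rfl rfl))

theorem kernel_bc_kMinus : kernel P t (bc P a b u r) (kMinusExp P μ v) =
    (if (a < μ ∧ μ ≤ b) ∧ IsPair P a b then expo (u - v) t *
      (chi P t (r - (a / 2 + b / 2) - 1 / 2) - chi P t (r - (a / 2 + b / 2) + 1 / 2)) else 0)
    - if (a ≤ μ ∧ μ < b) ∧ IsPair P a b then expo (u - v) t *
      (chi P t (r - (a / 2 - 1 + b / 2) - 1 / 2) - chi P t (r - (a / 2 - 1 + b / 2) + 1 / 2))
      else 0 := by
  simp only [kMinusExp_eq, map_sub, map_add, map_neg, map_sum, kernel_bc_lamMinus,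
    kernel_bc_rowMinus P ht, neg_zero, zero_add]
  have h1 := sum_ite_and_eq' (Finset.Ico 1 μ) a (μ ≤ b ∧ b < P.N + 1) (fun _ => IsPair P a b)
    fun n => expo (u - v) t *
      (chi P t (r - (n / 2 + b / 2) - 1 / 2) - chi P t (r - (n / 2 + b / 2) + 1 / 2))
  have h2 := sum_ite_and_eq' (Finset.Ico 1 (μ + 1)) a (μ + 1 ≤ b ∧ b < P.N + 1)
    (fun _ => IsPair P a b) fun n => expo (u - v) t *
      (chi P t (r - (n / 2 - 1 + b / 2) - 1 / 2) - chi P t (r - (n / 2 - 1 + b / 2) + 1 / 2))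
  simp only [Finset.mem_Ico] at h1 h2
  congr 1
  · exact (Finset.sum_congr rfl fun n _ => if_congr (by tauto) rfl rfl).trans
      (h1.trans (if_congr (by rw [IsPair]; omega) rfl rfl))
  · exact (Finset.sum_congr rfl fun n _ => if_congr (by tauto) rfl rfl).trans
      (h2.trans (if_congr (by rw [IsPair]; omega) rfl rfl))

omit ht in
theorem kernel_lamPlus_kMinus : kernel P t (lamPlus P ν u r) (kMinusExp P μ v) =
    -kernel P t (lamPlus P ν u r) (lamMinus P μ v (-((P.k - P.N) / 4))) := by
  simp only [kMinusExp_eq, map_sub, map_add, map_neg, map_sum, kernel_lamPlus_rowMinus,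
    Finset.sum_const_zero, sub_zero, add_zero]

theorem kernel_colPlus_kMinus (ha : 1 ≤ a) (hb : b ≤ y) (hy : y ≤ P.N) :
    kernel P t (colPlus P y a b u c) (kMinusExp P μ v) =
      (if μ ≤ y ∧ a ≤ min b μ then expo (u - v) t *
        (chi P t (c - y / 2 - a + 1) - chi P t (c - y / 2 - a)
          - (chi P t (c - y / 2 - (min b μ : ℕ) + 1) - chi P t (c - y / 2 - (min b μ : ℕ)))) else 0)
      - if μ < y ∧ a ≤ min b (μ + 1) then expo (u - v) t *
        (chi P t (c + 1 - y / 2 - a + 1) - chi P t (c + 1 - y / 2 - a)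
          - (chi P t (c + 1 - y / 2 - (min b (μ + 1) : ℕ) + 1)
            - chi P t (c + 1 - y / 2 - (min b (μ + 1) : ℕ)))) else 0 := by
  simp only [colPlus, map_sum, LinearMap.sum_apply, kernel_bPlus_kMinus P ht,
    Finset.sum_sub_distrib]
  congr 1
  · split_ifs with h
    · rw [← sum_chiDiff P t _ h.2, Finset.mul_sum]
      refine (sum_Ico_ite le_rfl (min_le_left _ _) _ _ fun n h1 h2 => ?_).trans
        (Finset.sum_congr rfl fun n _ => ?_)
      · rw [IsPair]; omega
      · congr 2; ring
    · refine Finset.sum_eq_zero fun n hn => if_neg fun h' => h ?_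
      rw [Finset.mem_Ico] at hn
      omega
  · split_ifs with h
    · rw [← sum_chiDiff P t _ h.2, Finset.mul_sum]
      refine (sum_Ico_ite le_rfl (min_le_left _ _) _ _ fun n h1 h2 => ?_).trans
        (Finset.sum_congr rfl fun n _ => ?_)
      · rw [IsPair]; omega
      · congr 2; ring
    · refine Finset.sum_eq_zero fun n hn => if_neg fun h' => h ?_
      rw [Finset.mem_Ico] at hn
      omega

theorem kernel_rowPlus_kMinus (hx : 1 ≤ x) (hb : b ≤ P.N + 1) :
    kernel P t (rowPlus P x a b u c) (kMinusExp P μ v) =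
      (if x < μ ∧ max a μ ≤ b then expo (u - v) t *
        (chi P t (c - x / 2 - (max a μ : ℕ) + 1) - chi P t (c - x / 2 - (max a μ : ℕ))
          - (chi P t (c - x / 2 - b + 1) - chi P t (c - x / 2 - b))) else 0)
      - if x ≤ μ ∧ max a (μ + 1) ≤ b then expo (u - v) t *
        (chi P t (c + 1 - x / 2 - (max a (μ + 1) : ℕ) + 1)
          - chi P t (c + 1 - x / 2 - (max a (μ + 1) : ℕ))
          - (chi P t (c + 1 - x / 2 - b + 1) - chi P t (c + 1 - x / 2 - b))) else 0 := by
  simp only [rowPlus, map_sum, LinearMap.sum_apply, kernel_bPlus_kMinus P ht,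
    Finset.sum_sub_distrib]
  congr 1
  · split_ifs with h
    · rw [← sum_chiDiff P t _ h.2, Finset.mul_sum]
      refine (sum_Ico_ite (le_max_left _ _) le_rfl _ _ fun n h1 h2 => ?_).trans
        (Finset.sum_congr rfl fun n _ => ?_)
      · rw [IsPair]; omega
      · congr 2; ring
    · refine Finset.sum_eq_zero fun n hn => if_neg fun h' => h ?_
      rw [Finset.mem_Ico] at hn
      omega
  · split_ifs with h
    · rw [← sum_chiDiff P t _ h.2, Finset.mul_sum]
      refine (sum_Ico_ite (le_max_left _ _) le_rfl _ _ fun n h1 h2 => ?_).trans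
        (Finset.sum_congr rfl fun n _ => ?_)
      · rw [IsPair]; omega
      · congr 2; ring
    · refine Finset.sum_eq_zero fun n hn => if_neg fun h' => h ?_
      rw [Finset.mem_Ico] at hn
      omega

end

/-- The shift in the contractions of `k_μ^±` and `X_ν^±`. -/
def shiftK (μ ν : ℕ) : ℂ := if μ = ν then 1 else if μ = ν + 1 then -1 else 0

/-- The rational part of the contraction of `k_μ⁺` and `k_ν⁻`. -/
def shiftKK (P : Params) (t : ℝ) (μ ν : ℕ) : ℂ :=
  if μ < ν then chi P t (-1) - chi P t 0 + (chi P t P.k - chi P t (P.k - 1))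
  else if ν < μ then chi P t 0 - chi P t 1 + (chi P t (P.k + 1) - chi P t P.k)
  else 0

section
variable {P : Params}

-- Unlike in the opposite order, λ⁺ now stands to the left of λ⁻, and the tails of b⁺ meet those of
-- b⁻. Together they give one additional linear fractional factor that depends on ν and ν' only; the
-- transcendental parts cancel in the two quotients of λ.
set_option maxHeartbeats 1000000 in
theorem kernel_xMinus₂_xMinus₁ {t : ℝ} (ht : 0 < t) (u v : ℂ) {ν m : ℕ} (a : Bool) {ν' m' : ℕ} (a' : Bool)
    (hν : ν < P.N) (hν0 : 1 ≤ ν) (hm : ν + 1 ≤ m) (hmN : m ≤ P.N)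
    (ha : a = true ∨ ν + 1 < m)
    (hν' : ν' < P.N) (hm' : 1 ≤ m') (hmν' : m' ≤ ν')
    (ha' : a' = true ∨ m' < ν') :
    kernel P t (xMinusExp₂ P ν m a u) (xMinusExp₁ P ν' m' a' v)
      = expo (u - v) t * (chi P t (denMinus ν ν') - chi P t (numMinus ν ν')
        + (chi P t (-(ν' + P.k)) - chi P t (-(ν' + P.k + epsMinus ν' ν m' a' m a)))) := by
  simp (disch := omega) only [xMinusExp₂_eq, xMinusExp₁_eq,
      map_add, map_sub, map_neg, map_smul, LinearMap.smul_apply, smul_eq_mul, mul_zero, LinearMap.add_apply, LinearMap.sub_apply,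
      LinearMap.neg_apply, kernel_bPlus_bMinus_chiDiff P ht, kernel_bPlus_bc P ht,
      kernel_bc_bMinus P ht, kernel_bc_bc, kernel_bMinus_left, kernel_bPlus_right,
      kernel_lamMinus_left, kernel_lamPlus_right, kernel_lamPlus_bMinus, kernel_lamPlus_bc,
      kernel_bPlus_lamMinus, kernel_bc_lamMinus, kernel_rowPlus_right, kernel_rowPlus_lamMinus, kernel_rowPlus_bMinus P ht, kernel_rowPlus_bc P ht,
      kernel_lamPlus_colMinus, kernel_lamPlus_rowMinus, kernel_colMinus_left, kernel_bPlus_colMinus P ht, kernel_bc_colMinus P ht,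
      kernel_bPlus_rowMinus P ht, kernel_bc_rowMinus P ht,
      kernel_rowPlus_colMinus P ht,
      kernel_rowPlus_rowMinus P ht, kernel_lamPlus_lamMinus_eq P ht, add_zero, zero_add, sub_zero, zero_sub, neg_zero]
  have s0 : ν' = ν ∨ ν' = ν + 1 ∨ ν = ν' + 1 ∨ ν' + 2 ≤ ν ∨ ν + 2 ≤ ν' := by omega
  have s1 : m < ν' ∨ m = ν' ∨ m = ν' + 1 ∨ ν' + 1 < m := by omega
  have s2 : m' < ν ∨ m' = ν ∨ m' = ν + 1 ∨ ν + 1 < m' := by omega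
  rcases s0 with rfl | rfl | rfl | h2 | h2 <;> rcases s1 with h3 | rfl | rfl | h3 <;> rcases s2 with h4 | rfl | rfl | h4
  all_goals first
    | (exfalso; omega)
    | (simp (disch := omega) only [denMinus, numMinus, epsMinus, lamShift, IsPair, true_and, and_true, if_neg, add_zero,
         zero_add, sub_zero]
       try simp (disch := omega) only [if_pos, max_eq_left, max_eq_right,
         min_eq_left, min_eq_right]
       try simp only [chiDiff]
       push_cast
       ring_nf
       all_goals cases a <;> cases a'
       all_goals try simp only [reduceCtorEq, false_or, true_or] at ha ha'
       all_goals first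
         | (exfalso; omega)
         | (simp only [ind]; ring_nf))

-- The result does not depend on m or on the flag. This uniformity makes conjugation by k^± act on
-- the whole current as a scalar.
set_option maxHeartbeats 1000000 in
theorem kernel_kPlus_xPlus {t : ℝ} (ht : 0 < t) (u v : ℂ) {μ : ℕ} {ν m : ℕ} (a : Bool)
    (hμ : 1 ≤ μ) (hμN : μ ≤ P.N)
    (hν : ν < P.N) (hm : 1 ≤ m) (hmν : m ≤ ν) :
    kernel P t (kPlusExp P μ u) (xPlusExp P ν m a v)
      = expo (u - v) t * (chi P t (-shiftK μ ν) - chi P t 0) := by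
  simp (disch := omega) only [kPlusExp_eq, xPlusExp_eq,
      map_add, map_sub, map_neg, map_smul, LinearMap.smul_apply, smul_eq_mul, mul_zero, LinearMap.add_apply, LinearMap.sub_apply,
      LinearMap.neg_apply, kernel_bPlus_bMinus_chiDiff P ht, kernel_bPlus_bc P ht,
      kernel_bc_bMinus P ht, kernel_bc_bc, kernel_bMinus_left, kernel_bPlus_right,
      kernel_lamMinus_left, kernel_lamPlus_right, kernel_lamPlus_bMinus, kernel_lamPlus_bc,
      kernel_bPlus_lamMinus, kernel_bc_lamMinus, kernel_colPlus_right, kernel_colPlus_lamMinus, kernel_colPlus_bMinus P ht, kernel_colPlus_bc P ht,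
      kernel_rowPlus_bMinus P ht, kernel_rowPlus_bc P ht,
      add_zero, zero_add, sub_zero, zero_sub, neg_zero]
  have s0 : μ = ν ∨ μ = ν + 1 ∨ μ < ν ∨ ν + 1 < μ := by omega
  have s1 : m < μ ∨ m = μ ∨ μ < m := by omega
  rcases s0 with rfl | rfl | h2 | h2 <;> rcases s1 with h1 | rfl | h1
  all_goals first
    | (exfalso; omega)
    | (simp (disch := omega) only [shiftK, IsPair, true_and, and_true, if_neg, add_zero,
         zero_add, sub_zero]
       try simp (disch := omega) only [if_pos, max_eq_left, max_eq_right,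
         min_eq_left, min_eq_right]
       try simp only [chiDiff]
       push_cast
       ring_nf
       all_goals cases a
       all_goals
         simp only [ind]; ring_nf)

set_option maxHeartbeats 1000000 in
theorem kernel_xPlus_kMinus {t : ℝ} (ht : 0 < t) (u v : ℂ) {ν m : ℕ} (a : Bool) {μ : ℕ}
    (hν : ν < P.N) (hm : 1 ≤ m) (hmν : m ≤ ν)
    (hμ : 1 ≤ μ) (hμN : μ ≤ P.N) :
    kernel P t (xPlusExp P ν m a u) (kMinusExp P μ v)
      = expo (u - v) t * (chi P t 0 - chi P t (shiftK μ ν)) := by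
  simp (disch := omega) only [xPlusExp_eq,
      map_add, map_sub, map_neg, map_smul, LinearMap.smul_apply, smul_eq_mul, mul_zero, LinearMap.add_apply, LinearMap.sub_apply,
      LinearMap.neg_apply, kernel_bPlus_bMinus_chiDiff P ht, kernel_bPlus_bc P ht,
      kernel_bc_bMinus P ht, kernel_bc_bc, kernel_bMinus_left, kernel_bPlus_right,
      kernel_lamMinus_left, kernel_lamPlus_right, kernel_lamPlus_bMinus, kernel_lamPlus_bc,
      kernel_bPlus_lamMinus, kernel_bc_lamMinus, kernel_bPlus_kMinus P ht, kernel_bc_kMinus P ht, kernel_colPlus_kMinus P ht,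
      kernel_rowPlus_kMinus P ht, kernel_lamPlus_kMinus, add_zero, zero_add, sub_zero, zero_sub, neg_zero]
  have s0 : μ = ν ∨ μ = ν + 1 ∨ μ < ν ∨ ν + 1 < μ := by omega
  have s1 : m < μ ∨ m = μ ∨ μ < m := by omega
  rcases s0 with rfl | rfl | h2 | h2 <;> rcases s1 with h1 | rfl | h1
  all_goals first
    | (exfalso; omega)
    | (simp (disch := omega) only [shiftK, IsPair, true_and, and_true, if_neg, add_zero,
         zero_add, sub_zero]
       try simp (disch := omega) only [if_pos, max_eq_left, max_eq_right,
         min_eq_left, min_eq_right]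
       try simp only [chiDiff]
       push_cast
       ring_nf
       all_goals cases a
       all_goals
         simp only [ind]; ring_nf)

set_option maxHeartbeats 1000000 in
theorem kernel_kPlus_xMinus₁ {t : ℝ} (ht : 0 < t) (u v : ℂ) {μ : ℕ} {ν m : ℕ} (a : Bool)
    (hμ : 1 ≤ μ) (hμN : μ ≤ P.N)
    (hν : ν < P.N) (hm : 1 ≤ m) (hmν : m ≤ ν)
    (ha : a = true ∨ m < ν) :
    kernel P t (kPlusExp P μ u) (xMinusExp₁ P ν m a v)
      = expo (u - v) t * (chi P t P.k - chi P t (P.k - shiftK μ ν)) := by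
  simp (disch := omega) only [kPlusExp_eq, xMinusExp₁_eq,
      map_add, map_sub, map_neg, map_smul, LinearMap.smul_apply, smul_eq_mul, mul_zero, LinearMap.add_apply, LinearMap.sub_apply,
      LinearMap.neg_apply, kernel_bPlus_bMinus_chiDiff P ht, kernel_bPlus_bc P ht,
      kernel_bc_bMinus P ht, kernel_bc_bc, kernel_bMinus_left, kernel_bPlus_right,
      kernel_lamMinus_left, kernel_lamPlus_right, kernel_lamPlus_bMinus, kernel_lamPlus_bc,
      kernel_bPlus_lamMinus, kernel_bc_lamMinus, kernel_rowPlus_right, kernel_lamPlus_colMinus, kernel_lamPlus_rowMinus, kernel_colPlus_right, kernel_colPlus_lamMinus, kernel_rowPlus_lamMinus, kernel_colPlus_bMinus P ht, kernel_colPlus_bc P ht,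
      kernel_rowPlus_bMinus P ht, kernel_rowPlus_bc P ht,
      kernel_colPlus_colMinus P ht, kernel_rowPlus_rowMinus P ht, kernel_colPlus_rowMinus P ht, kernel_rowPlus_colMinus P ht,
      kernel_lamPlus_lamMinus_eq P ht, add_zero, zero_add, sub_zero, zero_sub, neg_zero]
  have s0 : μ = ν ∨ μ = ν + 1 ∨ μ < ν ∨ ν + 1 < μ := by omega
  have s1 : m < μ ∨ m = μ ∨ μ < m := by omega
  rcases s0 with rfl | rfl | h2 | h2 <;> rcases s1 with h1 | rfl | h1
  all_goals first
    | (exfalso; omega)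
    | (simp (disch := omega) only [shiftK, lamShift, IsPair, true_and, and_true, if_neg, add_zero,
         zero_add, sub_zero]
       try simp (disch := omega) only [if_pos, max_eq_left, max_eq_right,
         min_eq_left, min_eq_right]
       try simp only [chiDiff]
       push_cast
       ring_nf
       all_goals cases a
       all_goals try simp only [reduceCtorEq, false_or, true_or] at ha'
       all_goals first
         | (exfalso; omega)
         | (simp only [ind]; ring_nf))

set_option maxHeartbeats 1000000 in
theorem kernel_kPlus_xMinus₂ {t : ℝ} (ht : 0 < t) (u v : ℂ) {μ : ℕ} {ν m : ℕ} (a : Bool)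
    (hμ : 1 ≤ μ) (hμN : μ ≤ P.N)
    (hν : ν < P.N) (hν0 : 1 ≤ ν) (hm : ν + 1 ≤ m) (hmN : m ≤ P.N)
    (ha : a = true ∨ ν + 1 < m) :
    kernel P t (kPlusExp P μ u) (xMinusExp₂ P ν m a v)
      = expo (u - v) t * (chi P t P.k - chi P t (P.k - shiftK μ ν)) := by
  simp (disch := omega) only [kPlusExp_eq, xMinusExp₂_eq,
      map_add, map_sub, map_neg, map_smul, LinearMap.smul_apply, smul_eq_mul, mul_zero, LinearMap.add_apply, LinearMap.sub_apply,
      LinearMap.neg_apply, kernel_bPlus_bMinus_chiDiff P ht, kernel_bPlus_bc P ht,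
      kernel_bc_bMinus P ht, kernel_bc_bc, kernel_bMinus_left, kernel_bPlus_right,
      kernel_lamMinus_left, kernel_lamPlus_right, kernel_lamPlus_bMinus, kernel_lamPlus_bc,
      kernel_bPlus_lamMinus, kernel_bc_lamMinus, kernel_rowPlus_right, kernel_lamPlus_colMinus, kernel_lamPlus_rowMinus, kernel_colPlus_right, kernel_colPlus_lamMinus, kernel_rowPlus_lamMinus, kernel_colPlus_bMinus P ht, kernel_colPlus_bc P ht,
      kernel_rowPlus_bMinus P ht, kernel_rowPlus_bc P ht,
      add_zero, zero_add, sub_zero, zero_sub, neg_zero]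
  have s0 : μ = ν ∨ μ = ν + 1 ∨ μ < ν ∨ ν + 1 < μ := by omega
  have s1 : m < μ ∨ m = μ ∨ μ < m := by omega
  rcases s0 with rfl | rfl | h2 | h2 <;> rcases s1 with h1 | rfl | h1
  all_goals first
    | (exfalso; omega)
    | (simp (disch := omega) only [shiftK, IsPair, true_and, and_true, if_neg, add_zero,
         zero_add, sub_zero]
       try simp (disch := omega) only [if_pos, max_eq_left, max_eq_right,
         min_eq_left, min_eq_right]
       try simp only [chiDiff]
       push_cast
       ring_nf
       all_goals cases a
       all_goals try simp only [reduceCtorEq, false_or, true_or] at ha'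
       all_goals first
         | (exfalso; omega)
         | (simp only [ind]; ring_nf))

set_option maxHeartbeats 1000000 in
theorem kernel_xMinus₁_kMinus {t : ℝ} (ht : 0 < t) (u v : ℂ) {ν m : ℕ} (a : Bool) {μ : ℕ}
    (hν : ν < P.N) (hm : 1 ≤ m) (hmν : m ≤ ν)
    (ha : a = true ∨ m < ν)
    (hμ : 1 ≤ μ) (hμN : μ ≤ P.N) :
    kernel P t (xMinusExp₁ P ν m a u) (kMinusExp P μ v)
      = expo (u - v) t * (chi P t (shiftK μ ν) - chi P t 0) := by
  simp (disch := omega) only [xMinusExp₁_eq,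
      map_add, map_sub, map_neg, map_smul, LinearMap.smul_apply, smul_eq_mul, mul_zero, LinearMap.add_apply, LinearMap.sub_apply,
      LinearMap.neg_apply, kernel_bPlus_bMinus_chiDiff P ht, kernel_bPlus_bc P ht,
      kernel_bc_bMinus P ht, kernel_bc_bc, kernel_bMinus_left, kernel_bPlus_right,
      kernel_lamMinus_left, kernel_lamPlus_right, kernel_lamPlus_bMinus, kernel_lamPlus_bc,
      kernel_bPlus_lamMinus, kernel_bc_lamMinus, kernel_colMinus_left, kernel_rowMinus_left, kernel_bPlus_kMinus P ht, kernel_bc_kMinus P ht, kernel_colPlus_kMinus P ht,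
      kernel_rowPlus_kMinus P ht, kernel_lamPlus_kMinus, add_zero, zero_add, sub_zero, zero_sub, neg_zero]
  have s0 : μ = ν ∨ μ = ν + 1 ∨ μ < ν ∨ ν + 1 < μ := by omega
  have s1 : m < μ ∨ m = μ ∨ μ < m := by omega
  rcases s0 with rfl | rfl | h2 | h2 <;> rcases s1 with h1 | rfl | h1
  all_goals first
    | (exfalso; omega)
    | (simp (disch := omega) only [shiftK, IsPair, true_and, and_true, if_neg, add_zero,
         zero_add, sub_zero]
       try simp (disch := omega) only [if_pos, max_eq_left, max_eq_right,
         min_eq_left, min_eq_right]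
       try simp only [chiDiff]
       push_cast
       ring_nf
       all_goals cases a
       all_goals try simp only [reduceCtorEq, false_or, true_or] at ha
       all_goals first
         | (exfalso; omega)
         | (simp only [ind]; ring_nf))

set_option maxHeartbeats 1000000 in
theorem kernel_xMinus₂_kMinus {t : ℝ} (ht : 0 < t) (u v : ℂ) {ν m : ℕ} (a : Bool) {μ : ℕ}
    (hν : ν < P.N) (hν0 : 1 ≤ ν) (hm : ν + 1 ≤ m) (hmN : m ≤ P.N)
    (ha : a = true ∨ ν + 1 < m)
    (hμ : 1 ≤ μ) (hμN : μ ≤ P.N) :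
    kernel P t (xMinusExp₂ P ν m a u) (kMinusExp P μ v)
      = expo (u - v) t * (chi P t (shiftK μ ν) - chi P t 0) := by
  simp (disch := omega) only [xMinusExp₂_eq,
      map_add, map_sub, map_neg, map_smul, LinearMap.smul_apply, smul_eq_mul, mul_zero, LinearMap.add_apply, LinearMap.sub_apply,
      LinearMap.neg_apply, kernel_bPlus_bMinus_chiDiff P ht, kernel_bPlus_bc P ht,
      kernel_bc_bMinus P ht, kernel_bc_bc, kernel_bMinus_left, kernel_bPlus_right,
      kernel_lamMinus_left, kernel_lamPlus_right, kernel_lamPlus_bMinus, kernel_lamPlus_bc,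
      kernel_bPlus_lamMinus, kernel_bc_lamMinus, kernel_bPlus_kMinus P ht, kernel_bc_kMinus P ht, kernel_colPlus_kMinus P ht,
      kernel_rowPlus_kMinus P ht, kernel_lamPlus_kMinus, kernel_lamPlus_lamMinus_eq P ht, add_zero, zero_add, sub_zero, zero_sub, neg_zero]
  have s0 : μ = ν ∨ μ = ν + 1 ∨ μ < ν ∨ ν + 1 < μ := by omega
  have s1 : m < μ ∨ m = μ ∨ μ < m := by omega
  rcases s0 with rfl | rfl | h2 | h2 <;> rcases s1 with h1 | rfl | h1
  all_goals first
    | (exfalso; omega)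
    | (simp (disch := omega) only [shiftK, lamShift, IsPair, true_and, and_true, if_neg, add_zero,
         zero_add, sub_zero]
       try simp (disch := omega) only [if_pos, max_eq_left, max_eq_right,
         min_eq_left, min_eq_right]
       try simp only [chiDiff]
       push_cast
       ring_nf
       all_goals cases a
       all_goals try simp only [reduceCtorEq, false_or, true_or] at ha
       all_goals first
         | (exfalso; omega)
         | (simp only [ind]; ring_nf))


end

section
variable {P : Params}

/-! ### The relations between the currents `k_μ^±` -/

-- The shifts ±(k - N)/4 of λ in k⁺ and k⁻ differ by (k - N)/2. The ends of the telescoping rows and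
-- columns of b combine with the rational part of the λ contraction into `shiftKK` and four further
-- characters, which are the numerator of the kernel of ρ.
set_option maxHeartbeats 1000000 in
theorem kernel_kPlus_kMinus_rhoShift {t : ℝ} (ht : 0 < t) (u v : ℂ) {μ ν : ℕ}
    (hμ : 1 ≤ μ) (hμN : μ ≤ P.N) (hν : 1 ≤ ν) (hνN : ν ≤ P.N) :
    kernel P t (kPlusExp P μ u) (kMinusExp P ν v) = expo (u - v) t * (shiftKK P t μ ν
      + (chi P t 0 - chi P t (-1) - chi P t (1 - P.N) + chi P t (-P.N))
      - rhoShift P t ((P.k - P.N) / 2)) := by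
  simp (disch := omega) only [kPlusExp_eq, map_add, map_sub, map_neg, LinearMap.add_apply,
    LinearMap.sub_apply, LinearMap.neg_apply, kernel_colPlus_kMinus P ht,
    kernel_rowPlus_kMinus P ht, kernel_lamPlus_kMinus, kernel_lamPlus_lamMinus_eq P ht]
  have s0 : μ < ν ∨ μ = ν ∨ ν < μ := by omega
  rcases s0 with h | rfl | h
  all_goals
    simp (disch := omega) only [shiftKK, lamShift, if_neg, add_zero, zero_add, sub_zero]
    try simp (disch := omega) only [if_pos, max_eq_left, max_eq_right, min_eq_left, min_eq_right]
    push_cast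
    ring_nf

/-- At the shift (k - N)/2 the two characters are χ(k) and χ(-N). Writing χ(k) - χ(-N) = (χ(k) - 1)
+ (1 - χ(-N)), the second part cancels the denominator 1 - e^{-Nħt} of the kernel and leaves its
numerator. The first part yields ρ at the arguments w + ikħ and w. -/
theorem rhoShift_eq {t : ℝ} (ht : 0 < t) :
    rhoShift P t ((P.k - P.N) / 2) = (chi P t P.k - 1) * (t * rhoKernel P t)
      + (chi P t 0 - chi P t (-1) - chi P t (1 - P.N) + chi P t (-P.N)) := by
  have h : (1 - chi P t (-P.N)) * (t * rhoKernel P t)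
      = chi P t 0 - chi P t (-1) - chi P t (1 - P.N) + chi P t (-P.N) := by
    have h0 := one_sub_exp_ne_zero P ht
    have ht0 : (t : ℂ) ≠ 0 := ofReal_ne_zero.2 ht.ne'
    have e1 : chi P t (-P.N) = exp (-(P.N * P.hbar) * t) := by rw [chi]; congr 1; ring
    have e2 : chi P t (-1) = exp (-P.hbar * t) := by rw [chi]; congr 1; ring
    have e3 : chi P t (1 - P.N) = exp (-((P.N - 1) * P.hbar) * t) := by rw [chi]; congr 1; ring
    have e4 : exp (-(P.N * P.hbar) * t) = exp (-P.hbar * t) * exp (-((P.N - 1) * P.hbar) * t) := by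
      rw [← exp_add]; congr 1; ring
    rw [rhoKernel, e1, e2, e3, chi_zero]
    rw [mul_div_assoc', mul_div_assoc', div_eq_iff (mul_ne_zero ht0 h0), e4]
    ring
  rw [rhoShift, ← h]
  have e1 : (P.k - P.N) / 2 + (P.k + P.N) / 2 = P.k := by ring
  have e2 : (P.k - P.N) / 2 - (P.k + P.N) / 2 = -P.N := by ring
  rw [e1, e2]
  ring

theorem kernel_kPlus_kMinus {t : ℝ} (ht : 0 < t) (u v : ℂ) {μ ν : ℕ}
    (hμ : 1 ≤ μ) (hμN : μ ≤ P.N) (hν : 1 ≤ ν) (hνN : ν ≤ P.N) :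
    kernel P t (kPlusExp P μ u) (kMinusExp P ν v) = expo (u - v) t * shiftKK P t μ ν
      + exp (-(I * (u - v) * t)) * (chi P t 0 * rhoKernel P t)
      - exp (-(I * (u - v) * t)) * (chi P t P.k * rhoKernel P t) := by
  have ht0 : (t : ℂ) ≠ 0 := ofReal_ne_zero.2 ht.ne'
  rw [kernel_kPlus_kMinus_rhoShift ht u v hμ hμN hν hνN, rhoShift_eq ht, chi_zero, expo]
  field_simp
  ring

/-- The shifts in the rational part of the contraction of `k_μ⁺` and `k_ν⁻`. -/
def shiftsKK (P : Params) (μ ν : ℕ) : List (ℂ × ℂ) :=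
  if μ < ν then [(-1, 0), (P.k, P.k - 1)] else if ν < μ then [(0, 1), (P.k + 1, P.k)] else []

theorem rho_ne_zero {w : ℂ} (hw : w.im < -(3 * P.N * ‖P.hbar‖)) : rho P w ≠ 0 := by
  rw [← exp_laplace_rhoKernel P hw]
  exact exp_ne_zero _

/-- Exponentiates the three parts of the kernel separately: Frullani integrals give the rational
factor, and the kernel of ρ with weights 1 and -χ(k) gives ρ(w)/ρ(w + ikħ). -/
theorem exp_contr_kPlus_kMinus {u v : ℂ} (h : (u - v).im < -radius P) {μ ν : ℕ}
    (hμ : 1 ≤ μ) (hμN : μ ≤ P.N) (hν : 1 ≤ ν) (hνN : ν ≤ P.N) :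
    rho P (u - v + I * P.k * P.hbar) * exp (contr P (kPlusExp P μ u) (kMinusExp P ν v))
      = ratio P (shiftsKK P μ ν) (u - v) * rho P (u - v) := by
  have hk := norm_nonneg P.k
  have hN : (2 : ℝ) ≤ P.N := by exact_mod_cast P.two_le
  have hh := norm_nonneg P.hbar
  obtain ⟨i1, r1⟩ := exp_laplace_list (P := P) (shiftsKK P μ ν) h (by
    have h1 := norm_sub_le P.k 1
    have h2 := norm_add_le P.k 1
    rw [norm_one] at h1 h2
    unfold shiftsKK
    split_ifs <;> simp [poleBound] <;> (repeat' constructor) <;> linarith)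
  have hs : ∀ t : ℝ, (List.map (fun x : ℂ × ℂ => chi P t x.1 - chi P t x.2) (shiftsKK P μ ν)).sum
      = shiftKK P t μ ν := fun t => by
    unfold shiftsKK shiftKK
    split_ifs <;> simp
  simp only [hs] at i1 r1
  obtain ⟨c0, C0, b0⟩ := isMild_chi_mul_rhoKernel (P := P) (a := 0)
    (by rw [norm_zero, poleBound]; linarith)
  obtain ⟨ck, Ck, bk⟩ := isMild_chi_mul_rhoKernel (P := P) (a := P.k) (by rw [poleBound]; linarith)
  have i0 := laplace_integrableOn c0 b0 h
  have ik := laplace_integrableOn ck bk h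
  have hw : (u - v).im < -(3 * P.N * ‖P.hbar‖) := by
    refine h.trans_le (neg_le_neg ?_)
    rw [radius, poleBound]
    nlinarith
  have hw' : (u - v + I * P.k * P.hbar).im < -(3 * P.N * ‖P.hbar‖) := by
    have h1 := abs_im_le_norm (I * P.k * P.hbar)
    rw [norm_mul, norm_mul, norm_I, one_mul] at h1
    have h2 := le_abs_self (I * P.k * P.hbar).im
    rw [add_im]
    rw [radius, poleBound] at h
    nlinarith [mul_nonneg hk hh]
  have i2 : IntegrableOn (fun t : ℝ => expo (u - v) t * shiftKK P t μ ν
      + exp (-(I * (u - v) * t)) * (chi P t 0 * rhoKernel P t)) (Ioi 0) := i1.add i0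
  rw [contr_eq, setIntegral_congr_fun measurableSet_Ioi fun t ht =>
      kernel_kPlus_kMinus (mem_Ioi.1 ht) u v hμ hμN hν hνN,
    integral_sub i2 ik, integral_add i1 i0, exp_sub, exp_add, r1]
  have e0 : exp (∫ t in Ioi (0 : ℝ), exp (-(I * (u - v) * t)) * (chi P t 0 * rhoKernel P t))
      = rho P (u - v) := by
    rw [← exp_laplace_rhoKernel P hw]
    simp only [chi_zero, one_mul]
  have ek : exp (∫ t in Ioi (0 : ℝ), exp (-(I * (u - v) * t)) * (chi P t P.k * rhoKernel P t))
      = rho P (u - v + I * P.k * P.hbar) := by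
    rw [← exp_laplace_rhoKernel P hw']
    congr 2
    funext t
    -- Multiplication by χ(k) = e^{kħt} shifts the argument of the Laplace transform by ikħ.
    rw [chi, ← mul_assoc, ← exp_add]
    congr 2
    linear_combination (P.k * P.hbar * t) * I_mul_I
  rw [e0, ek]
  exact mul_div_cancel₀ _ (rho_ne_zero hw')

theorem norm_le_poleBound {a : ℂ} (ha : ‖a‖ ≤ 2 * P.N + ‖P.k‖ + 8) : ‖a‖ ≤ poleBound P := by
  rw [poleBound]
  have := norm_nonneg P.k
  have : (0 : ℝ) ≤ P.N := Nat.cast_nonneg _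
  linarith

theorem eval_kPlus_kMinus (μ ν : Idx P.N) (p : Probe P (radius P)) {u v : ℂ} (hu : u ∈ p.band)
    (hv : v ∈ p.band) (h : (u - v).im < -radius P) :
    rho P (u - v + I * P.k * P.hbar) * p.eval (psi P) (cur (.kPlus μ) u * cur (.kMinus ν) v)
      = p.eval (psi P) (cur (.kMinus ν) v * cur (.kPlus μ) u)
        * ratio P (shiftsKK P μ ν) (u - v) * rho P (u - v) := by
  have hμ := Finset.mem_Icc.1 μ.2
  have hν := Finset.mem_Icc.1 ν.2
  rw [p.eval_kPlus_mul_kMinus μ ν hu hv h, ← mul_assoc,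
    exp_contr_kPlus_kMinus h hμ.1 hμ.2 hν.1 hν.2]
  ring

/-! ### The relations between `k_μ^±` and `X_ν^±` -/

theorem shiftK_low (ν : RootIdx P.N) : shiftK (low ν : ℕ) ν = 1 := if_pos rfl

theorem shiftK_high (ν : RootIdx P.N) : shiftK (high ν : ℕ) ν = -1 := by
  rw [shiftK, if_neg (by simp [high]), if_pos (by simp [high])]

theorem shiftK_far {μ ν : ℕ} (h : ν + 2 ≤ μ ∨ μ + 1 ≤ ν) : shiftK μ ν = 0 := by
  rw [shiftK, if_neg (by omega), if_neg (by omega)]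

theorem norm_shiftK_le (μ ν : ℕ) : ‖shiftK μ ν‖ ≤ 1 := by
  unfold shiftK
  split_ifs <;> simp

theorem exp_contr_eq_div {e e' : Exponent P} {a b w : ℂ} (hw : w.im < -radius P)
    (ha : ‖a‖ ≤ poleBound P) (hb : ‖b‖ ≤ poleBound P)
    (h : ∀ t : ℝ, 0 < t → kernel P t e e' = expo w t * (chi P t a - chi P t b)) :
    exp (contr P e e') = (w + b * (I * P.hbar)) / (w + a * (I * P.hbar)) := by
  rw [exp_contr_eq_ratio [(a, b)] hw (by simpa using ⟨ha, hb⟩)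
    fun t ht => by rw [h t ht]; simp]
  simp [ratio]

section
variable {u v : ℂ} {μ : ℕ} (hμ : 1 ≤ μ) (hμN : μ ≤ P.N) {ν : RootIdx P.N}
include hμ hμN

theorem exp_contr_kPlus_xPlus (h : (u - v).im < -radius P) :
    ∀ i ∈ labels P (.xPlus ν), exp (contr P (kPlusExp P μ u) (texp P (.xPlus ν) i v))
      = (u - v) / (u - v - shiftK μ ν * (I * P.hbar)) := by
  rintro ⟨s, m, a⟩ hi
  obtain ⟨-, hm⟩ := mem_labels_xPlus.1 hi
  have hν := Finset.mem_Ico.1 ν.2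
  rw [Finset.mem_Icc] at hm
  have hs := norm_shiftK_le μ ν
  have hN : (0 : ℝ) ≤ P.N := Nat.cast_nonneg _
  rw [texp, exp_contr_eq_div h (a := -shiftK μ ν) (b := 0)
    (by rw [norm_neg, poleBound]; linarith [norm_nonneg P.k]) (by simp [poleBound]; positivity)
    fun t ht => kernel_kPlus_xPlus ht u v a hμ hμN hν.2 hm.1 hm.2]
  ring_nf

theorem exp_contr_xPlus_kMinus (h : radius P < (u - v).im) :
    ∀ i ∈ labels P (.xPlus ν), exp (-contr P (texp P (.xPlus ν) i v) (kMinusExp P μ u))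
      = (u - v) / (u - v - shiftK μ ν * (I * P.hbar)) := by
  rintro ⟨s, m, a⟩ hi
  obtain ⟨-, hm⟩ := mem_labels_xPlus.1 hi
  have hν := Finset.mem_Ico.1 ν.2
  rw [Finset.mem_Icc] at hm
  have hs := norm_shiftK_le μ ν
  have hN : (0 : ℝ) ≤ P.N := Nat.cast_nonneg _
  have h' : (v - u).im < -radius P := by rw [← neg_sub, neg_im]; linarith
  rw [texp, exp_neg, exp_contr_eq_div h' (a := 0) (b := shiftK μ ν)
    (by simp [poleBound]; positivity) (by rw [poleBound]; linarith [norm_nonneg P.k])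
    fun t ht => kernel_xPlus_kMinus ht v u a hν.2 hm.1 hm.2 hμ hμN, inv_div, ← neg_div_neg_eq]
  ring_nf

theorem exp_contr_kPlus_xMinus (h : (u - v).im < -radius P) :
    ∀ i ∈ labels P (.xMinus ν), exp (contr P (kPlusExp P μ u) (texp P (.xMinus ν) i v))
      = (u - v - shiftK μ ν * (I * P.hbar) + I * P.k * P.hbar) / (u - v + I * P.k * P.hbar) := by
  rintro ⟨s, m, a⟩ hi
  have hm := mem_labels_xMinus.1 hi
  have hν := Finset.mem_Ico.1 ν.2
  have hs := norm_shiftK_le μ ν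
  have hN : (0 : ℝ) ≤ P.N := Nat.cast_nonneg _
  have hk := norm_sub_le P.k (shiftK μ ν)
  rw [exp_contr_eq_div h (a := P.k) (b := P.k - shiftK μ ν)
    (by rw [poleBound]; linarith [norm_nonneg P.k]) (by rw [poleBound]; linarith [norm_nonneg P.k])
    fun t ht => ?_]
  · ring_nf
  · cases s <;> simp only [if_true, Bool.false_eq_true, if_false, Finset.mem_Icc] at hm
    · exact kernel_kPlus_xMinus₂ ht u v a hμ hμN hν.2 hν.1 hm.1.1 hm.1.2 hm.2
    · exact kernel_kPlus_xMinus₁ ht u v a hμ hμN hν.2 hm.1.1 hm.1.2 hm.2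

theorem exp_contr_xMinus_kMinus (h : radius P < (u - v).im) :
    ∀ i ∈ labels P (.xMinus ν), exp (-contr P (texp P (.xMinus ν) i v) (kMinusExp P μ u))
      = (u - v - shiftK μ ν * (I * P.hbar)) / (u - v) := by
  rintro ⟨s, m, a⟩ hi
  have hm := mem_labels_xMinus.1 hi
  have hν := Finset.mem_Ico.1 ν.2
  have hs := norm_shiftK_le μ ν
  have hN : (0 : ℝ) ≤ P.N := Nat.cast_nonneg _
  have h' : (v - u).im < -radius P := by rw [← neg_sub, neg_im]; linarith
  rw [exp_neg, exp_contr_eq_div h' (a := shiftK μ ν) (b := 0)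
    (by rw [poleBound]; linarith [norm_nonneg P.k]) (by simp [poleBound]; positivity)
    fun t ht => ?_, inv_div, ← neg_div_neg_eq]
  · ring_nf
  · cases s <;> simp only [if_true, Bool.false_eq_true, if_false, Finset.mem_Icc] at hm
    · exact kernel_xMinus₂_kMinus ht v u a hν.2 hν.1 hm.1.1 hm.1.2 hm.2 hμ hμN
    · exact kernel_xMinus₁_kMinus ht v u a hν.2 hm.1.1 hm.1.2 hm.2 hμ hμN

end

end

section
variable {P : Params}

/-! ### Exchange relations of the currents `X_ν^±` -/

theorem shift_ne_zero_of_lower {a w : ℂ} (ha : ‖a‖ ≤ poleBound P) (hw : w.im < -radius P) :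
    w + a * (I * P.hbar) ≠ 0 := shift_ne_zero ha (lt_abs.2 (.inr (lt_neg_of_lt_neg hw)))

/-- A common factor f may be inserted and a common factor g removed, since only separated arguments
matter and g does not vanish there. It serves to clear the poles for the Serre relations of X⁻ and
to remove the factor w when the indices are far apart. -/
theorem Exchange.rescale {J J' : Current P.N} {α β α' β' : ℂ → ℂ} {H H' : Label → Label → ℂ → ℂ}
    (h : Exchange P J J' α β H) (f g : ℂ → ℂ) (hg : ∀ w : ℂ, radius P < |w.im| → g w ≠ 0)
    (hα : ∀ w : ℂ, radius P < |w.im| → g w * α' w = f w * α w)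
    (hβ : ∀ w : ℂ, radius P < |w.im| → g w * β' w = f w * β w)
    (hH : ∀ i ∈ labels P J, ∀ j ∈ labels P J', ∀ w : ℂ, radius P < |w.im| →
      g w * H' i j w = f w * H i j w) : Exchange P J J' α' β' H' where
  lower i hi j hj u v huv := by
    have hw := lt_abs.2 (.inr (lt_neg_of_lt_neg huv))
    refine mul_left_cancel₀ (hg _ hw) ?_
    rw [hH i hi j hj _ hw, ← h.lower i hi j hj u v huv, ← mul_assoc, hα _ hw, mul_assoc]
  upper i hi j hj u v huv := by
    have hw := lt_abs.2 (.inl huv)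
    refine mul_left_cancel₀ (hg _ hw) ?_
    rw [hH i hi j hj _ hw, ← h.upper i hi j hj u v huv, ← mul_assoc, hβ _ hw, mul_assoc]

theorem norm_denPlus_le (ν ν' : ℕ) : ‖denPlus ν ν'‖ ≤ 1 := by
  unfold denPlus
  split_ifs <;> simp

theorem norm_numPlus_le (ν ν' m : ℕ) (a : Bool) (m' : ℕ) (a' : Bool) :
    ‖numPlus ν ν' m a m' a'‖ ≤ 1 := by
  unfold numPlus
  split_ifs <;> cases a <;> cases a' <;> simp [ind]

/-- The antisymmetry of the table expresses that the numerators in the two orders are the same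
linear function up to sign, as w changes into -w. -/
theorem numPlus_swap (ν ν' m : ℕ) (a : Bool) (m' : ℕ) (a' : Bool) :
    numPlus ν' ν m' a' m a = -numPlus ν ν' m a m' a' := by
  unfold numPlus
  have s0 : ν' = ν ∨ ν' = ν + 1 ∨ ν = ν' + 1 ∨ ν' + 2 ≤ ν ∨ ν + 2 ≤ ν' := by omega
  have s1 : m' < m ∨ m' = m ∨ m < m' := by omega
  rcases s0 with rfl | rfl | rfl | h | h <;> rcases s1 with h' | rfl | h' <;>
    simp (disch := omega) only [if_pos, if_neg, if_true] <;> ring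

theorem norm_le_poleBound_of_le {a : ℂ} {c : ℝ} (ha : ‖a‖ ≤ c) (hc : c ≤ 8) : ‖a‖ ≤ poleBound P :=
  norm_le_poleBound (by have := norm_nonneg P.k; have : (0 : ℝ) ≤ P.N := Nat.cast_nonneg _; linarith)

/-- Cancelling the denominators, which depend only on ν and ν', leaves for each pair of terms a
polynomial of degree one; hence products of X⁺ have no poles beyond the structure factors. -/
theorem exchange_xPlus (ν ν' : RootIdx P.N) :
    Exchange P (.xPlus ν) (.xPlus ν') (fun w => w + denPlus ν ν' * (I * P.hbar))
      (fun w => w - denPlus ν' ν * (I * P.hbar))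
      (fun i j w => w + numPlus ν ν' i.2.1 i.2.2 j.2.1 j.2.2 * (I * P.hbar)) where
  lower := by
    rintro ⟨s, m, a⟩ hi ⟨s', m', a'⟩ hj u v h
    have hν := (Finset.mem_Ico.1 ν.2).2
    have hν' := (Finset.mem_Ico.1 ν'.2).2
    obtain ⟨h1, h2⟩ := Finset.mem_Icc.1 (mem_labels_xPlus.1 hi).2
    obtain ⟨h3, h4⟩ := Finset.mem_Icc.1 (mem_labels_xPlus.1 hj).2
    have hd := norm_le_poleBound_of_le (P := P) (norm_denPlus_le ν ν') (by norm_num)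
    rw [texp, texp, exp_contr_eq_div h hd
      (norm_le_poleBound_of_le (norm_numPlus_le ν ν' m a m' a') (by norm_num))
      fun t ht => kernel_xPlus_xPlus ht u v a a' hν h1 h2 hν' h3 h4,
      mul_div_cancel₀ _ (shift_ne_zero_of_lower hd h)]
  upper := by
    rintro ⟨s, m, a⟩ hi ⟨s', m', a'⟩ hj u v h
    have hν := (Finset.mem_Ico.1 ν.2).2
    have hν' := (Finset.mem_Ico.1 ν'.2).2
    obtain ⟨h1, h2⟩ := Finset.mem_Icc.1 (mem_labels_xPlus.1 hi).2
    obtain ⟨h3, h4⟩ := Finset.mem_Icc.1 (mem_labels_xPlus.1 hj).2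
    have hd := norm_le_poleBound_of_le (P := P) (norm_denPlus_le ν' ν) (by norm_num)
    have h' : (v - u).im < -radius P := by rw [← neg_sub, neg_im]; linarith
    have e : u - v - denPlus ν' ν * (I * P.hbar) = -(v - u + denPlus ν' ν * (I * P.hbar)) := by ring
    rw [texp, texp, exp_contr_eq_div h' hd
      (norm_le_poleBound_of_le (norm_numPlus_le ν' ν m' a' m a) (by norm_num))
      fun t ht => kernel_xPlus_xPlus ht v u a' a hν' h3 h4 hν h1 h2, e, neg_mul,
      mul_div_cancel₀ _ (shift_ne_zero_of_lower hd h'), numPlus_swap]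
    ring

theorem norm_denMinus_le (ν ν' : ℕ) : ‖denMinus ν ν'‖ ≤ 1 := by
  unfold denMinus
  split_ifs <;> simp

theorem norm_numMinus_le (ν ν' : ℕ) : ‖numMinus ν ν'‖ ≤ 1 := by
  unfold numMinus
  split_ifs <;> simp

theorem norm_numMinus₁_le (ν ν' m : ℕ) (a : Bool) (m' : ℕ) (a' : Bool) :
    ‖numMinus₁ ν ν' m a m' a'‖ ≤ 1 := by
  unfold numMinus₁
  split_ifs <;> cases a <;> cases a' <;> simp [ind]

theorem norm_numMinus₂_le (ν ν' m : ℕ) (a : Bool) (m' : ℕ) (a' : Bool) :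
    ‖numMinus₂ ν ν' m a m' a'‖ ≤ 1 := by
  unfold numMinus₂
  split_ifs <;> cases a <;> cases a' <;> simp [ind]

theorem norm_epsMinus_le (ν ν' m : ℕ) (a : Bool) (m' : ℕ) (a' : Bool) :
    ‖epsMinus ν ν' m a m' a'‖ ≤ 1 := by
  unfold epsMinus
  split_ifs <;> cases a <;> cases a' <;> simp [ind]

theorem numMinus₁_swap (ν ν' m : ℕ) (a : Bool) (m' : ℕ) (a' : Bool) :
    numMinus₁ ν' ν m' a' m a = -numMinus₁ ν ν' m a m' a' := by
  unfold numMinus₁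
  have s0 : ν' = ν ∨ ν' = ν + 1 ∨ ν = ν' + 1 ∨ ν' + 2 ≤ ν ∨ ν + 2 ≤ ν' := by omega
  have s1 : m' < m ∨ m' = m ∨ m < m' := by omega
  rcases s0 with rfl | rfl | rfl | h | h <;> rcases s1 with h' | rfl | h' <;>
    simp (disch := omega) only [if_pos, if_neg, if_true] <;> ring

theorem numMinus₂_swap (ν ν' m : ℕ) (a : Bool) (m' : ℕ) (a' : Bool) :
    numMinus₂ ν' ν m' a' m a = -numMinus₂ ν ν' m a m' a' := by
  unfold numMinus₂
  have s0 : ν' = ν ∨ ν' = ν + 1 ∨ ν = ν' + 1 ∨ ν' + 2 ≤ ν ∨ ν + 2 ≤ ν' := by omega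
  have s1 : m' < m ∨ m' = m ∨ m < m' := by omega
  rcases s0 with rfl | rfl | rfl | h | h <;> rcases s1 with h' | rfl | h' <;>
    simp (disch := omega) only [if_pos, if_neg, if_true] <;> ring

/-- This compatibility makes the mixed terms of X⁻X⁻ agree in the two orders: in one of them the
structure factor survives as it stands, in the other it is replaced by the numerator `numMinus`. -/
theorem numMinus_swap (ν ν' : ℕ) : numMinus ν' ν = -denMinus ν ν' := by
  unfold numMinus denMinus
  have s0 : ν' = ν ∨ ν' = ν + 1 ∨ ν = ν' + 1 ∨ ν' + 2 ≤ ν ∨ ν + 2 ≤ ν' := by omega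
  rcases s0 with rfl | rfl | rfl | h | h <;> simp (disch := omega) only [if_neg, if_true] <;> ring

/-- The entire factor in the contractions of the terms of `X_ν⁻` and `X_ν'⁻`. -/
def polyMinus (P : Params) (ν ν' : ℕ) : Label → Label → ℂ → ℂ
  | (true, m, a), (true, m', a'), w => w + numMinus₁ ν ν' m a m' a' * (I * P.hbar)
  | (false, m, a), (false, m', a'), w => w + numMinus₂ ν ν' m a m' a' * (I * P.hbar)
  | (true, _, _), (false, _, _), w => w + denMinus ν ν' * (I * P.hbar)
  | (false, _, _), (true, _, _), w => w + numMinus ν ν' * (I * P.hbar)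

/-- The pole in the contractions of the terms of `X_ν⁻` and `X_ν'⁻`. -/
def poleMinus (P : Params) (ν ν' : ℕ) : Label → Label → ℂ
  | (true, _, _), (false, _, _) => ν + P.k
  | (false, _, _), (true, _, _) => -(ν' + P.k)
  | _, _ => 0

/-- The residue in the contractions of the terms of `X_ν⁻` and `X_ν'⁻`. -/
def resMinus (ν ν' : ℕ) : Label → Label → ℂ
  | (true, m, a), (false, m', a') => epsMinus ν ν' m a m' a'
  | (false, m, a), (true, m', a') => -epsMinus ν' ν m' a' m a
  | _, _ => 0

theorem norm_resMinus_le (ν ν' : ℕ) (i j : Label) : ‖resMinus ν ν' i j‖ ≤ 1 := by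
  obtain ⟨_ | _, m, a⟩ := i <;> obtain ⟨_ | _, m', a'⟩ := j <;>
    simp [resMinus, norm_epsMinus_le]

theorem norm_poleMinus_le {ν ν' : ℕ} (hν : ν < P.N) (hν' : ν' < P.N) (i j : Label) :
    ‖poleMinus P ν ν' i j‖ ≤ P.N + ‖P.k‖ := by
  have h : ∀ n : ℕ, n < P.N → ‖(n : ℂ) + P.k‖ ≤ P.N + ‖P.k‖ := fun n hn =>
    (norm_add_le _ _).trans (by
      rw [Complex.norm_natCast]
      have : (n : ℝ) ≤ P.N := by exact_mod_cast hn.le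
      linarith)
  obtain ⟨_ | _, m, a⟩ := i <;> obtain ⟨_ | _, m', a'⟩ := j <;>
    simp only [poleMinus, norm_neg, norm_zero, h _ hν, h _ hν'] <;> positivity

theorem one_add_res_div {r q w : ℂ} (h : w + q * (I * P.hbar) ≠ 0) :
    (w + (q + r) * (I * P.hbar)) / (w + q * (I * P.hbar))
      = 1 + r * (I * P.hbar) / (w + q * (I * P.hbar)) := by
  rw [div_eq_iff h, one_add_mul, div_mul_cancel₀ _ h]
  ring

/-- Separates an entire factor from at most one simple pole 1 + res/(w + pole). Terms from the same
sum have no pole. For a term of the first sum to the left of one of the second the contraction is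
the pole factor alone, so the structure factor itself remains as the entire factor. -/
theorem exp_contr_xMinus {ν ν' : RootIdx P.N} {i j : Label} (hi : i ∈ labels P (.xMinus ν))
    (hj : j ∈ labels P (.xMinus ν')) {u v : ℂ} (h : (u - v).im < -radius P) :
    (u - v + denMinus ν ν' * (I * P.hbar))
        * exp (contr P (texp P (.xMinus ν) i u) (texp P (.xMinus ν') j v))
      = polyMinus P ν ν' i j (u - v) * (1 + resMinus ν ν' i j * (I * P.hbar)
        / (u - v + poleMinus P ν ν' i j * (I * P.hbar))) := by
  have hν := Finset.mem_Ico.1 ν.2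
  have hν' := Finset.mem_Ico.1 ν'.2
  have hd := norm_le_poleBound_of_le (P := P) (norm_denMinus_le ν ν') (by norm_num)
  have hd0 := shift_ne_zero_of_lower hd h
  have hp := norm_poleMinus_le (P := P) hν.2 hν'.2 i j
  have hr := norm_resMinus_le ν ν' i j
  have hpr := norm_add_le (poleMinus P ν ν' i j) (resMinus ν ν' i j)
  have hp1 : ‖poleMinus P ν ν' i j‖ ≤ poleBound P :=
    norm_le_poleBound (by linarith [norm_nonneg P.k, Nat.cast_nonneg (α := ℝ) P.N])
  have hp2 : ‖poleMinus P ν ν' i j + resMinus ν ν' i j‖ ≤ poleBound P :=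
    norm_le_poleBound (by linarith [norm_nonneg P.k, Nat.cast_nonneg (α := ℝ) P.N])
  have hp0 := shift_ne_zero_of_lower hp1 h
  rw [← one_add_res_div hp0]
  have hm := mem_labels_xMinus.1 hi
  have hm' := mem_labels_xMinus.1 hj
  obtain ⟨_ | _, m, a⟩ := i <;> obtain ⟨_ | _, m', a'⟩ := j <;>
    simp only [if_true, Bool.false_eq_true, if_false, Finset.mem_Icc] at hm hm' <;>
    simp only [polyMinus, poleMinus, resMinus, texp] at *
  · rw [exp_contr_eq_div h hd (norm_le_poleBound_of_le (norm_numMinus₂_le ν ν' m a m' a')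
      (by norm_num)) fun t ht => kernel_xMinus₂_xMinus₂ ht u v a a' hν.2 hν.1 hm.1.1 hm.1.2 hm.2
        hν'.2 hν'.1 hm'.1.1 hm'.1.2 hm'.2, mul_div_cancel₀ _ hd0, add_zero, div_self hp0, mul_one]
  · rw [exp_contr_eq_ratio [(denMinus ν ν', numMinus ν ν'),
      (-(ν' + P.k), -(ν' + P.k) + -epsMinus ν' ν m' a' m a)] h (by
        simpa using ⟨⟨hd, norm_le_poleBound_of_le (norm_numMinus_le ν ν') (by norm_num)⟩,
          by simpa using hp1, by simpa using hp2⟩) fun t ht => by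
        rw [kernel_xMinus₂_xMinus₁ ht u v a a' hν.2 hν.1 hm.1.1 hm.1.2 hm.2
          hν'.2 hm'.1.1 hm'.1.2 hm'.2]
        simp [add_comm]]
    simp only [ratio, List.map_cons, List.map_nil, List.prod_cons, List.prod_nil, mul_one]
    rw [← mul_assoc, mul_div_cancel₀ _ hd0]
  · rw [exp_contr_eq_div h hp1 hp2 fun t ht => kernel_xMinus₁_xMinus₂ ht u v a a' hν.2 hm.1.1
      hm.1.2 hm.2 hν'.2 hν'.1 hm'.1.1 hm'.1.2 hm'.2]
  · rw [exp_contr_eq_div h hd (norm_le_poleBound_of_le (norm_numMinus₁_le ν ν' m a m' a')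
      (by norm_num)) fun t ht => kernel_xMinus₁_xMinus₁ ht u v a a' hν.2 hm.1.1 hm.1.2 hm.2
        hν'.2 hm'.1.1 hm'.1.2 hm'.2, mul_div_cancel₀ _ hd0, add_zero, div_self hp0, mul_one]

theorem polyMinus_swap (ν ν' : ℕ) (i j : Label) (w : ℂ) :
    polyMinus P ν' ν j i (-w) = -polyMinus P ν ν' i j w := by
  have h1 := numMinus_swap ν ν'
  have h2 := numMinus_swap ν' ν
  obtain ⟨_ | _, m, a⟩ := i <;> obtain ⟨_ | _, m', a'⟩ := j <;>
    simp only [polyMinus, numMinus₁_swap ν ν', numMinus₂_swap ν ν', h1, h2] <;> ring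

theorem resMinus_swap (ν ν' : ℕ) (i j : Label) : resMinus ν' ν j i = -resMinus ν ν' i j := by
  obtain ⟨_ | _, m, a⟩ := i <;> obtain ⟨_ | _, m', a'⟩ := j <;> simp [resMinus]

theorem poleMinus_swap (ν ν' : ℕ) (i j : Label) :
    poleMinus P ν' ν j i = -poleMinus P ν ν' i j := by
  obtain ⟨_ | _, m, a⟩ := i <;> obtain ⟨_ | _, m', a'⟩ := j <;> simp [poleMinus]

theorem exchange_xMinus (ν ν' : RootIdx P.N) :
    Exchange P (.xMinus ν) (.xMinus ν') (fun w => w + denMinus ν ν' * (I * P.hbar))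
      (fun w => w - denMinus ν' ν * (I * P.hbar))
      (fun i j w => polyMinus P ν ν' i j w * (1 + resMinus ν ν' i j * (I * P.hbar)
        / (w + poleMinus P ν ν' i j * (I * P.hbar)))) where
  lower _ hi _ hj _ _ h := exp_contr_xMinus hi hj h
  upper i hi j hj u v h := by
    have h' : (v - u).im < -radius P := by rw [← neg_sub, neg_im]; linarith
    have := exp_contr_xMinus hj hi h'
    rw [← neg_sub u v, polyMinus_swap, resMinus_swap, poleMinus_swap] at this
    have e : -(u - v) + -poleMinus P ν ν' i j * (I * P.hbar)
      = -(u - v + poleMinus P ν ν' i j * (I * P.hbar)) := by ring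
    rw [e, neg_mul _ (I * P.hbar), neg_div_neg_eq] at this
    linear_combination -this

/-- The pole in the contractions of the terms of `X_ν⁺` and `X_ν'⁻`. -/
def poleCross (P : Params) (ν ν' : ℕ) : Label → Label → ℂ
  | (_, m, a), (true, _, _) => denCross ν ν' m a
  | _, (false, _, _) => ν - ν' + P.k

/-- The residue in the contractions of the terms of `X_ν⁺` and `X_ν'⁻`. -/
def resCross (ν ν' : ℕ) : Label → Label → ℂ
  | (_, m, a), (true, m', a') => epsCross₁ ν ν' m a m' a'
  | (_, m, a), (false, m', a') => epsCross₂ ν ν' m a m' a'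

theorem norm_resCross_le (ν ν' : ℕ) (i j : Label) : ‖resCross ν ν' i j‖ ≤ 1 := by
  obtain ⟨_, m, a⟩ := i
  obtain ⟨_ | _, m', a'⟩ := j <;> simp only [resCross, epsCross₁, epsCross₂] <;> split_ifs <;>
    cases a <;> cases a' <;> simp [ind]

theorem norm_poleCross_le {ν ν' : RootIdx P.N} {i j : Label} (hi : i ∈ labels P (.xPlus ν)) :
    ‖poleCross P ν ν' i j‖ ≤ 2 * P.N + ‖P.k‖ + 2 := by
  have h : ∀ ν : RootIdx P.N, ‖((ν : ℕ) : ℂ)‖ ≤ P.N := fun ν => by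
    rw [Complex.norm_natCast]
    exact_mod_cast (Finset.mem_Ico.1 ν.2).2.le
  obtain ⟨_, m, a⟩ := i
  have hm := (mem_labels_xPlus.1 hi).2
  rw [Finset.mem_Icc] at hm
  have hm' : ‖(m : ℂ)‖ ≤ P.N := by
    rw [Complex.norm_natCast]
    exact_mod_cast hm.2.trans (Finset.mem_Ico.1 ν.2).2.le
  have ha : ‖ind a‖ ≤ 1 := by cases a <;> simp [ind]
  have hk := norm_nonneg P.k
  have hN := Nat.cast_nonneg (α := ℝ) P.N
  obtain ⟨_ | _, m', a'⟩ := j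
  · have h1 := norm_add_le ((ν : ℂ) - (ν' : ℕ)) P.k
    have h2 := norm_sub_le ((ν : ℕ) : ℂ) (ν' : ℕ)
    have := h ν
    have := h ν'
    exact h1.trans (by linarith)
  · simp only [poleCross, denCross]
    split_ifs
    · have h1 := norm_sub_le (1 - (m : ℂ)) (ind a)
      have h2 := norm_sub_le 1 (m : ℂ)
      rw [norm_one] at h2
      linarith
    · rw [norm_neg]
      linarith

/-- No structure factors are needed: each pair of terms has literally the same contraction in both
orders, equal to 1 plus at most one simple pole. -/
theorem exchange_xPlus_xMinus (ν ν' : RootIdx P.N) :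
    Exchange P (.xPlus ν) (.xMinus ν') (fun _ => 1) (fun _ => 1)
      (fun i j w => 1 + resCross ν ν' i j * (I * P.hbar)
        / (w + poleCross P ν ν' i j * (I * P.hbar))) where
  lower i hi j hj u v h := by
    have hν := Finset.mem_Ico.1 ν.2
    have hν' := Finset.mem_Ico.1 ν'.2
    have hp := norm_poleCross_le (ν' := ν') (j := j) hi
    have hr := norm_resCross_le ν ν' i j
    have hpr := norm_add_le (poleCross P ν ν' i j) (resCross ν ν' i j)
    have hp1 : ‖poleCross P ν ν' i j‖ ≤ poleBound P := norm_le_poleBound (by linarith)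
    have hp2 : ‖poleCross P ν ν' i j + resCross ν ν' i j‖ ≤ poleBound P :=
      norm_le_poleBound (by linarith)
    rw [← one_add_res_div (shift_ne_zero_of_lower hp1 h), one_mul]
    obtain ⟨_, m, a⟩ := i
    have hm := (mem_labels_xPlus.1 hi).2
    have hm' := mem_labels_xMinus.1 hj
    rw [Finset.mem_Icc] at hm
    refine exp_contr_eq_div h hp1 hp2 fun t ht => ?_
    obtain ⟨_ | _, m', a'⟩ := j <;>
      simp only [if_true, Bool.false_eq_true, if_false, Finset.mem_Icc] at hm'
    · exact kernel_xPlus_xMinus₂ ht u v a a' hν.2 hm.1 hm.2 hν'.2 hν'.1 hm'.1.1 hm'.1.2 hm'.2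
    · exact kernel_xPlus_xMinus₁ ht u v a a' hν.2 hm.1 hm.2 hν'.2 hm'.1.1 hm'.1.2 hm'.2
  upper i hi j hj u v h := by
    have hν := Finset.mem_Ico.1 ν.2
    have hν' := Finset.mem_Ico.1 ν'.2
    have hp := norm_poleCross_le (ν' := ν') (j := j) hi
    have hr := norm_resCross_le ν ν' i j
    have hpr := norm_add_le (poleCross P ν ν' i j) (resCross ν ν' i j)
    have hp1 : ‖poleCross P ν ν' i j‖ ≤ poleBound P := norm_le_poleBound (by linarith)
    have hp2 : ‖poleCross P ν ν' i j + resCross ν ν' i j‖ ≤ poleBound P :=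
      norm_le_poleBound (by linarith)
    have h' : (v - u).im < -radius P := by rw [← neg_sub, neg_im]; linarith
    have e : ∀ x : ℂ, u - v + x * (I * P.hbar) = -(v - u + -x * (I * P.hbar)) := fun x => by ring
    rw [← one_add_res_div (shift_ne_zero hp1 (lt_abs.2 (.inl h))), one_mul, e, e, neg_div_neg_eq]
    obtain ⟨_, m, a⟩ := i
    have hm := (mem_labels_xPlus.1 hi).2
    have hm' := mem_labels_xMinus.1 hj
    rw [Finset.mem_Icc] at hm
    refine exp_contr_eq_div h' (by rwa [norm_neg]) (by rwa [norm_neg]) fun t ht => ?_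
    obtain ⟨_ | _, m', a'⟩ := j <;>
      simp only [if_true, Bool.false_eq_true, if_false, Finset.mem_Icc] at hm'
    · exact kernel_xMinus₂_xPlus ht v u a' a hν'.2 hν'.1 hm'.1.1 hm'.1.2 hm'.2 hν.2 hm.1 hm.2
    · exact kernel_xMinus₁_xPlus ht v u a' a hν'.2 hm'.1.1 hm'.1.2 hm'.2 hν.2 hm.1 hm.2

end

/-! ### Cancellation of poles in pairs, and the Serre relations -/

section
variable {P : Params}

theorem coef_ne_zero (i : Label) : coef i ≠ 0 := by
  obtain ⟨_ | _, m, _ | _⟩ := i <;> simp [coef]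

/-- The exponent of a product of terms. -/
def texp₂ (J J' : Current P.N) (y : Label × Label) (x : ℂ × ℂ) : Exponent P :=
  texp P J y.1 x.1 + texp P J' y.2 x.2

/-- If the terms with a pole can be matched so that the residues and the exponents at the pole
agree, then the sum is regular. -/
theorem Probe.Reg.sum_pole {p : Probe P (radius P)} {J J' : Current P.N}
    {S : Finset (Label × Label)} (hS : S ⊆ labels P J ×ˢ labels P J')
    {Q : Label × Label → ℂ → ℂ} {q : ℂ → ℂ} {ε a : Label × Label → ℂ}
    (g : Label × Label → Label × Label) (hQ : ∀ y ∈ S, Differentiable ℂ (Q y))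
    (hq : Differentiable ℂ q) (ha : ∀ y ∈ S, ‖a y‖ ≤ poleBound P)
    (hg : ∀ y ∈ S, ε y ≠ 0 → g y ∈ S ∧ g (g y) = y ∧ a (g y) = a y ∧
      coef (g y).1 * coef (g y).2 * ε (g y) = -(coef y.1 * coef y.2 * ε y) ∧
      ∀ u v : ℂ, u - v + a y * (I * P.hbar) = 0 →
        texp₂ J J' y (u, v) = texp₂ J J' (g y) (u, v)) :
    p.Reg fun x => ∑ y ∈ S, coef y.1 * coef y.2
      * (Q y (x.1 - x.2) + q (x.1 - x.2) * (ε y / (x.1 - x.2 + a y * (I * P.hbar))))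
      * p.coeffOf (vertex P (texp₂ J J' y x)) := by
  classical
  have hmem : ∀ y ∈ S, texp₂ J J' y ∈ fieldsAt P {Prod.fst, Prod.snd} := fun y hy =>
    have h := Finset.mem_product.1 (hS hy)
    texp_add_mem h.1 h.2
  have r1 : p.Reg fun x => ∑ y ∈ S, coef y.1 * coef y.2 * Q y (x.1 - x.2)
      * p.coeffOf (vertex P (texp₂ J J' y x)) := Reg.sum S fun y hy =>
    ((Reg.of_differentiableOn (differentiableOn_const _)).mul
      (Reg.of_differentiable (hQ y hy))).mul (coeffOf_add_reg (hmem y hy))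
  -- The matching is defined only on the terms with nonzero residue; the others do not contribute to
  -- the polar part.
  have r2 : p.Reg fun x => ∑ y ∈ S.filter (ε · ≠ 0), q (x.1 - x.2) * (coef y.1 * coef y.2 * ε y
      * (1 / (x.1 - x.2 + a y * (I * P.hbar)) * p.coeffOf (vertex P (texp₂ J J' y x)))) := by
    refine Reg.sum_of_involution _ g (fun y hy => ?_) (fun y hy => ?_) fun y hy => ?_
    all_goals
      obtain ⟨hy, h0⟩ := Finset.mem_filter.1 hy
      obtain ⟨h1, h2, h3, h4, h5⟩ := hg y hy h0
    -- The partner has a nonzero residue, because its weighted residue is minus that of y and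
    -- coefficients do not vanish.
    · refine Finset.mem_filter.2 ⟨h1, fun h => ?_⟩
      rw [h, mul_zero, zero_eq_neg] at h4
      exact mul_ne_zero (mul_ne_zero (coef_ne_zero _) (coef_ne_zero _)) h0 h4
    · exact h2
    · refine (((Reg.of_differentiable hq).mul (Reg.of_differentiableOn
        (differentiableOn_const (coef y.1 * coef y.2 * ε y)))).mul
        (Reg.pole (hmem y hy) (hmem _ h1) (ha y hy) h5)).congr fun x _ _ => ?_
      rw [h3, h4]
      ring
  refine (r1.add r2).congr fun x _ _ => ?_
  rw [Finset.sum_filter, ← Finset.sum_add_distrib]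
  refine Finset.sum_congr rfl fun y _ => ?_
  split_ifs with h
  · ring
  · rw [not_not.1 h]
    ring

/-! ### The Serre relations -/

-- The numerators are already polynomial in w, so only the identity between the structure factors
-- has to be checked. The cases ν = μ + 1 and μ = ν + 1 differ in the values of α and β.
open Polynomial in
theorem serre_xPlus {μ ν : RootIdx P.N} (h : (ν : ℕ) = μ + 1 ∨ (μ : ℕ) = ν + 1) :
    SerreRelation (radius P) (psi P) (.xPlus μ) (.xPlus ν) := by
  set c := I * P.hbar
  have e1 : ∀ x : ℂ, (fun w => w + x) = (X + C x).eval := fun x => by funext w; simp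
  have e2 : ∀ x : ℂ, (fun w => w - x) = (X - C x).eval := fun x => by funext w; simp
  have h₀ := exchange_xPlus μ μ
  have h₁ := exchange_xPlus μ ν
  rw [e1, e2] at h₀ h₁
  refine serreRelation_of_exchange h₀ h₁ (fun i _ j _ => by fun_prop) (fun i _ j _ => by fun_prop)
    (X_add_C_ne_zero _) (X_sub_C_ne_zero _) (X_add_C_ne_zero _) (X_sub_C_ne_zero _) fun x y => ?_
  rcases h with h | h
  all_goals
    simp (disch := omega) only [denPlus, h, if_true, if_neg, eval_add, eval_sub, eval_X, eval_C]
    ring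

theorem resMinus_self (ν : ℕ) (i j : Label) : resMinus ν ν i j = 0 := by
  obtain ⟨_ | _, m, a⟩ := i <;> obtain ⟨_ | _, m', a'⟩ := j <;> simp [resMinus, epsMinus]

theorem differentiable_polyMinus (ν ν' : ℕ) (i j : Label) :
    Differentiable ℂ (polyMinus P ν ν' i j) := by
  obtain ⟨_ | _, m, a⟩ := i <;> obtain ⟨_ | _, m', a'⟩ := j <;> unfold polyMinus <;> fun_prop

/-- For equal indices `epsMinus` vanishes, since it requires ν' < ν; so X_ν⁻ with itself is as free
of poles as X⁺. -/
theorem exchange_xMinus_self (ν : RootIdx P.N) :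
    Exchange P (.xMinus ν) (.xMinus ν) (fun w => w + denMinus ν ν * (I * P.hbar))
      (fun w => w - denMinus ν ν * (I * P.hbar)) (polyMinus P ν ν) :=
  (exchange_xMinus ν ν).rescale 1 1 (fun _ _ => one_ne_zero) (fun _ _ => rfl) (fun _ _ => rfl)
    fun i _ j _ w _ => by rw [resMinus_self, zero_mul, zero_div, add_zero, mul_one]

/-- The factor that is not cancelled by the pole of a contraction. -/
def copoleMinus (P : Params) (ν ν' : ℕ) : Label → Label → ℂ → ℂ
  | (true, _, _), (false, _, _), w => w - (ν' + P.k) * (I * P.hbar)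
  | _, _, w => w + (ν + P.k) * (I * P.hbar)

theorem differentiable_copoleMinus (ν ν' : ℕ) (i j : Label) :
    Differentiable ℂ (copoleMinus P ν ν' i j) := by
  obtain ⟨_ | _, m, a⟩ := i <;> obtain ⟨_ | _, m', a'⟩ := j <;> unfold copoleMinus <;> fun_prop

theorem res_mul_copoleMinus (ν ν' : ℕ) (i j : Label) {w : ℂ}
    (h : w + poleMinus P ν ν' i j * (I * P.hbar) ≠ 0) (c : ℂ) :
    (w + (ν + P.k) * (I * P.hbar)) * (w - (ν' + P.k) * (I * P.hbar))
        * (resMinus ν ν' i j * c / (w + poleMinus P ν ν' i j * (I * P.hbar)))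
      = resMinus ν ν' i j * c * copoleMinus P ν ν' i j w := by
  obtain ⟨_ | _, m, a⟩ := i <;> obtain ⟨_ | _, m', a'⟩ := j <;>
    simp only [resMinus, poleMinus, copoleMinus, zero_mul, zero_div, mul_zero] at h ⊢
  · rw [mul_div_assoc', div_eq_iff h]
    ring
  · rw [mul_div_assoc', div_eq_iff h]
    ring

-- The Serre relation allows a fixed denominator, so the poles need not be cancelled against each
-- other here. Multiplying α, β and H by (w + A)(w - B) removes both possible poles. The identity
-- for α and β survives, because each of its monomials acquires the same factor in x and in y.
open Polynomial in
theorem serre_xMinus {μ ν : RootIdx P.N} (h : (ν : ℕ) = μ + 1 ∨ (μ : ℕ) = ν + 1) :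
    SerreRelation (radius P) (psi P) (.xMinus μ) (.xMinus ν) := by
  have e1 : ∀ x : ℂ, (fun w => w + x) = (X + C x).eval := fun x => by funext w; simp
  have e2 : ∀ x : ℂ, (fun w => w - x) = (X - C x).eval := fun x => by funext w; simp
  have h₀ := exchange_xMinus_self μ
  rw [e1, e2] at h₀
  set A : ℂ := (μ + P.k) * (I * P.hbar) with hA
  set B : ℂ := (ν + P.k) * (I * P.hbar) with hB
  have hμ := Finset.mem_Ico.1 μ.2
  have hν := Finset.mem_Ico.1 ν.2
  -- The two possible poles are w = -A (a term of the first sum, then one of the second) and w = B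
  -- (the other way round); `copoleMinus` is the linear factor left over after one of them has been
  -- used.
  have h₁ := (exchange_xMinus μ ν).rescale
    (α' := ((X + C A) * (X - C B) * (X + C (denMinus μ ν * (I * P.hbar)))).eval)
    (β' := ((X + C A) * (X - C B) * (X - C (denMinus ν μ * (I * P.hbar)))).eval)
    (H' := fun i j w => polyMinus P μ ν i j w * ((w + A) * (w - B)
      + resMinus μ ν i j * (I * P.hbar) * copoleMinus P μ ν i j w))
    (fun w => (w + A) * (w - B)) 1 (fun _ _ => one_ne_zero) (fun w _ => by simp)
    (fun w _ => by simp) fun i hi j hj w hw => by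
      have h0 := shift_ne_zero (P := P) (a := poleMinus P μ ν i j) (norm_le_poleBound
        ((norm_poleMinus_le hμ.2 hν.2 i j).trans
          (by linarith [Nat.cast_nonneg (α := ℝ) P.N]))) hw
      rw [Pi.one_apply, one_mul, ← res_mul_copoleMinus μ ν i j h0]
      ring
  refine serreRelation_of_exchange h₀ h₁ (fun i _ j _ => differentiable_polyMinus _ _ _ _)
    (fun i _ j _ => ?_) (X_add_C_ne_zero _) (X_sub_C_ne_zero _)
    (mul_ne_zero (mul_ne_zero (X_add_C_ne_zero _) (X_sub_C_ne_zero _)) (X_add_C_ne_zero _))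
    (mul_ne_zero (mul_ne_zero (X_add_C_ne_zero _) (X_sub_C_ne_zero _)) (X_sub_C_ne_zero _))
    fun x y => ?_
  · have := differentiable_polyMinus (P := P) μ ν i j
    have := differentiable_copoleMinus (P := P) μ ν i j
    fun_prop
  rcases h with h | h
  all_goals
    simp (disch := omega) only [denMinus, h, if_true, if_neg, eval_add, eval_sub, eval_mul, eval_X,
      eval_C]
    ring

end

/-! ### Coincidence of exponents at the poles -/

section
variable (P : Params) (μ a b : ℕ) (v c r : ℂ)

theorem sh_add : sh P (v + c * (I * P.hbar)) r = sh P v (r + c) := by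
  simp only [sh]
  ring

theorem lamPlus_shift : lamPlus P μ (v + c * (I * P.hbar)) r = lamPlus P μ v (r + c) := by
  rw [lamPlus, lamPlus, sh_add]

theorem lamMinus_shift : lamMinus P μ (v + c * (I * P.hbar)) r = lamMinus P μ v (r + c) := by
  rw [lamMinus, lamMinus, sh_add]

theorem bPlus_shift : bPlus P a b (v + c * (I * P.hbar)) r = bPlus P a b v (r + c) := by
  rw [bPlus, bPlus, sh_add]

theorem bMinus_shift : bMinus P a b (v + c * (I * P.hbar)) r = bMinus P a b v (r + c) := by
  rw [bMinus, bMinus, sh_add]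

theorem bc_shift : bc P a b (v + c * (I * P.hbar)) r = bc P a b v (r + c) := by
  rw [bc, bc, sh_add]

end

section
variable {P : Params} {u v : ℂ}

theorem eq_add_of_pole {a : ℂ} (h : u - v + a * (I * P.hbar) = 0) :
    u = v + -a * (I * P.hbar) := by
  linear_combination h

theorem sum_Icc_succ_bot {M : Type*} [AddCommMonoid M] {m n : ℕ} (h : m ≤ n) (f : ℕ → M) :
    ∑ i ∈ Finset.Icc m n, f i = f m + ∑ i ∈ Finset.Icc (m + 1) n, f i := by
  rw [← Finset.Ico_add_one_right_eq_Icc, ← Finset.Ico_add_one_right_eq_Icc,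
    Finset.sum_eq_sum_Ico_succ_bot (by omega)]

/-- At this pole each (b+c) field of X⁺ meets its inverse from X⁻ at the same point. Only a product
over n remains, with b⁺ for n ≤ m and b⁻ for n > m, and it arises from both sides of the cut between
m and m + 1. -/
theorem xPlus_xMinus₁_succ {ν m : ℕ} (hm : 1 ≤ m) (hmν : m < ν)
    (h : u - v + (-m) * (I * P.hbar) = 0) :
    xPlusExp P ν m true u + xMinusExp₁ P ν m false v
      = xPlusExp P ν (m + 1) false u + xMinusExp₁ P ν (m + 1) true v := by
  rw [eq_add_of_pole h]
  simp only [xPlusExp, xMinusExp₁, bPlus_shift, bMinus_shift, bc_shift]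
  rw [Finset.sum_Ico_succ_top hm, sum_Icc_succ_bot (m := m + 1) hmν]
  simp only [Finset.sum_sub_distrib]
  push_cast
  ring_nf
  abel

/-- The two flags govern fields of the same boson b_{m,ν+1}, and at the pole these fields sit at the
same points; so the flags may be interchanged. -/
theorem xPlus_xMinus₁_swap {ν m : ℕ} (a a' : Bool)
    (h : u - v + (-m) * (I * P.hbar) = 0) :
    xPlusExp P ν m a u + xMinusExp₁ P (ν + 1) m a' v
      = xPlusExp P ν m a' u + xMinusExp₁ P (ν + 1) m a v := by
  rw [eq_add_of_pole h]
  cases a <;> cases a' <;>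
  simp only [xPlusExp, xMinusExp₁, bPlus_shift, bMinus_shift, bc_shift] <;>
  push_cast <;>
  ring_nf <;>
  abel

/-- The lower end of the chain of coincidences: for m = 1 all (b+c) and b⁺ fields are gone, and the
remaining b⁻ form the difference of two adjacent double products of k⁻. -/
theorem xPlus_xMinus₁_one {ν : ℕ} (hν : 1 ≤ ν) (hνN : ν < P.N) (h : u - v = 0) :
    xPlusExp P ν 1 false u + xMinusExp₁ P ν 1 true v = kMinusExp P (ν + 1) v - kMinusExp P ν v := by
  rw [sub_eq_zero.1 h]
  have e : ∀ f : ℕ → Exponent P, ∑ n ∈ Finset.Icc 1 ν, f n = (∑ n ∈ Finset.Ico 1 ν, f n) + f ν :=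
    fun f => by rw [← Finset.Ico_add_one_right_eq_Icc, Finset.sum_Ico_succ_top hν]
  have e' : ∀ f : ℕ → Exponent P,
      ∑ n ∈ Finset.Icc (1 + 1) ν, f n = (∑ n ∈ Finset.Ico 1 ν, f n) + f ν - f 1 :=
    fun f => by rw [← e, sum_Icc_succ_bot hν, add_sub_cancel_left]
  simp only [xPlusExp, xMinusExp₁, kMinusExp, e', Finset.Ico_self, Finset.sum_empty,
    Finset.sum_Ico_succ_top hν, Finset.sum_Icc_succ_top (Nat.le_add_left 1 ν), e,
    sum_Icc_succ_bot (m := ν) (n := P.N) hνN.le, sum_Icc_succ_bot (m := ν + 1) (n := P.N) hνN,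
    Finset.sum_add_distrib, Finset.sum_sub_distrib, bMinus_self]
  push_cast
  ring_nf
  abel

/-- On the left the two fields of b_{ν',ν+1} cancel, on the right those of b_{ν'+1,ν}. In both cases
the fields of b_{ν',ν} and b_{ν'+1,ν+1} remain, only with the roles of the two currents exchanged.
-/
theorem xPlus_xMinus₂_exchange {ν ν' : ℕ} (a : Bool) (hν'0 : 1 ≤ ν') (hνN : ν < P.N)
    (h : u - v + (ν - ν' + P.k) * (I * P.hbar) = 0) :
    xPlusExp P ν ν' true u + xMinusExp₂ P ν' (ν + 1) a v
      = xPlusExp P ν (ν' + 1) a u + xMinusExp₂ P ν' ν true v := by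
  rw [eq_add_of_pole h]
  cases a <;>
  simp only [xPlusExp, xMinusExp₂, bPlus_shift, bMinus_shift, bc_shift]
  all_goals
    rw [Finset.sum_Ico_succ_top hν'0, sum_Icc_succ_bot (m := ν) hνN.le]
    push_cast
    ring_nf
    abel

theorem xPlus_xMinus₂_swap {ν ν' : ℕ} (a a' : Bool)
    (h : u - v + (ν - ν' + P.k) * (I * P.hbar) = 0) :
    xPlusExp P ν (ν' + 1) a u + xMinusExp₂ P ν' (ν + 1) a' v
      = xPlusExp P ν (ν' + 1) a' u + xMinusExp₂ P ν' (ν + 1) a v := by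
  rw [eq_add_of_pole h]
  cases a <;> cases a' <;>
  simp only [xPlusExp, xMinusExp₂, bPlus_shift, bMinus_shift, bc_shift] <;>
  push_cast <;>
  ring_nf <;>
  abel

/-- The upper end: the bosons with equal indices vanish, the two fields of b_{ν,ν+1} cancel, and the
b⁺ tails together with λ_ν⁺ and λ_{ν+1}⁺ form the quotient of two adjacent k⁺. -/
theorem xPlus_xMinus₂_top {ν : ℕ} (hν : 1 ≤ ν) (hνN : ν < P.N)
    (h : u - v + P.k * (I * P.hbar) = 0) :
    xPlusExp P ν ν true u + xMinusExp₂ P ν (ν + 1) true v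
      = kPlusExp P (ν + 1) u - kPlusExp P ν u := by
  rw [eq_add_of_pole h]
  simp only [xPlusExp, xMinusExp₂, kPlusExp, bPlus_shift, bc_shift, lamPlus_shift, bc_self, bPlus_self,
    Finset.sum_Ico_succ_top hν, sum_Icc_succ_bot (m := ν + 1) (n := P.N) hνN,
    Finset.sum_sub_distrib]
  push_cast
  ring_nf
  abel

/-- The same exchange of corners between two currents X⁻: opposite corners of the square {ν', ν' +
1} × {ν, ν + 1} produce the same exponent at the pole. -/
theorem xMinus₁_xMinus₂_exchange {ν ν' : ℕ} (a : Bool) (hν : ν' < ν) (hνN : ν < P.N)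
    (h : u - v + (ν + P.k) * (I * P.hbar) = 0) :
    xMinusExp₁ P ν ν' false u + xMinusExp₂ P ν' ν a v
      = xMinusExp₁ P ν (ν' + 1) a u + xMinusExp₂ P ν' (ν + 1) false v := by
  rw [eq_add_of_pole h]
  cases a <;>
  simp only [xMinusExp₁, xMinusExp₂, bPlus_shift, bMinus_shift, bc_shift, lamMinus_shift]
  all_goals
    rw [sum_Icc_succ_bot (m := ν' + 1) hν, sum_Icc_succ_bot (m := ν) hνN.le]
    push_cast
    ring_nf
    abel

theorem xMinus₁_xMinus₂_swap {ν ν' : ℕ} (a a' : Bool)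
    (h : u - v + (ν + P.k) * (I * P.hbar) = 0) :
    xMinusExp₁ P ν (ν' + 1) a u + xMinusExp₂ P ν' ν a' v
      = xMinusExp₁ P ν (ν' + 1) a' u + xMinusExp₂ P ν' ν a v := by
  rw [eq_add_of_pole h]
  cases a <;> cases a' <;>
  simp only [xMinusExp₁, xMinusExp₂, bPlus_shift, bMinus_shift, bc_shift, lamMinus_shift] <;>
  push_cast <;>
  ring_nf <;>
  abel

end

section
variable {P : Params}

theorem Probe.EqUpToReg.swap {R : ℝ} {p : Probe P R} {ψ : Realization P}
    {A B C : ℂ → ℂ → FreeCurrents P} (h : p.EqUpToReg ψ A B C) :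
    p.EqUpToReg ψ (fun u v => B v u) (fun u v => A v u) (fun u v => C v u) := by
  obtain ⟨M, hM, e⟩ := h
  refine ⟨fun x => M (x.2, x.1), hM.comp (by fun_prop) fun x hx => ⟨hx.2, hx.1⟩,
    fun u hu v hv => ⟨fun huv => (e v hv u hu).2 ?_, fun huv => (e v hv u hu).1 ?_⟩⟩ <;>
  · rw [← neg_sub, neg_im]
    linarith

/-! ### Regularity of the exchange relations of the currents `X_ν⁻` -/

/-- The matching of the poles in the products of `X_ν⁻` and `X_ν'⁻`. -/
def matchMinus (ν ν' : ℕ) : Label × Label → Label × Label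
  | ((_, m, a), (_, m', a')) =>
    if m = ν' then ((true, ν' + 1, a'), (false, ν + 1, false))
    else if m' = ν then ((true, m, a'), (false, m', a))
    else ((true, ν', false), (false, ν, a))

/-- A nonzero residue forces one of three corners. The corners (ν', ν) and (ν' + 1, ν + 1) are
matched with each other, the flag that is free moving from one current to the other. At the corner
(ν' + 1, ν) the flags are different and the partner has them interchanged. In each case the weighted
residues are opposite. -/
theorem matchMinus_spec {ν ν' : RootIdx P.N} (h : (ν' : ℕ) < ν) {y : Label × Label}
    (hy : y ∈ labels P (.xMinus ν) ×ˢ labels P (.xMinus ν')) (hε : resMinus ν ν' y.1 y.2 ≠ 0) :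
    matchMinus ν ν' y ∈ labels P (.xMinus ν) ×ˢ labels P (.xMinus ν') ∧
    matchMinus ν ν' (matchMinus ν ν' y) = y ∧
    poleMinus P ν ν' (matchMinus ν ν' y).1 (matchMinus ν ν' y).2 = poleMinus P ν ν' y.1 y.2 ∧
    coef (matchMinus ν ν' y).1 * coef (matchMinus ν ν' y).2
        * resMinus ν ν' (matchMinus ν ν' y).1 (matchMinus ν ν' y).2
      = -(coef y.1 * coef y.2 * resMinus ν ν' y.1 y.2) ∧
    ∀ u v : ℂ, u - v + poleMinus P ν ν' y.1 y.2 * (I * P.hbar) = 0 →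
      texp₂ (.xMinus ν) (.xMinus ν') y (u, v)
        = texp₂ (.xMinus ν) (.xMinus ν') (matchMinus ν ν' y) (u, v) := by
  have hν := Finset.mem_Ico.1 ν.2
  have hν' := Finset.mem_Ico.1 ν'.2
  obtain ⟨⟨s, m, a⟩, ⟨s', m', a'⟩⟩ := y
  simp only [Finset.mem_product, mem_labels_xMinus] at hy ⊢
  obtain ⟨hi, hj⟩ := hy
  cases s <;> cases s'
  · simp [resMinus] at hε
  · simp [resMinus, epsMinus, h.not_gt] at hε
  swap
  · simp [resMinus] at hε
  simp only [if_true, Bool.false_eq_true, if_false, Finset.mem_Icc] at hi hj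
  simp only [resMinus, epsMinus, if_pos h] at hε
  split_ifs at hε with h1 h2 h3
  · obtain ⟨rfl, rfl⟩ := h1
    cases a
    swap
    · simp [ind] at hε
    simp (disch := omega) only [matchMinus, if_true, if_neg, poleMinus, resMinus, epsMinus, if_pos h,
      true_and, and_self, texp₂, texp, Bool.false_eq_true, if_false, Finset.mem_Icc]
    exact ⟨⟨⟨⟨by omega, by omega⟩, by grind⟩, ⟨by omega, by omega⟩, .inr (by omega)⟩,
      by cases a' <;> simp [coef, ind], fun u v => xMinus₁_xMinus₂_exchange a' h hν.2⟩
  · obtain ⟨rfl, rfl⟩ := h2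
    simp (disch := omega) only [matchMinus, if_true, if_neg, poleMinus, resMinus, epsMinus, if_pos h,
      true_and, and_self, texp₂, texp, Bool.false_eq_true, if_false, Finset.mem_Icc]
    refine ⟨⟨⟨⟨by omega, by omega⟩, by grind⟩, ⟨by omega, by omega⟩, by grind⟩,
      by cases a <;> cases a' <;> simp [coef, ind], fun u v => xMinus₁_xMinus₂_swap a a'⟩
  · obtain ⟨rfl, rfl⟩ := h3
    cases a'
    swap
    · simp [ind] at hε
    simp (disch := omega) only [matchMinus, if_true, if_neg, poleMinus, resMinus, epsMinus, if_pos h,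
      true_and, and_self, texp₂, texp, Bool.false_eq_true, if_false, Finset.mem_Icc]
    exact ⟨⟨⟨⟨by omega, by omega⟩, .inr h⟩, ⟨by omega, by omega⟩, by grind⟩,
      by cases a <;> simp [coef, ind], fun u v huv => (xMinus₁_xMinus₂_exchange a h hν.2 huv).symm⟩
  · exact absurd rfl hε

/-- For ν' < ν only a term of the first sum of X_ν⁻ against one of the second sum of X_ν'⁻ can have
a pole. The hypothesis that all these share the entire factor f is what allows the residues to
cancel in pairs. -/
theorem reg_xMinus {ν ν' : RootIdx P.N} (h : (ν' : ℕ) < ν) (p : Probe P (radius P)) {f : ℂ → ℂ}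
    {Q : Label → Label → ℂ → ℂ} (hf : Differentiable ℂ f)
    (hQ : ∀ i j, Differentiable ℂ (Q i j)) (hfQ : ∀ m a m' a', Q (true, m, a) (false, m', a') = f) :
    p.Reg fun x => ∑ y ∈ labels P (.xMinus ν) ×ˢ labels P (.xMinus ν'), coef y.1 * coef y.2
      * (Q y.1 y.2 (x.1 - x.2) * (1 + resMinus ν ν' y.1 y.2 * (I * P.hbar)
        / (x.1 - x.2 + poleMinus P ν ν' y.1 y.2 * (I * P.hbar))))
      * p.coeffOf (vertex P (texp P (.xMinus ν) y.1 x.1 + texp P (.xMinus ν') y.2 x.2)) := by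
  refine (Probe.Reg.sum_pole (p := p) (Finset.Subset.refl _) (matchMinus ν ν')
    (Q := fun y => Q y.1 y.2) (q := fun w => f w * (I * P.hbar))
    (ε := fun y => resMinus ν ν' y.1 y.2) (a := fun y => poleMinus P ν ν' y.1 y.2)
    (fun y _ => hQ _ _) (hf.mul_const _) (fun y _ => norm_le_poleBound
      ((norm_poleMinus_le (Finset.mem_Ico.1 ν.2).2 (Finset.mem_Ico.1 ν'.2).2 _ _).trans
        (by linarith [Nat.cast_nonneg (α := ℝ) P.N])))
    fun y hy hε => matchMinus_spec h hy hε).congr fun x _ _ =>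
      Finset.sum_congr rfl fun y _ => ?_
  congr 2
  obtain ⟨⟨_ | _, m, a⟩, ⟨_ | _, m', a'⟩⟩ := y <;>
    simp only [resMinus, epsMinus, if_neg h.not_gt, hfQ] <;> ring

theorem eqUpToReg_xMinus_self (ν : RootIdx P.N) (p : Probe P (radius P)) :
    p.EqUpToReg (psi P)
      (fun u v => (u - v - I * P.hbar) • (cur (.xMinus ν) u * cur (.xMinus ν) v))
      (fun u v => (u - v + I * P.hbar) • (cur (.xMinus ν) v * cur (.xMinus ν) u)) 0 :=
  (exchange_xMinus_self ν).eqUpToReg_zero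
    (fun u v => by simp [denMinus, sub_eq_add_neg]) (fun u v => by simp [denMinus])
    (Probe.Reg.sum _ fun _ hy => Probe.Reg.exchange_term hy (differentiable_polyMinus _ _ _ _))

/-- Regularity is available with the larger index on the left. The stated relation has the smaller
one there, so it is obtained by interchanging u and v; this turns w into -w and explains the signs.
-/
theorem exchange_xMinus_pred {μ ν : RootIdx P.N} (h : (ν : ℕ) = μ + 1) :
    Exchange P (.xMinus ν) (.xMinus μ) (fun w => -w - I * P.hbar) (fun w => -w)
      fun i j w => -polyMinus P ν μ i j w * (1 + resMinus ν μ i j * (I * P.hbar)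
        / (w + poleMinus P ν μ i j * (I * P.hbar))) := by
  have h1 : denMinus ν μ = 1 := by simp (disch := omega) only [denMinus, h, if_neg, if_true]
  have h2 : denMinus μ ν = 0 := by simp (disch := omega) only [denMinus, h, if_neg, if_true]
  refine (exchange_xMinus ν μ).rescale (fun _ => -1) 1 (fun _ _ => one_ne_zero) (fun w _ => ?_)
    (fun w _ => ?_) fun i _ j _ w _ => ?_
  · rw [h1, Pi.one_apply]
    ring
  · rw [h2, Pi.one_apply]
    ring
  · rw [Pi.one_apply]
    ring

theorem eqUpToReg_xMinus_succ {μ ν : RootIdx P.N} (h : (ν : ℕ) = μ + 1) (p : Probe P (radius P)) :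
    p.EqUpToReg (psi P)
      (fun u v => (u - v) • (cur (.xMinus μ) u * cur (.xMinus ν) v))
      (fun u v => (u - v - I * P.hbar) • (cur (.xMinus ν) v * cur (.xMinus μ) u)) 0 := by
  have hr := reg_xMinus (by omega : (μ : ℕ) < ν) p
    (f := fun w => -(w + denMinus ν μ * (I * P.hbar)))
    (Q := fun i j w => -polyMinus P ν μ i j w) (by fun_prop)
    (fun i j => (differentiable_polyMinus ν μ i j).neg) fun _ _ _ _ => rfl
  have := (exchange_xMinus_pred h).eqUpToReg_zero
    (A := fun u v => (v - u - I * P.hbar) • (cur (.xMinus ν) u * cur (.xMinus μ) v))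
    (B := fun u v => (v - u) • (cur (.xMinus μ) v * cur (.xMinus ν) u))
    (fun u v => by rw [neg_sub]) (fun u v => by rw [neg_sub]) hr
  exact this.swap

theorem denMinus_far {μ ν : ℕ} (h : μ + 2 ≤ ν ∨ ν + 2 ≤ μ) : denMinus μ ν = 0 := by
  simp (disch := omega) only [denMinus, if_neg]

theorem denPlus_far {μ ν : ℕ} (h : μ + 2 ≤ ν ∨ ν + 2 ≤ μ) : denPlus μ ν = 0 := by
  simp (disch := omega) only [denPlus, if_neg]

/-- For distant indices the structure factors and the entire factors are all equal to w. Removing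
this common factor gives the relation without prefactors; the poles still have to be cancelled by
the matching. -/
theorem eqUpToReg_xMinus_far_of_lt {μ ν : RootIdx P.N} (h : (ν : ℕ) + 2 ≤ μ) (p : Probe P (radius P)) :
    p.EqUpToReg (psi P)
      (fun u v => cur (.xMinus μ) u * cur (.xMinus ν) v)
      (fun u v => cur (.xMinus ν) v * cur (.xMinus μ) u) 0 :=
  ((exchange_xMinus μ ν).rescale 1 (fun w => w)
    (fun w hw h0 => by
      rw [h0, zero_im, abs_zero] at hw
      exact (radius_nonneg P).not_gt hw)
    (α' := 1) (β' := 1)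
    (H' := fun i j w => 1 * (1 + resMinus μ ν i j * (I * P.hbar)
        / (w + poleMinus P μ ν i j * (I * P.hbar))))
    (fun w _ => by simp [denMinus_far (.inr h)]) (fun w _ => by simp [denMinus_far (.inl h)]) fun i _ j _ w _ => by
      obtain ⟨_ | _, m, a⟩ := i <;> obtain ⟨_ | _, m', a'⟩ := j <;>
      simp (disch := omega) only [polyMinus, numMinus₁, numMinus₂, denMinus, numMinus, if_neg,
        zero_mul, add_zero, Pi.one_apply, one_mul]).eqUpToReg_zero
    (fun u v => by rw [Pi.one_apply, one_smul]) (fun u v => by rw [Pi.one_apply, one_smul])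
    (reg_xMinus (by omega) p (f := fun _ => 1) (Q := fun _ _ _ => 1) (by fun_prop) (by fun_prop)
      fun _ _ _ _ => rfl)

/-! ### Regularity of the exchange relations of the currents `X_ν⁺` -/

/-- The contractions, freed of their common denominator, are polynomial, so regularity holds term by
term without any matching. -/
theorem eqUpToReg_xPlus (μ ν : RootIdx P.N) (p : Probe P (radius P)) :
    p.EqUpToReg (psi P)
      (fun u v => (u - v + denPlus μ ν * (I * P.hbar)) • (cur (.xPlus μ) u * cur (.xPlus ν) v))
      (fun u v => (u - v - denPlus ν μ * (I * P.hbar)) • (cur (.xPlus ν) v * cur (.xPlus μ) u)) 0 :=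
  (exchange_xPlus μ ν).eqUpToReg_zero (fun _ _ => rfl) (fun _ _ => rfl)
    (Probe.Reg.sum _ fun y hy => Probe.Reg.exchange_term
      (H := fun i j w => w + numPlus μ ν i.2.1 i.2.2 j.2.1 j.2.2 * (I * P.hbar)) hy (by fun_prop))

theorem eqUpToReg_xPlus_far {μ ν : RootIdx P.N} (h : (μ : ℕ) + 2 ≤ ν ∨ (ν : ℕ) + 2 ≤ μ)
    (p : Probe P (radius P)) :
    p.EqUpToReg (psi P)
      (fun u v => cur (.xPlus μ) u * cur (.xPlus ν) v)
      (fun u v => cur (.xPlus ν) v * cur (.xPlus μ) u) 0 :=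
  ((exchange_xPlus μ ν).rescale 1 (fun w => w)
    (fun w hw h0 => by
      rw [h0, zero_im, abs_zero] at hw
      exact (radius_nonneg P).not_gt hw)
    (α' := 1) (β' := 1) (H' := 1)
    (fun w _ => by simp [denPlus_far h]) (fun w _ => by simp [denPlus_far h.symm])
    fun i _ j _ w _ => by
      simp (disch := omega) only [numPlus, if_neg, zero_mul, add_zero, Pi.one_apply, one_mul,
        mul_one]).eqUpToReg_zero
    (fun u v => by rw [Pi.one_apply, one_smul]) (fun u v => by rw [Pi.one_apply, one_smul])
    (Probe.Reg.sum _ fun _ hy => Probe.Reg.exchange_term hy (differentiable_const _))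

end

section
variable {P : Params}

/-! ### The commutators of the currents `X_ν⁺` and `X_ν⁻` -/

/-- The matching of the poles in the products of `X_ν⁺` and `X_ν'⁻` for different `ν` and `ν'`. -/
def matchCross (ν ν' : ℕ) : Label × Label → Label × Label
  | ((_, m, a), (s, m', a')) =>
    if s = false ∧ m = ν' then ((true, ν' + 1, a'), (false, ν, true))
    else if s = false ∧ m' = ν then ((true, ν', true), (false, ν + 1, a))
    else ((true, m, a'), (s, m', a))

/-- Against the first sum poles occur only for ν' = ν + 1 and m' = m with different flags, and
interchanging the flags gives the partner. Against the second sum they need ν' < ν and are matched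
between opposite corners or by interchanging flags, as for two currents X⁻. -/
theorem matchCross_spec {ν ν' : RootIdx P.N} (h : ν ≠ ν') {y : Label × Label}
    (hy : y ∈ labels P (.xPlus ν) ×ˢ labels P (.xMinus ν')) (hε : resCross ν ν' y.1 y.2 ≠ 0) :
    matchCross ν ν' y ∈ labels P (.xPlus ν) ×ˢ labels P (.xMinus ν') ∧
    matchCross ν ν' (matchCross ν ν' y) = y ∧
    poleCross P ν ν' (matchCross ν ν' y).1 (matchCross ν ν' y).2 = poleCross P ν ν' y.1 y.2 ∧
    coef (matchCross ν ν' y).1 * coef (matchCross ν ν' y).2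
        * resCross ν ν' (matchCross ν ν' y).1 (matchCross ν ν' y).2
      = -(coef y.1 * coef y.2 * resCross ν ν' y.1 y.2) ∧
    ∀ u v : ℂ, u - v + poleCross P ν ν' y.1 y.2 * (I * P.hbar) = 0 →
      texp₂ (.xPlus ν) (.xMinus ν') y (u, v)
        = texp₂ (.xPlus ν) (.xMinus ν') (matchCross ν ν' y) (u, v) := by
  have hν := Finset.mem_Ico.1 ν.2
  have hν' := Finset.mem_Ico.1 ν'.2
  have hne : (ν' : ℕ) ≠ ν := fun e => h (Subtype.ext e.symm)
  obtain ⟨⟨s, m, a⟩, ⟨s', m', a'⟩⟩ := y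
  simp only [Finset.mem_product, mem_labels_xMinus, mem_labels_xPlus] at hy ⊢
  obtain ⟨⟨rfl, hi⟩, hj⟩ := hy
  rw [Finset.mem_Icc] at hi
  cases s'
  · simp only [Bool.false_eq_true, if_false, Finset.mem_Icc] at hj
    simp only [resCross, epsCross₂, if_neg hne] at hε
    split_ifs at hε with h0 h1 h2 h3
    · obtain ⟨rfl, rfl⟩ := h1
      cases a
      · simp [ind] at hε
      simp (disch := omega) only [matchCross, if_true, if_neg, poleCross, resCross, epsCross₂,
        if_pos h0, true_and, and_self, texp₂, texp, Bool.false_eq_true, if_false, Finset.mem_Icc]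
      exact ⟨⟨⟨by omega, by omega⟩, ⟨by omega, by omega⟩, by simp⟩,
        by cases a' <;> simp [coef, ind], fun u v => xPlus_xMinus₂_exchange a' hν'.1 hν.2⟩
    · obtain ⟨rfl, rfl⟩ := h2
      cases a'
      · simp [ind] at hε
      simp (disch := omega) only [matchCross, if_true, if_neg, poleCross, resCross, epsCross₂,
        if_pos h0, true_and, and_self, texp₂, texp, Bool.false_eq_true, if_false, Finset.mem_Icc]
      exact ⟨⟨⟨by omega, by omega⟩, ⟨by omega, by omega⟩, .inr (by omega)⟩,
        by cases a <;> simp [coef, ind],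
        fun u v huv => (xPlus_xMinus₂_exchange a hν'.1 hν.2 huv).symm⟩
    · obtain ⟨rfl, rfl⟩ := h3
      simp (disch := omega) only [matchCross, if_true, if_neg, poleCross, resCross, epsCross₂,
        if_pos h0, true_and, and_self, texp₂, texp, Bool.false_eq_true, if_false, Finset.mem_Icc]
      exact ⟨⟨⟨by omega, by omega⟩, ⟨by omega, by omega⟩, .inr (by omega)⟩,
        by cases a <;> cases a' <;> simp [coef, ind], fun u v => xPlus_xMinus₂_swap a a'⟩
    · exact absurd rfl hε
    · exact absurd rfl hε
  · simp only [if_true, Finset.mem_Icc] at hj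
    simp only [resCross, epsCross₁, hne, and_false, if_false] at hε
    split_ifs at hε with h0
    · obtain ⟨rfl, h1⟩ := h0
      simp (disch := omega) only [matchCross, if_true, if_neg, poleCross, resCross, epsCross₁,
        denCross, true_and, and_self, texp₂, texp, Bool.true_eq_false, false_and, if_false,
        Finset.mem_Icc, h1]
      exact ⟨⟨hi, ⟨by omega, by omega⟩, .inr (by omega)⟩,
        by cases a <;> cases a' <;> simp [coef, ind], fun u v => xPlus_xMinus₁_swap a a'⟩
    · exact absurd rfl hε

theorem norm_poleCross_le_poleBound {ν ν' : RootIdx P.N} {y : Label × Label}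
    (hy : y ∈ labels P (.xPlus ν) ×ˢ labels P (.xMinus ν')) :
    ‖poleCross P ν ν' y.1 y.2‖ ≤ poleBound P :=
  norm_le_poleBound ((norm_poleCross_le (Finset.mem_product.1 hy).1).trans (by linarith))

theorem eqUpToReg_xPlus_xMinus_ne {μ ν : RootIdx P.N} (h : μ ≠ ν) (p : Probe P (radius P)) :
    p.EqUpToReg (psi P)
      (fun u v => cur (.xPlus μ) u * cur (.xMinus ν) v)
      (fun u v => cur (.xMinus ν) v * cur (.xPlus μ) u) 0 := by
  refine (exchange_xPlus_xMinus μ ν).eqUpToReg_zero (fun u v => by rw [one_smul])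
    (fun u v => by rw [one_smul]) ((Probe.Reg.sum_pole (p := p) (Finset.Subset.refl _)
    (matchCross μ ν) (Q := 1) (q := fun _ => I * P.hbar)
    (ε := fun y => resCross μ ν y.1 y.2) (a := fun y => poleCross P μ ν y.1 y.2)
    (fun y _ => differentiable_const _) (differentiable_const _)
    (fun y hy => norm_poleCross_le_poleBound hy)
    fun y hy hε => matchCross_spec h hy hε).congr fun x _ _ => Finset.sum_congr rfl fun y _ => ?_)
  rw [mul_div_assoc', mul_comm (I * P.hbar)]
  rfl

/-- The matching of the poles in the products of `X_ν⁺` and `X_ν⁻`. -/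
def matchSelf : Label × Label → Label × Label
  | ((_, m, true), _) => ((true, m + 1, false), (true, m + 1, true))
  | ((_, m, false), _) => ((true, m - 1, true), (true, m - 1, false))

/-- The terms of the products of `X_ν⁺` and `X_ν⁻` whose poles are not cancelled. -/
def unmatched (ν : ℕ) : Finset (Label × Label) :=
  {((true, 1, false), (true, 1, true)), ((true, ν, true), (false, ν + 1, true))}

/-- The poles at w = m iħ form a chain: the pair of terms m with flags (true, false) is matched with
the pair of terms m + 1 with flags (false, true). The chain starts with the unmatched pair at m = 1.
It stops at m = ν, because the flag false does not occur there in X⁻. -/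
theorem matchSelf_spec {ν : RootIdx P.N} {y : Label × Label}
    (hy : y ∈ (labels P (.xPlus ν) ×ˢ labels P (.xMinus ν)) \ unmatched ν)
    (hε : resCross ν ν y.1 y.2 ≠ 0) :
    matchSelf y ∈ (labels P (.xPlus ν) ×ˢ labels P (.xMinus ν)) \ unmatched ν ∧
    matchSelf (matchSelf y) = y ∧
    poleCross P ν ν (matchSelf y).1 (matchSelf y).2 = poleCross P ν ν y.1 y.2 ∧
    coef (matchSelf y).1 * coef (matchSelf y).2 * resCross ν ν (matchSelf y).1 (matchSelf y).2
      = -(coef y.1 * coef y.2 * resCross ν ν y.1 y.2) ∧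
    ∀ u v : ℂ, u - v + poleCross P ν ν y.1 y.2 * (I * P.hbar) = 0 →
      texp₂ (.xPlus ν) (.xMinus ν) y (u, v) = texp₂ (.xPlus ν) (.xMinus ν) (matchSelf y) (u, v) := by
  have hν := Finset.mem_Ico.1 ν.2
  obtain ⟨⟨s, m, a⟩, ⟨s', m', a'⟩⟩ := y
  simp only [Finset.mem_sdiff, Finset.mem_product, mem_labels_xMinus, mem_labels_xPlus, unmatched,
    Finset.mem_insert, Finset.mem_singleton, Prod.mk.injEq, not_or] at hy ⊢
  obtain ⟨⟨⟨rfl, hi⟩, hj⟩, h1, h2⟩ := hy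
  rw [Finset.mem_Icc] at hi
  cases s'
  -- Against the second sum the only term with a pole is the one removed as unmatched.
  · exfalso
    simp only [resCross, epsCross₂, if_true] at hε
    split_ifs at hε with h0
    · cases a <;> cases a' <;> simp [ind] at hε
      simp [h0] at h2
    · exact hε rfl
  · simp only [if_true, Finset.mem_Icc] at hj
    simp only [resCross, epsCross₁, and_true] at hε
    have hm : m' = m := by
      by_contra h0
      simp [h0] at hε
    subst hm
    cases a <;> cases a'
    · simp at hε
    · obtain ⟨n, rfl⟩ : ∃ n, m' = n + 1 := ⟨m' - 1, by omega⟩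
      have hn : n ≠ 0 := by rintro rfl; simp at h1
      simp only [matchSelf, Nat.add_sub_cancel, poleCross, resCross, epsCross₁, denCross, if_true,
        and_self, texp₂, texp, Finset.mem_Icc, true_and]
      refine ⟨⟨⟨⟨by omega, by omega⟩, ⟨by omega, by omega⟩, .inr (by omega)⟩, by simp, by simp⟩, ?_,
        by simp [coef, ind], fun u v huv => (xPlus_xMinus₁_succ (by omega) (by omega) ?_).symm⟩
      · simp only [ind]
        push_cast
        ring
      · simp only [ind] at huv
        push_cast at huv
        linear_combination huv
    · have hm : m' < ν := by simpa using hj.2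
      simp only [matchSelf, Nat.add_sub_cancel, poleCross, resCross, epsCross₁, denCross, if_true,
        and_self, texp₂, texp, Finset.mem_Icc, true_and]
      refine ⟨⟨⟨⟨by omega, by omega⟩, ⟨by omega, by omega⟩, .inl trivial⟩, by simp; omega, by simp⟩, ?_,
        by simp [coef, ind], fun u v huv => xPlus_xMinus₁_succ (by omega) (by omega) ?_⟩
      · simp only [ind]
        push_cast
        ring
      · simp only [ind] at huv
        linear_combination huv
    · simp at hε

/-- From each of the two unmatched terms one subtracts the exponential of the quotient of k currents
with the same pole. The exponents coincide at the pole, so the difference is regular, and the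
subtracted parts are the two summands of the claimed singular term, at w = 0 and at w = -ikħ. -/
theorem eqUpToReg_xPlus_xMinus_self (ν : RootIdx P.N) (p : Probe P (radius P)) :
    p.EqUpToReg (psi P)
      (fun u v => cur (.xPlus ν) u * cur (.xMinus ν) v)
      (fun u v => cur (.xMinus ν) v * cur (.xPlus ν) u)
      (fun u v => (-(I * P.hbar)) •
        ((1 / (u - v + I * P.k * P.hbar)) • (cur (.kPlus (high ν)) u * cur (.kPlusInv (low ν)) u)
          - (1 / (u - v)) • (cur (.kMinus (high ν)) v * cur (.kMinusInv (low ν)) v))) := by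
  have hν := Finset.mem_Ico.1 ν.2
  have hsub : unmatched ν ⊆ labels P (.xPlus ν) ×ˢ labels P (.xMinus ν) := by
    intro y hy
    simp only [unmatched, Finset.mem_insert, Finset.mem_singleton] at hy
    rcases hy with rfl | rfl <;>
      simp only [Finset.mem_product, mem_labels_xPlus, mem_labels_xMinus, if_true,
        Bool.false_eq_true, if_false, Finset.mem_Icc, true_and, true_or, and_true] <;> omega
  have hm1 : ((true, 1, false), (true, 1, true)) ∈ labels P (.xPlus ν) ×ˢ labels P (.xMinus ν) :=
    hsub (by simp [unmatched])
  have hm2 : ((true, (ν : ℕ), true), (false, (ν : ℕ) + 1, true))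
      ∈ labels P (.xPlus ν) ×ˢ labels P (.xMinus ν) := hsub (by simp [unmatched])
  rw [Finset.mem_product] at hm1 hm2
  have r0 := Probe.Reg.sum_pole (p := p) (J := .xPlus ν) (J' := .xMinus ν)
    (S := (labels P (.xPlus ν) ×ˢ labels P (.xMinus ν)) \ unmatched ν) Finset.sdiff_subset
    matchSelf (Q := 1) (q := fun _ => I * P.hbar)
    (ε := fun y => resCross ν ν y.1 y.2) (a := fun y => poleCross P ν ν y.1 y.2)
    (fun y _ => differentiable_const _) (differentiable_const _)
    (fun y hy => norm_poleCross_le_poleBound (Finset.sdiff_subset hy))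
    fun y hy hε => matchSelf_spec hy hε
  have k1 : (fun x : ℂ × ℂ => kMinusExp P (ν + 1) x.2 - kMinusExp P ν x.2)
      ∈ fieldsAt P {Prod.fst, Prod.snd} :=
    sub_mem (texp_comp_mem (Z := {Prod.fst, Prod.snd}) (ζ := Prod.snd) (.inr rfl)
        (mem_labels_kMinus (high ν)))
      (texp_comp_mem (Z := {Prod.fst, Prod.snd}) (ζ := Prod.snd) (.inr rfl)
        (mem_labels_kMinus (low ν)))
  have k2 : (fun x : ℂ × ℂ => kPlusExp P (ν + 1) x.1 - kPlusExp P ν x.1)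
      ∈ fieldsAt P {Prod.fst, Prod.snd} :=
    sub_mem (texp_comp_mem (Z := {Prod.fst, Prod.snd}) (ζ := Prod.fst) (.inl rfl)
        (mem_labels_kPlus (high ν)))
      (texp_comp_mem (Z := {Prod.fst, Prod.snd}) (ζ := Prod.fst) (.inl rfl)
        (mem_labels_kPlus (low ν)))
  have r1 := Probe.Reg.pole (p := p) (a := 0) (texp_add_mem hm1.1 hm1.2) k1
    (norm_le_poleBound_of_le (c := 0) (by simp) (by norm_num)) fun u v h =>
      xPlus_xMinus₁_one hν.1 hν.2 (by linear_combination h)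
  have r2 := Probe.Reg.pole (p := p) (a := P.k) (texp_add_mem hm2.1 hm2.2) k2
    (norm_le_poleBound (by linarith [Nat.cast_nonneg (α := ℝ) P.N])) fun u v h =>
      xPlus_xMinus₂_top hν.1 hν.2 h
  have s1 := Probe.coeffOf_add_reg (p := p) (texp_add_mem hm1.1 hm1.2)
  have s2 := Probe.coeffOf_add_reg (p := p) (texp_add_mem hm2.1 hm2.2)
  have c : ∀ z : ℂ, p.Reg fun _ => z := fun z =>
    Probe.Reg.of_differentiableOn (differentiableOn_const z)
  -- Both unmatched terms have coefficient -1, which gives the two regular summands with factor -1;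
  -- their residues are -1 and 1 (`e1`, `e2` below), whence the factors iħ and -iħ of the polar
  -- parts.
  refine (exchange_xPlus_xMinus ν ν).eqUpToReg (fun u v => by rw [one_smul])
    (fun u v => by rw [one_smul]) ((((r0.add ((c (I * P.hbar)).mul r1)).add
      ((c (-(I * P.hbar))).mul r2)).add (((c (-1)).mul s1).add ((c (-1)).mul s2))).congr
      fun x hx _ => ?_)
  rw [← Finset.sum_sdiff hsub, unmatched, Finset.sum_pair (by simp), ← unmatched]
  rw [p.eval_smul, p.eval_sub, p.eval_smul, p.eval_smul,
    p.eval_kPlus_mul_kPlusInv, p.eval_kMinus_mul_kMinusInv _ _ hx.2]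
  have e : ∀ y ∈ (labels P (.xPlus ν) ×ˢ labels P (.xMinus ν)) \ unmatched ν,
      coef y.1 * coef y.2 * (1 + resCross ν ν y.1 y.2 * (I * P.hbar)
        / (x.1 - x.2 + poleCross P ν ν y.1 y.2 * (I * P.hbar)))
        * p.coeffOf (vertex P (texp P (.xPlus ν) y.1 x.1 + texp P (.xMinus ν) y.2 x.2))
      = coef y.1 * coef y.2 * ((1 : Label × Label → ℂ → ℂ) y (x.1 - x.2) + I * P.hbar
        * (resCross ν ν y.1 y.2 / (x.1 - x.2 + poleCross P ν ν y.1 y.2 * (I * P.hbar))))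
        * p.coeffOf (vertex P (texp₂ (.xPlus ν) (.xMinus ν) y x)) := fun y _ => by
    rw [mul_div_assoc', mul_comm (I * P.hbar)]
    rfl
  rw [Finset.sum_congr rfl e]
  have h1 : ((high ν : Idx P.N) : ℕ) = ν + 1 := rfl
  have h2 : ((low ν : Idx P.N) : ℕ) = ν := rfl
  have e1 : resCross ν ν (true, 1, false) (true, 1, true) = -1 := by
    simp [resCross, epsCross₁, ind]
  have e2 : resCross ν ν (true, (ν : ℕ), true) (false, (ν : ℕ) + 1, true) = 1 := by
    simp [resCross, epsCross₂, ind]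
  have e3 : poleCross P ν ν (true, 1, false) (true, 1, true) = 0 := by
    simp [poleCross, denCross, ind]
  have e4 : poleCross P ν ν (true, (ν : ℕ), true) (false, (ν : ℕ) + 1, true) = P.k := by
    simp [poleCross]
  have e5 : x.1 - x.2 + I * P.k * P.hbar = x.1 - x.2 + P.k * (I * P.hbar) := by ring
  simp only [h1, h2, e1, e2, e3, e4, e5, coef, zero_mul, add_zero]
  ring

end

/-! ### Assembly of the relations -/

theorem drinfeldRelations_psi (P : Params) : DrinfeldRelations P (radius P) (psi P) where
  kPlus_inv μ u := by
    have h := kPlusExp_snd P μ u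
    rw [map_mul, map_mul, psi_kPlus, psi_kPlusInv]
    constructor
    · rw [vertex_mul_of_snd (by rw [Prod.snd_neg, h, neg_zero]), add_neg_cancel, vertex_zero]
    · rw [vertex_mul_of_snd h, neg_add_cancel, vertex_zero]
  kMinus_inv μ u := by
    have h := kMinusExp_fst P μ u
    rw [map_mul, map_mul, psi_kMinus, psi_kMinusInv]
    refine ⟨vertex_mul_neg_of_fst h, ?_⟩
    rw [vertex_comm_of_fst (by rw [Prod.fst_neg, h, neg_zero]) h, vertex_mul_neg_of_fst h]
  kPlus_kPlus μ ν u v := by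
    rw [map_mul, map_mul, psi_kPlus, psi_kPlus, vertex_mul_of_snd (kPlusExp_snd P ν v),
      vertex_mul_of_snd (kPlusExp_snd P μ u), add_comm]
  kMinus_kMinus μ ν u v := by
    rw [map_mul, map_mul, psi_kMinus, psi_kMinus,
      vertex_comm_of_fst (kMinusExp_fst P μ u) (kMinusExp_fst P ν v)]
  kPlus_kMinus_eq μ p u hu v hv h := by
    rw [eval_kPlus_kMinus μ μ p hu hv h]
    simp [ratio, shiftsKK]
  kPlus_kMinus_lt μ ν hμν p u hu v hv h := by
    have := eval_kPlus_kMinus μ ν p hu hv h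
    have e1 : u - v + I * P.k * P.hbar = u - v + P.k * (I * P.hbar) := by ring
    have e2 : u - v - I * P.hbar + I * P.k * P.hbar = u - v + (P.k - 1) * (I * P.hbar) := by ring
    have e3 : u - v - I * P.hbar = u - v + (-1) * (I * P.hbar) := by ring
    have hR := lt_abs.2 (.inr (lt_neg_of_lt_neg h))
    have n1 : u - v + P.k * (I * P.hbar) ≠ 0 := shift_ne_zero (norm_le_poleBound (by linarith [norm_nonneg P.k])) hR
    have n2 : u - v + (P.k - 1) * (I * P.hbar) ≠ 0 := shift_ne_zero (norm_le_poleBound (by linarith [norm_sub_le P.k 1, norm_one (α := ℂ)])) hR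
    rw [mul_right_comm, this, ratio, shiftsKK, if_pos hμν, e2, e3, e1]
    simp only [List.map_cons, List.map_nil, List.prod_cons, List.prod_nil, mul_one, zero_mul, add_zero]
    generalize u - v + (P.k - 1) * (I * P.hbar) = B at n2 ⊢
    generalize u - v + P.k * (I * P.hbar) = C at n1 ⊢
    field_simp
  kPlus_kMinus_gt μ ν hμν p u hu v hv h := by
    have := eval_kPlus_kMinus μ ν p hu hv h
    have e1 : u - v + I * P.k * P.hbar = u - v + P.k * (I * P.hbar) := by ring
    have e2 : u - v + I * P.hbar + I * P.k * P.hbar = u - v + (P.k + 1) * (I * P.hbar) := by ring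
    have hR := lt_abs.2 (.inr (lt_neg_of_lt_neg h))
    have n1 : u - v + P.k * (I * P.hbar) ≠ 0 := shift_ne_zero (norm_le_poleBound (by linarith [norm_nonneg P.k])) hR
    have n2 : u - v + (P.k + 1) * (I * P.hbar) ≠ 0 := shift_ne_zero (norm_le_poleBound (by linarith [norm_add_le P.k 1, norm_one (α := ℂ)])) hR
    rw [mul_right_comm, this, ratio, shiftsKK, if_neg hμν.not_gt, if_pos hμν, e2, e1]
    simp only [List.map_cons, List.map_nil, List.prod_cons, List.prod_nil, mul_one, zero_mul, add_zero, one_mul]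
    generalize u - v + (P.k + 1) * (I * P.hbar) = B at n2 ⊢
    generalize u - v + P.k * (I * P.hbar) = C at n1 ⊢
    field_simp
  kPlus_xPlus_low ν p u hu v hv h := by
    obtain ⟨h1, h2⟩ := Finset.mem_Icc.1 (low ν).2
    rw [p.eval_kPlus_conj _ _ hu hv h (exp_contr_kPlus_xPlus h1 h2 h), shiftK_low, one_mul]
  kMinus_xPlus_low ν p u hu v hv h := by
    obtain ⟨h1, h2⟩ := Finset.mem_Icc.1 (low ν).2
    rw [p.eval_kMinus_conj _ _ hu hv h (exp_contr_xPlus_kMinus h1 h2 h), shiftK_low, one_mul]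
  kPlus_xPlus_high ν p u hu v hv h := by
    obtain ⟨h1, h2⟩ := Finset.mem_Icc.1 (high ν).2
    rw [p.eval_kPlus_conj _ _ hu hv h (exp_contr_kPlus_xPlus h1 h2 h), shiftK_high, neg_one_mul, sub_neg_eq_add]
  kMinus_xPlus_high ν p u hu v hv h := by
    obtain ⟨h1, h2⟩ := Finset.mem_Icc.1 (high ν).2
    rw [p.eval_kMinus_conj _ _ hu hv h (exp_contr_xPlus_kMinus h1 h2 h), shiftK_high, neg_one_mul, sub_neg_eq_add]
  kMinus_xMinus_low ν p u hu v hv h := by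
    obtain ⟨h1, h2⟩ := Finset.mem_Icc.1 (low ν).2
    rw [p.eval_kMinus_conj _ _ hu hv h (exp_contr_xMinus_kMinus h1 h2 h), shiftK_low, one_mul]
  kMinus_xMinus_high ν p u hu v hv h := by
    obtain ⟨h1, h2⟩ := Finset.mem_Icc.1 (high ν).2
    rw [p.eval_kMinus_conj _ _ hu hv h (exp_contr_xMinus_kMinus h1 h2 h), shiftK_high, neg_one_mul, sub_neg_eq_add]
  kPlus_xMinus_low ν p u hu v hv h := by
    obtain ⟨h1, h2⟩ := Finset.mem_Icc.1 (low ν).2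
    rw [p.eval_kPlus_conj _ _ hu hv h (exp_contr_kPlus_xMinus h1 h2 h), shiftK_low, one_mul]
  kPlus_xMinus_high ν p u hu v hv h := by
    obtain ⟨h1, h2⟩ := Finset.mem_Icc.1 (high ν).2
    rw [p.eval_kPlus_conj _ _ hu hv h (exp_contr_kPlus_xMinus h1 h2 h), shiftK_high, neg_one_mul, sub_neg_eq_add]
  kPlus_x_far μ ν hμν J hJ p u hu v hv h := by
    obtain ⟨h1, h2⟩ := Finset.mem_Icc.1 μ.2
    have hR := lt_abs.2 (.inr (lt_neg_of_lt_neg h))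
    have n0 : u - v ≠ 0 := by
      simpa using shift_ne_zero (P := P) (norm_le_poleBound (a := 0) (by rw [norm_zero]; linarith [norm_nonneg P.k])) hR
    have n1 : u - v + I * P.k * P.hbar ≠ 0 := by
      have := shift_ne_zero (P := P) (norm_le_poleBound (a := P.k) (by linarith [norm_nonneg P.k])) hR
      rwa [mul_left_comm, ← mul_assoc] at this
    rcases hJ with rfl | rfl
    · rw [p.eval_kPlus_conj _ _ hu hv h (exp_contr_kPlus_xPlus h1 h2 h), shiftK_far hμν, zero_mul, sub_zero,
        div_self n0, one_mul]
    · rw [p.eval_kPlus_conj _ _ hu hv h (exp_contr_kPlus_xMinus h1 h2 h), shiftK_far hμν, zero_mul, sub_zero,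
        div_self n1, one_mul]
  kMinus_x_far μ ν hμν J hJ p u hu v hv h := by
    obtain ⟨h1, h2⟩ := Finset.mem_Icc.1 μ.2
    have n0 : u - v ≠ 0 := by
      simpa using shift_ne_zero (P := P) (norm_le_poleBound (a := 0) (by rw [norm_zero]; linarith [norm_nonneg P.k]))
        (lt_abs.2 (.inl h))
    rcases hJ with rfl | rfl
    · rw [p.eval_kMinus_conj _ _ hu hv h (exp_contr_xPlus_kMinus h1 h2 h), shiftK_far hμν, zero_mul, sub_zero,
        div_self n0, one_mul]
    · rw [p.eval_kMinus_conj _ _ hu hv h (exp_contr_xMinus_kMinus h1 h2 h), shiftK_far hμν, zero_mul, sub_zero,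
        div_self n0, one_mul]
  xPlus_xPlus ν p := by simpa [denPlus] using eqUpToReg_xPlus ν ν p
  xMinus_xMinus := eqUpToReg_xMinus_self
  xPlus_xPlus_succ μ ν h p := by
    have h1 : denPlus μ ν = -1 := by simp (disch := omega) only [denPlus, h, if_neg, if_true]
    have h2 : denPlus ν μ = 0 := by simp (disch := omega) only [denPlus, h, if_neg]
    have := eqUpToReg_xPlus μ ν p
    rw [h1, h2] at this
    simpa only [neg_one_mul, zero_mul, sub_zero, ← sub_eq_add_neg] using this
  xMinus_xMinus_succ _ _ h p := eqUpToReg_xMinus_succ h p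
  serre_xPlus _ _ h := serre_xPlus h
  serre_xMinus _ _ h := serre_xMinus h
  xPlus_xPlus_far _ _ h p := eqUpToReg_xPlus_far h p
  xMinus_xMinus_far _ _ h p := h.elim (fun h => (eqUpToReg_xMinus_far_of_lt h p).swap)
    fun h => eqUpToReg_xMinus_far_of_lt h p
  xPlus_xMinus_ne _ _ h p := eqUpToReg_xPlus_xMinus_ne h p
  xPlus_xMinus_eq := eqUpToReg_xPlus_xMinus_self

end YangianBoson

end

open YangianBoson in
theorem proposition1 (P : Params) :
    ∃ ψ : Realization P,
      (∀ (J : Current P.N) (u : ℂ), ψ (cur J u) = op P (image P J u)) ∧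
      ∃ R : ℝ, 0 ≤ R ∧ WellDefined P R ψ ∧ DrinfeldRelations P R ψ := by
  exact ⟨psi P, psi_cur P, radius P, radius_nonneg P, wellDefined_psi, drinfeldRelations_psi P⟩
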